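/- Let $\Bbbk$ be a commutative ring. A non-unital $A_\infty$ category $\mathcal A$ has a set of objects, graded $\Bbbk$-modules $\mathcal A(A,A')$ and $\Bbbk$-linear maps $m_i\colon \mathcal A(A_{i-1},A_i)\otimes\cdots\otimes\mathcal A(A_0,A_1)\to\mathcal A(A_0,A_i)$ of degree $2-i$ ($i\ge 1$) such that $\sum_{k=1}^n\sum_{i=0}^{n-k}(-1)^{i+k(n-i-k)}m_{n-k+1}\circ(\mathrm{id}^{\otimes n-i-k}\otimes m_k\otimes\mathrm{id}^{\otimes i})=0$ for all $n>0$ (Koszul sign rule). It is a non-unital dg category if $m_i=0$ for $i>2$. Write $s$ for the shift, so that $sx$ has degree $\deg x-1$. Let $B_\infty(\mathcal A)$ be the bar construction: the reduced tensor cocategory on $s\mathcal A$, with deconcatenation as cocomposition and with the coderivation determined by the $m_i$ as differential (a map $f$ of degree $n$ with $i$ arguments corresponds to $(-1)^{n+i-1}\iota^{-1}\circ f\circ\iota^{\otimes i}$, where $\iota\colon sM\to M$ is the natural map). For a quiver, category or cocategory, $(-)^+$ denotes its augmentation (a copy of $\Bbbk$ is added to the endomorphisms of every object, as unit or counit), and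 $(\mathcal P^+\otimes\mathcal Q^+)_{\mathrm{red}}$ is $\mathcal P^+\otimes\mathcal Q^+$ with the units removed: $$(\mathcal P^+\otimes\mathcal Q^+)_{\mathrm{red}}\bigl((A,B),(A',B')\bigr)=\mathcal P(A,A')\otimes\mathcal Q(B,B')\ \oplus\ \mathcal P(A,A')^{\delta_{B,B'}}\ \oplus\ \mathcal Q(B,B')^{\delta_{A,A'}}.$$ Let $\mathcal A$ and $\mathcal B$ be non-unital $A_\infty$ categories, and let $\mathcal C=(B_\infty(\mathcal A)^+\otimes B_\infty(\mathcal B)^+)_{\mathrm{red}}$. Let $\Omega(\mathcal C)$ be its cobar construction: the reduced tensor category on $s^{-1}\mathcal C$, with differential the derivation which on generators is $s^{-1}c\mapsto -s^{-1}dc-\sum(-1)^{\deg c'}s^{-1}c'\otimes s^{-1}c''$, where $\Delta c=\sum c'\otimes c''$. Let $C_{i,j}\subseteq\mathcal C$ be the part of tensors with $i$ factors from $s\mathcal A$ and $j$ factors from $s\mathcal B$, and let $V_{m,n}\subseteq\Omega(\mathcal C)\bigl((A,B),(A',B')\bigr)$ be the part spanned by tensors of elements of $s^{-1}C_{m_l,n_l},\dots,s^{-1}C_{m_1,n_1}$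 ($l\ge1$) with $m_1+\cdots+m_l=m$ and $n_1+\cdots+n_l=n$. 1. For all $A,A'\in\mathcal A$ and $B,B'\in\mathcal B$, both $(\mathcal A^+\otimes\mathcal B^+)_{\mathrm{red}}\bigl((A,B),(A',B')\bigr)$, with the differential induced by $m_1$ of $\mathcal A$ and of $\mathcal B$, and $\Omega(\mathcal C)\bigl((A,B),(A',B')\bigr)$ are complexes, and the map $$(\mathcal A^+\otimes\mathcal B^+)_{\mathrm{red}}\bigl((A,B),(A',B')\bigr)\to\Omega(\mathcal C)\bigl((A,B),(A',B')\bigr)$$ which sends $f\in\mathcal A(A,A')^{\delta_{B,B'}}=V_{1,0}$ to $f$, $g\in\mathcal B(B,B')^{\delta_{A,A'}}=V_{0,1}$ to $g$, and $f\otimes g\in\mathcal A(A,A')\otimes\mathcal B(B,B')$ to $(-1)^{\deg f\deg g}\,g\otimes f\in V_{1,1}$, is a homotopy equivalence of complexes of $\Bbbk$-modules. 2. $\bigoplus_{0\le m,n\le1}V_{m,n}$ is a subcomplex of $\Omega(\mathcal C)\bigl((A,B),(A',B')\bigr)$, and a morphism of complexes $\Omega(\mathcal C)\bigl((A,B),(A',B')\bigr)\to(\mathcal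 A^+\otimes\mathcal B^+)_{\mathrm{red}}\bigl((A,B),(A',B')\bigr)$ is a homotopy equivalence if and only if its restriction to this subcomplex is a homotopy equivalence. 3. If $\mathcal A$ and $\mathcal B$ are non-unital dg categories, then $\Omega(\mathcal C)$ and $(\mathcal A^+\otimes\mathcal B^+)_{\mathrm{red}}$ are non-unital dg categories, and there is a non-unital dg functor $N\colon\Omega(\mathcal C)\to(\mathcal A^+\otimes\mathcal B^+)_{\mathrm{red}}$, natural in $\mathcal A$ and $\mathcal B$ with respect to non-unital dg functors, which is the identity on objects and is given on generators by $s^{-1}sf\mapsto f$ on $C_{1,0}$, $s^{-1}sg\mapsto g$ on $C_{0,1}$ and $0$ on $s^{-1}C_{i,j}$ for $i+j\ge2$. The functor $N$ is a homotopy isomorphism: it is bijective on objects and a homotopy equivalence on all complexes of morphisms. -/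

import Mathlib

universe u v w

noncomputable section

namespace AInf

open scoped TensorProduct DirectSum Classical

/-! ## Graded modules -/

/-- A `ℤ`-graded `K`-module `M = ⨁ i, M^i`, with its homogeneous components `gr i` as submodules. -/
structure GrMod (K : Type u) [CommRing K] : Type (max u (w + 1)) where
  carrier : Type w
  [acg : AddCommGroup carrier]
  [mod : Module K carrier]
  gr : ℤ → Submodule K carrier
  internal : DirectSum.IsInternal gr

namespace GrMod

variable {K : Type u} [CommRing K]

instance : CoeSort (GrMod.{u, w} K) (Type w) := ⟨GrMod.carrier⟩

attribute [instance] GrMod.acg GrMod.mod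

/-- The decomposition of elements into homogeneous components. -/
def dec (M : GrMod.{u, w} K) : M →ₗ[K] ⨁ i, M.gr i :=
  ((LinearEquiv.ofBijective (DirectSum.coeLinearMap M.gr) M.internal).symm :
    M ≃ₗ[K] ⨁ i, M.gr i).toLinearMap

theorem dec_of_mem (M : GrMod.{u, w} K) {i : ℤ} {x : M} (hx : x ∈ M.gr i) :
    M.dec x = DirectSum.lof K ℤ (fun i => M.gr i) i ⟨x, hx⟩ := by
  have : DirectSum.coeLinearMap M.gr (DirectSum.lof K ℤ (fun i => M.gr i) i ⟨x, hx⟩) = x :=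
    DirectSum.coeLinearMap_lof M.gr _ _
  refine ((LinearEquiv.ofBijective (DirectSum.coeLinearMap M.gr) M.internal).symm_apply_eq).2 ?_
  exact this.symm

theorem iSup_gr (M : GrMod.{u, w} K) : ⨆ i, M.gr i = ⊤ :=
  DirectSum.IsInternal.submodule_iSup_eq_top M.internal

/-- A linear map given by a linear map on each homogeneous component. -/
def byDegree (M : GrMod.{u, w} K) {N : Type v} [AddCommGroup N] [Module K N]
    (f : ℤ → (M →ₗ[K] N)) : M →ₗ[K] N :=
  DirectSum.toModule K ℤ N (fun i => f i ∘ₗ (M.gr i).subtype) ∘ₗ M.dec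

theorem byDegree_of_mem (M : GrMod.{u, w} K) {N : Type v} [AddCommGroup N] [Module K N]
    (f : ℤ → (M →ₗ[K] N)) {i : ℤ} {x : M} (hx : x ∈ M.gr i) : M.byDegree f x = f i x := by
  rw [byDegree, LinearMap.comp_apply, M.dec_of_mem hx, DirectSum.toModule_lof]
  rfl

/-- The projection onto the component of degree `n`. -/
def proj (M : GrMod.{u, w} K) (n : ℤ) : M →ₗ[K] M :=
  M.byDegree fun i => if n = i then LinearMap.id else 0

theorem proj_of_mem (M : GrMod.{u, w} K) (n : ℤ) {i : ℤ} {x : M} (hx : x ∈ M.gr i) :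
    M.proj n x = if n = i then x else 0 := by
  rw [proj, M.byDegree_of_mem _ hx]
  split_ifs <;> rfl

theorem internal_of {M : Type w} [AddCommGroup M] [Module K M] (gr : ℤ → Submodule K M)
    (π : ℤ → (M →ₗ[K] M)) (h : ∀ n i, ∀ x ∈ gr i, π n x = if n = i then x else 0)
    (htop : ⨆ i, gr i = ⊤) : DirectSum.IsInternal gr := by
  refine DirectSum.isInternal_submodule_of_iSupIndep_of_iSup_eq_top ?_ htop
  rw [iSupIndep_def]
  intro i
  rw [Submodule.disjoint_def]
  intro x hx hx'
  have h1 : π i x = x := by rw [h i i x hx, if_pos rfl]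
  have h2 : (⨆ j, ⨆ (_ : j ≠ i), gr j) ≤ LinearMap.ker (π i) := by
    refine iSup₂_le fun j hj y hy => ?_
    rw [LinearMap.mem_ker, h i j y hy, if_neg (Ne.symm hj)]
  rw [← h1]
  exact h2 hx'

/-- The map multiplying an element of degree `i` by the sign `(-1)^(p * i)`. -/
def sgn (M : GrMod.{u, w} K) (p : ℤ) : M →ₗ[K] M :=
  M.byDegree fun i => ((p * i).negOnePow : ℤ) • LinearMap.id

/-- The shift `M[n]`: its component of degree `i` is the component of `M` of degree `n + i`. -/
abbrev shift (n : ℤ) (M : GrMod.{u, w} K) : GrMod.{u, w} K where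
  carrier := M
  gr i := M.gr (n + i)
  internal := by
    have h := (DirectSum.isInternal_submodule_iff_iSupIndep_and_iSup_eq_top M.gr).1 M.internal
    refine DirectSum.isInternal_submodule_of_iSupIndep_of_iSup_eq_top ?_ ?_
    · exact h.1.comp (f := fun i : ℤ => n + i) (add_right_injective n)
    · rw [← h.2]
      exact (Equiv.addLeft n).iSup_comp (g := M.gr)

/-- The identity map from `M` to `M[n]`, sending an element `x` of degree `i` to the same
element seen in degree `i - n`. -/
def toShift (n : ℤ) (M : GrMod.{u, w} K) : M →ₗ[K] M.shift n := LinearMap.id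

/-- The inverse of `toShift`. -/
def unShift (n : ℤ) (M : GrMod.{u, w} K) : M.shift n →ₗ[K] M := LinearMap.id

/-- The ground ring, in degree `0`. -/
abbrev unit (K : Type u) [CommRing K] : GrMod.{u, u} K where
  carrier := K
  gr i := if i = 0 then ⊤ else ⊥
  internal := by
    refine internal_of _ (fun n => if n = 0 then LinearMap.id else 0) (fun n i x hx => ?_) ?_
    · by_cases h : i = 0
      · subst h
        split_ifs <;> rfl
      · have : x = 0 := by simpa [h] using hx
        subst this
        simp
    · refine eq_top_iff.2 (le_trans ?_ (le_iSup _ 0))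
      simp

/-- The direct sum of two graded modules. -/
abbrev prod (M N : GrMod.{u, w} K) : GrMod.{u, w} K where
  carrier := M × N
  gr i := (M.gr i).prod (N.gr i)
  internal := by
    refine internal_of _ (fun n => (M.proj n).prodMap (N.proj n)) ?_ ?_
    · rintro n i ⟨x, y⟩ ⟨hx, hy⟩
      rw [LinearMap.prodMap_apply, M.proj_of_mem n hx, N.proj_of_mem n hy]
      split_ifs <;> rfl
    · have h1 : LinearMap.range (LinearMap.inl K M N) ≤ ⨆ i, (M.gr i).prod (N.gr i) := by
        rw [LinearMap.range_eq_map, ← M.iSup_gr, Submodule.map_iSup]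
        refine iSup_mono fun i => ?_
        rintro _ ⟨x, hx, rfl⟩
        exact ⟨hx, zero_mem _⟩
      have h2 : LinearMap.range (LinearMap.inr K M N) ≤ ⨆ i, (M.gr i).prod (N.gr i) := by
        rw [LinearMap.range_eq_map, ← N.iSup_gr, Submodule.map_iSup]
        refine iSup_mono fun i => ?_
        rintro _ ⟨x, hx, rfl⟩
        exact ⟨zero_mem _, hx⟩
      rw [eq_top_iff, ← LinearMap.sup_range_inl_inr]
      exact sup_le h1 h2

/-- The direct sum of a family of graded modules. -/
abbrev dsum {ι : Type v} (M : ι → GrMod.{u, w} K) : GrMod.{u, max v w} K where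
  carrier := ⨁ i, M i
  gr n := ⨆ i, ((M i).gr n).map (DirectSum.lof K ι (fun i => M i) i)
  internal := by
    refine internal_of _ (fun n => DirectSum.toModule K ι _
      (fun i => DirectSum.lof K ι (fun i => M i) i ∘ₗ (M i).proj n)) ?_ ?_
    · intro n j x hx
      induction hx using Submodule.iSup_induction' with
      | mem i x hx =>
        obtain ⟨x, hx, rfl⟩ := hx
        rw [DirectSum.toModule_lof, LinearMap.comp_apply, (M i).proj_of_mem n hx]
        split_ifs
        · rfl
        · exact map_zero _
      | zero => rw [map_zero, ite_self]
      | add x y _ _ hx hy =>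
        rw [map_add, hx, hy]
        split_ifs
        · rfl
        · exact add_zero _
    · rw [iSup_comm, eq_top_iff]
      rintro x -
      induction x using DirectSum.induction_on with
      | zero => exact zero_mem _
      | add x y hx hy => exact add_mem hx hy
      | of i x =>
        refine Submodule.mem_iSup_of_mem i ?_
        rw [← Submodule.map_iSup, (M i).iSup_gr]
        exact ⟨x, trivial, rfl⟩

/-- The tensor product of two graded modules. -/
abbrev tens (M N : GrMod.{u, w} K) : GrMod.{u, w} K where
  carrier := M ⊗[K] N
  gr n := ⨆ p : {p : ℤ × ℤ // p.1 + p.2 = n},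
    LinearMap.range (TensorProduct.map (M.gr p.1.1).subtype (N.gr p.1.2).subtype)
  internal := by
    refine internal_of _ (fun n => TensorProduct.lift (M.byDegree fun i =>
      (TensorProduct.mk K M N).compl₂ (N.proj (n - i)))) ?_ ?_
    · intro n j x hx
      induction hx using Submodule.iSup_induction' with
      | mem p x hx =>
        obtain ⟨⟨a, b⟩, rfl⟩ := p
        obtain ⟨x, rfl⟩ := hx
        induction x using TensorProduct.induction_on with
        | zero => rw [map_zero, map_zero, ite_self]
        | add x y hx hy =>
          rw [map_add, map_add, hx, hy]
          split_ifs
          · rfl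
          · exact add_zero _
        | tmul x y =>
          rw [TensorProduct.map_tmul, TensorProduct.lift.tmul, Submodule.subtype_apply,
            Submodule.subtype_apply, M.byDegree_of_mem _ x.2, LinearMap.compl₂_apply,
            N.proj_of_mem _ y.2, TensorProduct.mk_apply]
          simp only [sub_eq_iff_eq_add, add_comm b a]
          split_ifs
          · rfl
          · exact TensorProduct.tmul_zero _ _
      | zero => rw [map_zero, ite_self]
      | add x y _ _ hx hy =>
        rw [map_add, hx, hy]
        split_ifs
        · rfl
        · exact add_zero _
    · rw [eq_top_iff]
      rintro x -
      induction x using TensorProduct.induction_on with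
      | zero => exact zero_mem _
      | add x y hx hy => exact add_mem hx hy
      | tmul x y =>
        have hx : x ∈ ⨆ i, M.gr i := by rw [M.iSup_gr]; trivial
        have hy : y ∈ ⨆ i, N.gr i := by rw [N.iSup_gr]; trivial
        induction hx using Submodule.iSup_induction' with
        | zero => rw [TensorProduct.zero_tmul]; exact zero_mem _
        | add x x' _ _ hx hx' => rw [TensorProduct.add_tmul]; exact add_mem hx hx'
        | mem a x hx =>
          induction hy using Submodule.iSup_induction' with
          | zero => rw [TensorProduct.tmul_zero]; exact zero_mem _
          | add y y' _ _ hy hy' => rw [TensorProduct.tmul_add]; exact add_mem hy hy'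
          | mem b y hy =>
            exact Submodule.mem_iSup_of_mem (a + b) (Submodule.mem_iSup_of_mem ⟨(a, b), rfl⟩
              ⟨⟨x, hx⟩ ⊗ₜ ⟨y, hy⟩, rfl⟩)

/-- The inclusion of a summand in a direct sum. -/
def incl {ι : Type v} (M : ι → GrMod.{u, w} K) (i : ι) : M i →ₗ[K] dsum M :=
  DirectSum.lof K ι (fun i => M i) i

/-- The linear map out of a direct sum given by a linear map on each summand. -/
def desc {ι : Type v} {M : ι → GrMod.{u, w} K} {N : Type*} [AddCommGroup N] [Module K N]
    (f : ∀ i, M i →ₗ[K] N) : dsum M →ₗ[K] N :=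
  DirectSum.toModule K ι N f

/-- `M` if the proposition `p` holds and `0` otherwise. -/
abbrev pow (p : Prop) (M : GrMod.{u, w} K) : GrMod.{u, w} K := dsum fun _ : PLift p => M

/-- The inclusion of `M` in `M.pow p` when `p` holds. -/
def powIncl {p : Prop} (h : p) (M : GrMod.{u, w} K) : M →ₗ[K] M.pow p :=
  incl (fun _ : PLift p => M) ⟨h⟩

/-- A linear map `M.pow p → N.pow q` induced by a linear map `M → N`, if `p` implies `q`. -/
def powMap {p q : Prop} (h : p → q) {M N : GrMod.{u, w} K} (f : M →ₗ[K] N) :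
    M.pow p →ₗ[K] N.pow q :=
  desc fun hp => powIncl (h hp.down) N ∘ₗ f

/-- The Koszul symmetry `x ⊗ y ↦ (-1)^(deg x * deg y) y ⊗ x`. -/
def kswap (M N : GrMod.{u, w} K) : M.tens N →ₗ[K] N.tens M :=
  TensorProduct.lift (M.byDegree fun i => ((TensorProduct.mk K N M).compl₁₂ (N.sgn i)
    LinearMap.id).flip)

/-- The Koszul middle exchange
`(x ⊗ y) ⊗ (z ⊗ t) ↦ (-1)^(deg y * deg z) (x ⊗ z) ⊗ (y ⊗ t)`. -/
def midSwap (M N P Q : GrMod.{u, w} K) :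
    (M.tens N).tens (P.tens Q) →ₗ[K] (M.tens P).tens (N.tens Q) :=
  (TensorProduct.assoc K M P (N ⊗[K] Q)).symm.toLinearMap ∘ₗ
    TensorProduct.map LinearMap.id
      ((TensorProduct.assoc K P N Q).toLinearMap ∘ₗ
        TensorProduct.map (kswap N P) LinearMap.id ∘ₗ
        (TensorProduct.assoc K N P Q).symm.toLinearMap) ∘ₗ
    (TensorProduct.assoc K M N (P ⊗[K] Q)).toLinearMap

/-- The differential `d ⊗ 1 + 1 ⊗ d` on a tensor product, with the Koszul sign: the second term
maps `x ⊗ y` to `(-1)^(deg x) x ⊗ d y`. -/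
def tensD (M N : GrMod.{u, w} K) (dM : M →ₗ[K] M) (dN : N →ₗ[K] N) : M.tens N →ₗ[K] M.tens N :=
  TensorProduct.map dM LinearMap.id + TensorProduct.map (M.sgn 1) dN

end GrMod

/-! ## Complexes and homotopy equivalences

Graded modules are here given by a module with a family of submodules, so that the notions apply
both to graded modules and to their graded submodules. -/

section Complexes

variable {K : Type u} [CommRing K] {M N : Type u} [AddCommGroup M] [Module K M]
  [AddCommGroup N] [Module K N]

/-- A linear map is homogeneous of degree `n`. -/
def HasDegree (gM : ℤ → Submodule K M) (gN : ℤ → Submodule K N) (f : M →ₗ[K] N) (n : ℤ) : Prop :=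
  ∀ i, ∀ x ∈ gM i, f x ∈ gN (i + n)

/-- `d` is a (cohomological) differential. -/
def IsDifferential (gM : ℤ → Submodule K M) (d : M →ₗ[K] M) : Prop :=
  HasDegree gM gM d 1 ∧ ∀ x, d (d x) = 0

/-- `f` is a morphism of complexes. -/
def IsChainMap (gM : ℤ → Submodule K M) (dM : M →ₗ[K] M) (gN : ℤ → Submodule K N)
    (dN : N →ₗ[K] N) (f : M →ₗ[K] N) : Prop :=
  HasDegree gM gN f 0 ∧ ∀ x, f (dM x) = dN (f x)

/-- The two maps `f` and `f'` are homotopic. -/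
def AreHomotopic (gM : ℤ → Submodule K M) (dM : M →ₗ[K] M) (gN : ℤ → Submodule K N)
    (dN : N →ₗ[K] N) (f f' : M →ₗ[K] N) : Prop :=
  ∃ h : M →ₗ[K] N, HasDegree gM gN h (-1) ∧ ∀ x, f x - f' x = dN (h x) + h (dM x)

/-- `f` is a homotopy equivalence of complexes. -/
def IsHomotopyEquiv (gM : ℤ → Submodule K M) (dM : M →ₗ[K] M) (gN : ℤ → Submodule K N)
    (dN : N →ₗ[K] N) (f : M →ₗ[K] N) : Prop :=
  IsChainMap gM dM gN dN f ∧ ∃ g : N →ₗ[K] M, IsChainMap gN dN gM dM g ∧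
    AreHomotopic gM dM gM dM (g ∘ₗ f) LinearMap.id ∧
    AreHomotopic gN dN gN dN (f ∘ₗ g) LinearMap.id

end Complexes

/-! ## Graded quivers and tensor quivers -/

/-- A graded `K`-quiver with set of objects `O`. -/
abbrev GQuiver (K : Type u) [CommRing K] (O : Type u) := O → O → GrMod.{u, u} K

section Quivers

variable {K : Type u} [CommRing K] {O : Type u}

open GrMod

/-- The shift of a graded quiver. -/
abbrev qshift (n : ℤ) (Q : GQuiver K O) : GQuiver K O := fun X Y => (Q X Y).shift n

/-- The tensor product of two quivers with the same objects. -/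
abbrev qtens (P Q : GQuiver K O) : GQuiver K O :=
  fun X Z => dsum fun Y => (P Y Z).tens (Q X Y)

/-- Linear maps out of `qtens P Q` are given by bilinear maps. -/
def qlift {P Q : GQuiver K O} {X Z : O} {N : Type*} [AddCommGroup N] [Module K N]
    (f : ∀ Y, P Y Z →ₗ[K] Q X Y →ₗ[K] N) : qtens P Q X Z →ₗ[K] N :=
  desc fun Y => TensorProduct.lift (f Y)

/-- The element `x ⊗ y` of `qtens P Q`, as a bilinear map. -/
def qmk (P Q : GQuiver K O) (X Y Z : O) : P Y Z →ₗ[K] Q X Y →ₗ[K] qtens P Q X Z :=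
  (TensorProduct.mk K (P Y Z) (Q X Y)).compr₂ (incl (fun Y => (P Y Z).tens (Q X Y)) Y)

/-- `tpow Q n` is the tensor power of `Q` with `n + 1` factors: its morphisms from `X₀` to `X_{n+1}`
are the direct sum over `X₁, …, X_n` of the tensor products
`Q X_n X_{n+1} ⊗ ⋯ ⊗ Q X₀ X₁`. -/
def tpow (Q : GQuiver K O) : ℕ → GQuiver K O
  | 0 => Q
  | n + 1 => qtens Q (tpow Q n)

/-- Linear maps out of the tensor power with `n + 2` factors are given by bilinear maps. -/
def tlift {Q : GQuiver K O} {n : ℕ} {X Z : O} {N : Type*} [AddCommGroup N] [Module K N]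
    (f : ∀ Y, Q Y Z →ₗ[K] tpow Q n X Y →ₗ[K] N) : tpow Q (n + 1) X Z →ₗ[K] N :=
  qlift (P := Q) (Q := tpow Q n) f

/-- The reduced tensor quiver: the direct sum of the tensor powers with at least one factor. -/
abbrev tbar (Q : GQuiver K O) : GQuiver K O := fun X Z => dsum fun n : ℕ => tpow Q n X Z

/-- The inclusion of the tensor power with `n + 1` factors. -/
def tin (Q : GQuiver K O) (n : ℕ) (X Z : O) : tpow Q n X Z →ₗ[K] tbar Q X Z :=
  incl (fun n : ℕ => tpow Q n X Z) n

/-- The inclusion of the generators in the reduced tensor quiver. -/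
def tgen (Q : GQuiver K O) (X Z : O) : Q X Z →ₗ[K] tbar Q X Z := tin Q 0 X Z

/-- `x ⊗ w`, for a generator `x` and a tensor `w`. -/
def tcons (Q : GQuiver K O) (X Y Z : O) : Q Y Z →ₗ[K] tbar Q X Y →ₗ[K] tbar Q X Z :=
  (desc fun n => ((qmk Q (tpow Q n) X Y Z).compr₂ (tin Q (n + 1) X Z)).flip).flip

/-- The concatenation of tensors, for a tensor with `n + 1` factors on the left. -/
def tconc (Q : GQuiver K O) (X Y : O) :
    ∀ (n : ℕ) (Z : O), tpow Q n Y Z →ₗ[K] tbar Q X Y →ₗ[K] tbar Q X Z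
  | 0, Z => tcons Q X Y Z
  | n + 1, Z => tlift fun W =>
      (LinearMap.llcomp K (tbar Q X Y) (tbar Q X W) (tbar Q X Z)).compl₁₂
        (tcons Q X W Z) (tconc Q X Y n W)

/-- The concatenation `tbar Q Y Z ⊗ tbar Q X Y → tbar Q X Z`. -/
def tmul (Q : GQuiver K O) (X Y Z : O) : tbar Q Y Z →ₗ[K] tbar Q X Y →ₗ[K] tbar Q X Z :=
  desc fun n => tconc Q X Y n Z

/-- Tensoring with a generator on the left of the first factor:
`x ↦ (u ⊗ v ↦ (x ⊗ u) ⊗ v)`. -/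
def tconsLeft (Q : GQuiver K O) (X Y Z : O) :
    Q Y Z →ₗ[K] qtens (tbar Q) (tbar Q) X Y →ₗ[K] qtens (tbar Q) (tbar Q) X Z :=
  (qlift fun W => LinearMap.lflip.toLinearMap ∘ₗ
    (LinearMap.llcomp K (Q Y Z) (tbar Q W Z) (tbar Q X W →ₗ[K] qtens (tbar Q) (tbar Q) X Z)
      (qmk (tbar Q) (tbar Q) X W Z)) ∘ₗ (tcons Q W Y Z).flip).flip

/-- The deconcatenation of a tensor with `n + 1` factors: the sum of the `u ⊗ v` over all ways of
writing it as a concatenation of two nonempty tensors `u` and `v`. -/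
def deconc (Q : GQuiver K O) (X : O) :
    ∀ (n : ℕ) (Z : O), tpow Q n X Z →ₗ[K] qtens (tbar Q) (tbar Q) X Z
  | 0, _ => 0
  | n + 1, Z => tlift fun Y =>
      (qmk (tbar Q) (tbar Q) X Y Z).compl₁₂ (tgen Q Y Z) (tin Q n X Y) +
        (tconsLeft Q X Y Z).compl₁₂ LinearMap.id (deconc Q X n Y)

/-- The sum of the maps `σ ⊗ ⋯ ⊗ σ ⊗ β ⊗ ρ` over all ways of writing a tensor with `n + 1` factors
as `x₁ ⊗ ⋯ ⊗ x_a ⊗ u ⊗ v` with `a ≥ 0`, `u` nonempty and `v` possibly empty: here `σ` is applied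
to each `x_i`, `β` to `u`, and `ρ` to `v`. -/
def insertion (Q : GQuiver K O) (β : ∀ X Z, tbar Q X Z →ₗ[K] Q X Z)
    (σ : ∀ X Z, Q X Z →ₗ[K] Q X Z) (ρ : ∀ X Z, tbar Q X Z →ₗ[K] tbar Q X Z) (X : O) :
    ∀ (n : ℕ) (Z : O), tpow Q n X Z →ₗ[K] tbar Q X Z
  | 0, Z => tgen Q X Z ∘ₗ β X Z ∘ₗ tgen Q X Z
  | n + 1, Z => tgen Q X Z ∘ₗ β X Z ∘ₗ tin Q (n + 1) X Z +
      (qlift fun Y => (tcons Q X Y Z).compl₁₂ (β Y Z) (ρ X Y)) ∘ₗ deconc Q X (n + 1) Z +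
      tlift fun Y => (tcons Q X Y Z).compl₁₂ (σ Y Z) (insertion Q β σ ρ X n Y)

/-- The derivation of the reduced tensor quiver extending a map `δ` of degree `1` on the generators,
on tensors with `n + 1` factors: `x ⊗ w ↦ δ x ⊗ w + (-1)^(deg x) x ⊗ d w`. -/
def derivation (Q : GQuiver K O) (δ : ∀ X Z, Q X Z →ₗ[K] tbar Q X Z) (X : O) :
    ∀ (n : ℕ) (Z : O), tpow Q n X Z →ₗ[K] tbar Q X Z
  | 0, Z => δ X Z
  | n + 1, Z => tlift fun Y =>
      (tmul Q X Y Z).compl₁₂ (δ Y Z) (tin Q n X Y) +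
        (tcons Q X Y Z).compl₁₂ ((Q Y Z).sgn 1) (derivation Q δ X n Y)

/-- The map between tensor powers induced by a morphism of quivers which is `φ` on objects. -/
def tpowMap {O' : Type u} (φ : O → O') {Q : GQuiver K O} {Q' : GQuiver K O'}
    (F : ∀ X Y, Q X Y →ₗ[K] Q' (φ X) (φ Y)) (X : O) :
    ∀ (n : ℕ) (Z : O), tpow Q n X Z →ₗ[K] tpow Q' n (φ X) (φ Z)
  | 0, Z => F X Z
  | n + 1, Z => tlift fun Y =>
      (qmk Q' (tpow Q' n) (φ X) (φ Y) (φ Z)).compl₁₂ (F Y Z) (tpowMap φ F X n Y)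

/-- The map between reduced tensor quivers induced by a morphism of quivers. -/
def tbarMap {O' : Type u} (φ : O → O') {Q : GQuiver K O} {Q' : GQuiver K O'}
    (F : ∀ X Y, Q X Y →ₗ[K] Q' (φ X) (φ Y)) (X Z : O) :
    tbar Q X Z →ₗ[K] tbar Q' (φ X) (φ Z) :=
  desc fun n => tin Q' n (φ X) (φ Z) ∘ₗ tpowMap φ F X n Z

/-- The submodule of tensors with exactly `i` factors. -/
def tlen (Q : GQuiver K O) (i : ℕ) (X Z : O) : Submodule K (tbar Q X Z) :=
  ⨆ n : {n : ℕ // n + 1 = i}, LinearMap.range (tin Q n X Z)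

end Quivers

/-! ## Non-unital A-infinity categories and the bar construction -/

section AInfinity

variable {K : Type u} [CommRing K]

open GrMod

section

variable {O : Type u}

/-- The map on `tbar Q` which is `m n` on tensors with `n + 1` factors. -/
def opTotal (Q : GQuiver K O) (m : ∀ (n : ℕ) (X Z : O), tpow Q n X Z →ₗ[K] Q X Z) (X Z : O) :
    tbar Q X Z →ₗ[K] Q X Z :=
  desc fun n => m n X Z

/-- The map on `tbar Q` which is `m k` on tensors with `k + 1` factors and `0` on the others. -/
def opOnly (Q : GQuiver K O) (m : ∀ (n : ℕ) (X Z : O), tpow Q n X Z →ₗ[K] Q X Z) (k : ℕ)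
    (X Z : O) : tbar Q X Z →ₗ[K] Q X Z :=
  desc fun n => if n = k then m n X Z else 0

/-- Multiplication of a tensor with `i` factors by `(-1)^i`. -/
def lenSign (Q : GQuiver K O) (X Z : O) : tbar Q X Z →ₗ[K] tbar Q X Z :=
  desc fun n => (-1 : ℤ) ^ (n + 1) • tin Q n X Z

end

/-- A non-unital `A∞` category over `K`. The operation `m n` takes `n + 1` arguments, that is,
`m n` is `m_{n+1}` in the usual notation.

The relation `rel n` is, for `N = n + 1` arguments,
`∑_{k=1}^{N} ∑_{i=0}^{N-k} (-1)^(i + k(N-i-k)) m_{N-k+1} ∘ (id^{⊗ N-i-k} ⊗ m_k ⊗ id^{⊗ i}) = 0`.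
By the Koszul sign rule `m_k`, of degree `2 - k`, moves past a factor `x` on its left with the sign
`(-1)^(k * deg x)`; with the factor `(-1)^k` for each of the `N - i - k` arguments on the left this
makes the map `x ↦ (-1)^(k (deg x + 1)) x` for each argument on the left. The sign `(-1)^i` is
carried by the `i` arguments on the right. -/
structure AInfCat (K : Type u) [CommRing K] where
  Ob : Type u
  Hom : GQuiver K Ob
  m : ∀ (n : ℕ) (X Z : Ob), tpow Hom n X Z →ₗ[K] Hom X Z
  m_deg : ∀ n X Z, HasDegree (tpow Hom n X Z).gr (Hom X Z).gr (m n X Z) (1 - n)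
  rel : ∀ (n : ℕ) (X Z : Ob) (w : tpow Hom n X Z),
    ∑ k ∈ Finset.range (n + 1), opTotal Hom m X Z
      (insertion Hom (opOnly Hom m k)
        (fun X Y => (-1 : ℤ) ^ (k + 1) • (Hom X Y).sgn (k + 1)) (lenSign Hom) X n Z w) = 0

namespace AInfCat

variable (A : AInfCat K)

/-- The differential `m_1`. -/
def d (X Y : A.Ob) : A.Hom X Y →ₗ[K] A.Hom X Y := A.m 0 X Y

/-- The composition `m_2`. -/
def comp (X Y Z : A.Ob) : A.Hom Y Z →ₗ[K] A.Hom X Y →ₗ[K] A.Hom X Z :=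
  (qmk A.Hom (tpow A.Hom 0) X Y Z).compr₂ (A.m 1 X Z)

/-- A non-unital dg category is a non-unital `A∞` category with `m_i = 0` for `i > 2`. -/
def IsDG : Prop := ∀ n, 2 ≤ n → ∀ X Z, A.m n X Z = 0

/-- The shifted quiver `A[1]`. -/
abbrev sHom : GQuiver K A.Ob := qshift 1 A.Hom

/-- The map `ι ⊗ ⋯ ⊗ ι` from tensors on `A[1]` to tensors on `A`, where `ι : A[1] → A` is the
natural map of degree `1`, with its Koszul signs: in `x ⊗ w`, with `w` having `n + 1` factors, the
sign for `x` is `(-1)^((n + 1) * deg x)`, the degree being that in `A[1]`. -/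
def unshiftPow (X : A.Ob) : ∀ (n : ℕ) (Z : A.Ob), tpow A.sHom n X Z →ₗ[K] tpow A.Hom n X Z
  | 0, Z => (A.Hom X Z).unShift 1
  | n + 1, Z => tlift fun Y =>
      (qmk A.Hom (tpow A.Hom n) X Y Z).compl₁₂
        ((A.Hom Y Z).unShift 1 ∘ₗ (A.sHom Y Z).sgn (n + 1)) (unshiftPow X n Y)

/-- The operations on `A[1]`, of degree `1`, corresponding to the operations `m`: the map
corresponding to `m_i` is `(-1)^(deg m_i + i - 1) ι⁻¹ ∘ m_i ∘ (ι ⊗ ⋯ ⊗ ι)`, and the sign is `-1`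
because `m_i` has degree `2 - i`. -/
def b (n : ℕ) (X Z : A.Ob) : tpow A.sHom n X Z →ₗ[K] A.sHom X Z :=
  -((A.Hom X Z).toShift 1 ∘ₗ A.m n X Z ∘ₗ A.unshiftPow X n Z)

/-- The bar construction, as a graded quiver: the reduced tensor quiver on `A[1]`. -/
abbrev bar : GQuiver K A.Ob := tbar A.sHom

/-- The differential of the bar construction: the coderivation determined by the maps `b`. -/
def barD (X Z : A.Ob) : A.bar X Z →ₗ[K] A.bar X Z :=
  desc fun n => insertion A.sHom (opTotal A.sHom A.b) (fun X Y => (A.sHom X Y).sgn 1)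
    (fun _ _ => LinearMap.id) X n Z

/-- The comultiplication of the bar construction: deconcatenation. -/
def barComul (X Z : A.Ob) : A.bar X Z →ₗ[K] qtens A.bar A.bar X Z :=
  desc fun n => deconc A.sHom X n Z

end AInfCat

end AInfinity

/-! ## Reduced tensor products of augmentations -/

section Reduced

variable {K : Type u} [CommRing K] {O O' : Type u}

open GrMod

/-- The augmentation of a quiver: a copy of `K` is added to the endomorphisms of each object. -/
abbrev aug (P : GQuiver K O) : GQuiver K O := fun X Y => (P X Y).prod ((unit K).pow (X = Y))

/-- The unit of an object in an augmentation. -/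
def augOne (P : GQuiver K O) (X Y : O) (h : X = Y) : aug P X Y :=
  (0, powIncl h (unit K) (1 : K))

/-- The tensor product of two quivers, with objects the pairs of objects. -/
abbrev ptens (P : GQuiver K O) (Q : GQuiver K O') : GQuiver K (O × O') :=
  fun X Y => (P X.1 Y.1).tens (Q X.2 Y.2)

/-- The reduction of the tensor product of the augmentations of `P` and `Q`: the tensor product
`aug P ⊗ aug Q` without the units, that is, without the summands `K ⊗ K`.
Explicitly, the morphisms from `(A, B)` to `(A', B')` are
`P(A, A') ⊗ Q(B, B') ⊕ P(A, A')^{δ_{B,B'}} ⊕ Q(B, B')^{δ_{A,A'}}`. -/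
abbrev red (P : GQuiver K O) (Q : GQuiver K O') : GQuiver K (O × O') :=
  fun X Y => ((P X.1 Y.1).tens (Q X.2 Y.2)).prod
    (((P X.1 Y.1).pow (X.2 = Y.2)).prod ((Q X.2 Y.2).pow (X.1 = Y.1)))

/-- The inclusion of the reduction: `f ⊗ g ↦ f ⊗ g`, `f ↦ f ⊗ 1` and `g ↦ 1 ⊗ g`. -/
def redIncl (P : GQuiver K O) (Q : GQuiver K O') (X Y : O × O') :
    red P Q X Y →ₗ[K] ptens (aug P) (aug Q) X Y :=
  LinearMap.coprod (TensorProduct.map (LinearMap.inl K _ _) (LinearMap.inl K _ _))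
    (LinearMap.coprod
      (desc fun h => (TensorProduct.mk K (aug P X.1 Y.1) (aug Q X.2 Y.2)).flip
        (augOne Q X.2 Y.2 h.down) ∘ₗ LinearMap.inl K _ _)
      (desc fun h => (TensorProduct.mk K (aug P X.1 Y.1) (aug Q X.2 Y.2))
        (augOne P X.1 Y.1 h.down) ∘ₗ LinearMap.inl K _ _))

/-- The projection onto the reduction, with kernel spanned by the tensors `1 ⊗ 1`. -/
def redProj (P : GQuiver K O) (Q : GQuiver K O') (X Y : O × O') :
    ptens (aug P) (aug Q) X Y →ₗ[K] red P Q X Y :=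
  LinearMap.prod
    (TensorProduct.map (LinearMap.fst K _ _) (LinearMap.fst K _ _))
    (LinearMap.prod
      (TensorProduct.lift ((desc fun h =>
        ((LinearMap.lsmul K (P X.1 Y.1)).compr₂ (powIncl h.down (P X.1 Y.1)))).flip.compl₁₂
          (LinearMap.fst K _ _) (LinearMap.snd K _ _)))
      (TensorProduct.lift ((desc fun h =>
        ((LinearMap.lsmul K (Q X.2 Y.2)).compr₂ (powIncl h.down (Q X.2 Y.2)))).compl₁₂
          (LinearMap.snd K _ _) (LinearMap.fst K _ _))))

/-- The differential of `red P Q` induced by differentials on `P` and `Q`. -/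
def redD (P : GQuiver K O) (Q : GQuiver K O') (dP : ∀ X Y, P X Y →ₗ[K] P X Y)
    (dQ : ∀ X Y, Q X Y →ₗ[K] Q X Y) (X Y : O × O') : red P Q X Y →ₗ[K] red P Q X Y :=
  LinearMap.prodMap (tensD (P X.1 Y.1) (Q X.2 Y.2) (dP X.1 Y.1) (dQ X.2 Y.2))
    (LinearMap.prodMap (powMap id (dP X.1 Y.1)) (powMap id (dQ X.2 Y.2)))

/-- The comultiplication of the augmentation of a non-unital cocategory with comultiplication `Δ`:
`x ↦ Δ x + x ⊗ 1 + 1 ⊗ x` and `1 ↦ 1 ⊗ 1`. -/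
def augComul (P : GQuiver K O) (Δ : ∀ X Z, P X Z →ₗ[K] qtens P P X Z) (X Z : O) :
    aug P X Z →ₗ[K] qtens (aug P) (aug P) X Z :=
  LinearMap.coprod
    ((qlift fun Y => (qmk (aug P) (aug P) X Y Z).compl₁₂ (LinearMap.inl K _ _)
        (LinearMap.inl K _ _)) ∘ₗ Δ X Z +
      (qmk (aug P) (aug P) X X Z).flip (augOne P X X rfl) ∘ₗ LinearMap.inl K _ _ +
      (qmk (aug P) (aug P) X Z Z) (augOne P Z Z rfl) ∘ₗ LinearMap.inl K _ _)
    (desc fun h => LinearMap.toSpanSingleton K _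
      (qmk (aug P) (aug P) X X Z (augOne P X Z h.down) (augOne P X X rfl)))

/-- The comultiplication of the tensor product of two cocategories:
`(Δ x = x' ⊗ x'', Δ y = y' ⊗ y'') ↦ (-1)^(deg x'' * deg y') (x' ⊗ y') ⊗ (x'' ⊗ y'')`. -/
def ptensComul (P : GQuiver K O) (Q : GQuiver K O') (ΔP : ∀ X Z, P X Z →ₗ[K] qtens P P X Z)
    (ΔQ : ∀ X Z, Q X Z →ₗ[K] qtens Q Q X Z) (X Z : O × O') :
    ptens P Q X Z →ₗ[K] qtens (ptens P Q) (ptens P Q) X Z :=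
  TensorProduct.lift
    (desc (M := fun Y => (P Y Z.1).tens (P X.1 Y)) fun Y => LinearMap.flip
      (desc (M := fun Y' => (Q Y' Z.2).tens (Q X.2 Y')) fun Y' => LinearMap.flip
        ((TensorProduct.mk K _ _).compr₂
          (incl (fun W : O × O' => (ptens P Q W Z).tens (ptens P Q X W)) (Y, Y') ∘ₗ
            midSwap (P Y Z.1) (P X.1 Y) (Q Y' Z.2) (Q X.2 Y'))))) ∘ₗ
    TensorProduct.map (ΔP X.1 Z.1) (ΔQ X.2 Z.2)

/-- The comultiplication of the reduction of `aug P ⊗ aug Q`. -/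
def redComul (P : GQuiver K O) (Q : GQuiver K O') (ΔP : ∀ X Z, P X Z →ₗ[K] qtens P P X Z)
    (ΔQ : ∀ X Z, Q X Z →ₗ[K] qtens Q Q X Z) (X Z : O × O') :
    red P Q X Z →ₗ[K] qtens (red P Q) (red P Q) X Z :=
  (qlift fun Y => (qmk (red P Q) (red P Q) X Y Z).compl₁₂ (redProj P Q Y Z) (redProj P Q X Y)) ∘ₗ
    ptensComul (aug P) (aug Q) (augComul P ΔP) (augComul Q ΔQ) X Z ∘ₗ redIncl P Q X Z

/-- The composition of the augmentation of a non-unital graded category. -/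
def augComp (P : GQuiver K O) (c : ∀ X Y Z, P Y Z →ₗ[K] P X Y →ₗ[K] P X Z) (X Y Z : O) :
    aug P Y Z →ₗ[K] aug P X Y →ₗ[K] aug P X Z :=
  LinearMap.coprod
    (LinearMap.flip (LinearMap.coprod
      ((c X Y Z).compr₂ (LinearMap.inl K _ _)).flip
      (desc fun h => (LinearMap.lsmul K (aug P X Z)).compl₂
        (LinearMap.inl K _ _ ∘ₗ (h.down ▸ LinearMap.id : P Y Z →ₗ[K] P X Z)))))
    (LinearMap.flip (LinearMap.coprod
      (LinearMap.flip (desc fun h => (LinearMap.lsmul K (aug P X Z)).compl₂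
        (LinearMap.inl K _ _ ∘ₗ (h.down ▸ LinearMap.id : P X Y →ₗ[K] P X Z))))
      (desc fun h => LinearMap.flip (desc fun h' => (LinearMap.mul K K).compr₂
        (LinearMap.inr K _ _ ∘ₗ powIncl (h.down.trans h'.down) (unit K))))))

/-- The composition of the tensor product of two non-unital graded categories:
`(f ⊗ g) ∘ (f' ⊗ g') = (-1)^(deg g * deg f') (f ∘ f') ⊗ (g ∘ g')`. -/
def ptensComp (P : GQuiver K O) (Q : GQuiver K O')
    (cP : ∀ X Y Z, P Y Z →ₗ[K] P X Y →ₗ[K] P X Z) (cQ : ∀ X Y Z, Q Y Z →ₗ[K] Q X Y →ₗ[K] Q X Z)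
    (X Y Z : O × O') : ptens P Q Y Z →ₗ[K] ptens P Q X Y →ₗ[K] ptens P Q X Z :=
  (TensorProduct.mk K _ _).compr₂
    (TensorProduct.map (TensorProduct.lift (cP X.1 Y.1 Z.1)) (TensorProduct.lift (cQ X.2 Y.2 Z.2)) ∘ₗ
      midSwap (P Y.1 Z.1) (Q Y.2 Z.2) (P X.1 Y.1) (Q X.2 Y.2))

/-- The composition of the reduction of `aug P ⊗ aug Q`. -/
def redComp (P : GQuiver K O) (Q : GQuiver K O')
    (cP : ∀ X Y Z, P Y Z →ₗ[K] P X Y →ₗ[K] P X Z) (cQ : ∀ X Y Z, Q Y Z →ₗ[K] Q X Y →ₗ[K] Q X Z)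
    (X Y Z : O × O') : red P Q Y Z →ₗ[K] red P Q X Y →ₗ[K] red P Q X Z :=
  ((ptensComp (aug P) (aug Q) (augComp P cP) (augComp Q cQ) X Y Z).compl₁₂
    (redIncl P Q Y Z) (redIncl P Q X Y)).compr₂ (redProj P Q X Z)

/-- The map between reductions induced by morphisms of quivers. -/
def redMap {O₁ O₁' : Type u} {P : GQuiver K O} {Q : GQuiver K O'} {P₁ : GQuiver K O₁}
    {Q₁ : GQuiver K O₁'} (φ : O → O₁) (ψ : O' → O₁') (F : ∀ X Y, P X Y →ₗ[K] P₁ (φ X) (φ Y))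
    (G : ∀ X Y, Q X Y →ₗ[K] Q₁ (ψ X) (ψ Y)) (X Y : O × O') :
    red P Q X Y →ₗ[K] red P₁ Q₁ (Prod.map φ ψ X) (Prod.map φ ψ Y) :=
  LinearMap.prodMap (TensorProduct.map (F X.1 Y.1) (G X.2 Y.2))
    (LinearMap.prodMap (powMap (congrArg ψ) (F X.1 Y.1)) (powMap (congrArg φ) (G X.2 Y.2)))

end Reduced

/-! ## The cobar construction -/

section Cobar

variable {K : Type u} [CommRing K] {O : Type u}

open GrMod

/-- The cobar construction on a graded cocategory `C`, as a graded quiver: the reduced tensor quiver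
on `C[-1]`. Its composition is the concatenation `tmul`. -/
abbrev cobar (C : GQuiver K O) : GQuiver K O := tbar (qshift (-1) C)

/-- The differential of the cobar construction on the generators, for a cocategory with
differential `d` and comultiplication `Δ`. If `s` is the natural map `C → C[-1]`, of degree `1`,
and `Δ c = c' ⊗ c''`, then `s c` is mapped to `- s (d c) - (-1)^(deg c') s c' ⊗ s c''`. -/
def cobarGenD (C : GQuiver K O) (d : ∀ X Z, C X Z →ₗ[K] C X Z)
    (Δ : ∀ X Z, C X Z →ₗ[K] qtens C C X Z) (X Z : O) :
    qshift (-1) C X Z →ₗ[K] cobar C X Z :=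
  -(tgen (qshift (-1) C) X Z ∘ₗ (C X Z).toShift (-1) ∘ₗ d X Z ∘ₗ (C X Z).unShift (-1)) -
    (qlift fun Y => (tcons (qshift (-1) C) X Y Z).compl₁₂
      ((C Y Z).toShift (-1) ∘ₗ (C Y Z).sgn 1)
      (tgen (qshift (-1) C) X Y ∘ₗ (C X Y).toShift (-1))) ∘ₗ Δ X Z ∘ₗ (C X Z).unShift (-1)

/-- The differential of the cobar construction. -/
def cobarD (C : GQuiver K O) (d : ∀ X Z, C X Z →ₗ[K] C X Z)
    (Δ : ∀ X Z, C X Z →ₗ[K] qtens C C X Z) (X Z : O) : cobar C X Z →ₗ[K] cobar C X Z :=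
  desc fun n => derivation (qshift (-1) C) (cobarGenD C d Δ) X n Z

/-- For a quiver `Q` with bigraded pieces `V i j`, the part of bidegree `(m, n)` of the tensors with
`l + 1` factors: it is spanned by the tensors of elements of pieces with total bidegree `(m, n)`. -/
def bidegPow (Q : GQuiver K O) (V : ℕ → ℕ → ∀ X Y, Submodule K (Q X Y)) (X : O) :
    ∀ (l : ℕ), ℕ → ℕ → ∀ Z, Submodule K (tpow Q l X Z)
  | 0, m, n, Z => V m n X Z
  | l + 1, m, n, Z => Submodule.span K {z : tpow Q (l + 1) X Z |
      ∃ (Y : O) (i j m' n' : ℕ) (x : Q Y Z) (w : tpow Q l X Y), i + m' = m ∧ j + n' = n ∧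
        x ∈ V i j Y Z ∧ w ∈ bidegPow Q V X l m' n' Y ∧ z = qmk Q (tpow Q l) X Y Z x w}

end Cobar

/-! ## The two quivers and the comparison map -/

section Main

variable {K : Type u} [CommRing K] (A B : AInfCat K)

open GrMod

/-- The reduction of the tensor product of the augmentations of `A` and `B`. -/
abbrev redAB : GQuiver K (A.Ob × B.Ob) := red A.Hom B.Hom

/-- Its differential. -/
def redABD (X Y : A.Ob × B.Ob) : redAB A B X Y →ₗ[K] redAB A B X Y :=
  redD A.Hom B.Hom A.d B.d X Y

/-- The cocategory `C`, the reduction of the tensor product of the augmentations of the bar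
constructions of `A` and `B`. -/
abbrev barAB : GQuiver K (A.Ob × B.Ob) := red A.bar B.bar

/-- The differential of `C`. -/
def barABD (X Y : A.Ob × B.Ob) : barAB A B X Y →ₗ[K] barAB A B X Y :=
  redD A.bar B.bar A.barD B.barD X Y

/-- The comultiplication of `C`. -/
def barABComul (X Y : A.Ob × B.Ob) : barAB A B X Y →ₗ[K] qtens (barAB A B) (barAB A B) X Y :=
  redComul A.bar B.bar A.barComul B.barComul X Y

/-- The generators of the cobar construction of `C`. -/
abbrev genAB : GQuiver K (A.Ob × B.Ob) := qshift (-1) (barAB A B)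

/-- The cobar construction of `C`. -/
abbrev cobarAB : GQuiver K (A.Ob × B.Ob) := cobar (barAB A B)

/-- The differential of the cobar construction of `C`. -/
def cobarABD (X Y : A.Ob × B.Ob) : cobarAB A B X Y →ₗ[K] cobarAB A B X Y :=
  cobarD (barAB A B) (barABD A B) (barABComul A B) X Y

/-- The piece `C_{i,j}` of `C`: the tensors with `i` factors from `A[1]` and `j` from `B[1]`. -/
def genBideg (i j : ℕ) (X Y : A.Ob × B.Ob) : Submodule K (genAB A B X Y) :=
  Submodule.span K ({z : barAB A B X Y | ∃ u ∈ tlen A.sHom i X.1 Y.1, ∃ v ∈ tlen B.sHom j X.2 Y.2,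
      z = (u ⊗ₜ v, 0, 0)} ∪
    {z : barAB A B X Y | j = 0 ∧ ∃ h : X.2 = Y.2, ∃ u ∈ tlen A.sHom i X.1 Y.1,
      z = (0, powIncl h (A.bar X.1 Y.1) u, 0)} ∪
    {z : barAB A B X Y | i = 0 ∧ ∃ h : X.1 = Y.1, ∃ v ∈ tlen B.sHom j X.2 Y.2,
      z = (0, 0, powIncl h (B.bar X.2 Y.2) v)})

/-- The part `V_{m,n}` of the cobar construction of `C`: it is spanned by the tensors of elements of
`C_{m_l,n_l}`, …, `C_{m_1,n_1}` with `m_1 + ⋯ + m_l = m` and `n_1 + ⋯ + n_l = n`. -/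
def bideg (m n : ℕ) (X Y : A.Ob × B.Ob) : Submodule K (cobarAB A B X Y) :=
  ⨆ l : ℕ, (bidegPow (genAB A B) (genBideg A B) X l m n Y).map (tin (genAB A B) l X Y)

/-- The direct sum of the `V_{m,n}` with `0 ≤ m, n ≤ 1`. -/
def lowPart (X Y : A.Ob × B.Ob) : Submodule K (cobarAB A B X Y) :=
  ⨆ (m : ℕ) (n : ℕ) (_ : m ≤ 1 ∧ n ≤ 1), bideg A B m n X Y

/-- The morphisms of `A` as generators of the cobar construction of `C`. -/
def genA (X Y : A.Ob × B.Ob) (h : X.2 = Y.2) : A.Hom X.1 Y.1 →ₗ[K] genAB A B X Y :=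
  (barAB A B X Y).toShift (-1) ∘ₗ LinearMap.inr K _ _ ∘ₗ LinearMap.inl K _ _ ∘ₗ
    powIncl h (A.bar X.1 Y.1) ∘ₗ tgen A.sHom X.1 Y.1 ∘ₗ (A.Hom X.1 Y.1).toShift 1

/-- The morphisms of `B` as generators of the cobar construction of `C`. -/
def genB (X Y : A.Ob × B.Ob) (h : X.1 = Y.1) : B.Hom X.2 Y.2 →ₗ[K] genAB A B X Y :=
  (barAB A B X Y).toShift (-1) ∘ₗ LinearMap.inr K _ _ ∘ₗ LinearMap.inr K _ _ ∘ₗ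
    powIncl h (B.bar X.2 Y.2) ∘ₗ tgen B.sHom X.2 Y.2 ∘ₗ (B.Hom X.2 Y.2).toShift 1

/-- The comparison map from the reduction of the tensor product of the augmentations of `A` and `B`
to the cobar construction of `C`: it maps `f` to `f`, `g` to `g`, and `f ⊗ g` to
`(-1)^(deg f * deg g) g ⊗ f`. -/
def comparison (X Y : A.Ob × B.Ob) : redAB A B X Y →ₗ[K] cobarAB A B X Y :=
  LinearMap.coprod
    (TensorProduct.lift ((tcons (genAB A B) X (Y.1, X.2) Y).compl₁₂
      (genB A B (Y.1, X.2) Y rfl)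
      (tgen (genAB A B) X (Y.1, X.2) ∘ₗ genA A B X (Y.1, X.2) rfl)) ∘ₗ
      kswap (A.Hom X.1 Y.1) (B.Hom X.2 Y.2))
    (LinearMap.coprod
      (desc fun h => tgen (genAB A B) X Y ∘ₗ genA A B X Y h.down)
      (desc fun h => tgen (genAB A B) X Y ∘ₗ genB A B X Y h.down))

end Main

/-! ## Non-unital dg categories and dg functors -/

section DG

variable {K : Type u} [CommRing K]

open GrMod

/-- The data of a non-unital dg category; the laws are in `DGData.IsDGCat`. -/
structure DGData (K : Type u) [CommRing K] where
  Ob : Type u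
  Hom : GQuiver K Ob
  d : ∀ X Y, Hom X Y →ₗ[K] Hom X Y
  comp : ∀ X Y Z, Hom Y Z →ₗ[K] Hom X Y →ₗ[K] Hom X Z

/-- The laws of a non-unital dg category. -/
structure DGData.IsDGCat (D : DGData K) : Prop where
  isDifferential : ∀ X Y, IsDifferential (D.Hom X Y).gr (D.d X Y)
  comp_deg : ∀ X Y Z i j, ∀ f ∈ (D.Hom Y Z).gr i, ∀ g ∈ (D.Hom X Y).gr j,
    D.comp X Y Z f g ∈ (D.Hom X Z).gr (i + j)
  leibniz : ∀ X Y Z i, ∀ f ∈ (D.Hom Y Z).gr i, ∀ g : D.Hom X Y,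
    D.d X Z (D.comp X Y Z f g) =
      D.comp X Y Z (D.d Y Z f) g + (i.negOnePow : ℤ) • D.comp X Y Z f (D.d X Y g)
  assoc : ∀ X Y Z W (f : D.Hom Z W) (g : D.Hom Y Z) (h : D.Hom X Y),
    D.comp X Y W (D.comp Y Z W f g) h = D.comp X Z W f (D.comp X Y Z g h)

/-- The data of a non-unital dg functor. -/
structure DGFunData (D E : DGData K) where
  obj : D.Ob → E.Ob
  map : ∀ X Y, D.Hom X Y →ₗ[K] E.Hom (obj X) (obj Y)

/-- A non-unital dg functor preserves degrees, differentials and compositions. -/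
structure DGFunData.IsDGFunctor {D E : DGData K} (F : DGFunData D E) : Prop where
  isChainMap : ∀ X Y, IsChainMap (D.Hom X Y).gr (D.d X Y) (E.Hom (F.obj X) (F.obj Y)).gr
    (E.d (F.obj X) (F.obj Y)) (F.map X Y)
  map_comp : ∀ X Y Z (f : D.Hom Y Z) (g : D.Hom X Y),
    F.map X Z (D.comp X Y Z f g) = E.comp _ _ _ (F.map Y Z f) (F.map X Y g)

/-- A homotopy isomorphism is bijective on objects and a homotopy equivalence on morphisms. -/
def DGFunData.IsHomotopyIso {D E : DGData K} (F : DGFunData D E) : Prop :=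
  Function.Bijective F.obj ∧
    ∀ X Y, IsHomotopyEquiv (D.Hom X Y).gr (D.d X Y) (E.Hom (F.obj X) (F.obj Y)).gr
      (E.d (F.obj X) (F.obj Y)) (F.map X Y)

/-- The composition of two functors. -/
def DGFunData.comp {D E F : DGData K} (G : DGFunData E F) (H : DGFunData D E) : DGFunData D F where
  obj := G.obj ∘ H.obj
  map X Y := G.map (H.obj X) (H.obj Y) ∘ₗ H.map X Y

/-- An `A∞` category as the data of a dg category, forgetting `m_i` for `i > 2`. -/
def AInfCat.toDG (A : AInfCat K) : DGData K where
  Ob := A.Ob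
  Hom := A.Hom
  d := A.d
  comp := A.comp

/-- The cobar construction of `C` as a non-unital dg category. -/
def cobarDG (A B : AInfCat K) : DGData K where
  Ob := A.Ob × B.Ob
  Hom := cobarAB A B
  d := cobarABD A B
  comp := tmul (genAB A B)

/-- The reduction of the tensor product of the augmentations of `A` and `B` as a non-unital dg
category, when `A` and `B` are non-unital dg categories. -/
def redDG (A B : AInfCat K) : DGData K where
  Ob := A.Ob × B.Ob
  Hom := redAB A B
  d := redABD A B
  comp := redComp A.Hom B.Hom A.comp B.comp

/-- The projection from the bar construction of `A` to `A`. -/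
def AInfCat.barProj (A : AInfCat K) (X Y : A.Ob) : A.bar X Y →ₗ[K] A.Hom X Y :=
  desc fun n => match n with
    | 0 => (A.Hom X Y).unShift 1
    | _ + 1 => 0

/-- The values of the functor `N` on generators: the identity on the morphisms of `A` and on those
of `B`, and `0` on the tensors with at least two factors. -/
def nGen (A B : AInfCat K) (X Y : A.Ob × B.Ob) : genAB A B X Y →ₗ[K] redAB A B X Y :=
  LinearMap.inr K _ _ ∘ₗ
    LinearMap.prodMap (powMap id (A.barProj X.1 Y.1)) (powMap id (B.barProj X.2 Y.2)) ∘ₗ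
    LinearMap.snd K _ _ ∘ₗ (barAB A B X Y).unShift (-1)

/-- The functor `N` on tensors with `n + 1` factors: the multiplicative extension of `nGen`. -/
def nPow (A B : AInfCat K) (X : A.Ob × B.Ob) :
    ∀ (n : ℕ) (Z : A.Ob × B.Ob), tpow (genAB A B) n X Z →ₗ[K] redAB A B X Z
  | 0, Z => nGen A B X Z
  | n + 1, Z => tlift fun Y =>
      ((redDG A B).comp X Y Z).compl₁₂ (nGen A B Y Z) (nPow A B X n Y)

/-- The functor `N` from the cobar construction of `C` to the reduction of the tensor product of the
augmentations of `A` and `B`. -/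
def functorN (A B : AInfCat K) : DGFunData (cobarDG A B) (redDG A B) where
  obj := id
  map X Y := desc fun n => nPow A B X n Y

/-- The functor between reductions induced by functors `F` and `G`. -/
def redFun {A B A' B' : AInfCat K} (F : DGFunData A.toDG A'.toDG) (G : DGFunData B.toDG B'.toDG) :
    DGFunData (redDG A B) (redDG A' B') where
  obj := Prod.map F.obj G.obj
  map := redMap (P := A.Hom) (Q := B.Hom) (P₁ := A'.Hom) (Q₁ := B'.Hom) F.obj G.obj F.map G.map

/-- The map between bar constructions induced by a functor. -/
def barFun {A A' : AInfCat K} (F : DGFunData A.toDG A'.toDG) (X Y : A.Ob) :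
    A.bar X Y →ₗ[K] A'.bar (F.obj X) (F.obj Y) :=
  tbarMap (Q := A.sHom) (Q' := A'.sHom) F.obj (fun X Y =>
    (A'.Hom (F.obj X) (F.obj Y)).toShift 1 ∘ₗ F.map X Y ∘ₗ (A.Hom X Y).unShift 1) X Y

/-- The functor between cobar constructions induced by functors `F` and `G`. -/
def cobarFun {A B A' B' : AInfCat K} (F : DGFunData A.toDG A'.toDG)
    (G : DGFunData B.toDG B'.toDG) : DGFunData (cobarDG A B) (cobarDG A' B') where
  obj := Prod.map F.obj G.obj
  map := tbarMap (Q := genAB A B) (Q' := genAB A' B') (Prod.map F.obj G.obj) fun X Y =>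
    (barAB A' B' (Prod.map F.obj G.obj X) (Prod.map F.obj G.obj Y)).toShift (-1) ∘ₗ
      redMap F.obj G.obj (barFun F) (barFun G) X Y ∘ₗ (barAB A B X Y).unShift (-1)

end DG

end AInf

end

noncomputable section

namespace AInf

open scoped TensorProduct DirectSum Classical

variable {K : Type u} [CommRing K] {N : Type*} [AddCommGroup N] [Module K N]

section Instances

/-! ## Shortcuts for instances -/

abbrev dsumModule {ι : Type v} (M : ι → GrMod.{u, w} K) : Module K (⨁ i, (M i).carrier) :=
  DirectSum.instModule

abbrev tensModule (M N : GrMod.{u, w} K) : Module K (M.carrier ⊗[K] N.carrier) :=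
  TensorProduct.leftModule

abbrev homModule (M : Type v) (N : Type w) [AddCommMonoid M] [AddCommMonoid N] [Module K M]
    [Module K N] : Module K (M →ₗ[K] N) :=
  LinearMap.module

theorem smulCommClass_self' (M : Type v) [AddCommMonoid M] [Module K M] : SMulCommClass K K M :=
  inferInstance

theorem isScalarTower_self (M : Type v) [AddCommMonoid M] [Module K M] : IsScalarTower K K M :=
  inferInstance

theorem zeroHomClass_linearMap (M : Type v) (N : Type w) [AddCommMonoid M] [AddCommMonoid N]
    [Module K M] [Module K N] : ZeroHomClass (M →ₗ[K] N) M N :=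
  inferInstance

theorem addMonoidHomClass_linearMap (M : Type v) (N : Type w) [AddCommMonoid M] [AddCommMonoid N]
    [Module K M] [Module K N] : AddMonoidHomClass (M →ₗ[K] N) M N :=
  inferInstance

theorem addHomClass_linearMap (M : Type v) (N : Type w) [AddCommMonoid M] [AddCommMonoid N]
    [Module K M] [Module K N] : AddHomClass (M →ₗ[K] N) M N :=
  inferInstance

variable (M : GrMod.{u, w} K)

abbrev carrierAddCommMonoid : AddCommMonoid M := inferInstance

abbrev carrierAddGroup : AddGroup M := inferInstance

abbrev carrierAddMonoid : AddMonoid M := inferInstance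

abbrev carrierAddZeroClass : AddZeroClass M := inferInstance

abbrev carrierZero : Zero M := inferInstance

abbrev carrierAdd : Add M := inferInstance

variable {ι : Type v} (F : ι → Type w)

abbrev dsumAddGroup [∀ i, AddCommGroup (F i)] : AddGroup (⨁ i, F i) := inferInstance

variable [∀ i, AddCommMonoid (F i)]

abbrev dsumAddCommMonoid : AddCommMonoid (⨁ i, F i) := inferInstance

abbrev dsumAddMonoid : AddMonoid (⨁ i, F i) := inferInstance

abbrev dsumAddZeroClass : AddZeroClass (⨁ i, F i) := inferInstance

abbrev dsumZero : Zero (⨁ i, F i) := inferInstance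

abbrev dsumAdd : Add (⨁ i, F i) := inferInstance

variable (M : Type v) (N : Type w) [AddCommGroup M] [AddCommMonoid N] [Module K M] [Module K N]

abbrev tensAddCommMonoid : AddCommMonoid (M ⊗[K] N) := inferInstance

abbrev tensAddGroup : AddGroup (M ⊗[K] N) := inferInstance

abbrev tensAddMonoid : AddMonoid (M ⊗[K] N) := inferInstance

abbrev tensAddZeroClass : AddZeroClass (M ⊗[K] N) := inferInstance

abbrev tensZero : Zero (M ⊗[K] N) := inferInstance

abbrev tensAdd : Add (M ⊗[K] N) := inferInstance

end Instances

attribute [local instance] dsumModule tensModule homModule smulCommClass_self'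
  isScalarTower_self zeroHomClass_linearMap addMonoidHomClass_linearMap addHomClass_linearMap
  GrMod.acg DirectSum.instAddCommGroup TensorProduct.addCommGroup carrierAddCommMonoid
  carrierAddGroup carrierAddMonoid carrierAddZeroClass carrierZero carrierAdd dsumAddCommMonoid
  dsumAddGroup dsumAddMonoid dsumAddZeroClass dsumZero dsumAdd tensAddCommMonoid tensAddGroup
  tensAddMonoid tensAddZeroClass tensZero tensAdd

theorem lapply_eq {M : Type*} [AddCommGroup M] [Module K M] (f g : M →ₗ[K] N) (h : f = g) (x : M) :
    f x = g x :=
  LinearMap.congr_fun h x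

open LinearMap (inl inr)
open LinearMap renaming comp_apply → comp_app, flip_apply → flip_app, compl₁₂_apply → compl₁₂_app,
  compr₂_apply → compr₂_app, coprod_apply → coprod_app, inl_apply → inl_app, id_apply → id_app,
  congr_fun → lcongr, ext → lext, id → lid, add_apply → ladd_app, zero_apply → lzero_app,
  neg_apply → lneg_app, sub_apply → lsub_app, smul_apply → lsmul_app
open Int (negOnePow_add negOnePow_one negOnePow_zero negOnePow_sub negOnePow_succ)
open TensorProduct (zero_tmul tmul_zero add_tmul tmul_add smul_tmul' tmul_smul)
open Submodule (mem_comap subset_span mem_bot mem_iSup_of_mem span_le)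

/-! ## Homogeneous elements -/

namespace GrMod

theorem gr_le_induction (M : GrMod.{u, w} K) {p : M → Prop} (hom : ∀ i, ∀ x ∈ M.gr i, p x)
    (zero : p 0) (add : ∀ x y, p x → p y → p (x + y)) (x : M) : p x := by
  have hx : x ∈ ⨆ i, M.gr i := by rw [M.iSup_gr]; trivial
  induction hx using Submodule.iSup_induction' with
  | mem i x hx => exact hom i x hx
  | zero => exact zero
  | add x y _ _ hx hy => exact add x y hx hy

theorem hom_ext_gr (M : GrMod.{u, w} K) {N : Type v} [AddCommGroup N] [Module K N]
    {f g : M →ₗ[K] N} (h : ∀ i, ∀ x ∈ M.gr i, f x = g x) : f = g := by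
  ext x
  exact gr_le_induction M (p := fun x => f x = g x) h (by simp)
    (fun x y hx hy => by rw [map_add, map_add, hx, hy]) x

theorem sgn_of_mem (M : GrMod.{u, w} K) (p : ℤ) {i : ℤ} {x : M} (hx : x ∈ M.gr i) :
    M.sgn p x = ((p * i).negOnePow : ℤ) • x := by
  rw [sgn, M.byDegree_of_mem _ hx]
  rfl

theorem sgn_one_of_mem (M : GrMod.{u, w} K) {i : ℤ} {x : M} (hx : x ∈ M.gr i) :
    M.sgn 1 x = (i.negOnePow : ℤ) • x := by
  rw [M.sgn_of_mem 1 hx, one_mul]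

theorem sgn_mem (M : GrMod.{u, w} K) (p : ℤ) {i : ℤ} {x : M} (hx : x ∈ M.gr i) :
    M.sgn p x ∈ M.gr i := by
  rw [M.sgn_of_mem p hx]
  exact zsmul_mem hx _

theorem negOnePow_cases (n : ℤ) : n.negOnePow = 1 ∨ n.negOnePow = -1 := Int.units_eq_one_or _

theorem sgn_sgn (M : GrMod.{u, w} K) (p q : ℤ) (x : M) : M.sgn p (M.sgn q x) = M.sgn (p + q) x := by
  refine M.gr_le_induction (p := fun x => M.sgn p (M.sgn q x) = M.sgn (p + q) x) ?_ (by simp)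
    (fun x y hx hy => by simp only [map_add, hx, hy]) x
  intro i x hx
  rw [M.sgn_of_mem q hx, map_zsmul, M.sgn_of_mem p hx, M.sgn_of_mem _ hx, smul_smul, add_mul,
    negOnePow_add, mul_comm]
  rfl

theorem sgn_even (M : GrMod.{u, w} K) {p : ℤ} (hp : Even p) (x : M) : M.sgn p x = x := by
  refine M.gr_le_induction (p := fun x => M.sgn p x = x) ?_ (by simp)
    (fun x y hx hy => by simp only [map_add, hx, hy]) x
  intro i x hx
  rw [M.sgn_of_mem p hx, Int.negOnePow_even _ (hp.mul_right i), Units.val_one, one_smul]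

@[simp]
theorem sgn_one_sgn_one (M : GrMod.{u, w} K) (x : M) : M.sgn 1 (M.sgn 1 x) = x := by
  rw [sgn_sgn, M.sgn_even (by decide)]

theorem shift_sgn (M : GrMod.{u, w} K) (n p : ℤ) (x : M) :
    (M.shift n).sgn p x = ((p * n).negOnePow : ℤ) • M.sgn p x := by
  refine M.gr_le_induction
    (p := fun x => (M.shift n).sgn p x = ((p * n).negOnePow : ℤ) • M.sgn p x) ?_ (by simp)
    (fun x y hx hy => by
      rw [map_add (M.sgn p), smul_add, ← hx, ← hy]
      exact map_add ((M.shift n).sgn p) x y) x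
  intro i x hx
  have h : (M.shift n).sgn p x = _ := (M.shift n).sgn_of_mem p (i := i - n) (x := x)
    (by show x ∈ M.gr (n + (i - n)); rwa [add_sub_cancel])
  rw [h, M.sgn_of_mem p hx, smul_smul]
  congr 1
  rw [mul_sub, negOnePow_sub, mul_comm]
  rfl

/-- Homogeneous maps commute with the sign operator up to the sign of their degree. -/
theorem sgn_map_of_hasDegree {M N : GrMod.{u, u} K} {f : M →ₗ[K] N} {n : ℤ}
    (hf : HasDegree M.gr N.gr f n) (p : ℤ) (x : M) :
    N.sgn p (f x) = ((p * n).negOnePow : ℤ) • f (M.sgn p x) := by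
  refine M.gr_le_induction
    (p := fun x => N.sgn p (f x) = ((p * n).negOnePow : ℤ) • f (M.sgn p x)) ?_ (by simp)
    (fun x y hx hy => by simp only [map_add, hx, hy, smul_add]) x
  intro i x hx
  rw [N.sgn_of_mem p (hf i x hx), M.sgn_of_mem p hx, map_zsmul, smul_smul, mul_add, negOnePow_add,
    mul_comm]
  rfl

/-! ### Direct sums -/

section Dsum

variable {ι : Type v} {M : ι → GrMod.{u, w} K}

theorem desc_incl
    (f : ∀ i, M i →ₗ[K] N) (i : ι) (x : M i) : desc f (incl M i x) = f i x :=
  DirectSum.toModule_lof (M := fun i => (M i : Type w)) K i x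

theorem dsum_induction {p : dsum M → Prop} (zero : p 0) (add : ∀ x y, p x → p y → p (x + y))
    (of : ∀ i x, p (incl M i x)) (x : dsum M) : p x :=
  DirectSum.induction_on x zero of add

theorem dsum_ext {f g : dsum M →ₗ[K] N}
    (h : ∀ i x, f (incl M i x) = g (incl M i x)) : f = g := by
  refine lext fun x => ?_
  induction x using dsum_induction with
  | zero => simp
  | add x y hx hy => rw [map_add, map_add, hx, hy]
  | of i x => exact h i x

theorem incl_mem {i : ι} {n : ℤ} {x : M i} (hx : x ∈ (M i).gr n) : incl M i x ∈ (dsum M).gr n :=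
  mem_iSup_of_mem i ⟨x, hx, rfl⟩

theorem dsum_gr_le {n : ℤ} {S : Submodule K (dsum M)}
    (h : ∀ i, ∀ x ∈ (M i).gr n, incl M i x ∈ S) : (dsum M).gr n ≤ S := by
  refine iSup_le fun i => ?_
  rintro _ ⟨x, hx, rfl⟩
  exact h i x hx

theorem dsum_sgn (p : ℤ) (i : ι) (x : M i) :
    (dsum M).sgn p (incl M i x) = incl M i ((M i).sgn p x) := by
  refine (M i).gr_le_induction
    (p := fun x => (dsum M).sgn p (incl M i x) = incl M i ((M i).sgn p x)) ?_ (by simp)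
    (fun x y hx hy => by simp only [map_add, hx, hy]) x
  intro n x hx
  rw [(dsum M).sgn_of_mem p (incl_mem hx), (M i).sgn_of_mem p hx, map_zsmul]

theorem powMap_powIncl {p q : Prop} (h : p → q) {M N : GrMod.{u, w} K} (f : M →ₗ[K] N) (hp : p)
    (x : M) : powMap h f (powIncl hp M x) = powIncl (h hp) N (f x) :=
  desc_incl _ _ _

theorem desc_powIncl {p : Prop} {M : GrMod.{u, w} K}
    (f : ∀ _ : PLift p, M →ₗ[K] N) (hp : p) (x : M) : no_index (desc f (powIncl hp M x)) = f ⟨hp⟩ x :=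
  desc_incl _ _ _

theorem pow_induction {p : Prop} {M : GrMod.{u, w} K} {P : M.pow p → Prop} (zero : ¬ p → P 0)
    (of : ∀ (h : p) x, P (powIncl h M x)) (x : M.pow p) : P x := by
  by_cases h : p
  · suffices ∃ y, x = powIncl h M y by
      obtain ⟨y, rfl⟩ := this
      exact of h y
    induction x using dsum_induction with
    | zero => exact ⟨0, by simp⟩
    | add x y hx hy =>
      obtain ⟨x, rfl⟩ := hx
      obtain ⟨y, rfl⟩ := hy
      exact ⟨x + y, by simp⟩
    | of i x => exact ⟨x, rfl⟩
  · have : x = 0 := by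
      induction x using dsum_induction with
      | zero => rfl
      | add x y hx hy => rw [hx, hy, add_zero]
      | of i x => exact absurd i.down h
    rw [this]
    exact zero h

theorem powIncl_mem {p : Prop} (h : p) {M : GrMod.{u, w} K} {n : ℤ} {x : M} (hx : x ∈ M.gr n) :
    powIncl h M x ∈ (M.pow p).gr n :=
  incl_mem hx

end Dsum

/-! ### Direct sums of two modules and tensor products -/

section Tens

theorem prod_sgn (M N : GrMod.{u, w} K) (p : ℤ) (x : M) (y : N) :
    (M.prod N).sgn p (x, y) = (M.sgn p x, N.sgn p y) := by
  have h1 : (M.prod N).sgn p ∘ₗ inl K M N = inl K M N ∘ₗ M.sgn p := by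
    refine M.hom_ext_gr fun i x hx => ?_
    have : inl K M N x ∈ (M.prod N).gr i := ⟨hx, zero_mem _⟩
    rw [comp_app, comp_app, (M.prod N).sgn_of_mem p this, M.sgn_of_mem p hx, map_zsmul]
  have h2 : (M.prod N).sgn p ∘ₗ inr K M N = inr K M N ∘ₗ N.sgn p := by
    refine N.hom_ext_gr fun i x hx => ?_
    have : inr K M N x ∈ (M.prod N).gr i := ⟨zero_mem _, hx⟩
    rw [comp_app, comp_app, (M.prod N).sgn_of_mem p this, N.sgn_of_mem p hx, map_zsmul]
  have := congrArg₂ (· + ·) (lcongr h1 x) (lcongr h2 y)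
  simpa [← map_add] using this

theorem tmul_mem {M N : GrMod.{u, w} K} {i j : ℤ} {x : M} {y : N} (hx : x ∈ M.gr i)
    (hy : y ∈ N.gr j) {n : ℤ} (h : i + j = n) : x ⊗ₜ[K] y ∈ (M.tens N).gr n :=
  mem_iSup_of_mem ⟨(i, j), h⟩ ⟨⟨x, hx⟩ ⊗ₜ ⟨y, hy⟩, rfl⟩

theorem tens_gr_le {M N : GrMod.{u, w} K} {n : ℤ} {S : Submodule K (M.tens N)}
    (h : ∀ i j, i + j = n → ∀ x ∈ M.gr i, ∀ y ∈ N.gr j, x ⊗ₜ[K] y ∈ S) : (M.tens N).gr n ≤ S := by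
  refine iSup_le fun p => ?_
  rintro _ ⟨z, rfl⟩
  induction z using TensorProduct.induction_on with
  | zero => rw [map_zero]; exact zero_mem _
  | add x y hx hy => rw [map_add]; exact add_mem hx hy
  | tmul x y => exact h p.1.1 p.1.2 p.2 _ x.2 _ y.2

theorem tens_ext {M N : GrMod.{u, w} K} {L : Type v} [AddCommGroup L] [Module K L]
    {f g : M.tens N →ₗ[K] L}
    (h : ∀ i, ∀ x ∈ M.gr i, ∀ j, ∀ y ∈ N.gr j, f (x ⊗ₜ y) = g (x ⊗ₜ y)) : f = g := by
  refine TensorProduct.ext ?_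
  refine M.hom_ext_gr fun i x hx => ?_
  refine N.hom_ext_gr fun j y hy => ?_
  exact h i x hx j y hy

theorem tens_sgn (M N : GrMod.{u, w} K) (x : M) (y : N) (p : ℤ) :
    (M.tens N).sgn p (x ⊗ₜ y) = M.sgn p x ⊗ₜ N.sgn p y := by
  have : (M.tens N).sgn p = TensorProduct.map (M.sgn p) (N.sgn p) := by
    refine tens_ext fun i x hx j y hy => ?_
    rw [(M.tens N).sgn_of_mem p (tmul_mem hx hy rfl), TensorProduct.map_tmul, M.sgn_of_mem p hx,
      N.sgn_of_mem p hy, mul_add, negOnePow_add, mul_comm]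
    simp only [smul_tmul', tmul_smul, smul_smul, Units.val_mul]
  rw [this, TensorProduct.map_tmul]

theorem kswap_tmul {M N : GrMod.{u, w} K} {i : ℤ} {x : M} (hx : x ∈ M.gr i) (y : N) :
    kswap M N (x ⊗ₜ y) = N.sgn i y ⊗ₜ x := by
  rw [kswap, TensorProduct.lift.tmul, M.byDegree_of_mem _ hx]
  rfl

theorem midSwap_tmul (M N P Q : GrMod.{u, w} K) (x : M) {j : ℤ} {y : N} (hy : y ∈ N.gr j) (z : P)
    (t : Q) : midSwap M N P Q ((x ⊗ₜ y) ⊗ₜ (z ⊗ₜ t)) = (x ⊗ₜ P.sgn j z) ⊗ₜ (y ⊗ₜ t) := by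
  simp only [midSwap, comp_app, LinearEquiv.coe_coe, TensorProduct.assoc_tmul,
    TensorProduct.map_tmul, TensorProduct.assoc_symm_tmul, id_app]
  erw [kswap_tmul hy z]
  rfl

end Tens

end GrMod

open GrMod

/-! ## Tensor quivers -/

section Quivers

variable {O : Type u}

theorem qlift_qmk {P Q : GQuiver K O} {X Z : O}
    (f : ∀ Y, P Y Z →ₗ[K] Q X Y →ₗ[K] N) (Y : O) (x : P Y Z) (y : Q X Y) :
    no_index (qlift f (qmk P Q X Y Z x y)) = f Y x y := by
  rw [qlift, qmk, compr₂_app, desc_incl]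
  rfl

theorem qtens_induction {P Q : GQuiver K O} {X Z : O} {p : qtens P Q X Z → Prop} (zero : p 0)
    (add : ∀ x y, p x → p y → p (x + y))
    (qmk : ∀ Y x y, p (qmk P Q X Y Z x y)) (x : qtens P Q X Z) : p x := by
  induction x using dsum_induction with
  | zero => exact zero
  | add x y hx hy => exact add x y hx hy
  | of Y z =>
    induction z using TensorProduct.induction_on with
    | zero => rw [map_zero]; exact zero
    | add x y hx hy => rw [map_add]; exact add _ _ hx hy
    | tmul x y => exact qmk Y x y

theorem qtens_ext {P Q : GQuiver K O} {X Z : O}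
    {f g : qtens P Q X Z →ₗ[K] N}
    (h : ∀ Y i, ∀ x ∈ (P Y Z).gr i, ∀ j, ∀ y ∈ (Q X Y).gr j,
      f (qmk P Q X Y Z x y) = g (qmk P Q X Y Z x y)) : f = g := by
  refine dsum_ext fun Y z => ?_
  refine lapply_eq (f ∘ₗ incl (fun Y => (P Y Z).tens (Q X Y)) Y)
    (g ∘ₗ incl (fun Y => (P Y Z).tens (Q X Y)) Y) (tens_ext ?_) z
  intro i x hx j y hy
  exact h Y i x hx j y hy

theorem qmk_mem {P Q : GQuiver K O} {X Y Z : O} {i j n : ℤ} {x : P Y Z} {y : Q X Y}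
    (hx : x ∈ (P Y Z).gr i) (hy : y ∈ (Q X Y).gr j) (h : i + j = n) :
    qmk P Q X Y Z x y ∈ (qtens P Q X Z).gr n :=
  incl_mem (M := fun Y => (P Y Z).tens (Q X Y)) (tmul_mem hx hy h)

theorem qtens_gr_le {P Q : GQuiver K O} {X Z : O} {n : ℤ} {S : Submodule K (qtens P Q X Z)}
    (h : ∀ Y i j, i + j = n → ∀ x ∈ (P Y Z).gr i, ∀ y ∈ (Q X Y).gr j, qmk P Q X Y Z x y ∈ S) :
    (qtens P Q X Z).gr n ≤ S := by
  refine dsum_gr_le fun Y z hz => ?_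
  have := tens_gr_le (S := S.comap (incl (fun Y => (P Y Z).tens (Q X Y)) Y)) (n := n) (h Y)
  exact this hz

theorem qlift_hasDegree {P Q : GQuiver K O} {X Z : O} {N : GrMod.{u, u} K}
    {f : ∀ Y, P Y Z →ₗ[K] Q X Y →ₗ[K] N} {n : ℤ}
    (h : ∀ Y i, ∀ x ∈ (P Y Z).gr i, ∀ j, ∀ y ∈ (Q X Y).gr j, f Y x y ∈ N.gr (i + j + n)) :
    HasDegree (qtens P Q X Z).gr N.gr (qlift f) n := by
  intro k z hz
  refine qtens_gr_le (S := (N.gr (k + n)).comap (qlift f)) ?_ hz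
  rintro Y i j rfl x hx y hy
  rw [mem_comap, qlift_qmk]
  exact h Y i x hx j y hy

/-- The element `x ⊗ w` of a tensor power. -/
def tmk (Q : GQuiver K O) (n : ℕ) (X Y Z : O) : Q Y Z →ₗ[K] tpow Q n X Y →ₗ[K] tpow Q (n + 1) X Z :=
  qmk Q (tpow Q n) X Y Z

theorem tlift_tmk {Q : GQuiver K O} {n : ℕ} {X Z : O}
    (f : ∀ Y, Q Y Z →ₗ[K] tpow Q n X Y →ₗ[K] N) (Y : O) (x : Q Y Z) (w : tpow Q n X Y) :
    no_index (tlift f (tmk Q n X Y Z x w)) = f Y x w :=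
  qlift_qmk (P := Q) (Q := tpow Q n) f Y x w

theorem tpow_succ_induction {Q : GQuiver K O} {n : ℕ} {X Z : O} {p : tpow Q (n + 1) X Z → Prop}
    (zero : p 0) (add : ∀ x y, p x → p y → p (x + y)) (tmk : ∀ Y x w, p (tmk Q n X Y Z x w))
    (x : tpow Q (n + 1) X Z) : p x :=
  qtens_induction (P := Q) (Q := tpow Q n) (p := p) zero add tmk x

theorem tcons_tin (Q : GQuiver K O) (n : ℕ) (X Y Z : O) (x : Q Y Z) (w : tpow Q n X Y) :
    tcons Q X Y Z x (tin Q n X Y w) = tin Q (n + 1) X Z (tmk Q n X Y Z x w) := by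
  rw [tcons, flip_app, tin, desc_incl]
  rfl

theorem desc_tin (Q : GQuiver K O) (n : ℕ) (X Z : O)
    (f : ∀ n : ℕ, tpow Q n X Z →ₗ[K] N) (w : tpow Q n X Z) :
    desc (M := fun n => tpow Q n X Z) f (tin Q n X Z w) = f n w :=
  desc_incl _ _ _

theorem desc_tgen (Q : GQuiver K O) (X Z : O)
    (f : ∀ n : ℕ, tpow Q n X Z →ₗ[K] N) (x : Q X Z) :
    desc (M := fun n => tpow Q n X Z) f (tgen Q X Z x) = f 0 x :=
  desc_incl _ _ _

theorem tpow_gr_induction (Q : GQuiver K O) (X : O) {p : ∀ (n : ℕ) (Z : O), ℤ → tpow Q n X Z → Prop}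
    (zero : ∀ n Z k, p n Z k 0) (add : ∀ n Z k x y, p n Z k x → p n Z k y → p n Z k (x + y))
    (gen : ∀ Z k, ∀ x ∈ (Q X Z).gr k, p 0 Z k x)
    (cons : ∀ n Y Z i j, ∀ x ∈ (Q Y Z).gr i, ∀ w ∈ (tpow Q n X Y).gr j, p n Y j w →
      p (n + 1) Z (i + j) (tmk Q n X Y Z x w))
    (smul : ∀ n Z k (a : K) x, p n Z k x → p n Z k (a • x)) :
    ∀ n Z k, ∀ x ∈ (tpow Q n X Z).gr k, p n Z k x := by
  intro n
  induction n with
  | zero => exact gen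
  | succ n ih =>
    intro Z k x hx
    let S : Submodule K (qtens Q (tpow Q n) X Z) :=
      { carrier := {x | p (n + 1) Z k x}
        add_mem' := fun {x y} hx hy => add (n + 1) Z k x y hx hy
        zero_mem' := zero (n + 1) Z k
        smul_mem' := fun a x hx => smul (n + 1) Z k a x hx }
    refine qtens_gr_le (P := Q) (Q := tpow Q n) (S := S) ?_ hx
    rintro Y i j rfl x hx w hw
    exact cons n Y Z i j x hx w hw (ih Y j w hw)

theorem tbar_gr_induction (Q : GQuiver K O) (X : O) {p : ∀ Z : O, ℤ → tbar Q X Z → Prop}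
    (zero : ∀ Z k, p Z k 0) (add : ∀ Z k x y, p Z k x → p Z k y → p Z k (x + y))
    (smul : ∀ Z k (a : K) x, p Z k x → p Z k (a • x))
    (gen : ∀ Z k, ∀ x ∈ (Q X Z).gr k, p Z k (tgen Q X Z x))
    (cons : ∀ Y Z i j, ∀ x ∈ (Q Y Z).gr i, ∀ w ∈ (tbar Q X Y).gr j, p Y j w →
      p Z (i + j) (tcons Q X Y Z x w)) (Z : O) (k : ℤ) (w : tbar Q X Z)
    (hw : w ∈ (tbar Q X Z).gr k) : p Z k w := by
  let S : Submodule K (tbar Q X Z) :=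
    { carrier := {x | p Z k x}
      add_mem' := fun {x y} hx hy => add Z k x y hx hy
      zero_mem' := zero Z k
      smul_mem' := fun a x hx => smul Z k a x hx }
  refine dsum_gr_le (S := S) ?_ hw
  intro n x hx
  refine tpow_gr_induction Q X (p := fun n Z k x => p Z k (tin Q n X Z x)) ?_ ?_ ?_ ?_ ?_ n Z k x hx
  · intros; rw [map_zero]; exact zero _ _
  · intro n Z k x y hx hy; rw [map_add]; exact add _ _ _ _ hx hy
  · exact gen
  · intro n Y Z i j x hx w hw h
    rw [← tcons_tin]
    exact cons Y Z i j x hx _ (incl_mem hw) h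
  · intro n Z k a x hx; rw [map_smul]; exact smul _ _ _ _ hx

theorem tbar_induction (Q : GQuiver K O) (X : O) {p : ∀ Z : O, tbar Q X Z → Prop}
    (zero : ∀ Z, p Z 0) (add : ∀ Z x y, p Z x → p Z y → p Z (x + y))
    (gen : ∀ Z i, ∀ x ∈ (Q X Z).gr i, p Z (tgen Q X Z x))
    (cons : ∀ Y Z i, ∀ x ∈ (Q Y Z).gr i, ∀ w, p Y w → p Z (tcons Q X Y Z x w)) (Z : O)
    (w : tbar Q X Z) : p Z w := by
  induction w using dsum_induction with
  | zero => exact zero Z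
  | add x y hx hy => exact add Z x y hx hy
  | of n w =>
    change p Z (tin Q n X Z w)
    induction n generalizing Z with
    | zero =>
      refine (Q X Z).gr_le_induction (p := fun x => p Z (tgen Q X Z x)) (fun i x hx => gen Z i x hx)
        ?_ ?_ w
      · rw [map_zero]; exact zero Z
      · intro x y hx hy; rw [map_add]; exact add Z _ _ hx hy
    | succ n ih =>
      refine qtens_induction (P := Q) (Q := tpow Q n) (p := fun w => p Z (tin Q (n + 1) X Z w))
        ?_ ?_ ?_ w
      · exact (congrArg (p Z) (map_zero (tin Q (n + 1) X Z))).mpr (zero Z)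
      · intro x y hx hy
        exact (congrArg (p Z) (map_add (tin Q (n + 1) X Z) x y)).mpr (add Z _ _ hx hy)
      · intro Y x y
        change p Z (tin Q (n + 1) X Z (tmk Q n X Y Z x y))
        rw [← tcons_tin]
        refine (Q Y Z).gr_le_induction (p := fun x => p Z (tcons Q X Y Z x (tin Q n X Y y)))
          (fun i x hx => cons Y Z i x hx _ (ih Y y)) ?_ ?_ x
        · rw [map_zero, lzero_app]; exact zero Z
        · intro x y hx hy; rw [map_add, ladd_app]; exact add Z _ _ hx hy

theorem tbar_ext (Q : GQuiver K O) (X : O) {N : O → Type*} [∀ Z, AddCommGroup (N Z)]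
    [∀ Z, Module K (N Z)] {f g : ∀ Z, tbar Q X Z →ₗ[K] N Z}
    (gen : ∀ Z i, ∀ x ∈ (Q X Z).gr i, f Z (tgen Q X Z x) = g Z (tgen Q X Z x))
    (cons : ∀ Y Z i, ∀ x ∈ (Q Y Z).gr i, ∀ w, f Y w = g Y w →
      f Z (tcons Q X Y Z x w) = g Z (tcons Q X Y Z x w)) (Z : O) (w : tbar Q X Z) :
    f Z w = g Z w :=
  tbar_induction Q X (p := fun Z w => f Z w = g Z w) (fun Z => by simp)
    (fun Z x y hx hy => by rw [map_add, map_add, hx, hy]) gen cons Z w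

theorem tgen_mem {Q : GQuiver K O} {X Z : O} {i : ℤ} {x : Q X Z} (hx : x ∈ (Q X Z).gr i) :
    tgen Q X Z x ∈ (tbar Q X Z).gr i :=
  incl_mem (M := fun n : ℕ => tpow Q n X Z) (i := 0) hx

theorem tcons_mem {Q : GQuiver K O} {X Y Z : O} {i j n : ℤ} {x : Q Y Z} {w : tbar Q X Y}
    (hx : x ∈ (Q Y Z).gr i) (hw : w ∈ (tbar Q X Y).gr j) (h : i + j = n) :
    tcons Q X Y Z x w ∈ (tbar Q X Z).gr n := by
  refine dsum_gr_le (S := ((tbar Q X Z).gr n).comap (tcons Q X Y Z x)) ?_ hw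
  intro m w hw
  have := tcons_tin Q m X Y Z x w
  rw [tin] at this
  rw [mem_comap, this]
  exact incl_mem (qmk_mem (P := Q) (Q := tpow Q m) hx hw h)

theorem tgen_sgn (Q : GQuiver K O) (X Z : O) (p : ℤ) (x : Q X Z) :
    no_index ((tbar Q X Z).sgn p (tgen Q X Z x)) = tgen Q X Z ((Q X Z).sgn p x) :=
  dsum_sgn (M := fun n : ℕ => tpow Q n X Z) p 0 x

theorem tcons_sgn (Q : GQuiver K O) (X Y Z : O) (p : ℤ) (x : Q Y Z) (w : tbar Q X Y) :
    (tbar Q X Z).sgn p (tcons Q X Y Z x w) =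
      tcons Q X Y Z ((Q Y Z).sgn p x) ((tbar Q X Y).sgn p w) := by
  have : (tcons Q X Y Z).compr₂ ((tbar Q X Z).sgn p) =
      (tcons Q X Y Z).compl₁₂ ((Q Y Z).sgn p) ((tbar Q X Y).sgn p) := by
    refine (Q Y Z).hom_ext_gr fun i x hx => ?_
    refine (tbar Q X Y).hom_ext_gr fun j w hw => ?_
    rw [compr₂_app, compl₁₂_app, (tbar Q X Z).sgn_of_mem p (tcons_mem hx hw rfl), (Q Y Z).sgn_of_mem
      p hx, (tbar Q X Y).sgn_of_mem p hw, mul_add, negOnePow_add, mul_comm]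
    simp only [map_zsmul, lsmul_app, smul_smul, Units.val_mul]
  exact lcongr (lcongr this x) w

/-! ### Maps between tensor products of quivers -/

/-- The map `F ⊗ G` between tensor products of quivers. -/
def qmap {P Q P' Q' : GQuiver K O} {X Z X' Z' : O} (F : ∀ Y, P Y Z →ₗ[K] P' Y Z')
    (G : ∀ Y, Q X Y →ₗ[K] Q' X' Y) : qtens P Q X Z →ₗ[K] qtens P' Q' X' Z' :=
  qlift fun Y => (qmk P' Q' X' Y Z').compl₁₂ (F Y) (G Y)

theorem qmap_qmk {P Q P' Q' : GQuiver K O} {X Z X' Z' : O} (F : ∀ Y, P Y Z →ₗ[K] P' Y Z')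
    (G : ∀ Y, Q X Y →ₗ[K] Q' X' Y) (Y : O) (x : P Y Z) (y : Q X Y) :
    no_index (qmap F G (qmk P Q X Y Z x y)) = qmk P' Q' X' Y Z' (F Y x) (G Y y) := by
  rw [qmap, qlift_qmk, compl₁₂_app]

/-- The associativity of the tensor product of quivers. -/
def qassoc (P Q R : GQuiver K O) (X Z : O) :
    qtens (qtens P Q) R X Z →ₗ[K] qtens P (qtens Q R) X Z :=
  qlift fun W => qlift fun Y =>
    (LinearMap.llcomp K (R X W) (qtens Q R X Y) (qtens P (qtens Q R) X Z)).compl₁₂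
      (qmk P (qtens Q R) X Y Z) (qmk Q R X W Y)

theorem qassoc_qmk (P Q R : GQuiver K O) (X Y W Z : O) (x : P Y Z) (y : Q W Y) (z : R X W) :
    no_index (qassoc P Q R X Z (qmk (qtens P Q) R X W Z (qmk P Q W Y Z x y) z)) =
      qmk P (qtens Q R) X Y Z x (qmk Q R X W Y y z) := by
  rw [qassoc, qlift_qmk, qlift_qmk]
  rfl

theorem qtens_sgn (P Q : GQuiver K O) (X Z : O) (p : ℤ) (z : qtens P Q X Z) :
    (qtens P Q X Z).sgn p z =
      qmap (fun Y => (P Y Z).sgn p) (fun Y => (Q X Y).sgn p) z := by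
  refine lcongr (qtens_ext fun Y i x hx j y hy => ?_) z
  rw [(qtens P Q X Z).sgn_of_mem p (qmk_mem hx hy rfl), qmap_qmk, (P Y Z).sgn_of_mem p hx, (Q X
    Y).sgn_of_mem p hy, mul_add, negOnePow_add, mul_comm]
  simp only [map_zsmul, lsmul_app, smul_smul, Units.val_mul]

end Quivers

/-- The map `qmap` with explicit quivers. -/
local notation "qmap[" p "," q "," r "," t "]" => qmap (P := p) (Q := q) (P' := r) (Q' := t)

/-- The map `qmap` between tensor squares of quivers. -/
local notation "qmap[" p "," q "]" => qmap (P := p) (Q := p) (P' := q) (Q' := q)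

local notation "qmap[" p "]" => qmap (P := p) (Q := p) (P' := p) (Q' := p)

section TensorCoalgebra

variable {O : Type u}

/-! ## The tensor cocategory -/

/-- The deconcatenation on the reduced tensor quiver. -/
def tcomul (Q : GQuiver K O) (X Z : O) : tbar Q X Z →ₗ[K] qtens (tbar Q) (tbar Q) X Z :=
  desc fun n => deconc Q X n Z

/-- The insertion map on the reduced tensor quiver. -/
def tins (Q : GQuiver K O) (β : ∀ X Z, tbar Q X Z →ₗ[K] Q X Z)
    (σ : ∀ X Z, Q X Z →ₗ[K] Q X Z) (ρ : ∀ X Z, tbar Q X Z →ₗ[K] tbar Q X Z) (X Z : O) :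
    tbar Q X Z →ₗ[K] tbar Q X Z :=
  desc fun n => insertion Q β σ ρ X n Z

/-- The part of the insertion map where nothing is left of the inserted map. -/
def tpre (Q : GQuiver K O) (β : ∀ X Z, tbar Q X Z →ₗ[K] Q X Z)
    (ρ : ∀ X Z, tbar Q X Z →ₗ[K] tbar Q X Z) (X Z : O) : tbar Q X Z →ₗ[K] tbar Q X Z :=
  tgen Q X Z ∘ₗ β X Z + (qlift fun Y => (tcons Q X Y Z).compl₁₂ (β Y Z) (ρ X Y)) ∘ₗ tcomul Q X Z

theorem tconsLeft_apply (Q : GQuiver K O) (X Y Z : O) (x : Q Y Z)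
    (z : qtens (tbar Q) (tbar Q) X Y) :
    no_index (tconsLeft Q X Y Z x z) = qmap (fun W => tcons Q W Y Z x) (fun _ => lid) z := by
  refine lcongr (qtens_ext fun W i u hu j v hv => ?_) z
  rw [qmap_qmk, tconsLeft, flip_app, qlift_qmk]
  rfl

theorem tcomul_tgen (Q : GQuiver K O) (X Z : O) (x : Q X Z) :
    no_index (tcomul Q X Z (tgen Q X Z x)) = 0 := by
  rw [tcomul, desc_tgen]
  rfl

theorem tcomul_tcons (Q : GQuiver K O) (X Y Z : O) (x : Q Y Z) (w : tbar Q X Y) :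
    no_index (tcomul Q X Z (tcons Q X Y Z x w)) = qmk (tbar Q) (tbar Q) X Y Z (tgen Q Y Z x) w +
      qmap (fun W => tcons Q W Y Z x) (fun _ => lid) (tcomul Q X Y w) := by
  induction w using dsum_induction with
  | zero => simp
  | add u v hu hv => simp only [map_add, hu, hv]; exact add_add_add_comm _ _ _ _
  | of n w =>
    change tcomul Q X Z (tcons Q X Y Z x (tin Q n X Y w)) =
      qmk (tbar Q) (tbar Q) X Y Z (tgen Q Y Z x) (tin Q n X Y w) +
        qmap _ _ (tcomul Q X Y (tin Q n X Y w))
    rw [tcons_tin, tcomul, tcomul, desc_tin, desc_tin, deconc, tlift_tmk, ladd_app, ladd_app,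
      compl₁₂_app, compl₁₂_app, tconsLeft_apply]
    rfl

theorem tins_tgen (Q : GQuiver K O) (β : ∀ X Z, tbar Q X Z →ₗ[K] Q X Z)
    (σ : ∀ X Z, Q X Z →ₗ[K] Q X Z) (ρ : ∀ X Z, tbar Q X Z →ₗ[K] tbar Q X Z) (X Z : O) (x : Q X Z) :
    tins Q β σ ρ X Z (tgen Q X Z x) = tpre Q β ρ X Z (tgen Q X Z x) := by
  rw [tins, desc_tgen, tpre, ladd_app, comp_app _ (tcomul Q X Z), tcomul_tgen, map_zero, add_zero]
  rfl

theorem tins_tcons (Q : GQuiver K O) (β : ∀ X Z, tbar Q X Z →ₗ[K] Q X Z)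
    (σ : ∀ X Z, Q X Z →ₗ[K] Q X Z) (ρ : ∀ X Z, tbar Q X Z →ₗ[K] tbar Q X Z) (X Y Z : O)
    (x : Q Y Z) (w : tbar Q X Y) :
    tins Q β σ ρ X Z (tcons Q X Y Z x w) = tpre Q β ρ X Z (tcons Q X Y Z x w) +
      tcons Q X Y Z (σ Y Z x) (tins Q β σ ρ X Y w) := by
  induction w using dsum_induction with
  | zero => simp
  | add u v hu hv => simp only [map_add, hu, hv]; exact add_add_add_comm _ _ _ _
  | of n w =>
    change tins Q β σ ρ X Z (tcons Q X Y Z x (tin Q n X Y w)) =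
      tpre Q β ρ X Z (tcons Q X Y Z x (tin Q n X Y w)) +
      tcons Q X Y Z (σ Y Z x) (tins Q β σ ρ X Y (tin Q n X Y w))
    rw [tcons_tin, tins, tins, desc_tin, desc_tin, insertion]
    simp only [ladd_app, comp_app, tlift_tmk, compl₁₂_app, tpre]
    rw [tcomul, desc_tin]

theorem qmap_comp {P Q P' Q' P'' Q'' : GQuiver K O} {X Z X' Z' X'' Z'' : O}
    (F : ∀ Y, P Y Z →ₗ[K] P' Y Z') (G : ∀ Y, Q X Y →ₗ[K] Q' X' Y)
    (F' : ∀ Y, P' Y Z' →ₗ[K] P'' Y Z'') (G' : ∀ Y, Q' X' Y →ₗ[K] Q'' X'' Y)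
    (z : qtens P Q X Z) :
    no_index (qmap F' G' (qmap F G z)) = qmap (fun Y => F' Y ∘ₗ F Y) (fun Y => G' Y ∘ₗ G Y) z := by
  refine lcongr (f := qmap F' G' ∘ₗ qmap F G) (qtens_ext ?_) z
  intro Y i x hx j y hy
  simp only [comp_app, qmap_qmk, qlift_qmk, compl₁₂_app, compr₂_app]

theorem qlift_qmap {P Q P' Q' : GQuiver K O} {X Z X' Z' : O} (F : ∀ Y, P Y Z →ₗ[K] P' Y Z') (G : ∀ Y, Q X Y →ₗ[K] Q' X' Y)
    (f : ∀ Y, P' Y Z' →ₗ[K] Q' X' Y →ₗ[K] N) (z : qtens P Q X Z) :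
    qlift f (qmap F G z) = qlift (fun Y => (f Y).compl₁₂ (F Y) (G Y)) z := by
  refine lcongr (f := qlift f ∘ₗ qmap F G) (qtens_ext ?_) z
  intro Y i x hx j y hy
  simp only [comp_app, qmap_qmk, qlift_qmk, compl₁₂_app, compr₂_app]

theorem comp_qlift {P Q : GQuiver K O} {X Z : O} {N N' : Type*} [AddCommGroup N]
    [Module K N] [AddCommGroup N'] [Module K N'] (f : ∀ Y, P Y Z →ₗ[K] Q X Y →ₗ[K] N)
    (g : N →ₗ[K] N') (z : qtens P Q X Z) :
    g (qlift f z) = qlift (fun Y => (f Y).compr₂ g) z := by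
  refine lcongr (f := g ∘ₗ qlift f) (qtens_ext ?_) z
  intro Y i x hx j y hy
  simp only [comp_app, qmap_qmk, qlift_qmk, compl₁₂_app, compr₂_app]

theorem tcomul_coassoc (Q : GQuiver K O) (X Z : O) (w : tbar Q X Z) :
    qassoc _ _ _ X Z (qmap (fun Y => tcomul Q Y Z) (fun _ => lid) (tcomul Q X Z w)) =
      qmap (fun _ => lid) (fun Y => tcomul Q X Y) (tcomul Q X Z w) := by
  refine tbar_ext Q X (N := fun Z => qtens (tbar Q) (qtens (tbar Q) (tbar Q)) X Z)
    (f := fun Z => qassoc _ _ _ X Z ∘ₗ qmap (fun Y => tcomul Q Y Z) (fun _ => lid) ∘ₗ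
      tcomul Q X Z) (g := fun Z => qmap (fun _ => lid) (fun Y => tcomul Q X Y) ∘ₗ
      tcomul Q X Z) ?_ ?_ Z w
  · intro Z i x hx
    simp only [comp_app, tcomul_tgen, map_zero]
  · intro Y Z i x hx w ih
    simp only [comp_app] at ih ⊢
    rw [tcomul_tcons, map_add, map_add, map_add, qmap_qmk, qmap_qmk, tcomul_tgen, map_zero,
      lzero_app, map_zero, zero_add, id_app, qmap_comp]
    have h1 : qassoc _ _ _ X Z (qmap (fun W => tcomul Q W Z ∘ₗ tcons Q W Y Z x)
        (fun _ => lid ∘ₗ lid) (tcomul Q X Y w)) =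
        qmk _ _ X Y Z (tgen Q Y Z x) (tcomul Q X Y w) +
        qmap (fun W => tcons Q W Y Z x) (fun _ => lid) (qassoc _ _ _ X Y
          (qmap (fun Y' => tcomul Q Y' Y) (fun _ => lid) (tcomul Q X Y w))) := by
      generalize tcomul Q X Y w = z
      refine lapply_eq (qassoc _ _ _ X Z ∘ₗ
        qmap (fun W => tcomul Q W Z ∘ₗ tcons Q W Y Z x) (fun _ => lid ∘ₗ lid))
        (qmk _ _ X Y Z (tgen Q Y Z x) +
          qmap (fun W => tcons Q W Y Z x) (fun _ => lid) ∘ₗ qassoc _ _ _ X Y ∘ₗ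
          qmap (fun Y' => tcomul Q Y' Y) (fun _ => lid))
        (qtens_ext fun W j a ha k b hb => ?_) z
      simp only [comp_app, ladd_app, qmap_qmk, tcomul_tcons, map_add, id_app, qassoc_qmk]
      congr 1
      generalize tcomul Q W Y a = z
      refine lapply_eq (qassoc _ _ _ X Z ∘ₗ (qmk (qtens (tbar Q) (tbar Q)) (tbar Q)
          X W Z).flip b ∘ₗ qmap (fun W => tcons Q W Y Z x) (fun _ => lid))
        (qmap (fun W => tcons Q W Y Z x) (fun _ => lid) ∘ₗ qassoc _ _ _ X Y ∘ₗ
          (qmk (qtens (tbar Q) (tbar Q)) (tbar Q) X W Y).flip b)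
        (qtens_ext fun W' j a ha k c hc => ?_) z
      simp only [comp_app, flip_app, qmap_qmk, qassoc_qmk, id_app]
    rw [h1, ih, qmap_comp, qmap_comp]
    rfl

end TensorCoalgebra

section DGCocategories

variable {O : Type u}

/-! ## Non-unital dg cocategories -/

/-- The laws of a non-unital dg cocategory. -/
structure IsDGCocat (C : GQuiver K O) (d : ∀ X Z, C X Z →ₗ[K] C X Z)
    (Δ : ∀ X Z, C X Z →ₗ[K] qtens C C X Z) : Prop where
  d_deg : ∀ X Z, HasDegree (C X Z).gr (C X Z).gr (d X Z) 1
  d_d : ∀ X Z x, d X Z (d X Z x) = 0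
  comul_deg : ∀ X Z, HasDegree (C X Z).gr (qtens C C X Z).gr (Δ X Z) 0
  coassoc : ∀ X Z x, qassoc C C C X Z (qmap (fun Y => Δ Y Z) (fun _ => lid) (Δ X Z x)) =
    qmap (fun _ => lid) (fun Y => Δ X Y) (Δ X Z x)
  coder : ∀ X Z x, Δ X Z (d X Z x) = qmap (fun Y => d Y Z) (fun _ => lid) (Δ X Z x) +
    qmap (fun Y => (C Y Z).sgn 1) (fun Y => d X Y) (Δ X Z x)

section

variable {P Q P' Q' : GQuiver K O} {X Z X' Z' : O}

theorem qmap_add_left (F F' : ∀ Y, P Y Z →ₗ[K] P' Y Z') (G : ∀ Y, Q X Y →ₗ[K] Q' X' Y)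
    (z : qtens P Q X Z) :
    no_index (qmap (fun Y => F Y + F' Y) G z) = qmap F G z + qmap F' G z := by
  refine lcongr (g := qmap F G + qmap F' G) (qtens_ext ?_) z
  intro Y i x hx j y hy
  simp only [ladd_app, qmap_qmk, map_add]

theorem qlift_congr {f g : ∀ Y, P Y Z →ₗ[K] Q X Y →ₗ[K] N}
    (h : ∀ Y i, ∀ x ∈ (P Y Z).gr i, ∀ j, ∀ y ∈ (Q X Y).gr j, f Y x y = g Y x y)
    (z : qtens P Q X Z) : qlift f z = qlift g z := by
  refine lcongr (qtens_ext ?_) z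
  intro Y i x hx j y hy
  rw [qlift_qmk, qlift_qmk]
  exact h Y i x hx j y hy

theorem qlift_add
    (f g : ∀ Y, P Y Z →ₗ[K] Q X Y →ₗ[K] N) (z : qtens P Q X Z) :
    qlift (fun Y => f Y + g Y) z = qlift f z + qlift g z := by
  refine lcongr (g := qlift f + qlift g) (qtens_ext ?_) z
  intro Y i x hx j y hy
  simp only [ladd_app, qlift_qmk]

theorem qlift_eq_zero {f : ∀ Y, P Y Z →ₗ[K] Q X Y →ₗ[K] N}
    (h : ∀ Y i, ∀ x ∈ (P Y Z).gr i, ∀ j, ∀ y ∈ (Q X Y).gr j, f Y x y = 0)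
    (z : qtens P Q X Z) : qlift f z = 0 := by
  refine lcongr (g := 0) (qtens_ext ?_) z
  intro Y i x hx j y hy
  rw [qlift_qmk, lzero_app]
  exact h Y i x hx j y hy

theorem qmap_hasDegree {F : ∀ Y, P Y Z →ₗ[K] P' Y Z'} {G : ∀ Y, Q X Y →ₗ[K] Q' X' Y} {m n k : ℤ}
    (hF : ∀ Y, HasDegree (P Y Z).gr (P' Y Z').gr (F Y) m)
    (hG : ∀ Y, HasDegree (Q X Y).gr (Q' X' Y).gr (G Y) n) (h : m + n = k) :
    HasDegree (qtens P Q X Z).gr (qtens P' Q' X' Z').gr (qmap F G) k :=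
  qlift_hasDegree fun Y i x hx j y hy =>
    qmk_mem (hF Y i x hx) (hG Y j y hy) (by rw [← h]; ring)

end

/-! ### Coderivations of the tensor cocategory -/

section Coderivation

variable {Q : GQuiver K O} {β : ∀ X Z, tbar Q X Z →ₗ[K] Q X Z}

theorem tcomul_hasDegree (X Z : O) :
    HasDegree (tbar Q X Z).gr (qtens (tbar Q) (tbar Q) X Z).gr (tcomul Q X Z) 0 := by
  refine tbar_gr_induction Q X (p := fun Z k w =>
    tcomul Q X Z w ∈ (qtens (tbar Q) (tbar Q) X Z).gr (k + 0)) ?_ ?_ ?_ ?_ ?_ Z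
  · intro Z k; rw [map_zero]; exact zero_mem _
  · intro Z k x y hx hy; rw [map_add]; exact add_mem hx hy
  · intro Z k a x hx; rw [map_smul]; exact Submodule.smul_mem _ _ hx
  · intro Z k x hx; rw [tcomul_tgen]; exact zero_mem _
  · intro Y Z i j x hx w hw ih
    rw [tcomul_tcons]
    refine add_mem (qmk_mem (tgen_mem hx) hw (by ring)) ?_
    have := qmap_hasDegree (P := tbar Q) (Q := tbar Q) (P' := tbar Q) (Q' := tbar Q) (X := X)
      (X' := X) (F := fun W => tcons Q W Y Z x) (G := fun _ => lid) (m := i) (n := 0)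
      (fun W k w hw => tcons_mem hx hw (by ring)) (fun W k w hw => by simpa using hw) rfl _ _ ih
    rwa [show j + 0 + (i + 0) = i + j + 0 by ring] at this

theorem tpre_hasDegree (hβ : ∀ X Z, HasDegree (tbar Q X Z).gr (Q X Z).gr (β X Z) 1) (X Z : O) :
    HasDegree (tbar Q X Z).gr (tbar Q X Z).gr (tpre Q β (fun _ _ => lid) X Z) 1 := by
  intro k w hw
  refine add_mem (tgen_mem (hβ _ _ _ _ hw)) ?_
  have := qlift_hasDegree (P := tbar Q) (Q := tbar Q) (N := tbar Q X Z) (X := X) (n := 1)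
    (f := fun Y => (tcons Q X Y Z).compl₁₂ (β Y Z) lid)
    (fun Y i x hx j y hy => tcons_mem (hβ _ _ _ _ hx) hy (by ring)) _ _ (tcomul_hasDegree X Z k w hw)
  rwa [add_zero] at this

theorem tins_hasDegree (hβ : ∀ X Z, HasDegree (tbar Q X Z).gr (Q X Z).gr (β X Z) 1) (X Z : O) :
    HasDegree (tbar Q X Z).gr (tbar Q X Z).gr
      (tins Q β (fun X Z => (Q X Z).sgn 1) (fun _ _ => lid) X Z) 1 := by
  refine tbar_gr_induction Q X (p := fun Z k w =>
    tins Q β (fun X Z => (Q X Z).sgn 1) (fun _ _ => lid) X Z w ∈ (tbar Q X Z).gr (k + 1))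
    ?_ ?_ ?_ ?_ ?_ Z
  · intro Z k; rw [map_zero]; exact zero_mem _
  · intro Z k x y hx hy; rw [map_add]; exact add_mem hx hy
  · intro Z k a x hx; rw [map_smul]; exact Submodule.smul_mem _ _ hx
  · intro Z k x hx; rw [tins_tgen]; exact tpre_hasDegree hβ _ _ _ _ (tgen_mem hx)
  · intro Y Z i j x hx w hw ih
    rw [tins_tcons]
    exact add_mem (tpre_hasDegree hβ _ _ _ _ (tcons_mem hx hw rfl))
      (tcons_mem (sgn_mem _ _ hx) ih (by ring))

theorem tcomul_tpre (X Z : O) (w : tbar Q X Z) :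
    no_index (tcomul Q X Z (tpre Q β (fun _ _ => lid) X Z w)) =
      qmap (fun Y => tpre Q β (fun _ _ => lid) Y Z) (fun _ => lid)
        (tcomul Q X Z w) := by
  have h1 := congrArg (qlift fun Y => tconsLeft Q X Y Z ∘ₗ β Y Z) (tcomul_coassoc Q X Z w)
  rw [qlift_qmap] at h1
  have h2 : tcomul Q X Z (tpre Q β (fun _ _ => lid) X Z w) =
      qlift (fun Y => (qmk (tbar Q) (tbar Q) X Y Z).compl₁₂ (tgen Q Y Z ∘ₗ β Y Z) lid)
        (tcomul Q X Z w) +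
      qlift (fun Y => (tconsLeft Q X Y Z ∘ₗ β Y Z).compl₁₂ lid (tcomul Q X Y))
        (tcomul Q X Z w) := by
    rw [← qlift_add]
    simp only [tpre, ladd_app, comp_app, map_add, tcomul_tgen, zero_add]
    rw [comp_qlift]
    refine qlift_congr (fun Y i x hx j y hy => ?_) _
    simp only [compr₂_app, compl₁₂_app, id_app, tcomul_tcons, ladd_app, comp_app, tconsLeft_apply]
  rw [h2, ← h1]
  generalize tcomul Q X Z w = z
  refine lcongr (f := qlift (fun Y => (qmk (tbar Q) (tbar Q) X Y Z).compl₁₂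
      (tgen Q Y Z ∘ₗ β Y Z) lid) + qlift (fun Y => tconsLeft Q X Y Z ∘ₗ β Y Z) ∘ₗ
      qassoc _ _ _ X Z ∘ₗ qmap (fun Y => tcomul Q Y Z) (fun _ => lid))
    (qtens_ext fun Y i x hx j y hy => ?_) z
  simp only [ladd_app, comp_app, qlift_qmk, qmap_qmk, tpre, map_add, compl₁₂_app, id_app]
  congr 1
  generalize tcomul Q Y Z x = z
  refine lapply_eq (qlift (fun Y => tconsLeft Q X Y Z ∘ₗ β Y Z) ∘ₗ
      qassoc _ _ _ X Z ∘ₗ (qmk (qtens (tbar Q) (tbar Q)) (tbar Q) X Y Z).flip y)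
    ((qmk (tbar Q) (tbar Q) X Y Z).flip y ∘ₗ qlift fun W => (tcons Q Y W Z).compl₁₂ (β W Z) lid)
    (qtens_ext fun W j a ha k c hc => ?_) z
  simp only [comp_app, flip_app, qassoc_qmk, qlift_qmk, tconsLeft_apply, qmap_qmk, compl₁₂_app,
    id_app]

theorem tcomul_tins (X Z : O) (w : tbar Q X Z) :
    tcomul Q X Z (tins Q β (fun X Z => (Q X Z).sgn 1) (fun _ _ => lid) X Z w) =
      qmap (fun Y => tins Q β (fun X Z => (Q X Z).sgn 1) (fun _ _ => lid) Y Z)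
        (fun _ => lid) (tcomul Q X Z w) +
      qmap (fun Y => (tbar Q Y Z).sgn 1)
        (fun Y => tins Q β (fun X Z => (Q X Z).sgn 1) (fun _ _ => lid) X Y)
        (tcomul Q X Z w) := by
  set D := tins Q β (fun X Z => (Q X Z).sgn 1) (fun _ _ => lid) with hD
  refine tbar_ext Q X (f := fun Z => tcomul Q X Z ∘ₗ D X Z)
    (g := fun Z => qmap (fun Y => D Y Z) (fun _ => lid) ∘ₗ tcomul Q X Z +
      qmap (fun Y => (tbar Q Y Z).sgn 1) (fun Y => D X Y) ∘ₗ tcomul Q X Z) ?_ ?_ Z w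
  · intro Z i x hx
    simp only [ladd_app, comp_app, tcomul_tgen, map_zero, add_zero]
    rw [hD, tins_tgen, tcomul_tpre, tcomul_tgen, map_zero]
  · intro Y Z i x hx w ih
    simp only [ladd_app, comp_app] at ih ⊢
    have h1 : ∀ W, D W Z ∘ₗ tcons Q W Y Z x = tpre Q β (fun _ _ => lid) W Z ∘ₗ tcons Q W Y Z x +
          tcons Q W Y Z ((Q Y Z).sgn 1 x) ∘ₗ D W Y := by
      intro W
      refine lext fun v => ?_
      exact tins_tcons ..
    have h2 : ∀ W, (tbar Q W Z).sgn 1 ∘ₗ tcons Q W Y Z x =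
        tcons Q W Y Z ((Q Y Z).sgn 1 x) ∘ₗ (tbar Q W Y).sgn 1 := by
      intro W
      refine lext fun v => ?_
      exact tcons_sgn ..
    have h3 : D X Z (tcons Q X Y Z x w) = tpre Q β (fun _ _ => lid) X Z
        (tcons Q X Y Z x w) + tcons Q X Y Z ((Q Y Z).sgn 1 x) (D X Y w) := tins_tcons ..
    have h4 : D Y Z (tgen Q Y Z x) = tpre Q β (fun _ _ => lid) Y Z (tgen Q Y Z x) := tins_tgen ..
    simp only [h3, map_add, tcomul_tpre, tcomul_tcons, ih, qmap_qmk, qmap_comp, tgen_sgn, id_app,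
      LinearMap.comp_id, LinearMap.id_comp, h1, h2, qmap_add_left, h4]
    abel

theorem tins_tins (hβ : ∀ X Z, HasDegree (tbar Q X Z).gr (Q X Z).gr (β X Z) 1) (h0 : ∀ X Z w, β X Z
      (tins Q β (fun X Z => (Q X Z).sgn 1) (fun _ _ => lid) X Z w) = 0)
    (X Z : O) (w : tbar Q X Z) :
    tins Q β (fun X Z => (Q X Z).sgn 1) (fun _ _ => lid) X Z
      (tins Q β (fun X Z => (Q X Z).sgn 1) (fun _ _ => lid) X Z w) = 0 := by
  set D := tins Q β (fun X Z => (Q X Z).sgn 1) (fun _ _ => lid) with hD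
  set B := tpre Q β (fun _ _ => lid) with hB
  have h1 : ∀ Z w, B X Z (D X Z w) =
      qlift (fun Y => (tcons Q X Y Z).compl₁₂ (β Y Z ∘ₗ (tbar Q Y Z).sgn 1) (D X Y))
        (tcomul Q X Z w) := by
    intro Z w
    simp only [hB, tpre, ladd_app, comp_app, h0, map_zero, zero_add]
    rw [hD, tcomul_tins, map_add, qlift_qmap, qlift_qmap, qlift_eq_zero, zero_add]
    · rfl
    · intro Y i x hx j y hy
      simp only [compl₁₂_app]
      rw [← hD, h0, map_zero, lzero_app]
  have h2 : ∀ Z w, D X Z (B X Z w) = B X Z (B X Z w) +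
      qlift (fun Y => (tcons Q X Y Z).compl₁₂ ((Q Y Z).sgn 1 ∘ₗ β Y Z) (D X Y))
        (tcomul Q X Z w) := by
    intro Z w
    have h3 : D X Z (B X Z w) = D X Z (tgen Q X Z (β X Z w)) + D X Z
      (qlift (fun Y => (tcons Q X Y Z).compl₁₂ (β Y Z) lid) (tcomul Q X Z w)) :=
      map_add _ _ _
    have h4 : B X Z (B X Z w) = B X Z (tgen Q X Z (β X Z w)) + B X Z
      (qlift (fun Y => (tcons Q X Y Z).compl₁₂ (β Y Z) lid) (tcomul Q X Z w)) :=
      map_add _ _ _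
    have h5 : D X Z (tgen Q X Z (β X Z w)) = B X Z (tgen Q X Z (β X Z w)) := tins_tgen ..
    rw [h3, h4, h5, comp_qlift, comp_qlift, add_assoc, ← qlift_add]
    congr 1
    refine qlift_congr (fun Y i x hx j y hy => ?_) _
    exact tins_tcons ..
  have h3 : ∀ Z w, D X Z (B X Z w) - B X Z (B X Z w) + B X Z (D X Z w) = 0 := by
    intro Z w
    rw [h2, add_sub_cancel_left, h1, ← qlift_add]
    refine qlift_eq_zero (fun Y i x hx j y hy => ?_) _
    have := sgn_map_of_hasDegree (hβ Y Z) 1 x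
    simp only [ladd_app, compl₁₂_app, comp_app, this]
    simp
  refine tbar_ext Q X (f := fun Z => D X Z ∘ₗ D X Z) (g := fun Z => 0) ?_ ?_ Z w
  · intro Z i x hx
    have h4 : D X Z (tgen Q X Z x) = B X Z (tgen Q X Z x) := tins_tgen ..
    have := h3 Z (tgen Q X Z x)
    rw [h4, sub_add_cancel] at this
    rw [comp_app, h4]
    exact this
  · intro Y Z i x hx w ih
    have h4 : ∀ x w, D X Z (tcons Q X Y Z x w) = B X Z (tcons Q X Y Z x w) +
      tcons Q X Y Z ((Q Y Z).sgn 1 x) (D X Y w) := fun _ _ => tins_tcons ..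
    have := h3 Z (tcons Q X Y Z x w)
    rw [h4 x w, map_add, ← add_assoc, sub_add_cancel] at this
    have ih' : D X Y (D X Y w) = 0 := ih
    rw [comp_app, h4 x w, map_add, h4, ih', map_zero, add_zero]
    exact this

theorem tbar_isDGCocat (hβ : ∀ X Z, HasDegree (tbar Q X Z).gr (Q X Z).gr (β X Z) 1)
    (h0 : ∀ X Z w, β X Z (tins Q β (fun X Z => (Q X Z).sgn 1) (fun _ _ => lid) X Z w) = 0) :
    IsDGCocat (tbar Q) (tins Q β (fun X Z => (Q X Z).sgn 1) (fun _ _ => lid)) (tcomul Q) where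
  d_deg := tins_hasDegree hβ
  d_d := tins_tins hβ h0
  comul_deg := tcomul_hasDegree
  coassoc := tcomul_coassoc Q
  coder := tcomul_tins

end Coderivation

end DGCocategories

section BarConstruction

section

variable {O : Type u} (Q : GQuiver K O)

/-! ## The bar construction -/

/-- Multiplication of a tensor with `l` factors by `(-1)^(i * l)`. -/
def lenPow (i : ℤ) (X Z : O) : tbar Q X Z →ₗ[K] tbar Q X Z :=
  desc fun n => ((i * (n + 1)).negOnePow : ℤ) • tin Q n X Z

theorem lenPow_tin (i : ℤ) (n : ℕ) (X Z : O) (x : tpow Q n X Z) :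
    lenPow Q i X Z (tin Q n X Z x) = ((i * (n + 1)).negOnePow : ℤ) • tin Q n X Z x := by
  rw [lenPow, desc_tin]
  rfl

theorem lenPow_tgen (i : ℤ) (X Z : O) (x : Q X Z) :
    no_index (lenPow Q i X Z (tgen Q X Z x)) = (i.negOnePow : ℤ) • tgen Q X Z x := by
  have := lenPow_tin Q i 0 X Z x
  rw [Nat.cast_zero, zero_add, mul_one] at this
  exact this

theorem lenPow_tcons (i : ℤ) (X Y Z : O) (x : Q Y Z) (w : tbar Q X Y) :
    no_index (lenPow Q i X Z (tcons Q X Y Z x w)) =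
      (i.negOnePow : ℤ) • tcons Q X Y Z x (lenPow Q i X Y w) := by
  induction w using dsum_induction with
  | zero => simp
  | add u v hu hv => simp only [map_add, hu, hv, smul_add]
  | of n w =>
    change lenPow Q i X Z (tcons Q X Y Z x (tin Q n X Y w)) =
      (i.negOnePow : ℤ) • tcons Q X Y Z x (lenPow Q i X Y (tin Q n X Y w))
    rw [lenPow_tin, tcons_tin, lenPow_tin, map_zsmul, tcons_tin, smul_smul, ← Units.val_mul, ←
      negOnePow_add]
    congr 3
    push_cast
    ring

theorem lenPow_lenPow (i j : ℤ) (X Z : O) (w : tbar Q X Z) :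
    no_index (lenPow Q i X Z (lenPow Q j X Z w)) = lenPow Q (i + j) X Z w := by
  induction w using dsum_induction with
  | zero => simp
  | add u v hu hv => simp only [map_add, hu, hv]
  | of n w =>
    change lenPow Q i X Z (lenPow Q j X Z (tin Q n X Z w)) = lenPow Q (i + j) X Z (tin Q n X Z w)
    rw [lenPow_tin, lenPow_tin, map_zsmul, lenPow_tin, smul_smul, ← Units.val_mul, ← negOnePow_add]
    congr 3
    ring

theorem lenSign_eq (X Z : O) : lenSign Q X Z = lenPow Q 1 X Z := by
  refine dsum_ext fun n w => ?_
  rw [lenSign, lenPow, desc_incl, desc_incl, one_mul, Int.negOnePow_def]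
  congr 1

theorem tcomul_lenPow (i : ℤ) (X Z : O) (w : tbar Q X Z) : tcomul Q X Z (lenPow Q i X Z w) =
      qmap (fun Y => lenPow Q i Y Z) (fun Y => lenPow Q i X Y) (tcomul Q X Z w) := by
  refine tbar_ext Q X (f := fun Z => tcomul Q X Z ∘ₗ lenPow Q i X Z)
    (g := fun Z => qmap (fun Y => lenPow Q i Y Z) (fun Y => lenPow Q i X Y) ∘ₗ tcomul Q X Z)
    ?_ ?_ Z w
  · intro Z k x hx
    simp only [comp_app, lenPow_tgen, map_zsmul, tcomul_tgen, map_zero, smul_zero]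
  · intro Y Z k x hx w ih
    have h : ∀ W, lenPow Q i W Z ∘ₗ tcons Q W Y Z x =
        (i.negOnePow : ℤ) • (tcons Q W Y Z x ∘ₗ lenPow Q i W Y) := fun W =>
      lext fun v => lenPow_tcons ..
    have h' : ∀ z : qtens (tbar Q) (tbar Q) X Y,
        qmap (fun W => (i.negOnePow : ℤ) • (tcons Q W Y Z x ∘ₗ lenPow Q i W Y))
          (fun W => lenPow Q i X W) z = (i.negOnePow : ℤ) • qmap (fun W => tcons Q W Y Z x)
            (fun _ => lid)
            (qmap (fun W => lenPow Q i W Y) (fun W => lenPow Q i X W) z) := by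
      refine fun z => lcongr (g := (i.negOnePow : ℤ) • (qmap (fun W => tcons Q W Y Z x)
            (fun _ => lid) ∘ₗ qmap (fun W => lenPow Q i W Y) (fun W => lenPow Q i X W)))
          (qtens_ext fun W j a ha k b hb => ?_) z
      simp only [lsmul_app, comp_app, qmap_qmk, map_zsmul, id_app]
    simp only [comp_app] at ih
    simp only [comp_app, lenPow_tcons, map_zsmul, tcomul_tcons, smul_add, map_add, qmap_qmk,
      lenPow_tgen, lsmul_app, qmap_comp, h, LinearMap.comp_id, h', ih]

end

section

variable {O : Type u} {Q : GQuiver K O} {X Z : O}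

/-- The deconcatenation of a tensor only involves shorter tensors. -/
theorem qlift_tcomul_congr (n : ℕ) {f g : ∀ Y, tbar Q Y Z →ₗ[K] tbar Q X Y →ₗ[K] N}
    (h : ∀ a < n, ∀ Y x, f Y (tin Q a Y Z x) = g Y (tin Q a Y Z x)) (w : tpow Q n X Z) :
    qlift f (tcomul Q X Z (tin Q n X Z w)) = qlift g (tcomul Q X Z (tin Q n X Z w)) := by
  induction n generalizing Z with
  | zero =>
    have : tcomul Q X Z (tin Q 0 X Z w) = 0 := tcomul_tgen ..
    rw [this, map_zero, map_zero]
  | succ n ih =>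
    refine tpow_succ_induction (p := fun w => qlift f (tcomul Q X Z (tin Q (n + 1) X Z w)) =
      qlift g (tcomul Q X Z (tin Q (n + 1) X Z w))) ?_ ?_ ?_ w
    · simp only [map_zero]
    · intro x y hx hy
      simp only [map_add, hx, hy]
    · intro Y x y
      rw [← tcons_tin, tcomul_tcons, map_add, map_add, qlift_qmk, qlift_qmk, qlift_qmap, qlift_qmap]
      congr 1
      · exact lcongr (h 0 n.succ_pos Y x) _
      · refine ih (fun a ha W u => ?_) y
        refine lext fun v => ?_
        rw [compl₁₂_app, compl₁₂_app, tcons_tin, h (a + 1) (Nat.succ_lt_succ ha)]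

theorem tins_tin_congr {β γ : ∀ X Z, tbar Q X Z →ₗ[K] Q X Z} {σ : ∀ X Z, Q X Z →ₗ[K] Q X Z}
    {ρ : ∀ X Z, tbar Q X Z →ₗ[K] tbar Q X Z} (n : ℕ)
    (h : ∀ a ≤ n, ∀ X Z x, β X Z (tin Q a X Z x) = γ X Z (tin Q a X Z x)) (w : tpow Q n X Z) :
    tins Q β σ ρ X Z (tin Q n X Z w) = tins Q γ σ ρ X Z (tin Q n X Z w) := by
  have key : ∀ n, (∀ a ≤ n, ∀ X Z x, β X Z (tin Q a X Z x) = γ X Z (tin Q a X Z x)) → ∀ Z w,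
      tpre Q β ρ X Z (tin Q n X Z w) = tpre Q γ ρ X Z (tin Q n X Z w) := by
    intro n h Z w
    simp only [tpre, ladd_app, comp_app]
    rw [h n le_rfl]
    congr 1
    refine qlift_tcomul_congr n (fun a ha Y x => ?_) w
    refine lext fun v => ?_
    rw [compl₁₂_app, compl₁₂_app, h a ha.le]
  induction n generalizing Z with
  | zero =>
    exact (tins_tgen Q β σ ρ X Z w).trans ((key 0 h Z w).trans (tins_tgen Q γ σ ρ X Z w).symm)
  | succ n ih =>
    refine tpow_succ_induction (p := fun w =>
      tins Q β σ ρ X Z (tin Q (n + 1) X Z w) = tins Q γ σ ρ X Z (tin Q (n + 1) X Z w)) ?_ ?_ ?_ w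
    · simp only [map_zero]
    · intro x y hx hy
      simp only [map_add, hx, hy]
    · intro Y x y
      have := key (n + 1) h Z (tmk Q n X Y Z x y)
      rw [← tcons_tin] at this ⊢
      rw [tins_tcons, tins_tcons, this, ih fun a ha => h a (ha.trans n.le_succ)]

theorem tins_sum {ι : Type*} (s : Finset ι) (β : ι → ∀ X Z, tbar Q X Z →ₗ[K] Q X Z)
    (σ : ∀ X Z, Q X Z →ₗ[K] Q X Z) (ρ : ∀ X Z, tbar Q X Z →ₗ[K] tbar Q X Z) (w : tbar Q X Z) :
    tins Q (fun X Z => ∑ k ∈ s, β k X Z) σ ρ X Z w = ∑ k ∈ s, tins Q (β k) σ ρ X Z w := by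
  have key : ∀ Z w, tpre Q (fun X Z => ∑ k ∈ s, β k X Z) ρ X Z w =
      ∑ k ∈ s, tpre Q (β k) ρ X Z w := by
    intro Z w
    simp only [tpre, ladd_app, comp_app, LinearMap.sum_apply, map_sum, Finset.sum_add_distrib]
    congr 1
    refine lcongr (g := ∑ k ∈ s, qlift fun Y => (tcons Q X Y Z).compl₁₂ (β k Y Z) (ρ X Y))
      (qtens_ext fun Y i x hx j y hy => ?_) _ |>.trans (LinearMap.sum_apply _ _ _)
    simp only [LinearMap.sum_apply, qlift_qmk, compl₁₂_app, map_sum]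
  refine (tbar_ext Q X (f := fun Z => tins Q (fun X Z => ∑ k ∈ s, β k X Z) σ ρ X Z)
    (g := fun Z => ∑ k ∈ s, tins Q (β k) σ ρ X Z) ?_ ?_ Z w).trans (LinearMap.sum_apply _ _ _)
  · intro Z i x hx
    rw [LinearMap.sum_apply, tins_tgen, key]
    exact Finset.sum_congr rfl fun k _ => (tins_tgen ..).symm
  · intro Y Z i x hx w ih
    rw [LinearMap.sum_apply] at ih ⊢
    rw [tins_tcons, key, ih, map_sum, ← Finset.sum_add_distrib]
    exact Finset.sum_congr rfl fun k _ => (tins_tcons ..).symm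

end

namespace AInfCat

variable (A : AInfCat K)

/-- The map `ι ⊗ ⋯ ⊗ ι` on the bar construction. -/
def unshiftBar (X Z : A.Ob) : A.bar X Z →ₗ[K] tbar A.Hom X Z :=
  desc fun n => tin A.Hom n X Z ∘ₗ A.unshiftPow X n Z

theorem unshiftBar_tin (n : ℕ) (X Z : A.Ob) (w : tpow A.sHom n X Z) :
    A.unshiftBar X Z (tin A.sHom n X Z w) = tin A.Hom n X Z (A.unshiftPow X n Z w) := by
  rw [unshiftBar, desc_tin]
  rfl

theorem unshiftBar_tgen (X Z : A.Ob) (x : A.sHom X Z) :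
    no_index (A.unshiftBar X Z (tgen A.sHom X Z x)) = tgen A.Hom X Z ((A.Hom X Z).unShift 1 x) :=
  A.unshiftBar_tin 0 X Z x

theorem unshiftPow_tmk (n : ℕ) (X Y Z : A.Ob) (x : A.sHom Y Z) (w : tpow A.sHom n X Y) :
    A.unshiftPow X (n + 1) Z (tmk A.sHom n X Y Z x w) = tmk A.Hom n X Y Z
      ((A.Hom Y Z).unShift 1 ((A.sHom Y Z).sgn (n + 1) x)) (A.unshiftPow X n Y w) :=
  tlift_tmk (Q := A.sHom) (n := n) _ Y x w

theorem unshiftBar_tcons (X Y Z : A.Ob) {i : ℤ} {x : A.sHom Y Z} (hx : x ∈ (A.sHom Y Z).gr i)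
    (w : A.bar X Y) : A.unshiftBar X Z (tcons A.sHom X Y Z x w) =
      tcons A.Hom X Y Z ((A.Hom Y Z).unShift 1 x) (lenPow A.Hom i X Y (A.unshiftBar X Y w)) := by
  induction w using dsum_induction with
  | zero => simp
  | add u v hu hv => simp only [map_add, hu, hv]
  | of n w =>
    change A.unshiftBar X Z (tcons A.sHom X Y Z x (tin A.sHom n X Y w)) =
      tcons A.Hom X Y Z ((A.Hom Y Z).unShift 1 x)
        (lenPow A.Hom i X Y (A.unshiftBar X Y (tin A.sHom n X Y w)))
    rw [tcons_tin, unshiftBar_tin, unshiftBar_tin, lenPow_tin, map_zsmul, tcons_tin, unshiftPow_tmk,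
      (A.sHom Y Z).sgn_of_mem _ hx, map_zsmul, mul_comm i]
    simp only [map_zsmul, lsmul_app]

/-- The compatibility of `unshiftBar` with deconcatenation, with the Koszul sign. -/
def unshiftPair (X Y Z : A.Ob) : A.bar Y Z →ₗ[K] A.bar X Y →ₗ[K]
    qtens (tbar A.Hom) (tbar A.Hom) X Z :=
  (A.bar Y Z).byDegree fun k => (qmk (tbar A.Hom) (tbar A.Hom) X Y Z).compl₁₂ (A.unshiftBar Y Z)
    (lenPow A.Hom k X Y ∘ₗ A.unshiftBar X Y)

theorem unshiftPair_of_mem (X Y Z : A.Ob) {k : ℤ} {u : A.bar Y Z} (hu : u ∈ (A.bar Y Z).gr k)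
    (v : A.bar X Y) : A.unshiftPair X Y Z u v = qmk (tbar A.Hom) (tbar A.Hom) X Y Z
      (A.unshiftBar Y Z u) (lenPow A.Hom k X Y (A.unshiftBar X Y v)) := by
  rw [unshiftPair, (A.bar Y Z).byDegree_of_mem _ hu]
  rfl

theorem tcomul_unshiftBar (X Z : A.Ob) (w : A.bar X Z) : tcomul A.Hom X Z (A.unshiftBar X Z w) =
      qlift (fun Y => A.unshiftPair X Y Z) (tcomul A.sHom X Z w) := by
  refine tbar_ext A.sHom X (f := fun Z => tcomul A.Hom X Z ∘ₗ A.unshiftBar X Z)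
    (g := fun Z => qlift (fun Y => A.unshiftPair X Y Z) ∘ₗ tcomul A.sHom X Z) ?_ ?_ Z w
  · intro Z i x hx
    simp only [comp_app, unshiftBar_tgen, tcomul_tgen, map_zero]
  · intro Y Z i x hx w ih
    simp only [comp_app] at ih ⊢
    rw [A.unshiftBar_tcons X Y Z hx, tcomul_tcons, tcomul_tcons, map_add, qlift_qmk,
      A.unshiftPair_of_mem X Y Z (tgen_mem hx), unshiftBar_tgen, tcomul_lenPow, ih, qlift_qmap,
      comp_qlift, comp_qlift]
    congr 1
    refine qlift_congr (fun W j u hu k v hv => ?_) _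
    rw [compr₂_app, compr₂_app, A.unshiftPair_of_mem X W Y hu, compl₁₂_app, id_app,
      A.unshiftPair_of_mem X W Z (tcons_mem hx hu rfl), A.unshiftBar_tcons W Y Z hx, qmap_qmk,
      qmap_qmk, lenPow_lenPow]
    rfl

theorem opTotal_b (X Z : A.Ob) (w : A.bar X Z) : opTotal A.sHom A.b X Z w =
    -(A.Hom X Z).toShift 1 (opTotal A.Hom A.m X Z (A.unshiftBar X Z w)) := by
  induction w using dsum_induction with
  | zero => simp
  | add u v hu hv => simp only [map_add, hu, hv, neg_add]
  | of n w =>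
    change opTotal A.sHom A.b X Z (tin A.sHom n X Z w) =
      -(A.Hom X Z).toShift 1 (opTotal A.Hom A.m X Z (A.unshiftBar X Z (tin A.sHom n X Z w)))
    rw [unshiftBar_tin, opTotal, opTotal, desc_tin, desc_tin]
    rfl

theorem opOnly_b (k : ℕ) (X Z : A.Ob) (w : A.bar X Z) : opOnly A.sHom A.b k X Z w =
    -(A.Hom X Z).toShift 1 (opOnly A.Hom A.m k X Z (A.unshiftBar X Z w)) := by
  induction w using dsum_induction with
  | zero => simp
  | add u v hu hv => simp only [map_add, hu, hv, neg_add]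
  | of n w =>
    change opOnly A.sHom A.b k X Z (tin A.sHom n X Z w) =
      -(A.Hom X Z).toShift 1 (opOnly A.Hom A.m k X Z (A.unshiftBar X Z (tin A.sHom n X Z w)))
    rw [unshiftBar_tin, opOnly, opOnly, desc_tin, desc_tin]
    split_ifs
    · rfl
    · simp

theorem unshiftPow_mem (X : A.Ob) : ∀ n Z k, ∀ x ∈ (tpow A.sHom n X Z).gr k,
    A.unshiftPow X n Z x ∈ (tpow A.Hom n X Z).gr (k + n + 1) := by
  refine tpow_gr_induction A.sHom X ?_ ?_ ?_ ?_ ?_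
  · intro n Z k; rw [map_zero]; exact zero_mem _
  · intro n Z k x y hx hy; rw [map_add]; exact add_mem hx hy
  · intro Z k x hx
    change x ∈ (A.Hom X Z).gr _
    change x ∈ (A.Hom X Z).gr _ at hx
    convert hx using 2
    push_cast
    ring
  · intro n Y Z i j x hx w hw ih
    rw [unshiftPow_tmk]
    refine qmk_mem (P := A.Hom) (Q := tpow A.Hom n) (i := 1 + i) ?_ ih (by push_cast; ring)
    exact (A.sHom Y Z).sgn_mem _ hx
  · intro n Z k a x hx; rw [map_smul]; exact Submodule.smul_mem _ _ hx

theorem opTotal_b_hasDegree (X Z : A.Ob) :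
    HasDegree (A.bar X Z).gr (A.sHom X Z).gr (opTotal A.sHom A.b X Z) 1 := by
  intro k w hw
  refine dsum_gr_le (S := ((A.sHom X Z).gr (k + 1)).comap (opTotal A.sHom A.b X Z)) ?_ hw
  intro n w hw
  rw [mem_comap, opTotal, desc_incl]
  refine neg_mem ?_
  have := A.m_deg n X Z _ _ (A.unshiftPow_mem X n Z k w hw)
  change A.m n X Z (A.unshiftPow X n Z w) ∈ (A.Hom X Z).gr _
  convert this using 2
  ring

theorem opOnly_b_mem (k : ℕ) (X Z : A.Ob) {j : ℤ} {w : A.bar X Z} (hw : w ∈ (A.bar X Z).gr j) :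
    opOnly A.sHom A.b k X Z w ∈ (A.sHom X Z).gr (j + 1) := by
  refine dsum_gr_le (S := ((A.sHom X Z).gr (j + 1)).comap (opOnly A.sHom A.b k X Z)) ?_ hw
  intro n w hw
  rw [mem_comap, opOnly, desc_incl]
  split_ifs
  · have := A.opTotal_b_hasDegree X Z j _ (incl_mem (M := fun n : ℕ => tpow A.sHom n X Z) hw)
    rwa [opTotal, desc_incl] at this
  · exact zero_mem _

theorem opOnly_lenPow (i : ℤ) (k : ℕ) (X Z : A.Ob) (w : tbar A.Hom X Z) :
    no_index (opOnly A.Hom A.m k X Z (lenPow A.Hom i X Z w)) =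
      ((i * (k + 1)).negOnePow : ℤ) • opOnly A.Hom A.m k X Z w := by
  induction w using dsum_induction with
  | zero => simp
  | add u v hu hv => simp only [map_add, hu, hv, smul_add]
  | of n w =>
    change opOnly A.Hom A.m k X Z (lenPow A.Hom i X Z (tin A.Hom n X Z w)) =
      ((i * (k + 1)).negOnePow : ℤ) • opOnly A.Hom A.m k X Z (tin A.Hom n X Z w)
    rw [lenPow_tin, map_zsmul, opOnly, desc_tin]
    split_ifs with h
    · subst h; rfl
    · simp

/-- The insertion of the operation `m k` with the signs of the `A∞` relations. -/
def insM (k : ℕ) : ∀ X Z, tbar A.Hom X Z →ₗ[K] tbar A.Hom X Z :=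
  tins A.Hom (opOnly A.Hom A.m k) (fun X Y => (-1 : ℤ) ^ (k + 1) • (A.Hom X Y).sgn (k + 1))
    (lenSign A.Hom)

theorem lenPow_insM (i : ℤ) (k : ℕ) (X Z : A.Ob) (w : tbar A.Hom X Z) :
    lenPow A.Hom i X Z (A.insM k X Z w) =
      ((i * k).negOnePow : ℤ) • A.insM k X Z (lenPow A.Hom i X Z w) := by
  have hs : i.negOnePow = (i * k).negOnePow * (i * (k + 1)).negOnePow := by
    rw [← negOnePow_add, Int.negOnePow_eq_iff]
    exact ⟨-(i * k), by ring⟩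
  have key : ∀ Z w, lenPow A.Hom i X Z (tpre A.Hom (opOnly A.Hom A.m k) (lenSign A.Hom) X Z w) =
      ((i * k).negOnePow : ℤ) •
        tpre A.Hom (opOnly A.Hom A.m k) (lenSign A.Hom) X Z (lenPow A.Hom i X Z w) := by
    intro Z w
    have h1 : lenPow A.Hom i X Z
        (qlift (fun Y => (tcons A.Hom X Y Z).compl₁₂ (opOnly A.Hom A.m k Y Z) (lenSign A.Hom X Y))
          (tcomul A.Hom X Z w)) = ((i * k).negOnePow : ℤ) •
        (qlift fun Y => (tcons A.Hom X Y Z).compl₁₂ (opOnly A.Hom A.m k Y Z) (lenSign A.Hom X Y))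
          (tcomul A.Hom X Z (lenPow A.Hom i X Z w)) := by
      rw [tcomul_lenPow, qlift_qmap]
      refine lapply_eq (lenPow A.Hom i X Z ∘ₗ qlift fun Y =>
          (tcons A.Hom X Y Z).compl₁₂ (opOnly A.Hom A.m k Y Z) (lenSign A.Hom X Y))
        (((i * k).negOnePow : ℤ) • qlift fun Y => ((tcons A.Hom X Y Z).compl₁₂
          (opOnly A.Hom A.m k Y Z) (lenSign A.Hom X Y)).compl₁₂ (lenPow A.Hom i Y Z)
            (lenPow A.Hom i X Y)) (qtens_ext fun Y a x hx b y hy => ?_) _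
      simp only [comp_app, lsmul_app, qlift_qmk, compl₁₂_app, lenPow_tcons, opOnly_lenPow,
        lenSign_eq, lenPow_lenPow, map_zsmul, smul_smul]
      rw [hs, add_comm i 1]
      rfl
    simp only [tpre, ladd_app, comp_app, map_add, h1, smul_add]
    rw [lenPow_tgen, opOnly_lenPow, map_zsmul, smul_smul, hs]
    rfl
  refine tbar_ext A.Hom X (f := fun Z => lenPow A.Hom i X Z ∘ₗ A.insM k X Z)
    (g := fun Z => ((i * k).negOnePow : ℤ) • (A.insM k X Z ∘ₗ lenPow A.Hom i X Z)) ?_ ?_ Z w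
  · intro Z j x hx
    rw [lsmul_app, comp_app, comp_app, insM, tins_tgen, key, lenPow_tgen, map_zsmul, map_zsmul,
      tins_tgen]
  · intro Y Z j x hx w ih
    simp only [comp_app, lsmul_app] at ih ⊢
    have h1 : ∀ w, A.insM k X Z (tcons A.Hom X Y Z x w) =
        tpre A.Hom (opOnly A.Hom A.m k) (lenSign A.Hom) X Z (tcons A.Hom X Y Z x w) +
        tcons A.Hom X Y Z (((-1 : ℤ) ^ (k + 1) • (A.Hom Y Z).sgn (k + 1)) x) (A.insM k X Y w) :=
      fun w => tins_tcons ..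
    rw [h1, map_add, key, lenPow_tcons A.Hom i X Y Z x w, lenPow_tcons, ih, map_zsmul, map_zsmul,
      map_zsmul, h1, smul_add, smul_add]
    congr 1
    exact smul_comm _ _ _

theorem unshiftBar_tins (k : ℕ) (X Z : A.Ob) (w : A.bar X Z) :
    no_index (A.unshiftBar X Z (tins A.sHom (opOnly A.sHom A.b k) (fun X Y => (A.sHom X Y).sgn 1)
      (fun _ _ => lid) X Z w)) = -A.insM k X Z (A.unshiftBar X Z w) := by
  have key : ∀ Z w, A.unshiftBar X Z (tpre A.sHom (opOnly A.sHom A.b k) (fun _ _ => lid) X Z w) =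
      -tpre A.Hom (opOnly A.Hom A.m k) (lenSign A.Hom) X Z (A.unshiftBar X Z w) := by
    intro Z w
    have h1 : A.unshiftBar X Z (qlift (fun Y => (tcons A.sHom X Y Z).compl₁₂
        (opOnly A.sHom A.b k Y Z) lid) (tcomul A.sHom X Z w)) =
        -(qlift fun Y => (tcons A.Hom X Y Z).compl₁₂ (opOnly A.Hom A.m k Y Z) (lenSign A.Hom X Y))
          (tcomul A.Hom X Z (A.unshiftBar X Z w)) := by
      rw [tcomul_unshiftBar, comp_qlift, comp_qlift, ← sub_eq_zero, sub_neg_eq_add, ← qlift_add]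
      refine qlift_eq_zero (fun Y a x hx b y hy => ?_) _
      rw [ladd_app, ladd_app, compr₂_app, compr₂_app, compl₁₂_app, A.unshiftPair_of_mem X Y Z hx,
        A.unshiftBar_tcons X Y Z (A.opOnly_b_mem k Y Z hx), qlift_qmk, compl₁₂_app, lenSign_eq,
        lenPow_lenPow, opOnly_b, map_neg, map_neg, lneg_app, add_comm 1 a]
      exact neg_add_cancel _
    simp only [tpre, ladd_app, comp_app, map_add, h1, neg_add]
    rw [unshiftBar_tgen, opOnly_b, map_neg, map_neg]
    rfl
  refine tbar_ext A.sHom X (f := fun Z => A.unshiftBar X Z ∘ₗ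
      tins A.sHom (opOnly A.sHom A.b k) (fun X Y => (A.sHom X Y).sgn 1) (fun _ _ => lid) X Z)
    (g := fun Z => -(A.insM k X Z ∘ₗ A.unshiftBar X Z)) ?_ ?_ Z w
  · intro Z j x hx
    rw [lneg_app, comp_app, comp_app, tins_tgen, key, unshiftBar_tgen, insM, tins_tgen]
  · intro Y Z i x hx w ih
    simp only [comp_app, lneg_app] at ih ⊢
    have h1 : ∀ w, A.insM k X Z (tcons A.Hom X Y Z ((A.Hom Y Z).unShift 1 x) w) =
        tpre A.Hom (opOnly A.Hom A.m k) (lenSign A.Hom) X Z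
          (tcons A.Hom X Y Z ((A.Hom Y Z).unShift 1 x) w) +
        tcons A.Hom X Y Z (((-1 : ℤ) ^ (k + 1) • (A.Hom Y Z).sgn (k + 1))
          ((A.Hom Y Z).unShift 1 x)) (A.insM k X Y w) := fun w => tins_tcons ..
    have h2 : (((-1 : ℤ) ^ (k + 1) • (A.Hom Y Z).sgn (k + 1)) ((A.Hom Y Z).unShift 1 x)) =
        ((i * (k + 1)).negOnePow : ℤ) • (A.Hom Y Z).unShift 1 x := by
      have h3 := (A.Hom Y Z).sgn_of_mem (k + 1) (i := 1 + i) (x := x) hx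
      change (-1 : ℤ) ^ (k + 1) • (A.Hom Y Z).sgn (k + 1) x = ((i * (k + 1)).negOnePow : ℤ) • x
      rw [h3]
      refine (smul_smul ..).trans ?_
      congr 1
      have : (-1 : ℤ) ^ (k + 1) = (((k + 1 : ℕ) : ℤ).negOnePow : ℤ) := by
        rw [Int.negOnePow_def]; norm_cast
      rw [this, ← Units.val_mul, ← negOnePow_add]
      congr 1
      rw [Int.negOnePow_eq_iff]
      exact ⟨k + 1, by push_cast; ring⟩
    rw [tins_tcons, map_add, key, A.unshiftBar_tcons X Y Z hx, h1, h2, A.unshiftBar_tcons X Y Z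
      ((A.sHom Y Z).sgn_mem 1 hx), ih, map_neg, lenPow_insM, (A.sHom Y Z).sgn_one_of_mem hx,
      neg_add]
    congr 1
    simp only [map_zsmul, map_neg, lsmul_app, smul_neg, smul_smul]
    congr 2
    rw [← Units.val_mul, ← negOnePow_add]
    congr 2
    ring

theorem opTotal_b_barD (X Z : A.Ob) (w : A.bar X Z) :
    opTotal A.sHom A.b X Z (A.barD X Z w) = 0 := by
  induction w using dsum_induction with
  | zero => simp
  | add u v hu hv => rw [map_add, map_add, hu, hv, add_zero]
  | of n w =>
    change opTotal A.sHom A.b X Z (tins A.sHom (opTotal A.sHom A.b) (fun X Y => (A.sHom X Y).sgn 1)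
      (fun _ _ => lid) X Z (tin A.sHom n X Z w)) = 0
    rw [tins_tin_congr n (γ := fun X Z => ∑ k ∈ Finset.range (n + 1), opOnly A.sHom A.b k X Z),
      tins_sum, opTotal_b, map_sum, map_sum]
    · simp only [unshiftBar_tins, map_neg]
      rw [neg_eq_zero, Finset.sum_neg_distrib, map_neg, neg_eq_zero]
      have := A.rel n X Z (A.unshiftPow X n Z w)
      rw [unshiftBar_tin]
      have h : ∀ k, A.insM k X Z (tin A.Hom n X Z (A.unshiftPow X n Z w)) =
          insertion A.Hom (opOnly A.Hom A.m k) (fun X Y => (-1 : ℤ) ^ (k + 1) •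
            (A.Hom X Y).sgn (k + 1)) (lenSign A.Hom) X n Z (A.unshiftPow X n Z w) :=
        fun k => desc_tin ..
      simp only [h]
      exact this
    · intro a ha X Z x
      rw [LinearMap.sum_apply, Finset.sum_eq_single a]
      · rw [opTotal, opOnly, desc_tin, desc_tin, if_pos rfl]
      · intro k _ hk
        rw [opOnly, desc_tin, if_neg hk.symm, lzero_app]
      · intro h
        exact absurd (Finset.mem_range.2 (Nat.lt_succ_of_le ha)) h

theorem bar_isDGCocat : IsDGCocat A.bar A.barD A.barComul :=
  tbar_isDGCocat A.opTotal_b_hasDegree A.opTotal_b_barD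

end AInfCat

end BarConstruction

section Augmentation

variable {O Ω : Type u}

/-! ## Augmentations and tensor products of dg cocategories -/

/-- The differential of an augmentation. -/
def augD (P : GQuiver K O) (d : ∀ X Z, P X Z →ₗ[K] P X Z) (X Z : O) : aug P X Z →ₗ[K] aug P X Z :=
  LinearMap.prodMap (d X Z) 0

/-- The inclusion of a quiver in its augmentation. -/
def augIn (P : GQuiver K O) (X Z : O) : P X Z →ₗ[K] aug P X Z := inl K _ _

theorem augD_augIn (P : GQuiver K O) (d : ∀ X Z, P X Z →ₗ[K] P X Z) (X Z : O) (x : P X Z) :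
    augD P d X Z (augIn P X Z x) = augIn P X Z (d X Z x) := by
  simp only [augD, augIn, LinearMap.prodMap_apply, inl_app, lzero_app]

theorem augD_augOne (P : GQuiver K O) (d : ∀ X Z, P X Z →ₗ[K] P X Z) (X Z : O) (h : X = Z) :
    augD P d X Z (augOne P X Z h) = 0 := by
  simp only [augD, augOne, LinearMap.prodMap_apply, lzero_app, map_zero]
  rfl

theorem aug_sgn_augIn (P : GQuiver K O) (p : ℤ) (X Z : O) (x : P X Z) :
    (aug P X Z).sgn p (augIn P X Z x) = augIn P X Z ((P X Z).sgn p x) := by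
  rw [augIn, inl_app, prod_sgn, map_zero]
  rfl

theorem augOne_mem (P : GQuiver K O) (X Z : O) (h : X = Z) : augOne P X Z h ∈ (aug P X Z).gr 0 :=
  ⟨zero_mem _, powIncl_mem h (by
    change (1 : K) ∈ (if (0 : ℤ) = 0 then ⊤ else ⊥ : Submodule K K)
    rw [if_pos rfl]
    trivial)⟩

theorem augIn_mem (P : GQuiver K O) {X Z : O} {n : ℤ} {x : P X Z} (hx : x ∈ (P X Z).gr n) :
    augIn P X Z x ∈ (aug P X Z).gr n :=
  ⟨hx, zero_mem _⟩

theorem aug_sgn_augOne (P : GQuiver K O) (p : ℤ) (X Z : O) (h : X = Z) :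
    (aug P X Z).sgn p (augOne P X Z h) = augOne P X Z h := by
  rw [(aug P X Z).sgn_of_mem p (augOne_mem P X Z h), mul_zero]
  simp

theorem aug_induction {P : GQuiver K O} {X Z : O} {p : aug P X Z → Prop}
    (add : ∀ x y, p x → p y → p (x + y)) (smul : ∀ (a : K) x, p x → p (a • x))
    (zero : p 0)
    (augIn : ∀ x, p (augIn P X Z x)) (augOne : ∀ h : X = Z, p (augOne P X Z h)) (x : aug P X Z) :
    p x := by
  obtain ⟨x, y⟩ := x
  have h : ((x, y) : aug P X Z) = AInf.augIn P X Z x + (inr K _ _ y : aug P X Z) := by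
    simp [AInf.augIn]
  rw [h]
  refine add _ _ (augIn x) ?_
  refine pow_induction (P := fun y => p (inr K _ _ y)) ?_ ?_ y
  · intro _; rw [map_zero]; exact zero
  · intro h a
    have := smul a _ (augOne h)
    convert this using 1
    rw [AInf.augOne, Prod.smul_mk, smul_zero, ← map_smul, smul_eq_mul, mul_one]
    rfl

theorem aug_ext {P : GQuiver K O} {X Z : O}
    {f g : aug P X Z →ₗ[K] N} (hin : ∀ x, f (augIn P X Z x) = g (augIn P X Z x))
    (hone : ∀ h, f (augOne P X Z h) = g (augOne P X Z h)) : f = g := by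
  refine lext fun x => ?_
  refine aug_induction (p := fun x => f x = g x) ?_ ?_ ?_ hin hone x
  · intro x y hx hy; rw [map_add, map_add, hx, hy]
  · intro a x hx; rw [map_smul, map_smul, hx]
  · rw [map_zero, map_zero]

theorem aug_gr_induction {P : GQuiver K O} {X Z : O} {n : ℤ} {S : Submodule K (aug P X Z)}
    (hin : ∀ x ∈ (P X Z).gr n, augIn P X Z x ∈ S) (hone : ∀ h, n = 0 → augOne P X Z h ∈ S) :
    (aug P X Z).gr n ≤ S := by
  rintro ⟨x, y⟩ ⟨hx, hy⟩
  have h : ((x, y) : aug P X Z) = AInf.augIn P X Z x + (inr K _ _ y : aug P X Z) := by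
    simp [AInf.augIn]
  rw [h]
  refine add_mem (hin x hx) ?_
  refine dsum_gr_le (S := S.comap (inr K _ _)) ?_ hy
  intro i a ha
  by_cases hn : n = 0
  · have h1 := S.smul_mem a (hone i.down hn)
    rw [augOne, Prod.smul_mk, smul_zero, ← map_smul, smul_eq_mul, mul_one] at h1
    exact h1
  · have : a = 0 := by simpa [hn] using ha
    rw [this, map_zero]
    exact zero_mem _

theorem augComul_augIn (P : GQuiver K O) (Δ : ∀ X Z, P X Z →ₗ[K] qtens P P X Z) (X Z : O)
    (x : P X Z) : augComul P Δ X Z (augIn P X Z x) =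
      qmap (fun Y => augIn P Y Z) (fun Y => augIn P X Y) (Δ X Z x) +
        qmk (aug P) (aug P) X X Z (augIn P X Z x) (augOne P X X rfl) +
        qmk (aug P) (aug P) X Z Z (augOne P Z Z rfl) (augIn P X Z x) := by
  rw [augComul, augIn, coprod_app]
  simp only [inl_app, map_zero, add_zero]
  rfl

theorem augComul_augOne (P : GQuiver K O) (Δ : ∀ X Z, P X Z →ₗ[K] qtens P P X Z) (X Z : O)
    (h : X = Z) : augComul P Δ X Z (augOne P X Z h) =
      qmk (aug P) (aug P) X X Z (augOne P X Z h) (augOne P X X rfl) := by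
  have h1 : augOne P X Z h = inr K (P X Z) _ (powIncl h (unit K) (1 : K)) := rfl
  conv_lhs => rw [augComul, h1]
  refine (lcongr (LinearMap.coprod_inr _ _) _).trans ?_
  exact (desc_powIncl _ _ _).trans (one_smul K _)

section AugCocat

variable {P : GQuiver K O} {d : ∀ X Z, P X Z →ₗ[K] P X Z} {Δ : ∀ X Z, P X Z →ₗ[K] qtens P P X Z}

theorem augComul_hasDegree (h : ∀ X Z, HasDegree (P X Z).gr (qtens P P X Z).gr (Δ X Z) 0)
    (X Z : O) : HasDegree (aug P X Z).gr (qtens (aug P) (aug P) X Z).gr (augComul P Δ X Z) 0 := by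
  intro n x hx
  refine aug_gr_induction (S := ((qtens (aug P) (aug P) X Z).gr (n + 0)).comap
    (augComul P Δ X Z)) ?_ ?_ hx
  · intro x hx
    rw [mem_comap, augComul_augIn]
    refine add_mem (add_mem ?_ ?_) ?_
    · have := qmap_hasDegree (P := P) (Q := P) (P' := aug P) (Q' := aug P)
        (F := fun Y => augIn P Y Z) (G := fun Y => augIn P X Y) (m := 0) (n := 0) (k := 0)
        (fun Y i x hx => by rw [add_zero]; exact augIn_mem P hx)
        (fun Y i x hx => by rw [add_zero]; exact augIn_mem P hx) rfl _ _ (h X Z n x hx)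
      rwa [add_zero] at this
    · exact qmk_mem (augIn_mem P hx) (augOne_mem P _ _ _) rfl
    · exact qmk_mem (augOne_mem P _ _ _) (augIn_mem P hx) (by ring)
  · rintro e rfl
    rw [mem_comap, augComul_augOne]
    exact qmk_mem (augOne_mem P _ _ _) (augOne_mem P _ _ _) (by ring)

theorem qassoc_qmap_qmap {P₁ P₂ P₃ Q₁ Q₂ Q₃ : GQuiver K O} {X Z : O}
    (F : ∀ Y Z, P₁ Y Z →ₗ[K] Q₁ Y Z) (G : ∀ Y Z, P₂ Y Z →ₗ[K] Q₂ Y Z)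
    (H : ∀ Y Z, P₃ Y Z →ₗ[K] Q₃ Y Z) (z : qtens (qtens P₁ P₂) P₃ X Z) :
    qassoc Q₁ Q₂ Q₃ X Z
      (qmap (fun Y => qmap (fun W => F W Z) (fun W => G Y W)) (fun Y => H X Y) z) =
    qmap (fun Y => F Y Z) (fun Y => qmap (fun W => G W Y) (fun W => H X W))
      (qassoc P₁ P₂ P₃ X Z z) := by
  refine lapply_eq (qassoc Q₁ Q₂ Q₃ X Z ∘ₗ
      (qmap (fun Y => qmap (fun W => F W Z) (fun W => G Y W)) (fun Y => H X Y)))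
    (qmap (fun Y => F Y Z) (fun Y => qmap (fun W => G W Y) (fun W => H X W)) ∘ₗ
      qassoc P₁ P₂ P₃ X Z) (qtens_ext fun Y i x hx j y hy => ?_) z
  clear hx
  rw [comp_app, comp_app, qmap_qmk]
  refine lapply_eq (qassoc Q₁ Q₂ Q₃ X Z ∘ₗ (qmk (qtens Q₁ Q₂) Q₃ X Y Z).flip (H X Y y) ∘ₗ
      qmap (fun W => F W Z) (fun W => G Y W))
    (qmap (fun Y => F Y Z) (fun Y => qmap (fun W => G W Y) (fun W => H X W)) ∘ₗ
      qassoc P₁ P₂ P₃ X Z ∘ₗ (qmk (qtens P₁ P₂) P₃ X Y Z).flip y)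
    (qtens_ext fun W i x hx j w hw => ?_) x
  simp only [comp_app, flip_app, qmap_qmk, qassoc_qmk]

theorem qassoc_qmap_augComul (X Z : O) (z : qtens P P X Z) :
    qassoc _ _ _ X Z (qmap (fun Y => augComul P Δ Y Z ∘ₗ augIn P Y Z) (fun Y => augIn P X Y) z) =
      qmap (fun Y => augIn P Y Z) (fun Y => qmap (fun W => augIn P W Y) (fun W => augIn P X W))
        (qassoc P P P X Z (qmap (fun Y => Δ Y Z) (fun _ => lid) z)) +
      qmap (fun Y => augIn P Y Z) (fun Y =>
        qmk (aug P) (aug P) X Y Y (augOne P Y Y rfl) ∘ₗ augIn P X Y) z +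
      qmk (aug P) _ X Z Z (augOne P Z Z rfl)
        (qmap (fun Y => augIn P Y Z) (fun Y => augIn P X Y) z) := by
  rw [← qassoc_qmap_qmap, qmap_comp]
  refine lapply_eq (qassoc _ _ _ X Z ∘ₗ (qmap
    (fun Y => augComul P Δ Y Z ∘ₗ augIn P Y Z) (fun Y => augIn P X Y)))
    (qassoc _ _ _ X Z ∘ₗ (qmap (fun Y => qmap (fun W => augIn P W Z) (fun W => augIn P Y W) ∘ₗ
        Δ Y Z) (fun Y => augIn P X Y ∘ₗ lid)) +
    qmap (fun Y => augIn P Y Z) (fun Y =>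
      qmk (aug P) (aug P) X Y Y (augOne P Y Y rfl) ∘ₗ augIn P X Y) +
    qmk (aug P) _ X Z Z (augOne P Z Z rfl) ∘ₗ (qmap (fun Y => augIn P Y Z) (fun Y => augIn P X Y)))
    (qtens_ext fun Y i x hx j y hy => ?_) z
  simp only [ladd_app, comp_app, qmap_qmk, id_app]
  rw [augComul_augIn]
  simp only [map_add, ladd_app, qassoc_qmk]

theorem qmap_augComul (X Z : O) (z : qtens P P X Z) :
    qmap (fun Y => augIn P Y Z) (fun Y => augComul P Δ X Y ∘ₗ augIn P X Y) z =
      qmap (fun Y => augIn P Y Z) (fun Y => qmap (fun W => augIn P W Y) (fun W => augIn P X W))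
        (qmap (fun _ => lid) (fun Y => Δ X Y) z) +
      qassoc _ _ _ X Z (qmk _ (aug P) X X Z
        (qmap (fun Y => augIn P Y Z) (fun Y => augIn P X Y) z) (augOne P X X rfl)) +
      qmap (fun Y => augIn P Y Z) (fun Y =>
        qmk (aug P) (aug P) X Y Y (augOne P Y Y rfl) ∘ₗ augIn P X Y) z := by
  rw [qmap_comp]
  refine lapply_eq (qmap (fun Y => augIn P Y Z) (fun Y => augComul P Δ X Y ∘ₗ augIn P X Y))
    (qmap (fun Y => augIn P Y Z ∘ₗ lid)
      (fun Y => qmap (fun W => augIn P W Y) (fun W => augIn P X W) ∘ₗ Δ X Y) +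
    qassoc _ _ _ X Z ∘ₗ (qmk _ (aug P) X X Z).flip (augOne P X X rfl) ∘ₗ
      (qmap (fun Y => augIn P Y Z) (fun Y => augIn P X Y)) +
    qmap (fun Y => augIn P Y Z) (fun Y =>
      qmk (aug P) (aug P) X Y Y (augOne P Y Y rfl) ∘ₗ augIn P X Y))
    (qtens_ext fun Y i x hx j y hy => ?_) z
  simp only [ladd_app, comp_app, flip_app, qmap_qmk, id_app]
  rw [augComul_augIn]
  simp only [map_add, ladd_app, qassoc_qmk]

theorem augComul_coassoc (h : ∀ X Z x, qassoc P P P X Z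
      (qmap (fun Y => Δ Y Z) (fun _ => lid) (Δ X Z x)) =
      qmap (fun _ => lid) (fun Y => Δ X Y) (Δ X Z x)) (X Z : O) (x : aug P X Z) :
    qassoc _ _ _ X Z (qmap (fun Y => augComul P Δ Y Z) (fun _ => lid) (augComul P Δ X Z x)) =
    qmap (fun _ => lid) (fun Y => augComul P Δ X Y) (augComul P Δ X Z x) := by
  refine lapply_eq (qassoc _ _ _ X Z ∘ₗ
      qmap (fun Y => augComul P Δ Y Z) (fun _ => lid) ∘ₗ augComul P Δ X Z)
    (qmap (fun _ => lid) (fun Y => augComul P Δ X Y) ∘ₗ augComul P Δ X Z)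
    (aug_ext ?_ ?_) x
  · intro x
    simp only [comp_app]
    rw [augComul_augIn]
    simp only [map_add, ladd_app]
    rw [qmap_comp, qmap_comp, qmap_qmk, qmap_qmk, qmap_qmk, qmap_qmk]
    simp only [LinearMap.id_comp, id_app]
    rw [qassoc_qmap_augComul, qmap_augComul, h]
    rw [augComul_augIn, augComul_augOne, augComul_augOne]
    simp only [map_add, ladd_app, qassoc_qmk]
    abel
  · intro e
    simp only [comp_app]
    rw [augComul_augOne, qmap_qmk, qmap_qmk, augComul_augOne, augComul_augOne, id_app, id_app,
      qassoc_qmk]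

theorem augComul_augD (h : ∀ X Z x, Δ X Z (d X Z x) =
      qmap (fun Y => d Y Z) (fun _ => lid) (Δ X Z x) +
      qmap (fun Y => (P Y Z).sgn 1) (fun Y => d X Y) (Δ X Z x)) (X Z : O) (x : aug P X Z) :
    augComul P Δ X Z (augD P d X Z x) =
      qmap (fun Y => augD P d Y Z) (fun _ => lid) (augComul P Δ X Z x) +
      qmap (fun Y => (aug P Y Z).sgn 1) (fun Y => augD P d X Y) (augComul P Δ X Z x) := by
  refine lapply_eq (augComul P Δ X Z ∘ₗ augD P d X Z)
    (qmap (fun Y => augD P d Y Z) (fun _ => lid) ∘ₗ augComul P Δ X Z +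
      qmap (fun Y => (aug P Y Z).sgn 1) (fun Y => augD P d X Y) ∘ₗ augComul P Δ X Z)
    (aug_ext ?_ ?_) x
  · intro x
    have h1 : ∀ Y Z, augD P d Y Z ∘ₗ augIn P Y Z = augIn P Y Z ∘ₗ d Y Z := fun Y Z =>
      lext fun x => augD_augIn ..
    have h2 : ∀ Y, (aug P Y Z).sgn 1 ∘ₗ augIn P Y Z = augIn P Y Z ∘ₗ (P Y Z).sgn 1 :=
      fun Y => lext fun x => aug_sgn_augIn ..
    simp only [comp_app, ladd_app]
    rw [augD_augIn, augComul_augIn, augComul_augIn, h]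
    simp only [map_add]
    rw [qmap_comp, qmap_comp, qmap_comp, qmap_comp]
    simp only [h1, h2, LinearMap.id_comp, LinearMap.comp_id]
    rw [qmap_qmk, qmap_qmk, qmap_qmk, qmap_qmk, augD_augIn, augD_augOne, augD_augOne,
      aug_sgn_augOne, map_zero, map_zero, lzero_app]
    change _ = _ + qmk (aug P) (aug P) X X Z (augIn P X Z (d X Z x)) (augOne P X X rfl) + _ + _
    abel
  · intro e
    simp only [comp_app, ladd_app]
    rw [augD_augOne, augComul_augOne, qmap_qmk, qmap_qmk, augD_augOne, augD_augOne, map_zero,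
      map_zero, map_zero, lzero_app, add_zero]

theorem IsDGCocat.aug (h : IsDGCocat P d Δ) : IsDGCocat (aug P) (augD P d) (augComul P Δ) where
  d_deg X Z i x hx := ⟨h.d_deg X Z i _ hx.1, zero_mem _⟩
  d_d X Z x := by
    refine lapply_eq (augD P d X Z ∘ₗ augD P d X Z) 0 (aug_ext ?_ ?_) x
    · intro x
      rw [comp_app, augD_augIn, augD_augIn, h.d_d, map_zero, lzero_app]
    · intro e
      rw [comp_app, augD_augOne, map_zero, lzero_app]
  comul_deg := augComul_hasDegree h.comul_deg
  coassoc := augComul_coassoc h.coassoc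
  coder := augComul_augD h.coder

end AugCocat

end Augmentation

section TensorCocat

variable {O Ω : Type u}

/-! ## Tensor products of dg cocategories -/

theorem qmap_qmk_id {P Q P' : GQuiver K O} {X Z Z' : O} (F : ∀ Y, P Y Z →ₗ[K] P' Y Z') (Y : O)
    (x : P Y Z) (y : Q X Y) :
    qmap F (fun _ => lid) (qmk P Q X Y Z x y) = qmk P' Q X Y Z' (F Y x) y :=
  qmap_qmk _ _ _ _ _

theorem qmap_id_qmk {P Q Q' : GQuiver K O} {X Z X' : O} (G : ∀ Y, Q X Y →ₗ[K] Q' X' Y) (Y : O)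
    (x : P Y Z) (y : Q X Y) :
    qmap (fun _ => lid) G (qmk P Q X Y Z x y) = qmk P Q' X' Y Z x (G Y y) :=
  qmap_qmk _ _ _ _ _

/-- The Koszul middle exchange for tensor products of quivers. -/
def qmid (P P' : GQuiver K O) (Q Q' : GQuiver K Ω) (X Z : O × Ω) :
    (qtens P P' X.1 Z.1).tens (qtens Q Q' X.2 Z.2) →ₗ[K] qtens (ptens P Q) (ptens P' Q') X Z :=
  TensorProduct.lift (desc (M := fun Y => (P Y Z.1).tens (P' X.1 Y)) fun Y => LinearMap.flip
      (desc (M := fun Y' => (Q Y' Z.2).tens (Q' X.2 Y')) fun Y' => LinearMap.flip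
        ((TensorProduct.mk K _ _).compr₂
          (incl (fun W : O × Ω => (ptens P Q W Z).tens (ptens P' Q' X W)) (Y, Y') ∘ₗ
            midSwap (P Y Z.1) (P' X.1 Y) (Q Y' Z.2) (Q' X.2 Y')))))

section

variable (P P' P'' : GQuiver K O) (Q Q' Q'' : GQuiver K Ω)

theorem qmid_tmul (X Z : O × Ω) (Y : O) (Y' : Ω) (x : P Y Z.1) {j : ℤ} {x' : P' X.1 Y}
    (hx' : x' ∈ (P' X.1 Y).gr j) (y : Q Y' Z.2) (y' : Q' X.2 Y') :
    qmid P P' Q Q' X Z (qmk P P' X.1 Y Z.1 x x' ⊗ₜ qmk Q Q' X.2 Y' Z.2 y y') =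
      qmk (ptens P Q) (ptens P' Q') X (Y, Y') Z (x ⊗ₜ (Q Y' Z.2).sgn j y) (x' ⊗ₜ y') := by
  have h := congrArg (incl (fun W : O × Ω => (ptens P Q W Z).tens (ptens P' Q' X W)) (Y, Y'))
    (midSwap_tmul (P Y Z.1) (P' X.1 Y) (Q Y' Z.2) (Q' X.2 Y') x hx' y y')
  refine Eq.trans ?_ h
  rw [qmid, TensorProduct.lift.tmul]
  simp only [qmk, compr₂_app, TensorProduct.mk_apply]
  rw [desc_incl, flip_app, desc_incl]
  rfl

variable {P P' P'' Q Q' Q''}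

theorem qtens_tens_ext {X Z : O} {X' Z' : Ω}
    {f g : (qtens P P' X Z).tens (qtens Q Q' X' Z') →ₗ[K] N}
    (h : ∀ Y i, ∀ x ∈ (P Y Z).gr i, ∀ j, ∀ x' ∈ (P' X Y).gr j, ∀ Y' k, ∀ y ∈ (Q Y' Z').gr k,
      ∀ l, ∀ y' ∈ (Q' X' Y').gr l, f (qmk P P' X Y Z x x' ⊗ₜ qmk Q Q' X' Y' Z' y y') =
        g (qmk P P' X Y Z x x' ⊗ₜ qmk Q Q' X' Y' Z' y y')) : f = g := by
  refine TensorProduct.ext (qtens_ext fun Y i x hx j x' hx' => qtens_ext ?_)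
  intro Y' k y hy l y' hy'
  exact h Y i x hx j x' hx' Y' k y hy l y' hy'

theorem qmid_mem {X Z : O × Ω} {i j n : ℤ} {a : qtens P P' X.1 Z.1} {b : qtens Q Q' X.2 Z.2}
    (ha : a ∈ (qtens P P' X.1 Z.1).gr i) (hb : b ∈ (qtens Q Q' X.2 Z.2).gr j) (h : i + j = n) :
    qmid P P' Q Q' X Z (a ⊗ₜ b) ∈ (qtens (ptens P Q) (ptens P' Q') X Z).gr n := by
  refine qtens_gr_le (S := ((qtens (ptens P Q) (ptens P' Q') X Z).gr n).comap
    (qmid P P' Q Q' X Z ∘ₗ (TensorProduct.mk K _ _).flip b)) ?_ ha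
  rintro Y i j' rfl x hx x' hx'
  refine qtens_gr_le (S := ((qtens (ptens P Q) (ptens P' Q') X Z).gr n).comap
    (qmid P P' Q Q' X Z ∘ₗ (TensorProduct.mk K _ _) (qmk P P' X.1 Y Z.1 x x'))) ?_ hb
  rintro Y' k l rfl y hy y' hy'
  rw [mem_comap, comp_app, TensorProduct.mk_apply, qmid_tmul _ _ _ _ _ _ _ _ _ hx']
  exact qmk_mem (tmul_mem hx (sgn_mem _ _ hy) rfl) (tmul_mem hx' hy' rfl) (by rw [← h]; ring)

theorem qmap_qmid {P₁ P₁' : GQuiver K O} {Q₁ Q₁' : GQuiver K Ω} {X Z X' Z' : O × Ω}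
    (F : ∀ Y, P Y Z.1 →ₗ[K] P₁ Y Z'.1) (F' : ∀ Y, P' X.1 Y →ₗ[K] P₁' X'.1 Y)
    (G : ∀ Y, Q Y Z.2 →ₗ[K] Q₁ Y Z'.2) (G' : ∀ Y, Q' X.2 Y →ₗ[K] Q₁' X'.2 Y)
    (hF' : ∀ Y, HasDegree (P' X.1 Y).gr (P₁' X'.1 Y).gr (F' Y) 0)
    (hG : ∀ Y, HasDegree (Q Y Z.2).gr (Q₁ Y Z'.2).gr (G Y) 0)
    (a : qtens P P' X.1 Z.1) (b : qtens Q Q' X.2 Z.2) :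
    qmap (P := ptens P Q) (Q := ptens P' Q') (P' := ptens P₁ Q₁) (Q' := ptens P₁' Q₁')
      (X := X) (Z := Z) (X' := X') (Z' := Z')
      (fun Y => TensorProduct.map (F Y.1) (G Y.2)) (fun Y => TensorProduct.map (F' Y.1) (G' Y.2))
      (qmid P P' Q Q' X Z (a ⊗ₜ b)) = qmid P₁ P₁' Q₁ Q₁' X' Z' (qmap F F' a ⊗ₜ qmap G G' b) := by
  refine lapply_eq (qmap (P := ptens P Q) (Q := ptens P' Q') (P' := ptens P₁ Q₁) (Q' := ptens P₁' Q₁')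
      (X := X) (Z := Z) (X' := X') (Z' := Z')
      (fun Y => TensorProduct.map (F Y.1) (G Y.2)) (fun Y => TensorProduct.map (F' Y.1) (G' Y.2)) ∘ₗ
      qmid P P' Q Q' X Z)
    (qmid P₁ P₁' Q₁ Q₁' X' Z' ∘ₗ TensorProduct.map (qmap F F') (qmap G G'))
    (qtens_tens_ext ?_) (a ⊗ₜ b)
  intro Y i x hx j x' hx' Y' k y hy l y' hy'
  have h1 := hF' Y j x' hx'
  rw [add_zero] at h1
  have h2 := sgn_map_of_hasDegree (hG Y') j y
  rw [mul_zero, negOnePow_zero, Units.val_one, one_smul] at h2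
  rw [comp_app, comp_app, TensorProduct.map_tmul, qmap_qmk, qmap_qmk, qmid_tmul _ _ _ _ _ _ _ _ _
    hx', qmid_tmul _ _ _ _ _ _ _ _ _ h1, qmap_qmk, TensorProduct.map_tmul, TensorProduct.map_tmul,
    h2]

theorem qassoc_qmid_aux (X Z : O × Ω) (Y : O) (Y' : Ω) {j : ℤ} {x' : P'' X.1 Y}
    (hx' : x' ∈ (P'' X.1 Y).gr j) (y' : Q'' X.2 Y') (x : qtens P P' Y Z.1) (y : qtens Q Q' Y' Z.2) :
    qassoc (ptens P Q) (ptens P' Q') (ptens P'' Q'') X Z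
      (qmk (qtens (ptens P Q) (ptens P' Q')) (ptens P'' Q'') X (Y, Y') Z
        (qmid P P' Q Q' (Y, Y') Z (x ⊗ₜ (qtens Q Q' Y' Z.2).sgn j y)) (x' ⊗ₜ y')) =
    qmap (P := ptens P Q) (P' := ptens P Q) (Q := ptens (qtens P' P'') (qtens Q' Q''))
      (Q' := qtens (ptens P' Q') (ptens P'' Q''))
      (fun _ => lid) (fun Y => qmid P' P'' Q' Q'' X Y)
      (qmid P (qtens P' P'') Q (qtens Q' Q'') X Z
        (qassoc P P' P'' X.1 Z.1 (qmk (qtens P P') P'' X.1 Y Z.1 x x') ⊗ₜ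
          qassoc Q Q' Q'' X.2 Z.2 (qmk (qtens Q Q') Q'' X.2 Y' Z.2 y y'))) := by
  refine lapply_eq (qassoc (ptens P Q) (ptens P' Q') (ptens P'' Q'') X Z ∘ₗ
      (qmk (qtens (ptens P Q) (ptens P' Q')) (ptens P'' Q'') X (Y, Y') Z).flip (x' ⊗ₜ y') ∘ₗ
        qmid P P' Q Q' (Y, Y') Z ∘ₗ TensorProduct.map lid ((qtens Q Q' Y' Z.2).sgn j))
    (qmap (P := ptens P Q) (P' := ptens P Q) (Q := ptens (qtens P' P'') (qtens Q' Q''))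
      (Q' := qtens (ptens P' Q') (ptens P'' Q''))
      (fun _ => lid) (fun Y => qmid P' P'' Q' Q'' X Y) ∘ₗ
      qmid P (qtens P' P'') Q (qtens Q' Q'') X Z ∘ₗ
        TensorProduct.map (qassoc P P' P'' X.1 Z.1 ∘ₗ (qmk (qtens P P') P'' X.1 Y Z.1).flip x')
          (qassoc Q Q' Q'' X.2 Z.2 ∘ₗ (qmk (qtens Q Q') Q'' X.2 Y' Z.2).flip y'))
    (qtens_tens_ext ?_) (x ⊗ₜ y)
  intro W i x₁ hx₁ i' x₂ hx₂ W' k y₁ hy₁ k' y₂ hy₂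
  change qassoc (ptens P Q) (ptens P' Q') (ptens P'' Q'') X Z
      (qmk (qtens (ptens P Q) (ptens P' Q')) (ptens P'' Q'') X (Y, Y') Z
        (qmid P P' Q Q' (Y, Y') Z (qmk P P' Y W Z.1 x₁ x₂ ⊗ₜ
          (qtens Q Q' Y' Z.2).sgn j (qmk Q Q' Y' W' Z.2 y₁ y₂))) (x' ⊗ₜ y')) =
    qmap (P := ptens P Q) (P' := ptens P Q) (Q := ptens (qtens P' P'') (qtens Q' Q''))
      (Q' := qtens (ptens P' Q') (ptens P'' Q''))
      (fun _ => lid) (fun Y => qmid P' P'' Q' Q'' X Y)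
      (qmid P (qtens P' P'') Q (qtens Q' Q'') X Z
        (qassoc P P' P'' X.1 Z.1 (qmk (qtens P P') P'' X.1 Y Z.1 (qmk P P' Y W Z.1 x₁ x₂) x') ⊗ₜ
          qassoc Q Q' Q'' X.2 Z.2 (qmk (qtens Q Q') Q'' X.2 Y' Z.2 (qmk Q Q' Y' W' Z.2 y₁ y₂) y')))
  rw [qassoc_qmk, qassoc_qmk, qtens_sgn, qmap_qmk, qmid_tmul _ _ _ _ _ _ _ _ _ (qmk_mem hx₂ hx'
    rfl), qmid_tmul P P' Q Q' (Y, Y') Z W W' x₁ hx₂, qassoc_qmk, qmap_id_qmk, qmid_tmul P' P'' Q'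
    Q'' X (W, W') Y Y' x₂ hx', sgn_sgn]

theorem qassoc_qmid (X Z : O × Ω) (a : qtens (qtens P P') P'' X.1 Z.1)
    (b : qtens (qtens Q Q') Q'' X.2 Z.2) :
    qassoc (ptens P Q) (ptens P' Q') (ptens P'' Q'') X Z
      (qmap (P := ptens (qtens P P') (qtens Q Q')) (P' := qtens (ptens P Q) (ptens P' Q'))
        (Q := ptens P'' Q'') (Q' := ptens P'' Q'')
        (fun Y => qmid P P' Q Q' Y Z) (fun _ => lid)
        (qmid (qtens P P') P'' (qtens Q Q') Q'' X Z (a ⊗ₜ b))) =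
    qmap (P := ptens P Q) (P' := ptens P Q) (Q := ptens (qtens P' P'') (qtens Q' Q''))
      (Q' := qtens (ptens P' Q') (ptens P'' Q''))
      (fun _ => lid) (fun Y => qmid P' P'' Q' Q'' X Y)
      (qmid P (qtens P' P'') Q (qtens Q' Q'') X Z
        (qassoc P P' P'' X.1 Z.1 a ⊗ₜ qassoc Q Q' Q'' X.2 Z.2 b)) := by
  refine lapply_eq (qassoc (ptens P Q) (ptens P' Q') (ptens P'' Q'') X Z ∘ₗ
      qmap (P := ptens (qtens P P') (qtens Q Q')) (P' := qtens (ptens P Q) (ptens P' Q'))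
        (Q := ptens P'' Q'') (Q' := ptens P'' Q'')
        (fun Y => qmid P P' Q Q' Y Z) (fun _ => lid) ∘ₗ
        qmid (qtens P P') P'' (qtens Q Q') Q'' X Z)
    (qmap (P := ptens P Q) (P' := ptens P Q) (Q := ptens (qtens P' P'') (qtens Q' Q''))
      (Q' := qtens (ptens P' Q') (ptens P'' Q''))
      (fun _ => lid) (fun Y => qmid P' P'' Q' Q'' X Y) ∘ₗ
      qmid P (qtens P' P'') Q (qtens Q' Q'') X Z ∘ₗ
        TensorProduct.map (qassoc P P' P'' X.1 Z.1) (qassoc Q Q' Q'' X.2 Z.2))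
    (qtens_tens_ext ?_) (a ⊗ₜ b)
  intro Y i x hx j x' hx' Y' k y hy l y' hy'
  rw [comp_app, comp_app, comp_app, comp_app, TensorProduct.map_tmul, qmid_tmul _ _ _ _ _ _ _ _ _
    hx', qmap_qmk_id]
  exact qassoc_qmid_aux X Z Y Y' hx' y' x y

end

section

variable {P : GQuiver K O} {Q : GQuiver K Ω} {dP : ∀ X Z, P X Z →ₗ[K] P X Z}
  {dQ : ∀ X Z, Q X Z →ₗ[K] Q X Z} {ΔP : ∀ X Z, P X Z →ₗ[K] qtens P P X Z}
  {ΔQ : ∀ X Z, Q X Z →ₗ[K] qtens Q Q X Z}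

theorem ptensComul_tmul (X Z : O × Ω) (x : P X.1 Z.1) (y : Q X.2 Z.2) :
    ptensComul P Q ΔP ΔQ X Z (x ⊗ₜ y) = qmid P P Q Q X Z (ΔP X.1 Z.1 x ⊗ₜ ΔQ X.2 Z.2 y) := rfl

theorem tensD_tmul {M N : GrMod.{u, w} K} (dM : M →ₗ[K] M) (dN : N →ₗ[K] N) (x : M) (y : N) :
    tensD M N dM dN (x ⊗ₜ y) = dM x ⊗ₜ y + M.sgn 1 x ⊗ₜ dN y := rfl

theorem ptensComul_coassoc (hP : IsDGCocat P dP ΔP) (hQ : IsDGCocat Q dQ ΔQ) (X Z : O × Ω)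
    (z : ptens P Q X Z) :
    qassoc _ _ _ X Z (qmap (fun Y => ptensComul P Q ΔP ΔQ Y Z) (fun _ => lid)
      (ptensComul P Q ΔP ΔQ X Z z)) =
    qmap (fun _ => lid) (fun Y => ptensComul P Q ΔP ΔQ X Y)
      (ptensComul P Q ΔP ΔQ X Z z) := by
  refine lapply_eq (qassoc _ _ _ X Z ∘ₗ qmap (fun Y => ptensComul P Q ΔP ΔQ Y Z) (fun _ => lid) ∘ₗ
      ptensComul P Q ΔP ΔQ X Z)
    (qmap (fun _ => lid) (fun Y => ptensComul P Q ΔP ΔQ X Y) ∘ₗ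
      ptensComul P Q ΔP ΔQ X Z) (tens_ext fun i x hx j y hy => ?_) z
  rw [comp_app, comp_app, comp_app, ptensComul_tmul]
  have h1 := qmap_comp (P := ptens P Q) (Q := ptens P Q) (P' := ptens (qtens P P) (qtens Q Q))
    (Q' := ptens P Q) (P'' := qtens (ptens P Q) (ptens P Q)) (Q'' := ptens P Q)
    (X := X) (Z := Z) (X' := X) (Z' := Z) (X'' := X) (Z'' := Z)
    (fun Y => TensorProduct.map (ΔP Y.1 Z.1) (ΔQ Y.2 Z.2))
    (fun Y => TensorProduct.map lid lid)
    (fun Y => qmid P P Q Q Y Z) (fun _ => lid)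
    (qmid P P Q Q X Z (ΔP X.1 Z.1 x ⊗ₜ ΔQ X.2 Z.2 y))
  have h2 := qmap_comp (P := ptens P Q) (Q := ptens P Q) (P' := ptens P Q)
    (Q' := ptens (qtens P P) (qtens Q Q)) (P'' := ptens P Q)
    (Q'' := qtens (ptens P Q) (ptens P Q))
    (X := X) (Z := Z) (X' := X) (Z' := Z) (X'' := X) (Z'' := Z)
    (fun Y => TensorProduct.map lid lid)
    (fun Y => TensorProduct.map (ΔP X.1 Y.1) (ΔQ X.2 Y.2))
    (fun _ => lid) (fun Y => qmid P P Q Q X Y)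
    (qmid P P Q Q X Z (ΔP X.1 Z.1 x ⊗ₜ ΔQ X.2 Z.2 y))
  have hd : ∀ {M : GrMod.{u, u} K}, HasDegree M.gr M.gr lid 0 := fun i x hx => by
    rwa [add_zero]
  have h3 := qmap_qmid (X := X) (Z := Z) (X' := X) (Z' := Z) (fun Y => ΔP Y Z.1) (fun _ => lid)
    (fun Y => ΔQ Y Z.2) (fun _ => lid) (fun _ => hd) (fun Y => hQ.comul_deg _ _)
    (ΔP X.1 Z.1 x) (ΔQ X.2 Z.2 y)
  have h4 := qmap_qmid (X := X) (Z := Z) (X' := X) (Z' := Z) (fun _ => lid) (fun Y => ΔP X.1 Y)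
    (fun _ => lid) (fun Y => ΔQ X.2 Y) (fun Y => hP.comul_deg _ _) (fun _ => hd)
    (ΔP X.1 Z.1 x) (ΔQ X.2 Z.2 y)
  rw [h3] at h1
  rw [h4] at h2
  simp only [TensorProduct.map_id] at h1 h2
  refine (congrArg (qassoc _ _ _ X Z) h1.symm).trans (Eq.trans ?_ h2)
  rw [qassoc_qmid, hP.coassoc, hQ.coassoc]

theorem ptensComul_tensD (hP : IsDGCocat P dP ΔP) (hQ : IsDGCocat Q dQ ΔQ) (X Z : O × Ω)
    (z : ptens P Q X Z) :
    ptensComul P Q ΔP ΔQ X Z (tensD (P X.1 Z.1) (Q X.2 Z.2) (dP X.1 Z.1) (dQ X.2 Z.2) z) =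
      qmap[ptens P Q] (fun Y => tensD (P Y.1 Z.1) (Q Y.2 Z.2) (dP Y.1 Z.1) (dQ Y.2 Z.2))
        (fun _ => lid) (ptensComul P Q ΔP ΔQ X Z z) +
      qmap[ptens P Q] (fun Y => (ptens P Q Y Z).sgn 1)
        (fun Y => tensD (P X.1 Y.1) (Q X.2 Y.2) (dP X.1 Y.1) (dQ X.2 Y.2))
        (ptensComul P Q ΔP ΔQ X Z z) := by
  refine lapply_eq (ptensComul P Q ΔP ΔQ X Z ∘ₗ tensD (P X.1 Z.1) (Q X.2 Z.2) (dP X.1 Z.1) (dQ X.2 Z.2))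
    (qmap[ptens P Q] (fun Y => tensD (P Y.1 Z.1) (Q Y.2 Z.2) (dP Y.1 Z.1) (dQ Y.2 Z.2))
        (fun _ => lid) ∘ₗ ptensComul P Q ΔP ΔQ X Z +
      qmap[ptens P Q] (fun Y => (ptens P Q Y Z).sgn 1)
        (fun Y => tensD (P X.1 Y.1) (Q X.2 Y.2) (dP X.1 Y.1) (dQ X.2 Y.2)) ∘ₗ
        ptensComul P Q ΔP ΔQ X Z) (tens_ext fun i x hx j y hy => ?_) z
  have h1 : ΔP X.1 Z.1 ((P X.1 Z.1).sgn 1 x) =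
      qmap (fun Y => (P Y Z.1).sgn 1) (fun Y => (P X.1 Y).sgn 1) (ΔP X.1 Z.1 x) := by
    have := sgn_map_of_hasDegree (hP.comul_deg X.1 Z.1) 1 x
    rw [mul_zero, negOnePow_zero, Units.val_one, one_smul, qtens_sgn] at this
    exact this.symm
  rw [ladd_app, comp_app, comp_app, comp_app, tensD_tmul, map_add, ptensComul_tmul, ptensComul_tmul,
    ptensComul_tmul, hP.coder, hQ.coder, h1]
  generalize ΔP X.1 Z.1 x = a
  generalize ΔQ X.2 Z.2 y = b
  refine lapply_eq (qmid P P Q Q X Z ∘ₗ TensorProduct.map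
        (qmap (fun Y => dP Y Z.1) (fun _ => lid) +
          qmap (fun Y => (P Y Z.1).sgn 1) (fun Y => dP X.1 Y)) lid +
      qmid P P Q Q X Z ∘ₗ TensorProduct.map
        (qmap (fun Y => (P Y Z.1).sgn 1) (fun Y => (P X.1 Y).sgn 1))
        (qmap (fun Y => dQ Y Z.2) (fun _ => lid) +
          qmap (fun Y => (Q Y Z.2).sgn 1) (fun Y => dQ X.2 Y)))
    (qmap[ptens P Q] (fun Y => tensD (P Y.1 Z.1) (Q Y.2 Z.2) (dP Y.1 Z.1) (dQ Y.2 Z.2))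
        (fun _ => lid) ∘ₗ qmid P P Q Q X Z +
      qmap[ptens P Q] (fun Y => (ptens P Q Y Z).sgn 1)
        (fun Y => tensD (P X.1 Y.1) (Q X.2 Y.2) (dP X.1 Y.1) (dQ X.2 Y.2)) ∘ₗ
        qmid P P Q Q X Z)
    (qtens_tens_ext ?_) (a ⊗ₜ b)
  intro Y i x hx j x' hx' Y' k y hy l y' hy'
  simp only [ladd_app, comp_app, TensorProduct.map_tmul, id_app]
  have h3 := sgn_map_of_hasDegree (hQ.d_deg Y' Z.2) j y
  have h4 := (P X.1 Y).sgn_one_of_mem hx'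
  have h5 := (Q Y' Z.2).sgn_sgn 1 j y
  have h6 := (Q Y' Z.2).sgn_sgn j 1 y
  rw [mul_one] at h3
  rw [qmap_qmk_id, qmap_qmk, qmap_qmk, qmap_qmk_id, qmap_qmk, qmid_tmul _ _ _ _ _ _ _ _ _ hx',
    add_tmul, map_add, tmul_add, map_add, qmid_tmul _ _ _ _ _ _ _ _ _ hx', qmid_tmul _ _ _ _ _ _ _ _
    _ (hP.d_deg _ _ _ _ hx'), qmid_tmul _ _ _ _ _ _ _ _ _ (sgn_mem _ _ hx'), qmid_tmul _ _ _ _ _ _ _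
    _ _ (sgn_mem _ _ hx'), qmap_qmk_id, qmap_qmk, tens_sgn, tensD_tmul, tensD_tmul, h5, h6, h3, h4,
    add_comm 1 j]
  rcases negOnePow_cases j with h | h <;>
    simp only [h, map_add, ladd_app, Units.val_one, Units.val_neg, one_smul, neg_smul,
      TensorProduct.neg_tmul, TensorProduct.tmul_neg, map_neg, lneg_app, neg_neg] <;>
    abel

theorem tensD_tensD {M N : GrMod.{u, u} K} {dM : M →ₗ[K] M} {dN : N →ₗ[K] N}
    (hM : IsDifferential M.gr dM) (hN : IsDifferential N.gr dN) :
    IsDifferential (M.tens N).gr (tensD M N dM dN) := by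
  refine ⟨fun k z hz => ?_, fun z => ?_⟩
  · refine tens_gr_le (S := ((M.tens N).gr (k + 1)).comap (tensD M N dM dN)) ?_ hz
    rintro i j rfl x hx y hy
    rw [mem_comap, tensD_tmul]
    exact add_mem (tmul_mem (hM.1 i x hx) hy (by ring))
      (tmul_mem (sgn_mem _ _ hx) (hN.1 j y hy) (by ring))
  · refine lapply_eq (tensD M N dM dN ∘ₗ tensD M N dM dN) 0
      (tens_ext fun i x hx j y hy => ?_) z
    have h1 := sgn_map_of_hasDegree hM.1 1 x
    rw [mul_one, negOnePow_one] at h1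
    rw [comp_app, tensD_tmul, map_add, tensD_tmul, tensD_tmul, hM.2, hN.2, h1, zero_tmul, tmul_zero,
      lzero_app]
    simp [TensorProduct.neg_tmul]

theorem IsDGCocat.ptens (hP : IsDGCocat P dP ΔP) (hQ : IsDGCocat Q dQ ΔQ) :
    IsDGCocat (ptens P Q) (fun X Z => tensD (P X.1 Z.1) (Q X.2 Z.2) (dP X.1 Z.1) (dQ X.2 Z.2))
      (ptensComul P Q ΔP ΔQ) where
  d_deg X Z := (tensD_tensD ⟨hP.d_deg _ _, hP.d_d _ _⟩ ⟨hQ.d_deg _ _, hQ.d_d _ _⟩).1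
  d_d X Z := (tensD_tensD ⟨hP.d_deg _ _, hP.d_d _ _⟩ ⟨hQ.d_deg _ _, hQ.d_d _ _⟩).2
  comul_deg X Z k z hz := by
    refine tens_gr_le (S := ((qtens (AInf.ptens P Q) (AInf.ptens P Q) X Z).gr (k + 0)).comap
      (ptensComul P Q ΔP ΔQ X Z)) ?_ hz
    rintro i j rfl x hx y hy
    exact qmid_mem (hP.comul_deg _ _ _ _ hx) (hQ.comul_deg _ _ _ _ hy) (by ring)
  coassoc := ptensComul_coassoc hP hQ
  coder := ptensComul_tensD hP hQ

end

end TensorCocat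

section ReducedCocat

variable {O Ω : Type u}

/-! ## The reduction of a tensor product of augmentations -/

/-- A dg cocategory structure passes to a quotient which is a direct summand as a complex. -/
theorem IsDGCocat.retract {E R : GQuiver K O} {d : ∀ X Z, E X Z →ₗ[K] E X Z}
    {Δ : ∀ X Z, E X Z →ₗ[K] qtens E E X Z} (h : IsDGCocat E d Δ)
    (i : ∀ X Z, R X Z →ₗ[K] E X Z) (p : ∀ X Z, E X Z →ₗ[K] R X Z) {dR : ∀ X Z, R X Z →ₗ[K] R X Z}
    (hi : ∀ X Z, HasDegree (R X Z).gr (E X Z).gr (i X Z) 0)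
    (hp : ∀ X Z, HasDegree (E X Z).gr (R X Z).gr (p X Z) 0)
    (hpi : ∀ X Z x, p X Z (i X Z x) = x)
    (hid : ∀ X Z x, i X Z (dR X Z x) = d X Z (i X Z x))
    (hpd : ∀ X Z x, p X Z (d X Z x) = dR X Z (p X Z x))
    (hΔ : ∀ X Z x, qmap (fun Y => p Y Z) (fun Y => p X Y) (Δ X Z (i X Z (p X Z x))) =
      qmap (fun Y => p Y Z) (fun Y => p X Y) (Δ X Z x)) :
    IsDGCocat R dR (fun X Z => qmap[E, R] (fun Y => p Y Z) (fun Y => p X Y) ∘ₗ Δ X Z ∘ₗ i X Z) where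
  d_deg X Z k x hx := by
    have := hp X Z _ _ (h.d_deg X Z _ _ (hi X Z k x hx))
    rwa [hpd, hpi, show k + 0 + 1 + 0 = k + 1 by ring] at this
  d_d X Z x := by
    rw [← hpi X Z (dR X Z (dR X Z x)), hid, hid, h.d_d, map_zero]
  comul_deg X Z k x hx := by
    have := qmap_hasDegree (P := E) (Q := E) (P' := R) (Q' := R) (X := X) (Z := Z) (X' := X)
      (Z' := Z) (fun Y => hp Y Z) (fun Y => hp X Y) rfl _ _
      (h.comul_deg X Z _ _ (hi X Z k x hx))
    rwa [show k + 0 + 0 + (0 + 0) = k + 0 by ring] at this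
  coassoc X Z x := by
    simp only [comp_app]
    generalize i X Z x = x
    have h1 : ∀ Y, (qmap (P := E) (Q := E) (P' := R) (Q' := R) (X := Y) (X' := Y)
        (fun W => p W Z) (fun W => p Y W) ∘ₗ Δ Y Z ∘ₗ i Y Z) ∘ₗ p Y Z =
        qmap[E, R] (fun W => p W Z) (fun W => p Y W) ∘ₗ Δ Y Z :=
      fun Y => lext fun x => hΔ Y Z x
    have h2 : ∀ Y, (qmap (P := E) (Q := E) (P' := R) (Q' := R) (Z := Y) (Z' := Y)
        (fun W => p W Y) (fun W => p X W) ∘ₗ Δ X Y ∘ₗ i X Y) ∘ₗ p X Y =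
        qmap[E, R] (fun W => p W Y) (fun W => p X W) ∘ₗ Δ X Y :=
      fun Y => lext fun x => hΔ X Y x
    have h3 := qmap_comp (P := E) (Q := E) (P' := R) (Q' := R) (P'' := qtens R R) (Q'' := R)
      (X := X) (X' := X) (X'' := X) (Z := Z) (Z' := Z) (Z'' := Z)
      (fun Y => p Y Z) (fun Y => p X Y) (fun Y => qmap (P := E) (Q := E) (P' := R) (Q' := R)
        (X := Y) (X' := Y) (fun W => p W Z) (fun W => p Y W) ∘ₗ Δ Y Z ∘ₗ i Y Z)
      (fun Y => lid) (Δ X Z x)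
    have h4 := qmap_comp (P := E) (Q := E) (P' := R) (Q' := R) (P'' := R) (Q'' := qtens R R)
      (X := X) (X' := X) (X'' := X) (Z := Z) (Z' := Z) (Z'' := Z)
      (fun Y => p Y Z) (fun Y => p X Y) (fun Y => lid)
      (fun Y => qmap (P := E) (Q := E) (P' := R) (Q' := R)
        (Z := Y) (Z' := Y) (fun W => p W Y) (fun W => p X W) ∘ₗ Δ X Y ∘ₗ i X Y) (Δ X Z x)
    have h5 := qmap_comp (P := E) (Q := E) (P' := qtens E E) (Q' := E) (P'' := qtens R R) (Q'' := R)
      (X := X) (X' := X) (X'' := X) (Z := Z) (Z' := Z) (Z'' := Z)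
      (fun Y => Δ Y Z) (fun Y => lid) (fun Y => qmap (P := E) (Q := E) (P' := R) (Q' := R)
        (X := Y) (X' := Y) (fun W => p W Z) (fun W => p Y W)) (fun Y => p X Y) (Δ X Z x)
    have h6 := qmap_comp (P := E) (Q := E) (P' := E) (Q' := qtens E E) (P'' := R) (Q'' := qtens R R)
      (X := X) (X' := X) (X'' := X) (Z := Z) (Z' := Z) (Z'' := Z)
      (fun Y => lid) (fun Y => Δ X Y) (fun Y => p Y Z)
      (fun Y => qmap (P := E) (Q := E) (P' := R) (Q' := R)
        (Z := Y) (Z' := Y) (fun W => p W Y) (fun W => p X W)) (Δ X Z x)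
    simp only [h1, h2, LinearMap.id_comp, LinearMap.comp_id] at h3 h4 h5 h6
    refine (congrArg (qassoc R R R X Z) (h3.trans h5.symm)).trans (Eq.trans ?_ (h4.trans h6.symm).symm)
    rw [qassoc_qmap_qmap (P₁ := E) (P₂ := E) (P₃ := E) (Q₁ := R) (Q₂ := R) (Q₃ := R) p p p, h.coassoc]
  coder X Z x := by
    simp only [comp_app]
    rw [hid, h.coder, map_add]
    generalize Δ X Z (i X Z x) = z
    have h1 : ∀ Y Z, p Y Z ∘ₗ d Y Z = dR Y Z ∘ₗ p Y Z := fun Y Z => lext fun x => hpd Y Z x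
    have h2 : ∀ Y, p Y Z ∘ₗ (E Y Z).sgn 1 = (R Y Z).sgn 1 ∘ₗ p Y Z := by
      refine fun Y => lext fun x => ?_
      have := sgn_map_of_hasDegree (hp Y Z) 1 x
      rw [mul_zero, negOnePow_zero, Units.val_one, one_smul] at this
      exact this.symm
    have h3 := qmap_comp (P := E) (Q := E) (P' := E) (Q' := E) (P'' := R) (Q'' := R)
      (X := X) (X' := X) (X'' := X) (Z := Z) (Z' := Z) (Z'' := Z)
      (fun Y => d Y Z) (fun Y => lid) (fun Y => p Y Z) (fun Y => p X Y) z
    have h4 := qmap_comp (P := E) (Q := E) (P' := E) (Q' := E) (P'' := R) (Q'' := R)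
      (X := X) (X' := X) (X'' := X) (Z := Z) (Z' := Z) (Z'' := Z)
      (fun Y => (E Y Z).sgn 1) (fun Y => d X Y) (fun Y => p Y Z) (fun Y => p X Y) z
    have h5 := qmap_comp (P := E) (Q := E) (P' := R) (Q' := R) (P'' := R) (Q'' := R)
      (X := X) (X' := X) (X'' := X) (Z := Z) (Z' := Z) (Z'' := Z)
      (fun Y => p Y Z) (fun Y => p X Y) (fun Y => dR Y Z) (fun Y => lid) z
    have h6 := qmap_comp (P := E) (Q := E) (P' := R) (Q' := R) (P'' := R) (Q'' := R)
      (X := X) (X' := X) (X'' := X) (Z := Z) (Z' := Z) (Z'' := Z)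
      (fun Y => p Y Z) (fun Y => p X Y) (fun Y => (R Y Z).sgn 1) (fun Y => dR X Y) z
    simp only [h1, h2, LinearMap.id_comp, LinearMap.comp_id] at h3 h4 h5 h6
    exact congrArg₂ (· + ·) (h3.trans h5.symm) (h4.trans h6.symm)

section

variable (P : GQuiver K O) (Q : GQuiver K Ω)

/-- The tensors in the reduction. -/
def redT (X Y : O × Ω) : (P X.1 Y.1).tens (Q X.2 Y.2) →ₗ[K] red P Q X Y := inl K _ _

/-- The morphisms of the first quiver in the reduction. -/
def redL (X Y : O × Ω) (h : X.2 = Y.2) : P X.1 Y.1 →ₗ[K] red P Q X Y :=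
  inr K _ _ ∘ₗ inl K _ _ ∘ₗ powIncl h (P X.1 Y.1)

/-- The morphisms of the second quiver in the reduction. -/
def redR (X Y : O × Ω) (h : X.1 = Y.1) : Q X.2 Y.2 →ₗ[K] red P Q X Y :=
  inr K _ _ ∘ₗ inr K _ _ ∘ₗ powIncl h (Q X.2 Y.2)

variable {P Q}

theorem red_induction {X Y : O × Ω} {p : red P Q X Y → Prop}
    (add : ∀ x y, p x → p y → p (x + y))
    (redT : ∀ i, ∀ x ∈ (P X.1 Y.1).gr i, ∀ j, ∀ y ∈ (Q X.2 Y.2).gr j, p (redT P Q X Y (x ⊗ₜ y)))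
    (redL : ∀ h, ∀ i, ∀ x ∈ (P X.1 Y.1).gr i, p (redL P Q X Y h x))
    (redR : ∀ h, ∀ j, ∀ y ∈ (Q X.2 Y.2).gr j, p (redR P Q X Y h y)) (z : red P Q X Y) : p z := by
  have h0 : p 0 := by
    have := redT 0 0 (zero_mem _) 0 0 (zero_mem _)
    rwa [zero_tmul, map_zero] at this
  obtain ⟨z, x, y⟩ := z
  have h : ((z, x, y) : red P Q X Y) = AInf.redT P Q X Y z +
      ((inr K _ _ (inl K _ _ x) : red P Q X Y) +
        inr K _ _ (inr K _ _ y)) := by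
    simp [AInf.redT]
  rw [h]
  clear h
  refine add _ _ ?_ (add _ _ ?_ ?_)
  · induction z using TensorProduct.induction_on with
    | zero => rwa [map_zero]
    | add x y hx hy => rw [map_add]; exact add _ _ hx hy
    | tmul x y =>
      refine (P X.1 Y.1).gr_le_induction (p := fun x => p (AInf.redT P Q X Y (x ⊗ₜ y))) ?_ ?_ ?_ x
      · intro i x hx
        refine (Q X.2 Y.2).gr_le_induction (p := fun y => p (AInf.redT P Q X Y (x ⊗ₜ y)))
          (redT i x hx) ?_ ?_ y
        · rwa [tmul_zero, map_zero]
        · intro y y' hy hy'; rw [tmul_add, map_add]; exact add _ _ hy hy'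
      · rwa [zero_tmul, map_zero]
      · intro x x' hx hx'; rw [add_tmul, map_add]; exact add _ _ hx hx'
  · refine pow_induction
      (P := fun x => p (inr K _ _ (inl K _ _ x))) ?_ ?_ x
    · intro _; exact h0
    · intro e x
      refine (P X.1 Y.1).gr_le_induction (p := fun x => p (AInf.redL P Q X Y e x)) (redL e) ?_ ?_ x
      · rwa [map_zero]
      · intro x x' hx hx'; rw [map_add]; exact add _ _ hx hx'
  · refine pow_induction
      (P := fun x => p (inr K _ _ (inr K _ _ x))) ?_ ?_ y
    · intro _; exact h0
    · intro e x
      refine (Q X.2 Y.2).gr_le_induction (p := fun x => p (AInf.redR P Q X Y e x)) (redR e) ?_ ?_ x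
      · rwa [map_zero]
      · intro x x' hx hx'; rw [map_add]; exact add _ _ hx hx'

theorem red_ext {X Y : O × Ω} {f g : red P Q X Y →ₗ[K] N}
    (hT : ∀ i, ∀ x ∈ (P X.1 Y.1).gr i, ∀ j, ∀ y ∈ (Q X.2 Y.2).gr j,
      f (redT P Q X Y (x ⊗ₜ y)) = g (redT P Q X Y (x ⊗ₜ y)))
    (hL : ∀ h, ∀ i, ∀ x ∈ (P X.1 Y.1).gr i, f (redL P Q X Y h x) = g (redL P Q X Y h x))
    (hR : ∀ h, ∀ j, ∀ y ∈ (Q X.2 Y.2).gr j, f (redR P Q X Y h y) = g (redR P Q X Y h y)) :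
    f = g :=
  lext fun z => red_induction (p := fun z => f z = g z)
    (fun x y hx hy => by rw [map_add, map_add, hx, hy]) hT hL hR z

theorem redT_mem {X Y : O × Ω} {i j n : ℤ} {x : P X.1 Y.1} {y : Q X.2 Y.2}
    (hx : x ∈ (P X.1 Y.1).gr i) (hy : y ∈ (Q X.2 Y.2).gr j) (h : i + j = n) :
    redT P Q X Y (x ⊗ₜ y) ∈ (red P Q X Y).gr n :=
  ⟨tmul_mem hx hy h, zero_mem _⟩

theorem redL_mem {X Y : O × Ω} (h : X.2 = Y.2) {i : ℤ} {x : P X.1 Y.1}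
    (hx : x ∈ (P X.1 Y.1).gr i) : redL P Q X Y h x ∈ (red P Q X Y).gr i :=
  ⟨zero_mem _, powIncl_mem h hx, zero_mem _⟩

theorem redR_mem {X Y : O × Ω} (h : X.1 = Y.1) {i : ℤ} {x : Q X.2 Y.2}
    (hx : x ∈ (Q X.2 Y.2).gr i) : redR P Q X Y h x ∈ (red P Q X Y).gr i :=
  ⟨zero_mem _, zero_mem _, powIncl_mem h hx⟩

theorem red_gr_le {X Y : O × Ω} {n : ℤ} {S : Submodule K (red P Q X Y)}
    (hT : ∀ i j, i + j = n → ∀ x ∈ (P X.1 Y.1).gr i, ∀ y ∈ (Q X.2 Y.2).gr j,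
      redT P Q X Y (x ⊗ₜ y) ∈ S)
    (hL : ∀ h, ∀ x ∈ (P X.1 Y.1).gr n, redL P Q X Y h x ∈ S)
    (hR : ∀ h, ∀ y ∈ (Q X.2 Y.2).gr n, redR P Q X Y h y ∈ S) : (red P Q X Y).gr n ≤ S := by
  rintro ⟨z, x, y⟩ ⟨hz, hx, hy⟩
  have h : ((z, x, y) : red P Q X Y) = AInf.redT P Q X Y z +
      ((inr K _ _ (inl K _ _ x) : red P Q X Y) +
        inr K _ _ (inr K _ _ y)) := by
    simp [AInf.redT]
  rw [h]
  refine add_mem ?_ (add_mem ?_ ?_)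
  · exact tens_gr_le (S := S.comap (redT P Q X Y)) hT hz
  · exact dsum_gr_le (S := S.comap (inr K _ _ ∘ₗ inl K _ _))
      (fun i x hx => hL i.down x hx) hx
  · exact dsum_gr_le (S := S.comap (inr K _ _ ∘ₗ inr K _ _))
      (fun i x hx => hR i.down x hx) hy

variable (P Q)

theorem redIncl_redT (X Y : O × Ω) (x : P X.1 Y.1) (y : Q X.2 Y.2) :
    redIncl P Q X Y (redT P Q X Y (x ⊗ₜ y)) =
      augIn P X.1 Y.1 x ⊗ₜ augIn Q X.2 Y.2 y := by
  simp only [redIncl, redT, coprod_app, inl_app, Prod.fst_zero, Prod.snd_zero, map_zero, add_zero]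
  rfl

theorem redIncl_redL (X Y : O × Ω) (h : X.2 = Y.2) (x : P X.1 Y.1) :
    redIncl P Q X Y (redL P Q X Y h x) =
      augIn P X.1 Y.1 x ⊗ₜ augOne Q X.2 Y.2 h := by
  simp only [redIncl, redL, comp_app, coprod_app, inl_app, LinearMap.inr_apply, map_zero, add_zero,
    zero_add, desc_powIncl]
  rfl

theorem redIncl_redR (X Y : O × Ω) (h : X.1 = Y.1) (y : Q X.2 Y.2) :
    redIncl P Q X Y (redR P Q X Y h y) =
      augOne P X.1 Y.1 h ⊗ₜ augIn Q X.2 Y.2 y := by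
  simp only [redIncl, redR, comp_app, coprod_app, inl_app, LinearMap.inr_apply, map_zero, add_zero,
    zero_add, desc_powIncl]
  rfl

/-- The action of the scalars of a summand `K` with condition `p`. -/
def powAct (p : Prop) (M : GrMod.{u, u} K) : (unit K).pow p →ₗ[K] M →ₗ[K] M.pow p :=
  desc fun h => (LinearMap.lsmul K M).compr₂ (powIncl h.down M)

theorem powAct_one {p : Prop} (h : p) (M : GrMod.{u, u} K) (x : M) :
    powAct p M (powIncl h (unit K) (1 : K)) x = powIncl h M x := by
  refine (lcongr (desc_powIncl (M := unit K)
    (fun h : PLift p => (LinearMap.lsmul K M).compr₂ (powIncl h.down M)) h (1 : K)) x).trans ?_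
  exact congrArg (powIncl h M) (one_smul K x)

theorem redProj_in_in (X Y : O × Ω) (x : P X.1 Y.1) (y : Q X.2 Y.2) :
    redProj P Q X Y (augIn P X.1 Y.1 x ⊗ₜ augIn Q X.2 Y.2 y) =
      redT P Q X Y (x ⊗ₜ y) := by
  refine Prod.ext rfl (Prod.ext ?_ ?_)
  · change powAct (X.2 = Y.2) (P X.1 Y.1) 0 x = 0
    rw [map_zero, lzero_app]
  · change powAct (X.1 = Y.1) (Q X.2 Y.2) 0 y = 0
    rw [map_zero, lzero_app]

theorem redProj_in_one (X Y : O × Ω) (h : X.2 = Y.2) (x : P X.1 Y.1) :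
    redProj P Q X Y (augIn P X.1 Y.1 x ⊗ₜ augOne Q X.2 Y.2 h) =
      redL P Q X Y h x := by
  refine Prod.ext ?_ (Prod.ext ?_ ?_)
  · exact tmul_zero _ x
  · exact powAct_one h _ x
  · change powAct (X.1 = Y.1) (Q X.2 Y.2) 0 0 = 0
    rw [map_zero]

theorem redProj_one_in (X Y : O × Ω) (h : X.1 = Y.1) (y : Q X.2 Y.2) :
    redProj P Q X Y (augOne P X.1 Y.1 h ⊗ₜ augIn Q X.2 Y.2 y) =
      redR P Q X Y h y := by
  refine Prod.ext ?_ (Prod.ext ?_ ?_)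
  · exact zero_tmul _ y
  · change powAct (X.2 = Y.2) (P X.1 Y.1) 0 0 = 0
    rw [map_zero]
  · exact powAct_one h _ y

theorem redProj_one_one (X Y : O × Ω) (h : X.1 = Y.1) (h' : X.2 = Y.2) :
    redProj P Q X Y (augOne P X.1 Y.1 h ⊗ₜ augOne Q X.2 Y.2 h') = 0 := by
  refine Prod.ext ?_ (Prod.ext ?_ ?_)
  · exact zero_tmul _ (0 : Q X.2 Y.2)
  · exact map_zero (powAct (X.2 = Y.2) (P X.1 Y.1) (powIncl h' (unit K) (1 : K)))
  · exact map_zero (powAct (X.1 = Y.1) (Q X.2 Y.2) (powIncl h (unit K) (1 : K)))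

theorem redProj_redIncl (X Y : O × Ω) (z : red P Q X Y) :
    redProj P Q X Y (redIncl P Q X Y z) = z := by
  refine lapply_eq (redProj P Q X Y ∘ₗ redIncl P Q X Y) lid (red_ext ?_ ?_ ?_) z
  · intro i x hx j y hy
    rw [comp_app, redIncl_redT, redProj_in_in, id_app]
  · intro h i x hx
    rw [comp_app, redIncl_redL, redProj_in_one, id_app]
  · intro h i x hx
    rw [comp_app, redIncl_redR, redProj_one_in, id_app]

/-- Linear maps on the tensor product of augmentations agree when they agree on the elements of
the reduction and on the units. -/
theorem ptens_aug_ext {X Y : O × Ω}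
    {f g : ptens (aug P) (aug Q) X Y →ₗ[K] N}
    (hT : ∀ x y, f (augIn P X.1 Y.1 x ⊗ₜ augIn Q X.2 Y.2 y) =
      g (augIn P X.1 Y.1 x ⊗ₜ augIn Q X.2 Y.2 y))
    (hL : ∀ x h, f (augIn P X.1 Y.1 x ⊗ₜ augOne Q X.2 Y.2 h) =
      g (augIn P X.1 Y.1 x ⊗ₜ augOne Q X.2 Y.2 h))
    (hR : ∀ h y, f (augOne P X.1 Y.1 h ⊗ₜ augIn Q X.2 Y.2 y) =
      g (augOne P X.1 Y.1 h ⊗ₜ augIn Q X.2 Y.2 y))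
    (h1 : ∀ h h', f (augOne P X.1 Y.1 h ⊗ₜ augOne Q X.2 Y.2 h') =
      g (augOne P X.1 Y.1 h ⊗ₜ augOne Q X.2 Y.2 h')) : f = g := by
  refine TensorProduct.ext (aug_ext (fun x => aug_ext (fun y => ?_) fun h => ?_)
    fun h => aug_ext (fun y => ?_) fun h' => ?_)
  · exact hT x y
  · exact hL x h
  · exact hR h y
  · exact h1 h h'

theorem redIncl_hasDegree (X Y : O × Ω) :
    HasDegree (red P Q X Y).gr (ptens (aug P) (aug Q) X Y).gr (redIncl P Q X Y) 0 := by
  intro k z hz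
  refine red_gr_le (S := ((ptens (aug P) (aug Q) X Y).gr (k + 0)).comap (redIncl P Q X Y))
    ?_ ?_ ?_ hz
  · rintro i j rfl x hx y hy
    rw [mem_comap, redIncl_redT]
    exact tmul_mem (augIn_mem P hx) (augIn_mem Q hy) (by ring)
  · intro h x hx
    rw [mem_comap, redIncl_redL]
    exact tmul_mem (augIn_mem P hx) (augOne_mem Q _ _ h) (by ring)
  · intro h x hx
    rw [mem_comap, redIncl_redR]
    exact tmul_mem (augOne_mem P _ _ h) (augIn_mem Q hx) (by ring)

theorem redProj_hasDegree (X Y : O × Ω) :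
    HasDegree (ptens (aug P) (aug Q) X Y).gr (red P Q X Y).gr (redProj P Q X Y) 0 := by
  intro k z hz
  refine tens_gr_le (S := ((red P Q X Y).gr (k + 0)).comap (redProj P Q X Y)) ?_ hz
  rintro i j rfl x hx y hy
  refine aug_gr_induction (S := ((red P Q X Y).gr (i + j + 0)).comap
    (redProj P Q X Y ∘ₗ (TensorProduct.mk K _ _).flip y)) ?_ ?_ hx
  · intro x hx
    refine aug_gr_induction (S := ((red P Q X Y).gr (i + j + 0)).comap
      (redProj P Q X Y ∘ₗ (TensorProduct.mk K _ _) (augIn P X.1 Y.1 x))) ?_ ?_ hy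
    · intro y hy
      change redProj P Q X Y (augIn P X.1 Y.1 x ⊗ₜ augIn Q X.2 Y.2 y) ∈
        (red P Q X Y).gr (i + j + 0)
      rw [redProj_in_in]
      exact redT_mem hx hy (by ring)
    · rintro h rfl
      change redProj P Q X Y (augIn P X.1 Y.1 x ⊗ₜ augOne Q X.2 Y.2 h) ∈
        (red P Q X Y).gr (i + 0 + 0)
      rw [redProj_in_one, add_zero, add_zero]
      exact redL_mem h hx
  · rintro h rfl
    refine aug_gr_induction (S := ((red P Q X Y).gr (0 + j + 0)).comap
      (redProj P Q X Y ∘ₗ (TensorProduct.mk K _ _) (augOne P X.1 Y.1 h))) ?_ ?_ hy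
    · intro y hy
      change redProj P Q X Y (augOne P X.1 Y.1 h ⊗ₜ augIn Q X.2 Y.2 y) ∈
        (red P Q X Y).gr (0 + j + 0)
      rw [redProj_one_in, add_zero, zero_add]
      exact redR_mem h hy
    · rintro h' rfl
      change redProj P Q X Y (augOne P X.1 Y.1 h ⊗ₜ augOne Q X.2 Y.2 h') ∈
        (red P Q X Y).gr (0 + 0 + 0)
      rw [redProj_one_one]
      exact zero_mem _

variable {P Q} {dP : ∀ X Z, P X Z →ₗ[K] P X Z} {dQ : ∀ X Z, Q X Z →ₗ[K] Q X Z}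
  {ΔP : ∀ X Z, P X Z →ₗ[K] qtens P P X Z} {ΔQ : ∀ X Z, Q X Z →ₗ[K] qtens Q Q X Z}

theorem redD_redT (X Y : O × Ω) (x : P X.1 Y.1) (y : Q X.2 Y.2) :
    redD P Q dP dQ X Y (redT P Q X Y (x ⊗ₜ y)) =
      redT P Q X Y (dP X.1 Y.1 x ⊗ₜ y) + redT P Q X Y ((P X.1 Y.1).sgn 1 x ⊗ₜ dQ X.2 Y.2 y) := by
  rw [← map_add, ← tensD_tmul]
  refine Prod.ext rfl ?_
  exact map_zero (LinearMap.prodMap (powMap id (dP X.1 Y.1)) (powMap id (dQ X.2 Y.2)))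

theorem redD_redL (X Y : O × Ω) (h : X.2 = Y.2) (x : P X.1 Y.1) :
    redD P Q dP dQ X Y (redL P Q X Y h x) = redL P Q X Y h (dP X.1 Y.1 x) := by
  refine Prod.ext ?_ (Prod.ext ?_ ?_)
  · exact map_zero (tensD (P X.1 Y.1) (Q X.2 Y.2) (dP X.1 Y.1) (dQ X.2 Y.2))
  · exact powMap_powIncl id (dP X.1 Y.1) h x
  · exact map_zero (powMap id (dQ X.2 Y.2))

theorem redD_redR (X Y : O × Ω) (h : X.1 = Y.1) (y : Q X.2 Y.2) :
    redD P Q dP dQ X Y (redR P Q X Y h y) = redR P Q X Y h (dQ X.2 Y.2 y) := by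
  refine Prod.ext ?_ (Prod.ext ?_ ?_)
  · exact map_zero (tensD (P X.1 Y.1) (Q X.2 Y.2) (dP X.1 Y.1) (dQ X.2 Y.2))
  · exact map_zero (powMap id (dP X.1 Y.1))
  · exact powMap_powIncl id (dQ X.2 Y.2) h y

theorem redIncl_redD (X Y : O × Ω) (z : red P Q X Y) : redIncl P Q X Y (redD P Q dP dQ X Y z) =
      tensD (aug P X.1 Y.1) (aug Q X.2 Y.2) (augD P dP X.1 Y.1) (augD Q dQ X.2 Y.2)
        (redIncl P Q X Y z) := by
  refine lapply_eq (redIncl P Q X Y ∘ₗ redD P Q dP dQ X Y)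
    (tensD (aug P X.1 Y.1) (aug Q X.2 Y.2) (augD P dP X.1 Y.1) (augD Q dQ X.2 Y.2) ∘ₗ
      redIncl P Q X Y) (red_ext ?_ ?_ ?_) z
  · intro i x hx j y hy
    rw [comp_app, comp_app, redIncl_redT, redD_redT, map_add, redIncl_redT, redIncl_redT,
      tensD_tmul, augD_augIn, augD_augIn, aug_sgn_augIn]
  · intro h i x hx
    rw [comp_app, comp_app, redIncl_redL, redD_redL, redIncl_redL, tensD_tmul, augD_augIn,
      augD_augOne, tmul_zero, add_zero]
  · intro h i x hx
    rw [comp_app, comp_app, redIncl_redR, redD_redR, redIncl_redR, tensD_tmul, augD_augIn,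
      augD_augOne, zero_tmul, zero_add, aug_sgn_augOne]

theorem redProj_tensD (X Y : O × Ω) (z : ptens (aug P) (aug Q) X Y) :
    redProj P Q X Y (tensD (aug P X.1 Y.1) (aug Q X.2 Y.2) (augD P dP X.1 Y.1)
      (augD Q dQ X.2 Y.2) z) = redD P Q dP dQ X Y (redProj P Q X Y z) := by
  refine lapply_eq (redProj P Q X Y ∘ₗ tensD (aug P X.1 Y.1) (aug Q X.2 Y.2)
    (augD P dP X.1 Y.1) (augD Q dQ X.2 Y.2)) (redD P Q dP dQ X Y ∘ₗ redProj P Q X Y)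
    (ptens_aug_ext P Q ?_ ?_ ?_ ?_) z
  · intro x y
    rw [comp_app, comp_app, redProj_in_in, redD_redT, tensD_tmul, augD_augIn, augD_augIn,
      aug_sgn_augIn, map_add, redProj_in_in, redProj_in_in]
  · intro x h
    rw [comp_app, comp_app, redProj_in_one, redD_redL, tensD_tmul, augD_augIn, augD_augOne,
      tmul_zero, add_zero, redProj_in_one]
  · intro h y
    rw [comp_app, comp_app, redProj_one_in, redD_redR, tensD_tmul, augD_augIn, augD_augOne,
      zero_tmul, zero_add, aug_sgn_augOne, redProj_one_in]
  · intro h h'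
    rw [comp_app, comp_app, redProj_one_one, map_zero, tensD_tmul, augD_augOne, augD_augOne,
      zero_tmul, tmul_zero, add_zero, map_zero]

theorem redComul_redProj (X Z : O × Ω) (z : ptens (aug P) (aug Q) X Z) :
    redComul P Q ΔP ΔQ X Z (redProj P Q X Z z) = qmap[ptens (aug P) (aug Q), red P Q]
        (fun Y => redProj P Q Y Z) (fun Y => redProj P Q X Y)
        (ptensComul (aug P) (aug Q) (augComul P ΔP) (augComul Q ΔQ) X Z z) := by
  change qmap[ptens (aug P) (aug Q), red P Q] (fun Y => redProj P Q Y Z) (fun Y => redProj P Q X Y)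
    (ptensComul (aug P) (aug Q) (augComul P ΔP) (augComul Q ΔQ) X Z
      (redIncl P Q X Z (redProj P Q X Z z))) = _
  refine lapply_eq (qmap[ptens (aug P) (aug Q), red P Q] (fun Y => redProj P Q Y Z) (fun Y => redProj P Q X Y) ∘ₗ
      ptensComul (aug P) (aug Q) (augComul P ΔP) (augComul Q ΔQ) X Z ∘ₗ
        redIncl P Q X Z ∘ₗ redProj P Q X Z)
    (qmap[ptens (aug P) (aug Q), red P Q] (fun Y => redProj P Q Y Z) (fun Y => redProj P Q X Y) ∘ₗ
      ptensComul (aug P) (aug Q) (augComul P ΔP) (augComul Q ΔQ) X Z)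
    (ptens_aug_ext P Q ?_ ?_ ?_ ?_) z
  · intro x y
    rw [comp_app, comp_app, comp_app, comp_app, redProj_in_in, redIncl_redT]
  · intro x h
    rw [comp_app, comp_app, comp_app, comp_app, redProj_in_one, redIncl_redL]
  · intro h y
    rw [comp_app, comp_app, comp_app, comp_app, redProj_one_in, redIncl_redR]
  · intro h h'
    rw [comp_app, comp_app, comp_app, comp_app, redProj_one_one, map_zero, map_zero, map_zero,
      ptensComul_tmul, augComul_augOne, augComul_augOne, qmid_tmul _ _ _ _ _ _ _ _ _ (augOne_mem P _
      _ _), qmap_qmk, redProj_one_one, map_zero]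

theorem IsDGCocat.red (hP : IsDGCocat P dP ΔP) (hQ : IsDGCocat Q dQ ΔQ) :
    IsDGCocat (red P Q) (redD P Q dP dQ) (redComul P Q ΔP ΔQ) :=
  IsDGCocat.retract (hP.aug.ptens hQ.aug) (redIncl P Q) (redProj P Q) (redIncl_hasDegree P Q)
    (redProj_hasDegree P Q) (redProj_redIncl P Q) redIncl_redD redProj_tensD redComul_redProj

end

end ReducedCocat

section TensorCategory

variable {O : Type u}

/-! ## The tensor category and its derivations -/

section

variable (Q : GQuiver K O)

theorem tmul_tgen (X Y Z : O) (x : Q Y Z) (w : tbar Q X Y) :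
    tmul Q X Y Z (tgen Q Y Z x) w = tcons Q X Y Z x w := by
  rw [tmul, desc_tgen]
  rfl

theorem tmul_tcons (X Y W Z : O) (x : Q W Z) (u : tbar Q Y W) (w : tbar Q X Y) :
    tmul Q X Y Z (tcons Q Y W Z x u) w = tcons Q X W Z x (tmul Q X Y W u w) := by
  induction u using dsum_induction with
  | zero => simp
  | add u v hu hv => simp only [map_add, ladd_app, hu, hv]
  | of n u =>
    change tmul Q X Y Z (tcons Q Y W Z x (tin Q n Y W u)) w =
      tcons Q X W Z x (tmul Q X Y W (tin Q n Y W u) w)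
    rw [tcons_tin, tmul, tmul, desc_tin, desc_tin, tconc, tlift_tmk]
    rfl

theorem tmul_assoc (X Y Z W : O) (f : tbar Q Z W) (g : tbar Q Y Z) (h : tbar Q X Y) :
    tmul Q X Y W (tmul Q Y Z W f g) h = tmul Q X Z W f (tmul Q X Y Z g h) := by
  refine tbar_ext Q Z (N := fun W => tbar Q X W)
    (f := fun W => (tmul Q X Y W).flip h ∘ₗ (tmul Q Y Z W).flip g)
    (g := fun W => (tmul Q X Z W).flip (tmul Q X Y Z g h)) ?_ ?_ W f
  · intro W i x hx
    simp only [comp_app, flip_app]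
    rw [tmul_tgen, tmul_tgen, tmul_tcons]
  · intro V W i x hx w ih
    simp only [comp_app, flip_app] at ih ⊢
    rw [tmul_tcons, tmul_tcons, tmul_tcons, ih]

variable {Q} in
theorem tmul_mem (X Y Z : O) {i j : ℤ} {u : tbar Q Y Z} {w : tbar Q X Y}
    (hu : u ∈ (tbar Q Y Z).gr i) (hw : w ∈ (tbar Q X Y).gr j) :
    tmul Q X Y Z u w ∈ (tbar Q X Z).gr (i + j) := by
  refine tbar_gr_induction Q Y (p := fun Z i u => tmul Q X Y Z u w ∈ (tbar Q X Z).gr (i + j))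
    ?_ ?_ ?_ ?_ ?_ Z i u hu
  · intro Z k; rw [map_zero]; exact zero_mem _
  · intro Z k x y hx hy; rw [map_add]; exact add_mem hx hy
  · intro Z k a x hx; rw [map_smul]; exact Submodule.smul_mem _ _ hx
  · intro Z k x hx; rw [tmul_tgen]; exact tcons_mem hx hw rfl
  · intro W Z k l x hx u _ ih; rw [tmul_tcons]; exact tcons_mem hx ih (by ring)

/-- The derivation extending a map on generators. -/
def tder (δ : ∀ X Z, Q X Z →ₗ[K] tbar Q X Z) (X Z : O) : tbar Q X Z →ₗ[K] tbar Q X Z :=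
  desc fun n => derivation Q δ X n Z

variable {Q} {δ : ∀ X Z, Q X Z →ₗ[K] tbar Q X Z}

theorem tder_tgen (X Z : O) (x : Q X Z) : tder Q δ X Z (tgen Q X Z x) = δ X Z x := by
  rw [tder, desc_tgen]
  rfl

theorem tder_tcons (X Y Z : O) (x : Q Y Z) (w : tbar Q X Y) : tder Q δ X Z (tcons Q X Y Z x w) =
      tmul Q X Y Z (δ Y Z x) w + tcons Q X Y Z ((Q Y Z).sgn 1 x) (tder Q δ X Y w) := by
  induction w using dsum_induction with
  | zero => simp
  | add u v hu hv => simp only [map_add, hu, hv]; exact add_add_add_comm _ _ _ _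
  | of n w =>
    change tder Q δ X Z (tcons Q X Y Z x (tin Q n X Y w)) = tmul Q X Y Z (δ Y Z x) (tin Q n X Y w) +
        tcons Q X Y Z ((Q Y Z).sgn 1 x) (tder Q δ X Y (tin Q n X Y w))
    rw [tcons_tin, tder, tder, desc_tin, desc_tin, derivation, tlift_tmk]
    rfl

theorem tder_tmul (X Y Z : O) (u : tbar Q Y Z) (w : tbar Q X Y) :
    tder Q δ X Z (tmul Q X Y Z u w) = tmul Q X Y Z (tder Q δ Y Z u) w +
      tmul Q X Y Z ((tbar Q Y Z).sgn 1 u) (tder Q δ X Y w) := by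
  refine tbar_ext Q Y (N := fun Z => tbar Q X Z)
    (f := fun Z => tder Q δ X Z ∘ₗ (tmul Q X Y Z).flip w)
    (g := fun Z => (tmul Q X Y Z).flip w ∘ₗ tder Q δ Y Z +
      (tmul Q X Y Z).flip (tder Q δ X Y w) ∘ₗ (tbar Q Y Z).sgn 1) ?_ ?_ Z u
  · intro Z i x hx
    simp only [comp_app, ladd_app, flip_app]
    rw [tmul_tgen, tder_tcons, tder_tgen, tgen_sgn, tmul_tgen]
  · intro W Z i x hx u ih
    simp only [comp_app, ladd_app, flip_app] at ih ⊢
    rw [tmul_tcons, tder_tcons, tder_tcons, tcons_sgn, tmul_tcons, ih, map_add, map_add, ladd_app,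
      tmul_tcons, tmul_assoc, add_assoc]

theorem tder_hasDegree (hδ : ∀ X Z, HasDegree (Q X Z).gr (tbar Q X Z).gr (δ X Z) 1) (X Z : O) :
    HasDegree (tbar Q X Z).gr (tbar Q X Z).gr (tder Q δ X Z) 1 := by
  refine tbar_gr_induction Q X (p := fun Z i u => tder Q δ X Z u ∈ (tbar Q X Z).gr (i + 1))
    ?_ ?_ ?_ ?_ ?_ Z
  · intro Z k; rw [map_zero]; exact zero_mem _
  · intro Z k x y hx hy; rw [map_add]; exact add_mem hx hy
  · intro Z k a x hx; rw [map_smul]; exact Submodule.smul_mem _ _ hx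
  · intro Z k x hx; rw [tder_tgen]; exact hδ _ _ _ _ hx
  · intro Y Z i j x hx w hw ih
    rw [tder_tcons]
    refine add_mem ?_ (tcons_mem (sgn_mem _ _ hx) ih (by ring))
    have := tmul_mem X Y Z (hδ _ _ _ _ hx) hw
    rwa [show i + 1 + j = i + j + 1 by ring] at this

theorem tder_tder (hδ : ∀ X Z, HasDegree (Q X Z).gr (tbar Q X Z).gr (δ X Z) 1)
    (h0 : ∀ X Z x, tder Q δ X Z (δ X Z x) = 0) (X Z : O) (w : tbar Q X Z) :
    tder Q δ X Z (tder Q δ X Z w) = 0 := by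
  refine tbar_ext Q X (N := fun Z => tbar Q X Z)
    (f := fun Z => tder Q δ X Z ∘ₗ tder Q δ X Z) (g := fun Z => 0) ?_ ?_ Z w
  · intro Z i x hx
    rw [comp_app, tder_tgen, h0, lzero_app]
  · intro Y Z i x hx w ih
    have ih' : tder Q δ X Y (tder Q δ X Y w) = 0 := ih
    have h1 := sgn_map_of_hasDegree (hδ Y Z) 1 x
    rw [mul_one, negOnePow_one] at h1
    rw [comp_app, tder_tcons, map_add, tder_tmul, h0, map_zero, lzero_app, zero_add, tder_tcons,
      ih', map_zero, add_zero, h1, lzero_app]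
    simp

theorem tder_add (δ δ' : ∀ X Z, Q X Z →ₗ[K] tbar Q X Z) (X Z : O) (w : tbar Q X Z) :
    tder Q (fun X Z => δ X Z + δ' X Z) X Z w = tder Q δ X Z w + tder Q δ' X Z w := by
  refine tbar_ext Q X (N := fun Z => tbar Q X Z)
    (f := fun Z => tder Q (fun X Z => δ X Z + δ' X Z) X Z)
    (g := fun Z => tder Q δ X Z + tder Q δ' X Z) ?_ ?_ Z w
  · intro Z i x hx
    rw [ladd_app, tder_tgen, tder_tgen, tder_tgen, ladd_app]
  · intro Y Z i x hx w ih
    rw [ladd_app] at ih ⊢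
    rw [tder_tcons, tder_tcons, tder_tcons, ih, ladd_app, map_add, map_add, ladd_app]
    exact add_add_add_comm _ _ _ _

end

/-! ## The cobar construction -/

section Cobar

variable {C : GQuiver K O}

/-- The class in the cobar construction of an element of a cocategory. -/
def cgen (C : GQuiver K O) (X Z : O) : C X Z →ₗ[K] cobar C X Z :=
  tgen (qshift (-1) C) X Z ∘ₗ (C X Z).toShift (-1)

/-- The product with the class of an element of a cocategory. -/
def ccons (C : GQuiver K O) (X Y Z : O) : C Y Z →ₗ[K] cobar C X Y →ₗ[K] cobar C X Z :=
  tcons (qshift (-1) C) X Y Z ∘ₗ (C Y Z).toShift (-1)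

/-- The quadratic part of the differential of the cobar construction, up to sign. -/
def cquad (C : GQuiver K O) (X Z : O) : qtens C C X Z →ₗ[K] cobar C X Z :=
  qlift fun Y => (ccons C X Y Z).compl₁₂ ((C Y Z).sgn 1) (cgen C X Y)

theorem cquad_qmk (X Y Z : O) (x : C Y Z) (y : C X Y) :
    no_index (cquad C X Z (qmk C C X Y Z x y)) = ccons C X Y Z ((C Y Z).sgn 1 x) (cgen C X Y y) := by
  rw [cquad, qlift_qmk]
  rfl

theorem cobar_ext {X : O} {N : O → Type*} [∀ Z, AddCommGroup (N Z)]
    [∀ Z, Module K (N Z)] {f g : ∀ Z, cobar C X Z →ₗ[K] N Z}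
    (gen : ∀ Z i, ∀ x ∈ (C X Z).gr i, f Z (cgen C X Z x) = g Z (cgen C X Z x))
    (cons : ∀ Y Z i, ∀ x ∈ (C Y Z).gr i, ∀ w, f Y w = g Y w →
      f Z (ccons C X Y Z x w) = g Z (ccons C X Y Z x w)) (Z : O) (w : cobar C X Z) :
    f Z w = g Z w :=
  tbar_ext (qshift (-1) C) X (fun Z _ x hx => gen Z _ x hx) (fun Y Z _ x hx => cons Y Z _ x hx) Z w

theorem cgen_mem {X Z : O} {i j : ℤ} {x : C X Z} (hx : x ∈ (C X Z).gr i) (h : i + 1 = j) :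
    cgen C X Z x ∈ (cobar C X Z).gr j :=
  tgen_mem (Q := qshift (-1) C) (i := j) (x := x)
    (show x ∈ (C X Z).gr (-1 + j) by rwa [← h, neg_add_cancel_comm_assoc])

theorem ccons_mem {X Y Z : O} {i j k : ℤ} {x : C Y Z} (hx : x ∈ (C Y Z).gr i) {w : cobar C X Y}
    (hw : w ∈ (cobar C X Y).gr j) (h : i + 1 + j = k) :
    ccons C X Y Z x w ∈ (cobar C X Z).gr k :=
  tcons_mem (Q := qshift (-1) C) (i := i + 1) (x := x)
    (show x ∈ (C Y Z).gr (-1 + (i + 1)) by rwa [neg_add_cancel_comm_assoc]) hw h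

theorem qshift_sgn (X Z : O) (x : C X Z) :
    (qshift (-1) C X Z).sgn 1 x = -(C X Z).sgn 1 x := by
  refine ((C X Z).shift_sgn (-1) 1 x).trans ?_
  simp

variable {d : ∀ X Z, C X Z →ₗ[K] C X Z} {Δ : ∀ X Z, C X Z →ₗ[K] qtens C C X Z}

theorem cobarGenD_apply (X Z : O) (x : C X Z) :
    cobarGenD C d Δ X Z x = -cgen C X Z (d X Z x) - cquad C X Z (Δ X Z x) := rfl

theorem cobarD_cgen (X Z : O) (x : C X Z) : cobarD C d Δ X Z (cgen C X Z x) =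
      -cgen C X Z (d X Z x) - cquad C X Z (Δ X Z x) :=
  tder_tgen (Q := qshift (-1) C) (δ := cobarGenD C d Δ) X Z x

theorem cobarD_ccons (X Y Z : O) (x : C Y Z) (w : cobar C X Y) :
    cobarD C d Δ X Z (ccons C X Y Z x w) =
      -ccons C X Y Z (d Y Z x) w - tmul (qshift (-1) C) X Y Z (cquad C Y Z (Δ Y Z x)) w -
        ccons C X Y Z ((C Y Z).sgn 1 x) (cobarD C d Δ X Y w) := by
  refine (tder_tcons (Q := qshift (-1) C) (δ := cobarGenD C d Δ) X Y Z x w).trans ?_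
  rw [cobarGenD_apply, map_sub, map_neg, lsub_app, lneg_app, sub_eq_add_neg _ (ccons C X Y Z _ _)]
  congr 1
  · congr 2
    exact tmul_tgen (qshift (-1) C) X Y Z (d Y Z x) w
  · rw [qshift_sgn, map_neg, lneg_app]
    rfl

theorem cobarD_tmul (X Y Z : O) (u : cobar C Y Z) (w : cobar C X Y) :
    cobarD C d Δ X Z (tmul (qshift (-1) C) X Y Z u w) =
      tmul (qshift (-1) C) X Y Z (cobarD C d Δ Y Z u) w +
      tmul (qshift (-1) C) X Y Z ((cobar C Y Z).sgn 1 u) (cobarD C d Δ X Y w) :=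
  tder_tmul (Q := qshift (-1) C) (δ := cobarGenD C d Δ) X Y Z u w

theorem cobarD_add (X Z : O) (w : cobar C X Z) :
    cobarD C d Δ X Z w = cobarD C d 0 X Z w + cobarD C 0 Δ X Z w := by
  have h : cobarGenD C d Δ = fun X Z => cobarGenD C d 0 X Z + cobarGenD C 0 Δ X Z := by
    funext X Z
    refine lext fun x => ?_
    rw [ladd_app, cobarGenD_apply, cobarGenD_apply, cobarGenD_apply]
    simp only [Pi.zero_apply, lzero_app, map_zero]
    abel
  refine Eq.trans ?_ (tder_add (Q := qshift (-1) C) (cobarGenD C d 0) (cobarGenD C 0 Δ) X Z w)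
  rw [← h]
  rfl

theorem cquad_hasDegree (X Z : O) : HasDegree (qtens C C X Z).gr (cobar C X Z).gr (cquad C X Z) 2 :=
  qlift_hasDegree fun Y i x hx j y hy =>
    ccons_mem (sgn_mem _ _ hx) (cgen_mem hy rfl) (by ring)

theorem cobarGenD_hasDegree (hd : ∀ X Z, HasDegree (C X Z).gr (C X Z).gr (d X Z) 1)
    (hΔ : ∀ X Z, HasDegree (C X Z).gr (qtens C C X Z).gr (Δ X Z) 0) (X Z : O) :
    HasDegree (qshift (-1) C X Z).gr (cobar C X Z).gr (cobarGenD C d Δ X Z) 1 := by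
  intro i x hx
  rw [cobarGenD_apply]
  refine sub_mem (neg_mem (cgen_mem (hd X Z _ x hx) (by ring))) ?_
  have := cquad_hasDegree X Z _ _ (hΔ X Z _ x hx)
  rwa [show -1 + i + 0 + 2 = i + 1 by ring] at this

theorem cobarD_hasDegree (hd : ∀ X Z, HasDegree (C X Z).gr (C X Z).gr (d X Z) 1)
    (hΔ : ∀ X Z, HasDegree (C X Z).gr (qtens C C X Z).gr (Δ X Z) 0) (X Z : O) :
    HasDegree (cobar C X Z).gr (cobar C X Z).gr (cobarD C d Δ X Z) 1 :=
  tder_hasDegree (Q := qshift (-1) C) (cobarGenD_hasDegree hd hΔ) X Z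

theorem cobarD_cquad (h : IsDGCocat C d Δ) (X Z : O) (z : qtens C C X Z) :
    cobarD C d Δ X Z (cquad C X Z z) = cquad C X Z (qmap[C] (fun Y => d Y Z) (fun _ => lid) z) +
      cquad C X Z (qmap[C] (fun Y => (C Y Z).sgn 1) (fun Y => d X Y) z) +
      (qlift fun Y => (ccons C X Y Z).compl₁₂ lid (cquad C X Y))
        (qmap[C, C, C, qtens C C] (fun _ => lid) (fun Y => Δ X Y) z) -
      (qlift fun Y => (ccons C X Y Z).compl₁₂ lid (cquad C X Y))
        (qassoc C C C X Z (qmap[C, C, qtens C C, C] (fun Y => Δ Y Z)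
          (fun _ => lid) z)) := by
  refine lapply_eq (cobarD C d Δ X Z ∘ₗ cquad C X Z) (cquad C X Z ∘ₗ qmap[C] (fun Y => d Y Z)
        (fun _ => lid) +
      cquad C X Z ∘ₗ qmap[C] (fun Y => (C Y Z).sgn 1) (fun Y => d X Y) +
      (qlift fun Y => (ccons C X Y Z).compl₁₂ lid (cquad C X Y)) ∘ₗ
        qmap[C, C, C, qtens C C] (fun _ => lid) (fun Y => Δ X Y) -
      (qlift fun Y => (ccons C X Y Z).compl₁₂ lid (cquad C X Y)) ∘ₗ
        qassoc C C C X Z ∘ₗ qmap[C, C, qtens C C, C] (fun Y => Δ Y Z)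
          (fun _ => lid)) (qtens_ext fun Y i x hx j y hy => ?_) z
  have h1 := sgn_map_of_hasDegree (h.d_deg Y Z) 1 x
  rw [mul_one, negOnePow_one] at h1
  have h2 : tmul (qshift (-1) C) X Y Z (cquad C Y Z (Δ Y Z ((C Y Z).sgn 1 x))) (cgen C X Y y) =
      (qlift fun Y => (ccons C X Y Z).compl₁₂ lid (cquad C X Y))
        (qassoc C C C X Z (qmk (qtens C C) C X Y Z (Δ Y Z x) y)) := by
    have h3 := sgn_map_of_hasDegree (h.comul_deg Y Z) 1 x
    rw [mul_zero, negOnePow_zero, Units.val_one, one_smul, qtens_sgn] at h3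
    rw [← h3]
    generalize Δ Y Z x = z
    refine lapply_eq ((tmul (qshift (-1) C) X Y Z).flip (cgen C X Y y) ∘ₗ
        cquad C Y Z ∘ₗ qmap[C] (fun W => (C W Z).sgn 1) (fun W => (C Y W).sgn 1))
      ((qlift fun Y => (ccons C X Y Z).compl₁₂ lid (cquad C X Y)) ∘ₗ
        qassoc C C C X Z ∘ₗ (qmk (qtens C C) C X Y Z).flip y)
      (qtens_ext fun W i x hx j x' hx' => ?_) z
    simp only [comp_app, flip_app]
    rw [qmap_qmk, cquad_qmk, qassoc_qmk, qlift_qmk, compl₁₂_app, cquad_qmk, sgn_one_sgn_one]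
    refine (tmul_tcons (qshift (-1) C) X Y W Z x _ _).trans ?_
    refine congrArg (tcons (qshift (-1) C) X W Z x) ?_
    exact tmul_tgen (qshift (-1) C) X Y W ((C Y W).sgn 1 x') _
  simp only [comp_app, ladd_app, lsub_app]
  rw [qmap_qmk, qmap_qmk, qmap_qmk, qmap_qmk, cquad_qmk, cquad_qmk, cquad_qmk, cobarD_ccons,
    cobarD_cgen, id_app, id_app, h2, h1, qlift_qmk, compl₁₂_app, sgn_one_sgn_one, id_app, map_sub,
    map_neg]
  simp only [Units.val_neg, Units.val_one, neg_smul, one_smul, map_neg, lneg_app]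
  abel

theorem cobarD_cobarD (h : IsDGCocat C d Δ) (X Z : O) (w : cobar C X Z) :
    cobarD C d Δ X Z (cobarD C d Δ X Z w) = 0 := by
  refine tder_tder (Q := qshift (-1) C) (cobarGenD_hasDegree h.d_deg h.comul_deg) ?_ X Z w
  intro X Z x
  change cobarD C d Δ X Z (cobarGenD C d Δ X Z x) = 0
  rw [cobarGenD_apply, map_sub, map_neg, cobarD_cgen, h.d_d, cobarD_cquad h, h.coassoc, h.coder,
    map_add, map_zero]
  abel

end Cobar

end TensorCategory

section Complexes

variable {M N L : Type u} [AddCommGroup M] [Module K M]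
  [AddCommGroup N] [Module K N] [AddCommGroup L] [Module K L]
  {gM : ℤ → Submodule K M} {dM : M →ₗ[K] M} {gN : ℤ → Submodule K N} {dN : N →ₗ[K] N}
  {gL : ℤ → Submodule K L} {dL : L →ₗ[K] L}

/-! ## Homotopy equivalences -/

theorem HasDegree.comp {f : M →ₗ[K] N} {g : N →ₗ[K] L} {m n k : ℤ} (hg : HasDegree gN gL g n)
    (hf : HasDegree gM gN f m) (h : m + n = k) : HasDegree gM gL (g ∘ₗ f) k := by
  intro i x hx
  have := hg _ _ (hf i x hx)
  rwa [add_assoc, h] at this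

theorem IsChainMap.comp {f : M →ₗ[K] N} {g : N →ₗ[K] L} (hg : IsChainMap gN dN gL dL g)
    (hf : IsChainMap gM dM gN dN f) : IsChainMap gM dM gL dL (g ∘ₗ f) :=
  ⟨hg.1.comp hf.1 (add_zero 0), fun x => by
    rw [comp_app, comp_app, hf.2, hg.2]⟩

theorem IsChainMap.id : IsChainMap gM dM gM dM lid :=
  ⟨fun i x hx => by rwa [add_zero], fun _ => rfl⟩

theorem AreHomotopic.refl (f : M →ₗ[K] N) : AreHomotopic gM dM gN dN f f :=
  ⟨0, fun i x _ => zero_mem _, fun x => by simp⟩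

theorem AreHomotopic.symm {f g : M →ₗ[K] N} (h : AreHomotopic gM dM gN dN f g) :
    AreHomotopic gM dM gN dN g f := by
  obtain ⟨k, hk, h⟩ := h
  refine ⟨-k, fun i x hx => neg_mem (hk i x hx), fun x => ?_⟩
  rw [← neg_sub, h x, lneg_app, lneg_app, map_neg, neg_add]

theorem AreHomotopic.trans {f g k : M →ₗ[K] N} (h : AreHomotopic gM dM gN dN f g)
    (h' : AreHomotopic gM dM gN dN g k) : AreHomotopic gM dM gN dN f k := by
  obtain ⟨p, hp, h⟩ := h
  obtain ⟨q, hq, h'⟩ := h'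
  refine ⟨p + q, fun i x hx => add_mem (hp i x hx) (hq i x hx), fun x => ?_⟩
  rw [← sub_add_sub_cancel _ (g x), h, h', ladd_app, ladd_app, map_add]
  exact add_add_add_comm _ _ _ _

theorem AreHomotopic.comp_left {f g : M →ₗ[K] N} (h : AreHomotopic gM dM gN dN f g)
    {k : N →ₗ[K] L} (hk : IsChainMap gN dN gL dL k) :
    AreHomotopic gM dM gL dL (k ∘ₗ f) (k ∘ₗ g) := by
  obtain ⟨p, hp, h⟩ := h
  refine ⟨k ∘ₗ p, hk.1.comp hp (add_zero _), fun x => ?_⟩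
  simp only [comp_app]
  rw [← map_sub, h, map_add, hk.2]

theorem AreHomotopic.comp_right {f g : N →ₗ[K] L} (h : AreHomotopic gN dN gL dL f g)
    {k : M →ₗ[K] N} (hk : IsChainMap gM dM gN dN k) :
    AreHomotopic gM dM gL dL (f ∘ₗ k) (g ∘ₗ k) := by
  obtain ⟨p, hp, h⟩ := h
  refine ⟨p ∘ₗ k, hp.comp hk.1 (zero_add _), fun x => ?_⟩
  simp only [comp_app]
  rw [h, hk.2]

theorem IsHomotopyEquiv.comp {f : M →ₗ[K] N} {g : N →ₗ[K] L}
    (hg : IsHomotopyEquiv gN dN gL dL g) (hf : IsHomotopyEquiv gM dM gN dN f) :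
    IsHomotopyEquiv gM dM gL dL (g ∘ₗ f) := by
  obtain ⟨hf, f', hf', h1, h2⟩ := hf
  obtain ⟨hg, g', hg', h3, h4⟩ := hg
  exact ⟨hg.comp hf, f' ∘ₗ g', hf'.comp hg', ((h3.comp_left hf').comp_right hf).trans h1,
    ((h2.comp_left hg).comp_right hg').trans h4⟩

/-- If `f` and `g ∘ f` are homotopy equivalences then so is `g`. -/
theorem IsHomotopyEquiv.of_comp {f : M →ₗ[K] N} {g : N →ₗ[K] L}
    (hg : IsChainMap gN dN gL dL g) (hf : IsHomotopyEquiv gM dM gN dN f)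
    (h : IsHomotopyEquiv gM dM gL dL (g ∘ₗ f)) : IsHomotopyEquiv gN dN gL dL g := by
  obtain ⟨hf, f', hf', h1, h2⟩ := hf
  obtain ⟨-, k, hk, h3, h4⟩ := h
  refine ⟨hg, f ∘ₗ k, hf.comp hk, ?_, h4⟩
  have h5 : AreHomotopic gN dN gN dN (f ∘ₗ k ∘ₗ g) (f ∘ₗ k ∘ₗ g ∘ₗ f ∘ₗ f') :=
    (h2.comp_left ((hf.comp hk).comp hg)).symm
  have h6 : AreHomotopic gN dN gN dN (f ∘ₗ k ∘ₗ g ∘ₗ f ∘ₗ f') (f ∘ₗ f') :=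
    (h3.comp_left hf).comp_right hf'
  exact h5.trans (h6.trans h2)

theorem IsHomotopyEquiv.id : IsHomotopyEquiv gM dM gM dM lid :=
  ⟨IsChainMap.id, lid, IsChainMap.id, AreHomotopic.refl _, AreHomotopic.refl _⟩

/-- Homological perturbation: a chain map `c` with a left inverse `p`, not necessarily a chain map,
is a homotopy equivalence if there is a map `h` of degree `-1` with `h ∘ c = 0` such that
`1 - c ∘ p - (d ∘ h + h ∘ d)` is locally nilpotent. -/
theorem isHomotopyEquiv_of_locally_nilpotent {c : M →ₗ[K] N} (hc : IsChainMap gM dM gN dN c)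
    (p : N →ₗ[K] M) (hp : HasDegree gN gM p 0) (hpc : ∀ x, p (c x) = x)
    (h : N →ₗ[K] N) (hh : HasDegree gN gN h (-1)) (hhc : ∀ x, h (c x) = 0)
    (hdN : IsDifferential gN dN) (R : N →ₗ[K] N)
    (hR : ∀ x, R x = x - c (p x) - (dN (h x) + h (dN x)))
    (hnil : ∀ x, ∃ n : ℕ, (R ^ n) x = 0) : IsHomotopyEquiv gM dM gN dN c := by
  have hRdeg : HasDegree gN gN R 0 := by
    intro i x hx
    rw [hR, add_zero]
    refine sub_mem (sub_mem hx ?_) (add_mem ?_ ?_)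
    · have := hc.1 _ _ (hp _ _ hx)
      rwa [add_zero, add_zero] at this
    · have := hdN.1 _ _ (hh _ _ hx)
      rwa [neg_add_cancel_right] at this
    · have := hh _ _ (hdN.1 _ _ hx)
      rwa [add_neg_cancel_right] at this
  have hRpow : ∀ n : ℕ, ∀ i, ∀ x ∈ gN i, (R ^ n) x ∈ gN i := by
    intro n
    induction n with
    | zero => exact fun i x hx => hx
    | succ n ih =>
      intro i x hx
      rw [pow_succ', Module.End.mul_apply]
      have := hRdeg _ _ (ih i x hx)
      rwa [add_zero] at this
  set T : N →ₗ[K] N := lid - R with hT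
  have hTx : ∀ x, T x = x - R x := fun x => rfl
  have hsum : ∀ (n : ℕ) x, T (∑ k ∈ Finset.range n, (R ^ k) x) = x - (R ^ n) x := by
    intro n x
    induction n with
    | zero => simp
    | succ n ih =>
      rw [Finset.sum_range_succ, map_add, ih, hTx, pow_succ', Module.End.mul_apply]
      abel
  have hinj : Function.Injective T := by
    rw [← LinearMap.ker_eq_bot, LinearMap.ker_eq_bot']
    intro x hx
    have h1 : R x = x := (sub_eq_zero.1 hx).symm
    have h2 : ∀ n : ℕ, (R ^ n) x = x := by
      intro n
      induction n with
      | zero => rfl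
      | succ n ih => rw [pow_succ', Module.End.mul_apply, ih, h1]
    obtain ⟨n, hn⟩ := hnil x
    rw [← h2 n, hn]
  have hsurj : Function.Surjective T := fun x => by
    obtain ⟨n, hn⟩ := hnil x
    exact ⟨_, by rw [hsum n, hn, sub_zero]⟩
  let E : N ≃ₗ[K] N := LinearEquiv.ofBijective T ⟨hinj, hsurj⟩
  let G : N →ₗ[K] N := E.symm.toLinearMap
  have hTG : ∀ x, T (G x) = x := fun x => E.apply_symm_apply x
  have hGdeg : HasDegree gN gN G 0 := by
    intro i x hx
    obtain ⟨n, hn⟩ := hnil x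
    have : G x = ∑ k ∈ Finset.range n, (R ^ k) x := hinj (by rw [hTG, hsum, hn, sub_zero])
    rw [this, add_zero]
    exact sum_mem fun k _ => hRpow k i x hx
  have hTc : ∀ x, T (c x) = c x := by
    intro x
    rw [hTx, hR, hpc, hhc, ← hc.2, hhc]
    simp
  have hGc : ∀ x, G (c x) = c x := fun x => hinj (by rw [hTG, hTc])
  have hT' : ∀ x, T x = c (p x) + (dN (h x) + h (dN x)) := by
    intro x
    rw [hTx, hR]
    abel
  have hdG : ∀ x, dN (G x) = G (dN x) + c (p (dN (G x)) - dM (p (G x))) := by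
    intro x
    refine hinj ?_
    have h1 := congrArg dN (hTG x)
    rw [hT' (G x), map_add, map_add, hdN.2, zero_add, ← hc.2] at h1
    rw [map_add, hTG, hTc, hT', hdN.2, map_zero, add_zero, ← h1, map_sub]
    abel
  refine ⟨hc, p ∘ₗ G, ⟨hp.comp hGdeg (add_zero 0), fun x => ?_⟩, ?_, ?_⟩
  · have h1 := congrArg p (hdG x)
    rw [map_add, hpc] at h1
    rw [comp_app, comp_app]
    have : p (G (dN x)) = p (dN (G x)) - (p (dN (G x)) - dM (p (G x))) := by
      rw [eq_sub_iff_add_eq, ← h1]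
    rw [this, sub_sub_cancel]
  · have : (p ∘ₗ G) ∘ₗ c = lid := lext fun x => by
      rw [comp_app, comp_app, hGc, hpc, id_app]
    rw [this]
    exact AreHomotopic.refl _
  · refine ⟨-(h ∘ₗ G), fun i x hx => neg_mem (hh.comp hGdeg (zero_add _) i x hx), fun x => ?_⟩
    have h1 := hTG x
    have h2 : h (dN (G x)) = h (G (dN x)) := by
      rw [hdG x, map_add, hhc, add_zero]
    rw [hT', h2] at h1
    simp only [comp_app, lneg_app, id_app, map_neg]
    rw [← eq_sub_iff_add_eq] at h1
    rw [h1]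
    abel

end Complexes

namespace GrMod

theorem sgn_map_of_hasDegree_zero {M N : GrMod.{u, u} K} {f : M →ₗ[K] N}
    (hf : HasDegree M.gr N.gr f 0) (p : ℤ) (x : M) : N.sgn p (f x) = f (M.sgn p x) := by
  rw [sgn_map_of_hasDegree hf, mul_zero, negOnePow_zero, Units.val_one, one_smul]

end GrMod

section Composition

variable {O Ω : Type u}

/-! ## Compositions of augmentations and of reductions -/

section

variable (P : GQuiver K O) (c : ∀ X Y Z, P Y Z →ₗ[K] P X Y →ₗ[K] P X Z)

theorem augComp_in_in (X Y Z : O) (f : P Y Z) (g : P X Y) :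
    augComp P c X Y Z (augIn P Y Z f) (augIn P X Y g) = augIn P X Z (c X Y Z f g) := by
  simp only [augComp, augIn, coprod_app, inl_app, flip_app, map_zero, add_zero, ladd_app, lzero_app,
    compr₂_app]

theorem augComp_in_one (X Z : O) (f : P X Z) :
    augComp P c X X Z (augIn P X Z f) (augOne P X X rfl) = augIn P X Z f := by
  simp only [augComp, augIn, augOne, coprod_app, inl_app, flip_app, map_zero, add_zero, zero_add,
    ladd_app, lzero_app]
  refine (lcongr (desc_powIncl (M := unit K) (fun h : PLift (X = X) =>
    (LinearMap.lsmul K (aug P X Z)).compl₂ (inl K _ _ ∘ₗ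
      (h.down ▸ lid : P X Z →ₗ[K] P X Z))) rfl (1 : K)) f).trans ?_
  exact one_smul K _

theorem augComp_one_in (X Z : O) (f : P X Z) :
    augComp P c X Z Z (augOne P Z Z rfl) (augIn P X Z f) = augIn P X Z f := by
  simp only [augComp, augIn, augOne, coprod_app, inl_app, flip_app, map_zero, add_zero, zero_add,
    ladd_app, lzero_app]
  refine (lcongr (desc_powIncl (M := unit K) (fun h : PLift (Z = Z) =>
    (LinearMap.lsmul K (aug P X Z)).compl₂ (inl K _ _ ∘ₗ
      (h.down ▸ lid : P X Z →ₗ[K] P X Z))) rfl (1 : K)) f).trans ?_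
  exact one_smul K _

theorem augComp_one_one (X Y Z : O) (h : Y = Z) (h' : X = Y) :
    augComp P c X Y Z (augOne P Y Z h) (augOne P X Y h') =
      augOne P X Z (h'.trans h) := by
  simp only [augComp, augOne, coprod_app, inl_app, flip_app, map_zero, add_zero, zero_add, ladd_app,
    lzero_app]
  refine (lcongr (desc_powIncl (M := unit K) (fun h' : PLift (X = Y) =>
    LinearMap.flip (desc (M := fun _ : PLift (Y = Z) => unit K) fun h : PLift (Y = Z) =>
      (LinearMap.mul K K).compr₂
      (inr K (P X Z) _ ∘ₗ powIncl (h'.down.trans h.down) (unit K)))) h' (1 : K)) _).trans ?_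
  rw [flip_app]
  refine (lcongr (desc_powIncl (M := unit K) (fun h : PLift (Y = Z) =>
      (LinearMap.mul K K).compr₂
      (inr K (P X Z) _ ∘ₗ powIncl (h'.trans h.down) (unit K))) h (1 : K)) (1 : K)).trans ?_
  rw [compr₂_app, LinearMap.mul_apply', mul_one]
  rfl

theorem augComp_one_left (X Z : O) (x : aug P X Z) :
    augComp P c X Z Z (augOne P Z Z rfl) x = x := by
  refine lcongr (g := lid) (aug_ext (fun x => ?_) fun h => ?_) x
  · exact augComp_one_in P c X Z x
  · exact augComp_one_one P c X Z Z rfl h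

theorem augComp_one_right (X Z : O) (x : aug P X Z) :
    augComp P c X X Z x (augOne P X X rfl) = x := by
  refine lapply_eq ((augComp P c X X Z).flip (augOne P X X rfl))
    lid (aug_ext (fun x => ?_) fun h => ?_) x
  · exact augComp_in_one P c X Z x
  · exact augComp_one_one P c X X Z h rfl

variable {P c} in
theorem augComp_augOne_right_mem {X Y Z : O} (h : X = Y) {i : ℤ} {f : aug P Y Z}
    (hf : f ∈ (aug P Y Z).gr i) :
    augComp P c X Y Z f (augOne P X Y h) ∈ (aug P X Z).gr i := by
  subst h
  rwa [augComp_one_right]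

variable {P c} in
theorem augComp_augOne_left_mem {X Y Z : O} (h : Y = Z) {i : ℤ} {g : aug P X Y}
    (hg : g ∈ (aug P X Y).gr i) :
    augComp P c X Y Z (augOne P Y Z h) g ∈ (aug P X Z).gr i := by
  subst h
  rwa [augComp_one_left]

variable {P c} in
theorem augComp_mem (hc : ∀ X Y Z i j, ∀ f ∈ (P Y Z).gr i, ∀ g ∈ (P X Y).gr j,
      c X Y Z f g ∈ (P X Z).gr (i + j)) (X Y Z : O) {i j : ℤ} {f : aug P Y Z} {g : aug P X Y}
    (hf : f ∈ (aug P Y Z).gr i) (hg : g ∈ (aug P X Y).gr j) :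
    augComp P c X Y Z f g ∈ (aug P X Z).gr (i + j) := by
  refine aug_gr_induction (S := ((aug P X Z).gr (i + j)).comap ((augComp P c X Y Z).flip g))
    ?_ ?_ hf
  · intro f hf
    refine aug_gr_induction (S := ((aug P X Z).gr (i + j)).comap
      ((augComp P c X Y Z) (augIn P Y Z f))) ?_ ?_ hg
    · intro g hg
      rw [mem_comap, augComp_in_in]
      exact augIn_mem P (hc _ _ _ _ _ _ hf _ hg)
    · rintro h rfl
      rw [mem_comap, add_zero]
      exact augComp_augOne_right_mem h (augIn_mem P hf)
  · rintro h rfl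
    rw [mem_comap, flip_app, zero_add]
    exact augComp_augOne_left_mem h hg

end

section

variable (P : GQuiver K O) (Q : GQuiver K Ω)
  (cP : ∀ X Y Z, P Y Z →ₗ[K] P X Y →ₗ[K] P X Z) (cQ : ∀ X Y Z, Q Y Z →ₗ[K] Q X Y →ₗ[K] Q X Z)

theorem ptensComp_tmul (X Y Z : O × Ω) (f : P Y.1 Z.1) {j : ℤ} {g : Q Y.2 Z.2}
    (hg : g ∈ (Q Y.2 Z.2).gr j) (f' : P X.1 Y.1) (g' : Q X.2 Y.2) :
    ptensComp P Q cP cQ X Y Z (f ⊗ₜ g) (f' ⊗ₜ g') =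
      cP X.1 Y.1 Z.1 f ((P X.1 Y.1).sgn j f') ⊗ₜ cQ X.2 Y.2 Z.2 g g' := by
  refine (congrArg (TensorProduct.map (TensorProduct.lift (cP X.1 Y.1 Z.1))
    (TensorProduct.lift (cQ X.2 Y.2 Z.2)))
    (midSwap_tmul (P Y.1 Z.1) (Q Y.2 Z.2) (P X.1 Y.1) (Q X.2 Y.2) f hg f' g')).trans ?_
  rfl

theorem redComp_apply (X Y Z : O × Ω) (f : red P Q Y Z) (g : red P Q X Y) :
    redComp P Q cP cQ X Y Z f g = redProj P Q X Z
      (ptensComp (aug P) (aug Q) (augComp P cP) (augComp Q cQ) X Y Z (redIncl P Q Y Z f)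
        (redIncl P Q X Y g)) := rfl

theorem redComp_redL_redT (X : O × Ω) (y z : O) (b : Ω) (f : P y z) (f' : P X.1 y) (g' : Q X.2 b) :
    redComp P Q cP cQ X (y, b) (z, b) (redL P Q (y, b) (z, b) rfl f)
      (redT P Q X (y, b) (f' ⊗ₜ g')) = redT P Q X (z, b) (cP X.1 y z f f' ⊗ₜ g') := by
  rw [redComp_apply, redIncl_redL, redIncl_redT, ptensComp_tmul _ _ _ _ _ _ _ _ (augOne_mem Q _ _
    _), aug_sgn_augIn, sgn_even _ (by decide), augComp_in_in, augComp_one_in]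
  exact redProj_in_in P Q X (z, b) _ _

theorem redComp_redL_redL (X : O × Ω) (y z : O) (b : Ω) (h : X.2 = b) (f : P y z) (f' : P X.1 y) :
    redComp P Q cP cQ X (y, b) (z, b) (redL P Q (y, b) (z, b) rfl f)
      (redL P Q X (y, b) h f') = redL P Q X (z, b) h (cP X.1 y z f f') := by
  rw [redComp_apply, redIncl_redL, redIncl_redL, ptensComp_tmul _ _ _ _ _ _ _ _ (augOne_mem Q _ _
    _), aug_sgn_augIn, sgn_even _ (by decide), augComp_in_in, augComp_one_one]
  exact redProj_in_one P Q X (z, b) _ _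

theorem redComp_redL_redR (X : O × Ω) (z : O) (b : Ω) (f : P X.1 z) (g' : Q X.2 b) :
    redComp P Q cP cQ X (X.1, b) (z, b) (redL P Q (X.1, b) (z, b) rfl f)
      (redR P Q X (X.1, b) rfl g') = redT P Q X (z, b) (f ⊗ₜ g') := by
  rw [redComp_apply, redIncl_redL, redIncl_redR, ptensComp_tmul _ _ _ _ _ _ _ _ (augOne_mem Q _ _
    _), aug_sgn_augOne, augComp_in_one, augComp_one_in]
  exact redProj_in_in P Q X (z, b) _ _

theorem redComp_redR_redR (X : O × Ω) (x : O) (y z : Ω) (h : X.1 = x) {j : ℤ} {g : Q y z}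
    (hg : g ∈ (Q y z).gr j) (g' : Q X.2 y) :
    redComp P Q cP cQ X (x, y) (x, z) (redR P Q (x, y) (x, z) rfl g)
      (redR P Q X (x, y) h g') = redR P Q X (x, z) h (cQ X.2 y z g g') := by
  rw [redComp_apply, redIncl_redR, redIncl_redR, ptensComp_tmul _ _ _ _ _ _ _ _ (augIn_mem Q hg),
    aug_sgn_augOne, augComp_in_in, augComp_one_one]
  exact redProj_one_in P Q X (x, z) _ _

theorem redComp_redR_redL (X : O × Ω) (x : O) (z : Ω) {j : ℤ} {g : Q X.2 z}
    (hg : g ∈ (Q X.2 z).gr j) (f' : P X.1 x) :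
    redComp P Q cP cQ X (x, X.2) (x, z) (redR P Q (x, X.2) (x, z) rfl g)
      (redL P Q X (x, X.2) rfl f') = redT P Q X (x, z) ((P X.1 x).sgn j f' ⊗ₜ g) := by
  rw [redComp_apply, redIncl_redR, redIncl_redL, ptensComp_tmul _ _ _ _ _ _ _ _ (augIn_mem Q hg),
    aug_sgn_augIn, augComp_in_one, augComp_one_in]
  exact redProj_in_in P Q X (x, z) _ _

theorem redComp_redR_redT (X : O × Ω) (x : O) (y z : Ω) {j : ℤ} {g : Q y z}
    (hg : g ∈ (Q y z).gr j) (f' : P X.1 x) (g' : Q X.2 y) :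
    redComp P Q cP cQ X (x, y) (x, z) (redR P Q (x, y) (x, z) rfl g)
      (redT P Q X (x, y) (f' ⊗ₜ g')) =
        redT P Q X (x, z) ((P X.1 x).sgn j f' ⊗ₜ cQ X.2 y z g g') := by
  rw [redComp_apply, redIncl_redR, redIncl_redT, ptensComp_tmul _ _ _ _ _ _ _ _ (augIn_mem Q hg),
    aug_sgn_augIn, augComp_in_in, augComp_one_in]
  exact redProj_in_in P Q X (x, z) _ _

variable {P Q cP cQ}

theorem ptensComp_mem (hP : ∀ X Y Z i j, ∀ f ∈ (P Y Z).gr i, ∀ g ∈ (P X Y).gr j,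
      cP X Y Z f g ∈ (P X Z).gr (i + j))
    (hQ : ∀ X Y Z i j, ∀ f ∈ (Q Y Z).gr i, ∀ g ∈ (Q X Y).gr j, cQ X Y Z f g ∈ (Q X Z).gr (i + j))
    (X Y Z : O × Ω) {i j : ℤ} {f : ptens P Q Y Z} {g : ptens P Q X Y}
    (hf : f ∈ (ptens P Q Y Z).gr i) (hg : g ∈ (ptens P Q X Y).gr j) :
    ptensComp P Q cP cQ X Y Z f g ∈ (ptens P Q X Z).gr (i + j) := by
  refine tens_gr_le (S := ((ptens P Q X Z).gr (i + j)).comap ((ptensComp P Q cP cQ X Y Z).flip g))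
    ?_ hf
  rintro k l rfl f hf f' hf'
  refine tens_gr_le (S := ((ptens P Q X Z).gr (k + l + j)).comap
    (ptensComp P Q cP cQ X Y Z (f ⊗ₜ f'))) ?_ hg
  rintro m n rfl g hg g' hg'
  rw [mem_comap, ptensComp_tmul _ _ _ _ _ _ _ _ hf']
  exact GrMod.tmul_mem (hP _ _ _ _ _ _ hf _ (sgn_mem _ _ hg)) (hQ _ _ _ _ _ _ hf' _ hg') (by ring)

theorem redComp_mem (hP : ∀ X Y Z i j, ∀ f ∈ (P Y Z).gr i, ∀ g ∈ (P X Y).gr j,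
      cP X Y Z f g ∈ (P X Z).gr (i + j))
    (hQ : ∀ X Y Z i j, ∀ f ∈ (Q Y Z).gr i, ∀ g ∈ (Q X Y).gr j, cQ X Y Z f g ∈ (Q X Z).gr (i + j))
    (X Y Z : O × Ω) {i j : ℤ} {f : red P Q Y Z} {g : red P Q X Y}
    (hf : f ∈ (red P Q Y Z).gr i) (hg : g ∈ (red P Q X Y).gr j) :
    redComp P Q cP cQ X Y Z f g ∈ (red P Q X Z).gr (i + j) := by
  rw [redComp_apply]
  have h1 := redIncl_hasDegree P Q _ _ _ _ hf
  have h2 := redIncl_hasDegree P Q _ _ _ _ hg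
  rw [add_zero] at h1 h2
  have h3 := redProj_hasDegree P Q _ _ _ _ (ptensComp_mem
    (fun X Y Z i j f hf g hg => augComp_mem hP X Y Z hf hg)
    (fun X Y Z i j f hf g hg => augComp_mem hQ X Y Z hf hg) X Y Z h1 h2)
  rwa [add_zero] at h3

end

/-! ### Diagonal maps between reductions -/

section Diag

variable {P P' : GQuiver K O} {Q Q' : GQuiver K Ω}

/-- A map between reductions given by maps between the three summands. -/
def rdiag {X Y : O × Ω} (t : (P X.1 Y.1).tens (Q X.2 Y.2) →ₗ[K] (P' X.1 Y.1).tens (Q' X.2 Y.2))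
    (l : P X.1 Y.1 →ₗ[K] P' X.1 Y.1) (r : Q X.2 Y.2 →ₗ[K] Q' X.2 Y.2) :
    red P Q X Y →ₗ[K] red P' Q' X Y :=
  LinearMap.prodMap t (LinearMap.prodMap (powMap id l) (powMap id r))

variable {X Y : O × Ω} {t : (P X.1 Y.1).tens (Q X.2 Y.2) →ₗ[K] (P' X.1 Y.1).tens (Q' X.2 Y.2)}
    {l : P X.1 Y.1 →ₗ[K] P' X.1 Y.1} {r : Q X.2 Y.2 →ₗ[K] Q' X.2 Y.2}

theorem rdiag_redT (z : (P X.1 Y.1).tens (Q X.2 Y.2)) :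
    rdiag t l r (redT P Q X Y z) = redT P' Q' X Y (t z) :=
  Prod.ext rfl (map_zero (LinearMap.prodMap (powMap id l) (powMap id r)))

theorem rdiag_redL (h : X.2 = Y.2) (x : P X.1 Y.1) :
    rdiag t l r (redL P Q X Y h x) = redL P' Q' X Y h (l x) :=
  Prod.ext (map_zero t) (Prod.ext (powMap_powIncl id l h x) (map_zero (powMap id r)))

theorem rdiag_redR (h : X.1 = Y.1) (y : Q X.2 Y.2) :
    rdiag t l r (redR P Q X Y h y) = redR P' Q' X Y h (r y) :=
  Prod.ext (map_zero t) (Prod.ext (map_zero (powMap id l)) (powMap_powIncl id r h y))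

theorem rdiag_hasDegree {n : ℤ} (ht : HasDegree ((P X.1 Y.1).tens (Q X.2 Y.2)).gr
      ((P' X.1 Y.1).tens (Q' X.2 Y.2)).gr t n)
    (hl : HasDegree (P X.1 Y.1).gr (P' X.1 Y.1).gr l n)
    (hr : HasDegree (Q X.2 Y.2).gr (Q' X.2 Y.2).gr r n) :
    HasDegree (red P Q X Y).gr (red P' Q' X Y).gr (rdiag t l r) n := by
  intro k z hz
  refine red_gr_le (S := ((red P' Q' X Y).gr (k + n)).comap (rdiag t l r)) ?_ ?_ ?_ hz
  · rintro i j rfl x hx y hy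
    rw [mem_comap, rdiag_redT]
    exact ⟨ht _ _ (GrMod.tmul_mem hx hy rfl), zero_mem _⟩
  · intro h x hx
    rw [mem_comap, rdiag_redL]
    exact redL_mem h (hl _ _ hx)
  · intro h x hx
    rw [mem_comap, rdiag_redR]
    exact redR_mem h (hr _ _ hx)

end Diag

end Composition

section Letters

variable {O Ω : Type u}

/-! ## The comultiplication of a reduction of tensor cocategories -/

section

variable (P : GQuiver K O) (Q : GQuiver K Ω) {ΔP : ∀ X Z, P X Z →ₗ[K] qtens P P X Z}
  {ΔQ : ∀ X Z, Q X Z →ₗ[K] qtens Q Q X Z}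

/-- In the comultiplication of an element `x` of an augmentation, the only term whose first factor
is not in the cocategory is `1 ⊗ x`. -/
theorem exists_augComul (X Z : O) (x : aug P X Z) : ∃ u : qtens P (aug P) X Z,
    augComul P ΔP X Z x = qmap[P, aug P, aug P, aug P] (fun Y => augIn P Y Z) (fun _ => lid) u +
      qmk (aug P) (aug P) X Z Z (augOne P Z Z rfl) x := by
  have h1 : ∀ h : X = Z, qmk (aug P) (aug P) X X Z (augOne P X Z h) (augOne P X X rfl) =
      qmk (aug P) (aug P) X Z Z (augOne P Z Z rfl) (augOne P X Z h) := by
    intro h; subst h; rfl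
  refine aug_induction (p := fun x => ∃ u : qtens P (aug P) X Z,
    augComul P ΔP X Z x = qmap[P, aug P, aug P, aug P] (fun Y => augIn P Y Z) (fun _ => lid) u +
      qmk (aug P) (aug P) X Z Z (augOne P Z Z rfl) x) ?_ ?_ ?_ ?_ ?_ x
  · rintro x y ⟨u, hu⟩ ⟨v, hv⟩
    exact ⟨u + v, by rw [map_add, hu, hv, map_add, map_add, add_add_add_comm]⟩
  · rintro a x ⟨u, hu⟩
    exact ⟨a • u, by rw [map_smul, hu, map_smul, map_smul, smul_add]⟩
  · exact ⟨0, by simp only [map_zero, add_zero]⟩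
  · intro x
    refine ⟨qmap[P, P, P, aug P] (fun _ => lid)
      (fun Y => augIn P X Y) (ΔP X Z x) + qmk P (aug P) X X Z x (augOne P X X rfl), ?_⟩
    rw [augComul_augIn, map_add, qmap_comp (P := P) (Q := P) (P' := P) (Q' := aug P) (P'' := aug P)
      (Q'' := aug P), qmap_qmk_id]
    rfl
  · intro h
    exact ⟨0, by rw [augComul_augOne, map_zero, zero_add, h1]⟩

variable {P Q}

theorem qmap_ptensComul_of_eq_zero {L M : GQuiver K (O × Ω)} {X Z X' Z' : O × Ω}
    {κ : ∀ Y, ptens (aug P) (aug Q) Y Z →ₗ[K] L Y Z'}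
    (ρ : ∀ Y, ptens (aug P) (aug Q) X Y →ₗ[K] M X' Y)
    (hl : ∀ Y x y, κ Y (augIn P Y.1 Z.1 x ⊗ₜ y) = 0)
    (hr : ∀ Y x y, κ Y (x ⊗ₜ augIn Q Y.2 Z.2 y) = 0) (z : ptens (aug P) (aug Q) X Z) :
    qmap[ptens (aug P) (aug Q), ptens (aug P) (aug Q), L, M] κ ρ
      (ptensComul (aug P) (aug Q) (augComul P ΔP) (augComul Q ΔQ) X Z z) =
      qmk L M X' Z Z' (κ Z (augOne P Z.1 Z.1 rfl ⊗ₜ augOne Q Z.2 Z.2 rfl)) (ρ Z z) := by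
  have h1 : ∀ (u : qtens P (aug P) X.1 Z.1) (v : qtens (aug Q) (aug Q) X.2 Z.2),
      qmap[ptens (aug P) (aug Q), ptens (aug P) (aug Q), L, M] κ ρ
        (qmid (aug P) (aug P) (aug Q) (aug Q) X Z (qmap[P, aug P, aug P, aug P] (fun Y => augIn P Y Z.1) (fun _ => lid) u ⊗ₜ v)) = 0 := by
    intro u v
    refine lapply_eq (qmap[ptens (aug P) (aug Q), ptens (aug P) (aug Q), L, M] κ ρ ∘ₗ qmid (aug P) (aug P) (aug Q) (aug Q) X Z ∘ₗ
      TensorProduct.map (qmap[P, aug P, aug P, aug P] (fun Y => augIn P Y Z.1) (fun _ => lid)) lid)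
      0 (qtens_tens_ext ?_) (u ⊗ₜ v)
    intro Y i x hx j x' hx' Y' k y hy l y' hy'
    rw [comp_app, comp_app, TensorProduct.map_tmul, qmap_qmk_id, id_app, qmid_tmul _ _ _ _ _ _ _ _ _
      hx', qmap_qmk, hl, map_zero]
    rfl
  have h2 : ∀ i, ∀ x ∈ (aug P X.1 Z.1).gr i, ∀ (v : qtens Q (aug Q) X.2 Z.2),
      qmap[ptens (aug P) (aug Q), ptens (aug P) (aug Q), L, M] κ ρ
        (qmid (aug P) (aug P) (aug Q) (aug Q) X Z
          (qmk (aug P) (aug P) X.1 Z.1 Z.1 (augOne P Z.1 Z.1 rfl) x ⊗ₜ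
          qmap[Q, aug Q, aug Q, aug Q] (fun Y => augIn Q Y Z.2) (fun _ => lid) v)) = 0 := by
    intro i x hx v
    refine lapply_eq (qmap[ptens (aug P) (aug Q), ptens (aug P) (aug Q), L, M] κ ρ ∘ₗ qmid (aug P) (aug P) (aug Q) (aug Q) X Z ∘ₗ
      TensorProduct.mk K _ _ (qmk (aug P) (aug P) X.1 Z.1 Z.1 (augOne P Z.1 Z.1 rfl) x) ∘ₗ
      qmap[Q, aug Q, aug Q, aug Q] (fun Y => augIn Q Y Z.2) (fun _ => lid))
      0 (qtens_ext fun Y j y hy k y' hy' => ?_) v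
    rw [comp_app, comp_app, comp_app, qmap_qmk_id, TensorProduct.mk_apply, qmid_tmul _ _ _ _ _ _ _ _
      _ hx, qmap_qmk, aug_sgn_augIn, hr, map_zero]
    rfl
  refine lapply_eq (qmap[ptens (aug P) (aug Q), ptens (aug P) (aug Q), L, M] κ ρ ∘ₗ ptensComul (aug P) (aug Q) (augComul P ΔP) (augComul Q ΔQ) X Z)
    (qmk L M X' Z Z' (κ Z (augOne P Z.1 Z.1 rfl ⊗ₜ augOne Q Z.2 Z.2 rfl)) ∘ₗ ρ Z)
    (tens_ext fun i x hx j y hy => ?_) z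
  obtain ⟨u, hu⟩ := exists_augComul P (ΔP := ΔP) X.1 Z.1 x
  obtain ⟨v, hv⟩ := exists_augComul Q (ΔP := ΔQ) X.2 Z.2 y
  rw [comp_app, ptensComul_tmul, hu, add_tmul, map_add, map_add, h1, zero_add, hv, tmul_add,
    map_add, map_add, h2 i x hx, zero_add, qmid_tmul _ _ _ _ _ _ _ _ _ hx, qmap_qmk, aug_sgn_augOne]
  rfl

theorem redComul_redR (X Z : O × Ω) (h : X.1 = Z.1) (v : Q X.2 Z.2) :
    redComul P Q ΔP ΔQ X Z (redR P Q X Z h v) =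
      (qlift fun y => (qmk (red P Q) (red P Q) X (X.1, y) Z).compl₁₂
        (redR P Q (X.1, y) Z h) (redR P Q X (X.1, y) rfl)) (ΔQ X.2 Z.2 v) := by
  refine (congrArg _ (redProj_one_in P Q X Z h v).symm).trans ?_
  rw [redComul_redProj, ptensComul_tmul, augComul_augOne, augComul_augIn, tmul_add, tmul_add,
    map_add, map_add, map_add, map_add, qmid_tmul _ _ _ _ _ _ _ _ _ (augOne_mem P _ _ _), qmid_tmul
    _ _ _ _ _ _ _ _ _ (augOne_mem P _ _ _), qmap_qmk, qmap_qmk, aug_sgn_augOne, redProj_one_one,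
    redProj_one_one, map_zero, map_zero, lzero_app, add_zero, add_zero]
  generalize ΔQ X.2 Z.2 v = w
  refine lcongr (f := qmap[ptens (aug P) (aug Q), red P Q] (fun Y => redProj P Q Y Z) (fun Y => redProj P Q X Y) ∘ₗ
      qmid (aug P) (aug P) (aug Q) (aug Q) X Z ∘ₗ TensorProduct.mk K _ _
        (qmk (aug P) (aug P) X.1 X.1 Z.1 (augOne P X.1 Z.1 h) (augOne P X.1 X.1 rfl)) ∘ₗ
      qmap[Q, aug Q] (fun Y => augIn Q Y Z.2) (fun Y => augIn Q X.2 Y))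
    (qtens_ext fun Y i y hy j y' hy' => ?_) w
  rw [comp_app, comp_app, comp_app, qmap_qmk, TensorProduct.mk_apply, qmid_tmul _ _ _ _ _ _ _ _ _
    (augOne_mem P _ _ _), qmap_qmk, sgn_even _ (by decide), redProj_one_in, redProj_one_in,
    qlift_qmk, compl₁₂_app]

theorem redComul_redL (X Z : O × Ω) (h : X.2 = Z.2) (x : P X.1 Z.1) :
    redComul P Q ΔP ΔQ X Z (redL P Q X Z h x) =
      (qlift fun y => (qmk (red P Q) (red P Q) X (y, X.2) Z).compl₁₂
        (redL P Q (y, X.2) Z h) (redL P Q X (y, X.2) rfl)) (ΔP X.1 Z.1 x) := by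
  refine (congrArg _ (redProj_in_one P Q X Z h x).symm).trans ?_
  have h1 := lapply_eq (qmap[ptens (aug P) (aug Q), red P Q] (fun Y => redProj P Q Y Z)
      (fun Y => redProj P Q X Y) ∘ₗ qmid (aug P) (aug P) (aug Q) (aug Q) X Z ∘ₗ
      (TensorProduct.mk K _ _).flip (qmk (aug Q) (aug Q) X.2 X.2 Z.2 (augOne Q X.2 Z.2 h)
        (augOne Q X.2 X.2 rfl)) ∘ₗ qmk (aug P) (aug P) X.1 Z.1 Z.1 (augOne P Z.1 Z.1 rfl) ∘ₗ
      augIn P X.1 Z.1) 0 (hom_ext_gr _ fun i x hx => by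
    rw [comp_app, comp_app, comp_app, comp_app, flip_app, TensorProduct.mk_apply, qmid_tmul _ _ _ _
      _ _ _ _ _ (augIn_mem P hx), qmap_qmk, aug_sgn_augOne, redProj_one_one, map_zero, lzero_app]
    rfl) x
  rw [redComul_redProj, ptensComul_tmul, augComul_augOne, augComul_augIn, add_tmul, add_tmul,
    map_add, map_add, map_add, map_add, qmid_tmul _ _ _ _ _ _ _ _ _ (augOne_mem P _ _ _), qmap_qmk,
    redProj_one_one, map_zero, add_zero]
  refine (congrArg (_ + ·) h1).trans ((add_zero _).trans ?_)
  refine lcongr (f := qmap[ptens (aug P) (aug Q), red P Q] (fun Y => redProj P Q Y Z) (fun Y => redProj P Q X Y) ∘ₗ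
      qmid (aug P) (aug P) (aug Q) (aug Q) X Z ∘ₗ (TensorProduct.mk K _ _).flip
        (qmk (aug Q) (aug Q) X.2 X.2 Z.2 (augOne Q X.2 Z.2 h) (augOne Q X.2 X.2 rfl)) ∘ₗ
      qmap[P, aug P] (fun Y => augIn P Y Z.1) (fun Y => augIn P X.1 Y))
    (qtens_ext fun Y i y hy j y' hy' => ?_) (ΔP X.1 Z.1 x)
  rw [comp_app, comp_app, comp_app, qmap_qmk, flip_app, TensorProduct.mk_apply, qmid_tmul _ _ _ _ _
    _ _ _ _ (augIn_mem P hy'), qmap_qmk, aug_sgn_augOne, redProj_in_one, redProj_in_one, qlift_qmk,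
    compl₁₂_app]

end

/-! ### Letters -/

/-- The reduction of the tensor product of the augmentations of two tensor cocategories. -/
abbrev tred (E : GQuiver K O) (F : GQuiver K Ω) : GQuiver K (O × Ω) := red (tbar E) (tbar F)

variable (E : GQuiver K O) (F : GQuiver K Ω)

/-- The comultiplication of `tred E F`. -/
abbrev tredComul (X Z : O × Ω) : tred E F X Z →ₗ[K] qtens (tred E F) (tred E F) X Z :=
  redComul (tbar E) (tbar F) (tcomul E) (tcomul F) X Z

/-- The concatenation of `tred E F`. -/
abbrev tredComp (X Y Z : O × Ω) : tred E F Y Z →ₗ[K] tred E F X Y →ₗ[K] tred E F X Z :=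
  redComp (tbar E) (tbar F) (tmul E) (tmul F) X Y Z

/-- The elements of the first quiver as elements of `tred E F`. -/
def letL (y z : O) (b : Ω) : E y z →ₗ[K] tred E F (y, b) (z, b) :=
  redL (tbar E) (tbar F) (y, b) (z, b) rfl ∘ₗ tgen E y z

/-- The elements of the second quiver as elements of `tred E F`. -/
def letR (x : O) (y z : Ω) : F y z →ₗ[K] tred E F (x, y) (x, z) :=
  redR (tbar E) (tbar F) (x, y) (x, z) rfl ∘ₗ tgen F y z

variable {E F}

theorem tredComp_letL_redT (X : O × Ω) (y z : O) (b : Ω) (a : E y z) (x : tbar E X.1 y)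
    (v : tbar F X.2 b) :
    tredComp E F X (y, b) (z, b) (letL E F y z b a) (redT (tbar E) (tbar F) X (y, b) (x ⊗ₜ v)) =
      redT (tbar E) (tbar F) X (z, b) (tcons E X.1 y z a x ⊗ₜ v) := by
  refine (redComp_redL_redT (tbar E) (tbar F) (tmul E) (tmul F) X y z b (tgen E y z a) x v).trans ?_
  rw [tmul_tgen]

theorem tredComp_letL_redL (X : O × Ω) (y z : O) (b : Ω) (a : E y z) (h : X.2 = b)
    (x : tbar E X.1 y) :
    tredComp E F X (y, b) (z, b) (letL E F y z b a) (redL (tbar E) (tbar F) X (y, b) h x) =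
      redL (tbar E) (tbar F) X (z, b) h (tcons E X.1 y z a x) := by
  refine (redComp_redL_redL (tbar E) (tbar F) (tmul E) (tmul F) X y z b h (tgen E y z a) x).trans ?_
  rw [tmul_tgen]

theorem tredComp_letL_redR (X : O × Ω) (z : O) (b : Ω) (a : E X.1 z) (v : tbar F X.2 b) :
    tredComp E F X (X.1, b) (z, b) (letL E F X.1 z b a) (redR (tbar E) (tbar F) X (X.1, b) rfl v) =
      redT (tbar E) (tbar F) X (z, b) (tgen E X.1 z a ⊗ₜ v) :=
  redComp_redL_redR (tbar E) (tbar F) (tmul E) (tmul F) X z b (tgen E X.1 z a) v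

theorem tredComp_letR_redR (X : O × Ω) (x : O) (y z : Ω) (b : F y z) (h : X.1 = x)
    (v : tbar F X.2 y) :
    tredComp E F X (x, y) (x, z) (letR E F x y z b) (redR (tbar E) (tbar F) X (x, y) h v) =
      redR (tbar E) (tbar F) X (x, z) h (tcons F X.2 y z b v) := by
  refine lapply_eq (((tredComp E F X (x, y) (x, z)).flip
    (redR (tbar E) (tbar F) X (x, y) h v)) ∘ₗ letR E F x y z)
    (redR (tbar E) (tbar F) X (x, z) h ∘ₗ (tcons F X.2 y z).flip v)
    (hom_ext_gr _ fun i b hb => ?_) b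
  refine (redComp_redR_redR (tbar E) (tbar F) (tmul E) (tmul F) X x y z h (tgen_mem hb) v).trans ?_
  rw [tmul_tgen]
  rfl

theorem tred_induction {Y : O × Ω} {p : ∀ Z, tred E F Y Z → Prop}
    (add : ∀ Z c c', p Z c → p Z c' → p Z (c + c'))
    (letL : ∀ z i, ∀ a ∈ (E Y.1 z).gr i, p (z, Y.2) (letL E F Y.1 z Y.2 a))
    (compL : ∀ y z b i, ∀ a ∈ (E y z).gr i, ∀ c : tred E F Y (y, b),
      p (z, b) (tredComp E F Y (y, b) (z, b) (AInf.letL E F y z b a) c))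
    (letR : ∀ z i, ∀ b ∈ (F Y.2 z).gr i, p (Y.1, z) (letR E F Y.1 Y.2 z b))
    (compR : ∀ y z i, ∀ b ∈ (F y z).gr i, ∀ v : tbar F Y.2 y,
      p (Y.1, z) (redR (tbar E) (tbar F) Y (Y.1, z) rfl (tcons F Y.2 y z b v)))
    (Z : O × Ω) (c : tred E F Y Z) : p Z c := by
  have zero : ∀ Z, p Z 0 := fun Z => by
    have := compL Z.1 Z.1 Z.2 0 0 (zero_mem _) 0
    rwa [map_zero] at this
  have hL : ∀ z (x : tbar E Y.1 z), p (z, Y.2) (redL (tbar E) (tbar F) Y (z, Y.2) rfl x) := by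
    refine tbar_induction E Y.1 (fun z => ?_) (fun z x y hx hy => ?_) letL fun y z i a ha x _ => ?_
    · rw [map_zero]; exact zero _
    · rw [map_add]; exact add _ _ _ hx hy
    · have := compL y z Y.2 i a ha (redL (tbar E) (tbar F) Y (y, Y.2) rfl x)
      rwa [tredComp_letL_redL] at this
  have hR : ∀ z (v : tbar F Y.2 z), p (Y.1, z) (redR (tbar E) (tbar F) Y (Y.1, z) rfl v) := by
    refine tbar_induction F Y.2 (fun z => ?_) (fun z x y hx hy => ?_) letR fun y z i a ha x _ => ?_
    · rw [map_zero]; exact zero _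
    · rw [map_add]; exact add _ _ _ hx hy
    · exact compR y z i a ha x
  have hT : ∀ (b : Ω) (v : tbar F Y.2 b) z (x : tbar E Y.1 z),
      p (z, b) (redT (tbar E) (tbar F) Y (z, b) (x ⊗ₜ v)) := by
    intro b v
    refine tbar_induction E Y.1 (fun z => ?_) (fun z x y hx hy => ?_) (fun z i a ha => ?_)
      fun y z i a ha x _ => ?_
    · rw [zero_tmul, map_zero]; exact zero _
    · rw [add_tmul, map_add]; exact add _ _ _ hx hy
    · have := compL Y.1 z b i a ha (redR (tbar E) (tbar F) Y (Y.1, b) rfl v)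
      rwa [tredComp_letL_redR] at this
    · have := compL y z b i a ha (redT (tbar E) (tbar F) Y (y, b) (x ⊗ₜ v))
      rwa [tredComp_letL_redT] at this
  obtain ⟨z, b⟩ := Z
  have hL' : ∀ (h : Y.2 = b) x, p (z, b) (redL (tbar E) (tbar F) Y (z, b) h x) := by
    intro h; subst h; exact hL z
  have hR' : ∀ (h : Y.1 = z) x, p (z, b) (redR (tbar E) (tbar F) Y (z, b) h x) := by
    intro h; subst h; exact hR b
  exact red_induction (add _) (fun i x _ j y _ => hT b y z x) (fun h i x _ => hL' h x)
    (fun h i x _ => hR' h x) c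

end Letters

section LetterComul

variable {O Ω : Type u}

variable {E : GQuiver K O} {F : GQuiver K Ω}

/-! ### The comultiplication and the first letter -/

theorem tredComul_letL (y z : O) (b : Ω) (a : E y z) :
    tredComul E F (y, b) (z, b) (letL E F y z b a) = 0 := by
  refine (redComul_redL (P := tbar E) (Q := tbar F) (y, b) (z, b) rfl (tgen E y z a)).trans ?_
  rw [tcomul_tgen, map_zero]

theorem tredComul_letR (x : O) (y z : Ω) (b : F y z) :
    tredComul E F (x, y) (x, z) (letR E F x y z b) = 0 := by
  refine (redComul_redR (P := tbar E) (Q := tbar F) (x, y) (x, z) rfl (tgen F y z b)).trans ?_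
  rw [tcomul_tgen, map_zero]

theorem tredComul_redR_tcons (X : O × Ω) (x : O) (y z : Ω) (b : F y z) (h : X.1 = x)
    (v : tbar F X.2 y) :
    tredComul E F X (x, z) (redR (tbar E) (tbar F) X (x, z) h (tcons F X.2 y z b v)) =
      qmk (tred E F) (tred E F) X (x, y) (x, z) (letR E F x y z b)
        (redR (tbar E) (tbar F) X (x, y) h v) +
      qmap (P := tred E F) (Q := tred E F) (P' := tred E F) (Q' := tred E F) (X := X)
        (Z := (x, y)) (X' := X) (Z' := (x, z))
        (fun W => tredComp E F W (x, y) (x, z) (letR E F x y z b)) (fun _ => lid)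
        (tredComul E F X (x, y) (redR (tbar E) (tbar F) X (x, y) h v)) := by
  subst h
  refine (redComul_redR (P := tbar E) (Q := tbar F) X (X.1, z) rfl (tcons F X.2 y z b v)).trans ?_
  refine Eq.trans ?_ (congrArg (fun u => qmk (tred E F) (tred E F) X (X.1, y) (X.1, z)
    (letR E F X.1 y z b) (redR (tbar E) (tbar F) X (X.1, y) rfl v) +
      qmap (P := tred E F) (Q := tred E F) (P' := tred E F) (Q' := tred E F) (X := X)
        (Z := (X.1, y)) (X' := X) (Z' := (X.1, z))
        (fun W => tredComp E F W (X.1, y) (X.1, z) (letR E F X.1 y z b)) (fun _ => lid) u)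
      (redComul_redR (P := tbar E) (Q := tbar F) X (X.1, y) rfl v).symm)
  rw [tcomul_tcons, map_add]
  refine congrArg₂ (· + ·) ?_ ?_
  · rw [qlift_qmk]
    rfl
  · generalize tcomul F X.2 y v = w
    refine lapply_eq ((qlift fun y' => (qmk (tred E F) (tred E F) X (X.1, y') (X.1, z)).compl₁₂
        (redR (tbar E) (tbar F) (X.1, y') (X.1, z) rfl)
        (redR (tbar E) (tbar F) X (X.1, y') rfl)) ∘ₗ
        qmap[tbar F] (fun W => tcons F W y z b) (fun _ => lid))
      (qmap (P := tred E F) (Q := tred E F) (P' := tred E F) (Q' := tred E F) (X := X)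
        (Z := (X.1, y)) (X' := X) (Z' := (X.1, z))
        (fun W => tredComp E F W (X.1, y) (X.1, z) (letR E F X.1 y z b)) (fun _ => lid) ∘ₗ
        (qlift fun y' => (qmk (tred E F) (tred E F) X (X.1, y') (X.1, y)).compl₁₂
          (redR (tbar E) (tbar F) (X.1, y') (X.1, y) rfl)
          (redR (tbar E) (tbar F) X (X.1, y') rfl)))
      (qtens_ext fun Y i y hy j y' hy' => ?_) w
    rw [comp_app, comp_app, qmap_qmk_id, qlift_qmk, qlift_qmk, compl₁₂_app, compl₁₂_app,
      qmap_qmk_id]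
    refine congrArg (fun u => qmk (tred E F) (tred E F) X (X.1, Y) (X.1, z) u _) ?_
    exact (tredComp_letR_redR _ _ _ _ _ _ _).symm

/-- The product with a letter of the first quiver, on tensor products of augmentations. -/
def augLetL (X : O × Ω) (y z : O) (b : Ω) : E y z →ₗ[K]
    ptens (aug (tbar E)) (aug (tbar F)) X (y, b) →ₗ[K]
      ptens (aug (tbar E)) (aug (tbar F)) X (z, b) :=
  (TensorProduct.mapBilinear (RingHom.id K) _ _ _ _).flip lid ∘ₗ
    augComp (tbar E) (tmul E) X.1 y z ∘ₗ augIn (tbar E) y z ∘ₗ tgen E y z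

theorem augLetL_tmul (X : O × Ω) (y z : O) (b : Ω) (a : E y z) (x : aug (tbar E) X.1 y)
    (v : aug (tbar F) X.2 b) : augLetL X y z b a (x ⊗ₜ v) =
      augComp (tbar E) (tmul E) X.1 y z (augIn (tbar E) y z (tgen E y z a)) x ⊗ₜ v := rfl

theorem augComp_letL_augIn (X y z : O) (a : E y z) (x : tbar E X y) :
    augComp (tbar E) (tmul E) X y z (augIn (tbar E) y z (tgen E y z a))
      (augIn (tbar E) X y x) = augIn (tbar E) X z (tcons E X y z a x) := by
  rw [augComp_in_in, tmul_tgen]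

theorem redIncl_letL (X : O × Ω) (y z : O) (b : Ω) (a : E y z) (c : tred E F X (y, b)) :
    redIncl (tbar E) (tbar F) X (z, b) (tredComp E F X (y, b) (z, b) (letL E F y z b a) c) =
      augLetL X y z b a (redIncl (tbar E) (tbar F) X (y, b) c) := by
  refine lapply_eq (redIncl (tbar E) (tbar F) X (z, b) ∘ₗ
    tredComp E F X (y, b) (z, b) (letL E F y z b a)) (augLetL X y z b a ∘ₗ
    redIncl (tbar E) (tbar F) X (y, b)) (red_ext ?_ ?_ ?_) c
  · intro i x hx j v hv
    rw [comp_app, comp_app, tredComp_letL_redT, redIncl_redT, redIncl_redT, augLetL_tmul,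
      augComp_letL_augIn]
  · intro h i x hx
    rw [comp_app, comp_app, tredComp_letL_redL, redIncl_redL, redIncl_redL, augLetL_tmul,
      augComp_letL_augIn]
  · have : ∀ (h : X.1 = y) v, redIncl (tbar E) (tbar F) X (z, b)
        (tredComp E F X (y, b) (z, b) (letL E F y z b a) (redR (tbar E) (tbar F) X (y, b) h v)) =
        augLetL X y z b a (redIncl (tbar E) (tbar F) X (y, b)
          (redR (tbar E) (tbar F) X (y, b) h v)) := by
      intro h v
      subst h
      rw [tredComp_letL_redR, redIncl_redT, redIncl_redR, augLetL_tmul, augComp_in_one]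
    exact fun h i v _ => this h v

theorem augComul_letL (X y z : O) (a : E y z) (x : aug (tbar E) X y) :
    augComul (tbar E) (tcomul E) X z (augComp (tbar E) (tmul E) X y z
      (augIn (tbar E) y z (tgen E y z a)) x) =
      qmap[aug (tbar E)]
        (fun W => augComp (tbar E) (tmul E) W y z (augIn (tbar E) y z (tgen E y z a)))
        (fun _ => lid) (augComul (tbar E) (tcomul E) X y x) +
      qmk (aug (tbar E)) (aug (tbar E)) X z z (augOne (tbar E) z z rfl)
        (augComp (tbar E) (tmul E) X y z (augIn (tbar E) y z (tgen E y z a)) x) := by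
  refine lapply_eq (augComul (tbar E) (tcomul E) X z ∘ₗ
      augComp (tbar E) (tmul E) X y z (augIn (tbar E) y z (tgen E y z a)))
    (qmap[aug (tbar E)]
        (fun W => augComp (tbar E) (tmul E) W y z (augIn (tbar E) y z (tgen E y z a)))
        (fun _ => lid) ∘ₗ augComul (tbar E) (tcomul E) X y +
      qmk (aug (tbar E)) (aug (tbar E)) X z z (augOne (tbar E) z z rfl) ∘ₗ
        augComp (tbar E) (tmul E) X y z (augIn (tbar E) y z (tgen E y z a))) (aug_ext ?_ ?_) x
  · intro x
    rw [comp_app, ladd_app, comp_app, comp_app, augComp_letL_augIn, augComul_augIn, augComul_augIn,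
      tcomul_tcons, map_add, map_add, map_add, qmap_qmk, qmap_qmk_id, qmap_qmk_id, augComp_in_one,
      augComp_letL_augIn, qmap_comp (P := tbar E) (Q := tbar E) (P' := tbar E) (Q' := tbar E) (P''
      := aug (tbar E)) (Q'' := aug (tbar E)), qmap_comp (P := tbar E) (Q := tbar E) (P' := aug (tbar
      E)) (Q' := aug (tbar E)) (P'' := aug (tbar E)) (Q'' := aug (tbar E))]
    have h1 : ∀ W, augComp (tbar E) (tmul E) W y z (augIn (tbar E) y z (tgen E y z a)) ∘ₗ
        augIn (tbar E) W y = augIn (tbar E) W z ∘ₗ tcons E W y z a :=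
      fun W => lext fun x => augComp_letL_augIn W y z a x
    simp only [h1, LinearMap.id_comp, LinearMap.comp_id]
    abel
  · have : ∀ h : X = y, augComul (tbar E) (tcomul E) X z (augComp (tbar E) (tmul E) X y z
        (augIn (tbar E) y z (tgen E y z a)) (augOne (tbar E) X y h)) =
        qmap[aug (tbar E)]
          (fun W => augComp (tbar E) (tmul E) W y z (augIn (tbar E) y z (tgen E y z a)))
          (fun _ => lid) (augComul (tbar E) (tcomul E) X y (augOne (tbar E) X y h)) +
        qmk (aug (tbar E)) (aug (tbar E)) X z z (augOne (tbar E) z z rfl)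
          (augComp (tbar E) (tmul E) X y z (augIn (tbar E) y z (tgen E y z a))
            (augOne (tbar E) X y h)) := by
      intro h
      subst h
      rw [augComp_in_one, augComul_augIn, tcomul_tgen, map_zero, zero_add, augComul_augOne,
        qmap_qmk_id, augComp_in_one]
    exact this

end LetterComul

section Shuffles

variable {O Ω : Type u}

section

variable (P : GQuiver K O) (Q : GQuiver K Ω) {ΔP : ∀ X Z, P X Z →ₗ[K] qtens P P X Z}
  {ΔQ : ∀ X Z, Q X Z →ₗ[K] qtens Q Q X Z}

/-- The middle exchange for two pairs of elements of augmentations, followed by a map `κ` on the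
first factor and the projection to the reduction on the second. -/
def redShuf (X Z Z' : O × Ω) (κ : ∀ Y, ptens (aug P) (aug Q) Y Z →ₗ[K] red P Q Y Z') :
    qtens (aug P) (aug P) X.1 Z.1 →ₗ[K] qtens (aug Q) (aug Q) X.2 Z.2 →ₗ[K]
      qtens (red P Q) (red P Q) X Z' :=
  (TensorProduct.mk K _ _).compr₂ (qmap[ptens (aug P) (aug Q), red P Q]
      κ (fun Y => redProj P Q X Y) ∘ₗ qmid (aug P) (aug P) (aug Q) (aug Q) X Z)

variable {P Q}

theorem redShuf_qmk (X Z Z' : O × Ω) (κ : ∀ Y, ptens (aug P) (aug Q) Y Z →ₗ[K] red P Q Y Z')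
    (y : O) (y' : Ω) (x : aug P y Z.1) {j : ℤ} {x' : aug P X.1 y} (hx' : x' ∈ (aug P X.1 y).gr j)
    (v : aug Q y' Z.2) (v' : aug Q X.2 y') :
    redShuf P Q X Z Z' κ (qmk (aug P) (aug P) X.1 y Z.1 x x')
      (qmk (aug Q) (aug Q) X.2 y' Z.2 v v') =
    qmk (red P Q) (red P Q) X (y, y') Z' (κ (y, y') (x ⊗ₜ (aug Q y' Z.2).sgn j v))
      (redProj P Q X (y, y') (x' ⊗ₜ v')) := by
  refine (congrArg (qmap[ptens (aug P) (aug Q), red P Q] κ (fun Y => redProj P Q X Y))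
    (qmid_tmul (aug P) (aug P) (aug Q) (aug Q) X Z y y' x hx' v v')).trans ?_
  exact qmap_qmk _ _ _ _ _

theorem redComul_redProj_tmul (X Z : O × Ω) (x : aug P X.1 Z.1) (v : aug Q X.2 Z.2) :
    redComul P Q ΔP ΔQ X Z (redProj P Q X Z (x ⊗ₜ v)) =
      redShuf P Q X Z Z (fun Y => redProj P Q Y Z) (augComul P ΔP X.1 Z.1 x)
        (augComul Q ΔQ X.2 Z.2 v) :=
  redComul_redProj (P := P) (Q := Q) X Z (x ⊗ₜ v)

theorem redShuf_of_eq_zero (X Z Z' : O × Ω) {κ : ∀ Y, ptens (aug P) (aug Q) Y Z →ₗ[K] red P Q Y Z'}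
    (hl : ∀ Y x y, κ Y (augIn P Y.1 Z.1 x ⊗ₜ y) = 0)
    (hr : ∀ Y x y, κ Y (x ⊗ₜ augIn Q Y.2 Z.2 y) = 0) (x : aug P X.1 Z.1) (v : aug Q X.2 Z.2) :
    redShuf P Q X Z Z' κ (augComul P ΔP X.1 Z.1 x) (augComul Q ΔQ X.2 Z.2 v) =
      qmk (red P Q) (red P Q) X Z Z' (κ Z (augOne P Z.1 Z.1 rfl ⊗ₜ augOne Q Z.2 Z.2 rfl))
        (redProj P Q X Z (x ⊗ₜ v)) :=
  qmap_ptensComul_of_eq_zero (P := P) (Q := Q) (L := red P Q) (M := red P Q)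
    (fun Y => redProj P Q X Y) hl hr (x ⊗ₜ v)

theorem redShuf_ext {X Z : O × Ω}
    {f g : qtens (aug P) (aug P) X.1 Z.1 →ₗ[K] qtens (aug Q) (aug Q) X.2 Z.2 →ₗ[K] N}
    (h : ∀ y i, ∀ x ∈ (aug P y Z.1).gr i, ∀ j, ∀ x' ∈ (aug P X.1 y).gr j, ∀ y' v v',
      f (qmk (aug P) (aug P) X.1 y Z.1 x x') (qmk (aug Q) (aug Q) X.2 y' Z.2 v v') =
        g (qmk (aug P) (aug P) X.1 y Z.1 x x') (qmk (aug Q) (aug Q) X.2 y' Z.2 v v')) : f = g :=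
  qtens_ext fun Y i x hx j x' hx' => qtens_ext fun Y' _ v _ _ v' _ => h Y i x hx j x' hx' Y' v v'

theorem redShuf_add (X Z Z' : O × Ω) (κ κ' : ∀ Y, ptens (aug P) (aug Q) Y Z →ₗ[K] red P Q Y Z')
    (a : qtens (aug P) (aug P) X.1 Z.1) (b : qtens (aug Q) (aug Q) X.2 Z.2) :
    redShuf P Q X Z Z' (fun Y => κ Y + κ' Y) a b =
      redShuf P Q X Z Z' κ a b + redShuf P Q X Z Z' κ' a b := by
  refine lcongr (lapply_eq (redShuf P Q X Z Z' (fun Y => κ Y + κ' Y))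
    (redShuf P Q X Z Z' κ + redShuf P Q X Z Z' κ') (redShuf_ext ?_) a) b
  intro y i x hx j x' hx' y' v v'
  rw [ladd_app, ladd_app, redShuf_qmk _ _ _ _ _ _ _ hx', redShuf_qmk _ _ _ _ _ _ _ hx', redShuf_qmk
    _ _ _ _ _ _ _ hx', ladd_app, map_add, ladd_app]

theorem redShuf_comp (X Z Z' Z'' : O × Ω) (κ : ∀ Y, ptens (aug P) (aug Q) Y Z →ₗ[K] red P Q Y Z')
    (f : ∀ Y, red P Q Y Z' →ₗ[K] red P Q Y Z'')
    (a : qtens (aug P) (aug P) X.1 Z.1) (b : qtens (aug Q) (aug Q) X.2 Z.2) :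
    redShuf P Q X Z Z'' (fun Y => f Y ∘ₗ κ Y) a b =
      qmap (P := red P Q) (Q := red P Q) (P' := red P Q) (Q' := red P Q) (X := X) (X' := X)
        (Z := Z') (Z' := Z'') f (fun _ => lid) (redShuf P Q X Z Z' κ a b) := by
  refine lcongr (lapply_eq (redShuf P Q X Z Z'' (fun Y => f Y ∘ₗ κ Y))
    ((redShuf P Q X Z Z' κ).compr₂ (qmap (P := red P Q) (Q := red P Q) (P' := red P Q)
      (Q' := red P Q) (X := X) (X' := X) (Z := Z') (Z' := Z'') f (fun _ => lid)))
    (redShuf_ext ?_) a) b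
  intro y i x hx j x' hx' y' v v'
  rw [compr₂_app, redShuf_qmk _ _ _ _ _ _ _ hx', redShuf_qmk _ _ _ _ _ _ _ hx', qmap_qmk_id,
    comp_app]

theorem redShuf_qmap (X Z Z₁ Z' : O × Ω) (κ : ∀ Y, ptens (aug P) (aug Q) Y Z₁ →ₗ[K] red P Q Y Z')
    (α : ∀ Y, aug P Y Z.1 →ₗ[K] aug P Y Z₁.1) (β : ∀ Y, aug Q Y Z.2 →ₗ[K] aug Q Y Z₁.2)
    (hβ : ∀ Y, HasDegree (aug Q Y Z.2).gr (aug Q Y Z₁.2).gr (β Y) 0)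
    (a : qtens (aug P) (aug P) X.1 Z.1) (b : qtens (aug Q) (aug Q) X.2 Z.2) :
    redShuf P Q X Z₁ Z' κ (qmap[aug P] α (fun _ => lid) a) (qmap[aug Q] β (fun _ => lid) b) =
    redShuf P Q X Z Z' (fun Y => κ Y ∘ₗ TensorProduct.map (α Y.1) (β Y.2)) a b := by
  refine lcongr (lapply_eq ((redShuf P Q X Z₁ Z' κ).compl₁₂ (qmap[aug P] α (fun _ => lid))
      (qmap[aug Q] β (fun _ => lid)))
    (redShuf P Q X Z Z' (fun Y => κ Y ∘ₗ TensorProduct.map (α Y.1) (β Y.2)))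
    (redShuf_ext ?_) a) b
  intro y i x hx j x' hx' y' v v'
  rw [compl₁₂_app, qmap_qmk_id, qmap_qmk_id, redShuf_qmk _ _ _ _ _ _ _ hx', redShuf_qmk _ _ _ _ _ _
    _ hx', comp_app, TensorProduct.map_tmul, sgn_map_of_hasDegree_zero (hβ y')]

end

section

variable {E : GQuiver K O} {F : GQuiver K Ω}

theorem redShuf_augLetL (X : O × Ω) (y z : O) (b : Ω) (a : E y z)
    (x : qtens (aug (tbar E)) (aug (tbar E)) X.1 y)
    (v : qtens (aug (tbar F)) (aug (tbar F)) X.2 b) :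
    redShuf (tbar E) (tbar F) X (z, b) (z, b) (fun W => redProj (tbar E) (tbar F) W (z, b))
      (qmap[aug (tbar E)]
        (fun W => augComp (tbar E) (tmul E) W y z (augIn (tbar E) y z (tgen E y z a)))
        (fun _ => lid) x) v =
    redShuf (tbar E) (tbar F) X (y, b) (z, b) (fun W => redProj (tbar E) (tbar F) W (z, b) ∘ₗ
      augLetL W y z b a) x v := by
  have h := redShuf_qmap (P := tbar E) (Q := tbar F) X (y, b) (z, b) (z, b)
    (fun W => redProj (tbar E) (tbar F) W (z, b))
    (fun W => augComp (tbar E) (tmul E) W y z (augIn (tbar E) y z (tgen E y z a)))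
    (fun W => lid) (fun W k v hv => by rwa [add_zero]) x v
  have h1 : qmap (P := aug (tbar F)) (Q := aug (tbar F)) (P' := aug (tbar F)) (Q' := aug (tbar F))
      (X := X.2) (X' := X.2) (Z := b) (Z' := b) (fun _ => lid) (fun _ => lid) v =
      v := lcongr (g := lid) (qtens_ext fun Y i x _ j y _ => qmap_qmk_id _ _ _ _) v
  exact (congrArg _ h1).symm.trans h

/-- The terms of the comultiplication of the product of a letter of the first quiver with an
element in which the letter is in the second factor. -/
def tredTheta (X : O × Ω) (y z : O) (b : Ω) (a : E y z) :
    ptens (aug (tbar E)) (aug (tbar F)) X (y, b) →ₗ[K] qtens (tred E F) (tred E F) X (z, b) :=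
  TensorProduct.lift ((redShuf (tbar E) (tbar F) X (z, b) (z, b)
    (fun W => redProj (tbar E) (tbar F) W (z, b))).compl₁₂
    (qmk (aug (tbar E)) (aug (tbar E)) X.1 z z (augOne (tbar E) z z rfl) ∘ₗ
      augComp (tbar E) (tmul E) X.1 y z (augIn (tbar E) y z (tgen E y z a)))
    (augComul (tbar F) (tcomul F) X.2 b))

theorem tredTheta_tmul (X : O × Ω) (y z : O) (b : Ω) (a : E y z) (x : aug (tbar E) X.1 y)
    (v : aug (tbar F) X.2 b) :
    tredTheta X y z b a (x ⊗ₜ v) = redShuf (tbar E) (tbar F) X (z, b) (z, b)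
      (fun W => redProj (tbar E) (tbar F) W (z, b))
      (qmk (aug (tbar E)) (aug (tbar E)) X.1 z z (augOne (tbar E) z z rfl)
        (augComp (tbar E) (tmul E) X.1 y z (augIn (tbar E) y z (tgen E y z a)) x))
      (augComul (tbar F) (tcomul F) X.2 b v) := rfl

/-- The defect of `redProj` from commuting with the product with a letter. -/
def letDefect (y z : O) (b : Ω) (a : E y z) (W : O × Ω) :
    ptens (aug (tbar E)) (aug (tbar F)) W (y, b) →ₗ[K] tred E F W (z, b) :=
  redProj (tbar E) (tbar F) W (z, b) ∘ₗ augLetL W y z b a -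
    tredComp E F W (y, b) (z, b) (letL E F y z b a) ∘ₗ redProj (tbar E) (tbar F) W (y, b)

theorem letDefect_apply (y z : O) (b : Ω) (a : E y z) (W : O × Ω)
    (x : aug (tbar E) W.1 y) (v : aug (tbar F) W.2 b) : letDefect y z b a W (x ⊗ₜ v) =
      redProj (tbar E) (tbar F) W (z, b)
        (augComp (tbar E) (tmul E) W.1 y z (augIn (tbar E) y z (tgen E y z a)) x ⊗ₜ v) -
      tredComp E F W (y, b) (z, b) (letL E F y z b a)
        (redProj (tbar E) (tbar F) W (y, b) (x ⊗ₜ v)) := rfl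

theorem letDefect_in_in (y z : O) (b : Ω) (a : E y z) (W : O × Ω) (x : tbar E W.1 y)
    (v : tbar F W.2 b) :
    letDefect y z b a W (augIn (tbar E) W.1 y x ⊗ₜ augIn (tbar F) W.2 b v) = 0 := by
  rw [letDefect_apply, augComp_letL_augIn]
  refine sub_eq_zero.2 ((redProj_in_in (tbar E) (tbar F) W (z, b) _ v).trans ?_)
  rw [← tredComp_letL_redT]
  exact congrArg _ (redProj_in_in (tbar E) (tbar F) W (y, b) x v).symm

theorem letDefect_in_one (y z : O) (b : Ω) (a : E y z) (W : O × Ω) (x : tbar E W.1 y)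
    (h : W.2 = b) :
    letDefect y z b a W (augIn (tbar E) W.1 y x ⊗ₜ augOne (tbar F) W.2 b h) = 0 := by
  rw [letDefect_apply, augComp_letL_augIn]
  refine sub_eq_zero.2 ((redProj_in_one (tbar E) (tbar F) W (z, b) h _).trans ?_)
  rw [← tredComp_letL_redL]
  exact congrArg _ (redProj_in_one (tbar E) (tbar F) W (y, b) h x).symm

theorem letDefect_one_in (y z : O) (b : Ω) (a : E y z) (W : O × Ω) (h : W.1 = y)
    (v : tbar F W.2 b) :
    letDefect y z b a W (augOne (tbar E) W.1 y h ⊗ₜ augIn (tbar F) W.2 b v) = 0 := by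
  subst h
  rw [letDefect_apply, augComp_in_one]
  refine sub_eq_zero.2 ((redProj_in_in (tbar E) (tbar F) W (z, b) _ v).trans ?_)
  rw [← tredComp_letL_redR]
  exact congrArg _ (redProj_one_in (tbar E) (tbar F) W (W.1, b) rfl v).symm

theorem letDefect_one_one (y z : O) (b : Ω) (a : E y z) :
    letDefect y z b a (y, b) (augOne (tbar E) y y rfl ⊗ₜ augOne (tbar F) b b rfl) =
      letL E F y z b a := by
  refine (letDefect_apply y z b a (y, b) _ _).trans ?_
  rw [augComp_in_one, redProj_one_one (tbar E) (tbar F) (y, b) (y, b), map_zero, sub_zero]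
  exact redProj_in_one (tbar E) (tbar F) (y, b) (z, b) rfl _

theorem letDefect_in (y z : O) (b : Ω) (a : E y z) (W : O × Ω) (x : tbar E W.1 y)
    (v : aug (tbar F) W.2 b) : letDefect y z b a W (augIn (tbar E) W.1 y x ⊗ₜ v) = 0 :=
  lapply_eq (letDefect y z b a W ∘ₗ TensorProduct.mk K _ _ (augIn (tbar E) W.1 y x))
    0 (aug_ext (letDefect_in_in y z b a W x) (letDefect_in_one y z b a W x)) v

theorem letDefect_tmul_in (y z : O) (b : Ω) (a : E y z) (W : O × Ω) (x : aug (tbar E) W.1 y)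
    (v : tbar F W.2 b) : letDefect y z b a W (x ⊗ₜ augIn (tbar F) W.2 b v) = 0 :=
  lapply_eq (letDefect y z b a W ∘ₗ (TensorProduct.mk K _ _).flip (augIn (tbar F) W.2 b v)) 0
    (aug_ext (fun x => letDefect_in_in y z b a W x v) (fun h => letDefect_one_in y z b a W h v)) x

set_option maxHeartbeats 1000000 in
theorem tredComul_augLetL (X : O × Ω) (y z : O) (b : Ω) (a : E y z)
    (w : ptens (aug (tbar E)) (aug (tbar F)) X (y, b)) :
    tredComul E F X (z, b) (redProj (tbar E) (tbar F) X (z, b) (augLetL X y z b a w)) =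
      qmk (tred E F) (tred E F) X (y, b) (z, b) (letL E F y z b a)
        (redProj (tbar E) (tbar F) X (y, b) w) +
      qmap (P := tred E F) (Q := tred E F) (P' := tred E F) (Q' := tred E F) (X := X)
        (Z := (y, b)) (X' := X) (Z' := (z, b))
        (fun W => tredComp E F W (y, b) (z, b) (letL E F y z b a)) (fun _ => lid)
        (tredComul E F X (y, b) (redProj (tbar E) (tbar F) X (y, b) w)) +
      tredTheta X y z b a w := by
  induction w using TensorProduct.induction_on with
  | zero => simp only [map_zero, add_zero]
  | add w w' h h' => simp only [map_add, h, h']; abel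
  | tmul x v =>
    have e1 := redComul_redProj_tmul (P := tbar E) (Q := tbar F) (ΔP := tcomul E)
      (ΔQ := tcomul F) X (z, b)
      (augComp (tbar E) (tmul E) X.1 y z (augIn (tbar E) y z (tgen E y z a)) x) v
    have e2 := redComul_redProj_tmul (P := tbar E) (Q := tbar F) (ΔP := tcomul E)
      (ΔQ := tcomul F) X (y, b) x v
    have e3 := redShuf_augLetL X y z b a (augComul (tbar E) (tcomul E) X.1 y x)
      (augComul (tbar F) (tcomul F) X.2 b v)
    have e4 := redShuf_of_eq_zero (P := tbar E) (Q := tbar F) (ΔP := tcomul E)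
      (ΔQ := tcomul F) X (y, b) (z, b) (κ := letDefect y z b a) (letDefect_in y z b a)
      (letDefect_tmul_in y z b a) x v
    have e5 := redShuf_comp X (y, b) (y, b) (z, b) (fun W => redProj (tbar E) (tbar F) W (y, b))
      (fun W => tredComp E F W (y, b) (z, b) (letL E F y z b a))
      (augComul (tbar E) (tcomul E) X.1 y x) (augComul (tbar F) (tcomul F) X.2 b v)
    have e6 := redShuf_add X (y, b) (z, b) (letDefect y z b a)
      (fun W => tredComp E F W (y, b) (z, b) (letL E F y z b a) ∘ₗ
        redProj (tbar E) (tbar F) W (y, b))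
      (augComul (tbar E) (tcomul E) X.1 y x) (augComul (tbar F) (tcomul F) X.2 b v)
    have e7 : (fun W => redProj (tbar E) (tbar F) W (z, b) ∘ₗ augLetL W y z b a) =
        fun W => letDefect y z b a W + tredComp E F W (y, b) (z, b) (letL E F y z b a) ∘ₗ
          redProj (tbar E) (tbar F) W (y, b) := by
      funext W
      exact (sub_add_cancel _ _).symm
    rw [augLetL_tmul, tredTheta_tmul]
    refine e1.trans ?_
    refine (congrArg (fun u => redShuf (tbar E) (tbar F) X (z, b) (z, b)
      (fun W => redProj (tbar E) (tbar F) W (z, b)) u (augComul (tbar F) (tcomul F) X.2 b v))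
      (augComul_letL X.1 y z a x)).trans ?_
    rw [map_add, ladd_app]
    refine congrArg (· + _) ?_
    refine e3.trans ?_
    rw [e7]
    refine e6.trans (congrArg₂ (· + ·) (e4.trans ?_) (e5.trans ?_))
    · exact congrArg (fun u => qmk (tred E F) (tred E F) X (y, b) (z, b) u _)
        (letDefect_one_one y z b a)
    · exact congrArg (qmap (P := tred E F) (Q := tred E F) (P' := tred E F) (Q' := tred E F)
        (X := X) (Z := (y, b)) (X' := X) (Z' := (z, b))
        (fun W => tredComp E F W (y, b) (z, b) (letL E F y z b a)) (fun _ => lid)) e2.symm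

theorem tredComul_letL_comp (X : O × Ω) (y z : O) (b : Ω) (a : E y z) (c : tred E F X (y, b)) :
    tredComul E F X (z, b) (tredComp E F X (y, b) (z, b) (letL E F y z b a) c) =
      qmk (tred E F) (tred E F) X (y, b) (z, b) (letL E F y z b a) c +
      qmap (P := tred E F) (Q := tred E F) (P' := tred E F) (Q' := tred E F) (X := X)
        (Z := (y, b)) (X' := X) (Z' := (z, b))
        (fun W => tredComp E F W (y, b) (z, b) (letL E F y z b a)) (fun _ => lid)
        (tredComul E F X (y, b) c) +
      tredTheta X y z b a (redIncl (tbar E) (tbar F) X (y, b) c) := by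
  have h := tredComul_augLetL X y z b a (redIncl (tbar E) (tbar F) X (y, b) c)
  rwa [← redIncl_letL, redProj_redIncl, redProj_redIncl] at h

/-- In the terms of `tredTheta` the first factor is in the second cocategory. -/
theorem qlift_tredTheta (X : O × Ω) (y z : O) (b : Ω) (a : E y z) (f : ∀ W, tred E F W (z, b) →ₗ[K] tred E F X W →ₗ[K] N)
    (hf : ∀ W h v, f W (redR (tbar E) (tbar F) W (z, b) h v) = 0)
    (w : ptens (aug (tbar E)) (aug (tbar F)) X (y, b)) : qlift f (tredTheta X y z b a w) = 0 := by
  have h1 : ∀ Y (v : aug (tbar F) Y b),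
      f (z, Y) (redProj (tbar E) (tbar F) (z, Y) (z, b) (augOne (tbar E) z z rfl ⊗ₜ v)) = 0 := by
    intro Y v
    refine lapply_eq (f (z, Y) ∘ₗ redProj (tbar E) (tbar F) (z, Y) (z, b) ∘ₗ
      TensorProduct.mk K _ _ (augOne (tbar E) z z rfl)) 0 (aug_ext ?_ ?_) v
    · intro v
      refine (congrArg (f (z, Y)) (redProj_one_in (tbar E) (tbar F) (z, Y) (z, b) rfl v)).trans ?_
      exact hf _ _ _
    · intro h
      refine (congrArg (f (z, Y)) (redProj_one_one (tbar E) (tbar F) (z, Y) (z, b) rfl h)).trans ?_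
      exact map_zero _
  have h2 : ∀ j, ∀ x ∈ (aug (tbar E) X.1 z).gr j, ∀ v : qtens (aug (tbar F)) (aug (tbar F)) X.2 b,
      qlift f (redShuf (tbar E) (tbar F) X (z, b) (z, b)
        (fun W => redProj (tbar E) (tbar F) W (z, b))
        (qmk (aug (tbar E)) (aug (tbar E)) X.1 z z (augOne (tbar E) z z rfl) x) v) = 0 := by
    intro j x hx v
    refine lapply_eq (qlift f ∘ₗ redShuf (tbar E) (tbar F) X (z, b) (z, b)
        (fun W => redProj (tbar E) (tbar F) W (z, b))
        (qmk (aug (tbar E)) (aug (tbar E)) X.1 z z (augOne (tbar E) z z rfl) x)) 0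
      (qtens_ext fun Y k v hv l v' hv' => ?_) v
    refine (congrArg (qlift f) (redShuf_qmk X (z, b) (z, b) _ z Y _ hx v v')).trans ?_
    refine (qlift_qmk f _ _ _).trans ?_
    exact lcongr (h1 Y _) _
  have h3 : ∀ (x : aug (tbar E) X.1 z) (v : qtens (aug (tbar F)) (aug (tbar F)) X.2 b),
      qlift f (redShuf (tbar E) (tbar F) X (z, b) (z, b)
        (fun W => redProj (tbar E) (tbar F) W (z, b))
        (qmk (aug (tbar E)) (aug (tbar E)) X.1 z z (augOne (tbar E) z z rfl) x) v) = 0 := by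
    intro x v
    exact lapply_eq (qlift f ∘ₗ (redShuf (tbar E) (tbar F) X (z, b) (z, b)
        (fun W => redProj (tbar E) (tbar F) W (z, b))).flip v ∘ₗ
        qmk (aug (tbar E)) (aug (tbar E)) X.1 z z (augOne (tbar E) z z rfl)) 0
      (hom_ext_gr _ fun j x hx => h2 j x hx v) x
  induction w using TensorProduct.induction_on with
  | zero => rw [map_zero, map_zero]
  | add w w' h h' => rw [map_add, map_add, h, h', add_zero]
  | tmul x v => rw [tredTheta_tmul]; exact h3 _ _

end

end Shuffles

section Words

variable {O : Type u}

variable {C : GQuiver K O}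

/-! ## Operations on the first letter in a cobar construction -/

/-- A linear map on words given by its values on letters and on products of letters and words. -/
def chead {X Z : O} (f₀ : C X Z →ₗ[K] N)
    (f : ∀ Y, C Y Z →ₗ[K] cobar C X Y →ₗ[K] N) : cobar C X Z →ₗ[K] N :=
  desc fun n => match n with
    | 0 => f₀
    | n + 1 => tlift (Q := qshift (-1) C) fun Y => (f Y).compl₂ (tin (qshift (-1) C) n X Y)

section

variable {X Z : O}

theorem chead_cgen (f₀ : C X Z →ₗ[K] N) (f : ∀ Y, C Y Z →ₗ[K] cobar C X Y →ₗ[K] N) (c : C X Z) :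
    chead f₀ f (cgen C X Z c) = f₀ c :=
  desc_tgen (qshift (-1) C) X Z _ _

theorem chead_ccons (f₀ : C X Z →ₗ[K] N) (f : ∀ Y, C Y Z →ₗ[K] cobar C X Y →ₗ[K] N) (Y : O)
    (c : C Y Z) (w : cobar C X Y) : chead f₀ f (ccons C X Y Z c w) = f Y c w := by
  induction w using dsum_induction with
  | zero => simp only [map_zero]
  | add u v hu hv => rw [map_add, map_add, hu, hv, map_add]
  | of n w =>
    change desc _ (tcons (qshift (-1) C) X Y Z c (tin (qshift (-1) C) n X Y w)) = _
    rw [tcons_tin]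
    refine (desc_tin (qshift (-1) C) (n + 1) X Z _ _).trans ?_
    exact tlift_tmk (Q := qshift (-1) C) _ Y c w

theorem cobar_induction {p : cobar C X Z → Prop} (zero : p 0)
    (add : ∀ x y, p x → p y → p (x + y)) (gen : ∀ c, p (cgen C X Z c))
    (cons : ∀ Y c w, p (ccons C X Y Z c w)) (w : cobar C X Z) : p w := by
  induction w using dsum_induction with
  | zero => exact zero
  | add u v hu hv => exact add _ _ hu hv
  | of n w =>
    cases n with
    | zero => exact gen w
    | succ n =>
      refine tpow_succ_induction (Q := qshift (-1) C)
        (p := fun w => p (tin (qshift (-1) C) (n + 1) X Z w)) ?_ ?_ ?_ w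
      · rw [map_zero]; exact zero
      · intro x y hx hy; rw [map_add]; exact add _ _ hx hy
      · intro Y x w
        rw [← tcons_tin]
        exact cons Y x _

theorem cobar_hom_ext {f g : cobar C X Z →ₗ[K] N} (gen : ∀ c, f (cgen C X Z c) = g (cgen C X Z c))
    (cons : ∀ Y c w, f (ccons C X Y Z c w) = g (ccons C X Y Z c w)) : f = g :=
  lext fun w => cobar_induction (p := fun w => f w = g w) (by rw [map_zero, map_zero])
    (fun x y hx hy => by rw [map_add, map_add, hx, hy]) gen cons w

end

/-- The application of a linear map to the first letter. -/
def cfst (X : O) {Z Z' : O} (p : ∀ Y, C Y Z →ₗ[K] C Y Z') : cobar C X Z →ₗ[K] cobar C X Z' :=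
  chead (cgen C X Z' ∘ₗ p X) fun Y => ccons C X Y Z' ∘ₗ p Y

section

variable (X : O) {Z Z' Z'' : O}

theorem cfst_cgen (p : ∀ Y, C Y Z →ₗ[K] C Y Z') (c : C X Z) :
    cfst X p (cgen C X Z c) = cgen C X Z' (p X c) := chead_cgen _ _ _

theorem cfst_ccons (p : ∀ Y, C Y Z →ₗ[K] C Y Z') (Y : O) (c : C Y Z) (w : cobar C X Y) :
    cfst X p (ccons C X Y Z c w) = ccons C X Y Z' (p Y c) w := chead_ccons _ _ _ _ _

theorem cfst_cfst (p : ∀ Y, C Y Z →ₗ[K] C Y Z') (q : ∀ Y, C Y Z' →ₗ[K] C Y Z'')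
    (w : cobar C X Z) : cfst X q (cfst X p w) = cfst X (fun Y => q Y ∘ₗ p Y) w := by
  refine lcongr (f := cfst X q ∘ₗ cfst X p) (cobar_hom_ext (fun c => ?_) fun Y c w => ?_) w
  · rw [comp_app, cfst_cgen, cfst_cgen, cfst_cgen, comp_app]
  · rw [comp_app, cfst_ccons, cfst_ccons, cfst_ccons, comp_app]

theorem cfst_cquad (p p' : ∀ Y, C Y Z →ₗ[K] C Y Z')
    (h : ∀ Y c, p Y ((C Y Z).sgn 1 c) = (C Y Z').sgn 1 (p' Y c)) (z : qtens C C X Z) :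
    cfst X p (cquad C X Z z) = cquad C X Z' (qmap[C] p'
      (fun _ => lid) z) := by
  refine lapply_eq (cfst X p ∘ₗ cquad C X Z) (cquad C X Z' ∘ₗ qmap[C] p' (fun _ => lid))
    (qtens_ext fun Y i x hx j y hy => ?_) z
  rw [comp_app, comp_app, cquad_qmk, cfst_ccons, qmap_qmk_id, cquad_qmk, h]

theorem cfst_tmul (W : O) (p : ∀ Y, C Y Z →ₗ[K] C Y Z') (u : cobar C W Z) (w : cobar C X W) :
    cfst X p (tmul (qshift (-1) C) X W Z u w) =
      tmul (qshift (-1) C) X W Z' (cfst W p u) w := by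
  refine lapply_eq (cfst X p ∘ₗ (tmul (qshift (-1) C) X W Z).flip w)
    ((tmul (qshift (-1) C) X W Z').flip w ∘ₗ cfst W p) (cobar_hom_ext (fun c => ?_)
    fun Y c u => ?_) u
  · rw [comp_app, comp_app, cfst_cgen]
    refine (congrArg (cfst X p) (tmul_tgen (qshift (-1) C) X W Z c w)).trans ?_
    refine (cfst_ccons X p W c w).trans ?_
    exact (tmul_tgen (qshift (-1) C) X W Z' (p W c) w).symm
  · rw [comp_app, comp_app, cfst_ccons]
    refine (congrArg (cfst X p) (tmul_tcons (qshift (-1) C) X W Y Z c u w)).trans ?_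
    refine (cfst_ccons X p Y c _).trans ?_
    exact (tmul_tcons (qshift (-1) C) X W Y Z' (p Y c) u w).symm

theorem cobar_gr_le {n : ℤ} {S : Submodule K (cobar C X Z)}
    (gen : ∀ i, i + 1 = n → ∀ c ∈ (C X Z).gr i, cgen C X Z c ∈ S)
    (cons : ∀ Y i j, i + 1 + j = n → ∀ c ∈ (C Y Z).gr i, ∀ w ∈ (cobar C X Y).gr j,
      ccons C X Y Z c w ∈ S) : (cobar C X Z).gr n ≤ S := by
  refine dsum_gr_le (M := fun k : ℕ => tpow (qshift (-1) C) k X Z) fun k w hw => ?_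
  cases k with
  | zero => exact gen (-1 + n) (by ring) w hw
  | succ k =>
    refine qtens_gr_le (P := qshift (-1) C) (Q := tpow (qshift (-1) C) k)
      (S := S.comap (tin (qshift (-1) C) (k + 1) X Z)) ?_ hw
    rintro Y i j rfl c hc w hw
    have := cons Y (-1 + i) j (by ring) c hc (tin (qshift (-1) C) k X Y w)
      (incl_mem (M := fun k : ℕ => tpow (qshift (-1) C) k X Y) hw)
    exact (congrArg (· ∈ S) (tcons_tin (qshift (-1) C) k X Y Z c w)).mp this

theorem cfst_mem {p : ∀ Y, C Y Z →ₗ[K] C Y Z'} {k : ℤ}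
    (hp : ∀ Y, HasDegree (C Y Z).gr (C Y Z').gr (p Y) k) :
    HasDegree (cobar C X Z).gr (cobar C X Z').gr (cfst X p) k := by
  intro n w hw
  refine cobar_gr_le X (S := ((cobar C X Z').gr (n + k)).comap (cfst X p)) ?_ ?_ hw
  · rintro i rfl c hc
    rw [mem_comap, cfst_cgen]
    exact cgen_mem (hp X i c hc) (by ring)
  · rintro Y i j rfl c hc w hw
    rw [mem_comap, cfst_ccons]
    exact ccons_mem (hp Y i c hc) hw (by ring)

end

/-! ### Letters and first letters -/

/-- The data describing the first letters in a cocategory `C`: `pA` and `pB` are the projections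
onto the letters of the first and of the second kind, `pR` is the projection onto the words in
letters of the second kind, and `m` is the concatenation. -/
structure FirstLetter (C : GQuiver K O) (Δ : ∀ X Z, C X Z →ₗ[K] qtens C C X Z) where
  m : ∀ X Y Z, C Y Z →ₗ[K] C X Y →ₗ[K] C X Z
  pA : ∀ X Z, C X Z →ₗ[K] C X Z
  pB : ∀ X Z, C X Z →ₗ[K] C X Z
  pR : ∀ X Z, C X Z →ₗ[K] C X Z
  m_mem : ∀ X Y Z i j, ∀ f ∈ (C Y Z).gr i, ∀ g ∈ (C X Y).gr j, m X Y Z f g ∈ (C X Z).gr (i + j)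
  pA_deg : ∀ X Z, HasDegree (C X Z).gr (C X Z).gr (pA X Z) 0
  pB_deg : ∀ X Z, HasDegree (C X Z).gr (C X Z).gr (pB X Z) 0
  pR_deg : ∀ X Z, HasDegree (C X Z).gr (C X Z).gr (pR X Z) 0
  ind : ∀ (Y : O) (p : ∀ Z, C Y Z → Prop), (∀ Z c c', p Z c → p Z c' → p Z (c + c')) →
    (∀ Z a, pA Y Z a = a → p Z a) → (∀ W Z a, pA W Z a = a → ∀ c, p Z (m Y W Z a c)) →
    (∀ Z b, pB Y Z b = b → p Z b) →
    (∀ W Z b, pB W Z b = b → ∀ c, pR Y W c = c → p Z (m Y W Z b c)) → ∀ Z c, p Z c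
  pB_letA : ∀ X Z a, pA X Z a = a → pB X Z a = 0
  pR_letA : ∀ X Z a, pA X Z a = a → pR X Z a = 0
  comul_letA : ∀ X Z a, pA X Z a = a → Δ X Z a = 0
  pA_compA : ∀ X Y Z a, pA Y Z a = a → ∀ c, pA X Z (m X Y Z a c) = 0
  pB_compA : ∀ X Y Z a, pA Y Z a = a → ∀ c, pB X Z (m X Y Z a c) = 0
  pR_compA : ∀ X Y Z a, pA Y Z a = a → ∀ c, pR X Z (m X Y Z a c) = 0
  comul_compA : ∀ X Y Z a, pA Y Z a = a → ∀ c, ∃ θ, Δ X Z (m X Y Z a c) = qmk C C X Y Z a c +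
    qmap[C] (fun W => m W Y Z a) (fun _ => lid) (Δ X Y c) + θ ∧ qmap[C]
        (fun W => lid - pR W Z) (fun _ => lid) θ = 0
  pA_letB : ∀ X Z b, pB X Z b = b → pA X Z b = 0
  pR_letB : ∀ X Z b, pB X Z b = b → pR X Z b = b
  comul_letB : ∀ X Z b, pB X Z b = b → Δ X Z b = 0
  pA_compB : ∀ X Y Z b, pB Y Z b = b → ∀ c, pR X Y c = c → pA X Z (m X Y Z b c) = 0
  pB_compB : ∀ X Y Z b, pB Y Z b = b → ∀ c, pR X Y c = c → pB X Z (m X Y Z b c) = 0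
  pR_compB : ∀ X Y Z b, pB Y Z b = b → ∀ c, pR X Y c = c → pR X Z (m X Y Z b c) = m X Y Z b c
  comul_compB : ∀ X Y Z b, pB Y Z b = b → ∀ c, pR X Y c = c →
    Δ X Z (m X Y Z b c) = qmk C C X Y Z b c +
    qmap[C] (fun W => m W Y Z b) (fun _ => lid) (Δ X Y c)
  comul_pR : ∀ X Z c, pR X Z c = c → qmap[C] (fun W => pR W Z) (fun _ => lid) (Δ X Z c) = Δ X Z c

namespace FirstLetter

variable {Δ : ∀ X Z, C X Z →ₗ[K] qtens C C X Z} (L : FirstLetter C Δ)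

theorem pA_pA (X Z : O) (c : C X Z) : L.pA X Z (L.pA X Z c) = L.pA X Z c := by
  refine L.ind X (fun Z c => L.pA X Z (L.pA X Z c) = L.pA X Z c) ?_ ?_ ?_ ?_ ?_ Z c
  · intro Z c c' h h'; rw [map_add, map_add, h, h']
  · intro Z a h; rw [h, h]
  · intro W Z a h c; rw [L.pA_compA _ _ _ a h, map_zero]
  · intro Z b h; rw [L.pA_letB _ _ b h, map_zero]
  · intro W Z b h c hc; rw [L.pA_compB _ _ _ b h c hc, map_zero]

theorem pB_pB (X Z : O) (c : C X Z) : L.pB X Z (L.pB X Z c) = L.pB X Z c := by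
  refine L.ind X (fun Z c => L.pB X Z (L.pB X Z c) = L.pB X Z c) ?_ ?_ ?_ ?_ ?_ Z c
  · intro Z c c' h h'; rw [map_add, map_add, h, h']
  · intro Z a h; rw [L.pB_letA _ _ a h, map_zero]
  · intro W Z a h c; rw [L.pB_compA _ _ _ a h, map_zero]
  · intro Z b h; rw [h, h]
  · intro W Z b h c hc; rw [L.pB_compB _ _ _ b h c hc, map_zero]

theorem pR_pR (X Z : O) (c : C X Z) : L.pR X Z (L.pR X Z c) = L.pR X Z c := by
  refine L.ind X (fun Z c => L.pR X Z (L.pR X Z c) = L.pR X Z c) ?_ ?_ ?_ ?_ ?_ Z c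
  · intro Z c c' h h'; rw [map_add, map_add, h, h']
  · intro Z a h; rw [L.pR_letA _ _ a h, map_zero]
  · intro W Z a h c; rw [L.pR_compA _ _ _ a h, map_zero]
  · intro Z b h; rw [L.pR_letB _ _ b h, L.pR_letB _ _ b h]
  · intro W Z b h c hc; rw [L.pR_compB _ _ _ b h c hc, L.pR_compB _ _ _ b h c hc]

theorem pA_pR (X Z : O) (c : C X Z) : L.pA X Z (L.pR X Z c) = 0 := by
  refine L.ind X (fun Z c => L.pA X Z (L.pR X Z c) = 0) ?_ ?_ ?_ ?_ ?_ Z c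
  · intro Z c c' h h'; rw [map_add, map_add, h, h', add_zero]
  · intro Z a h; rw [L.pR_letA _ _ a h, map_zero]
  · intro W Z a h c; rw [L.pR_compA _ _ _ a h, map_zero]
  · intro Z b h; rw [L.pR_letB _ _ b h, L.pA_letB _ _ b h]
  · intro W Z b h c hc; rw [L.pR_compB _ _ _ b h c hc, L.pA_compB _ _ _ b h c hc]

theorem pR_pB (X Z : O) (c : C X Z) : L.pR X Z (L.pB X Z c) = L.pB X Z c :=
  L.pR_letB X Z _ (L.pB_pB X Z c)

theorem sgn_letA (X Z : O) {a : C X Z} (h : L.pA X Z a = a) :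
    L.pA X Z ((C X Z).sgn 1 a) = (C X Z).sgn 1 a := by
  rw [← sgn_map_of_hasDegree_zero (L.pA_deg X Z), h]

theorem sgn_letB (X Z : O) {b : C X Z} (h : L.pB X Z b = b) :
    L.pB X Z ((C X Z).sgn 1 b) = (C X Z).sgn 1 b := by
  rw [← sgn_map_of_hasDegree_zero (L.pB_deg X Z), h]

theorem sgn_m (X Y Z : O) (a : C Y Z) (c : C X Y) : (C X Z).sgn 1 (L.m X Y Z a c) =
    L.m X Y Z ((C Y Z).sgn 1 a) ((C X Y).sgn 1 c) := by
  refine lapply_eq ((C X Z).sgn 1 ∘ₗ (L.m X Y Z).flip c)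
    ((L.m X Y Z).flip ((C X Y).sgn 1 c) ∘ₗ (C Y Z).sgn 1) (hom_ext_gr _ fun i a ha => ?_) a
  refine lapply_eq ((C X Z).sgn 1 ∘ₗ L.m X Y Z a)
    (L.m X Y Z ((C Y Z).sgn 1 a) ∘ₗ (C X Y).sgn 1) (hom_ext_gr _ fun j c hc => ?_) c
  rw [comp_app, comp_app, sgn_one_of_mem _ (L.m_mem X Y Z i j a ha c hc), sgn_one_of_mem _ ha,
    sgn_one_of_mem _ hc, map_zsmul, map_zsmul, lsmul_app, negOnePow_add, Units.val_mul, mul_comm,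
    mul_smul]

/-- The product of an element with the first letter of a word. -/
def cmul (X Y Z : O) : C Y Z →ₗ[K] cobar C X Y →ₗ[K] cobar C X Z := LinearMap.flip (chead
    ((LinearMap.llcomp K (C Y Z) (C X Z) (cobar C X Z)) (cgen C X Z) ∘ₗ (L.m X Y Z).flip)
    fun W => (LinearMap.llcomp K (C Y Z) (C W Z) (cobar C X Z)).flip.compl₁₂
      (L.m W Y Z).flip (ccons C X W Z).flip)

theorem cmul_eq (X Y Z : O) (c : C Y Z) (w : cobar C X Y) :
    L.cmul X Y Z c w = cfst X (fun W => L.m W Y Z c) w := by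
  refine lcongr (f := L.cmul X Y Z c) (cobar_hom_ext (fun c' => ?_) fun W c' w => ?_) w
  · rw [cfst_cgen, cmul, flip_app, chead_cgen]
    rfl
  · rw [cfst_ccons, cmul, flip_app, chead_ccons]
    rfl

theorem cmul_cgen (X Y Z : O) (c : C Y Z) (c' : C X Y) :
    L.cmul X Y Z c (cgen C X Y c') = cgen C X Z (L.m X Y Z c c') := by
  rw [cmul_eq, cfst_cgen]

theorem cmul_ccons (X Y Z W : O) (c : C Y Z) (c' : C W Y) (w : cobar C X W) :
    no_index (L.cmul X Y Z c (ccons C X W Y c' w)) = ccons C X W Z (L.m W Y Z c c') w := by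
  rw [cmul_eq, cfst_ccons]

/-- The projection onto the words whose first letter is in letters of the second kind. -/
def cpR (X Z : O) : cobar C X Z →ₗ[K] cobar C X Z := cfst X fun Y => L.pR Y Z

/-- The complementary projection. -/
def cpN (X Z : O) : cobar C X Z →ₗ[K] cobar C X Z := cfst X fun Y => lid - L.pR Y Z

theorem cpR_cgen (X Z : O) (c : C X Z) : L.cpR X Z (cgen C X Z c) =
    cgen C X Z (L.pR X Z c) := cfst_cgen _ _ _

theorem cpR_ccons (X Y Z : O) (c : C Y Z) (w : cobar C X Y) :
    L.cpR X Z (ccons C X Y Z c w) = ccons C X Y Z (L.pR Y Z c) w := cfst_ccons _ _ _ _ _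

theorem cpN_eq (X Z : O) (w : cobar C X Z) : L.cpN X Z w = w - L.cpR X Z w := by
  refine lcongr (g := lid - L.cpR X Z) (cobar_hom_ext (fun c' => ?_) fun W c' w => ?_) w
  · rw [lsub_app, cpR_cgen, cpN, cfst_cgen, lsub_app, map_sub]
    rfl
  · rw [lsub_app, cpR_ccons, cpN, cfst_ccons, lsub_app, map_sub]
    rfl

theorem cpR_cpR (X Z : O) (w : cobar C X Z) : L.cpR X Z (L.cpR X Z w) = L.cpR X Z w := by
  refine (cfst_cfst X _ _ w).trans ?_
  refine congrArg (fun p => cfst X p w) (funext fun Y => lext fun c => L.pR_pR Y Z c)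

theorem cpN_cpR (X Z : O) (w : cobar C X Z) : L.cpN X Z (L.cpR X Z w) = 0 := by
  rw [cpN_eq, cpR_cpR, sub_self]

theorem word_induction {X Z : O} {p : cobar C X Z → Prop} (add : ∀ x y, p x → p y → p (x + y))
    (genA : ∀ a, L.pA X Z a = a → p (cgen C X Z a))
    (consA : ∀ Y a, L.pA Y Z a = a → ∀ w, p (ccons C X Y Z a w))
    (compA : ∀ Y a, L.pA Y Z a = a → ∀ w, p (L.cmul X Y Z a w))
    (genB : ∀ b, L.pB X Z b = b → p (cgen C X Z b))
    (consB : ∀ Y b, L.pB Y Z b = b → ∀ w, p (ccons C X Y Z b w))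
    (compB : ∀ Y b, L.pB Y Z b = b → ∀ w, L.cpR X Y w = w → p (L.cmul X Y Z b w))
    (w : cobar C X Z) : p w := by
  have zero : p 0 := by
    have := genA 0 (map_zero _)
    rwa [map_zero] at this
  refine cobar_induction zero add (fun c => ?_) (fun Y c w => ?_) w
  · refine L.ind X (fun Z' c => ∀ p : cobar C X Z' → Prop, (∀ x y, p x → p y → p (x + y)) →
      (∀ a, L.pA X Z' a = a → p (cgen C X Z' a)) →
      (∀ Y a, L.pA Y Z' a = a → ∀ w, p (L.cmul X Y Z' a w)) →
      (∀ b, L.pB X Z' b = b → p (cgen C X Z' b)) →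
      (∀ Y b, L.pB Y Z' b = b → ∀ w, L.cpR X Y w = w → p (L.cmul X Y Z' b w)) →
      p (cgen C X Z' c)) ?_ ?_ ?_ ?_ ?_ Z c p add genA compA genB compB
    · intro Z' c c' hc hc' p h1 h2 h3 h4 h5
      rw [map_add]
      exact h1 _ _ (hc p h1 h2 h3 h4 h5) (hc' p h1 h2 h3 h4 h5)
    · intro Z' a ha p h1 h2 h3 h4 h5
      exact h2 a ha
    · intro W Z' a ha c p h1 h2 h3 h4 h5
      have := h3 W a ha (cgen C X W c)
      rwa [cmul_cgen] at this
    · intro Z' b hb p h1 h2 h3 h4 h5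
      exact h4 b hb
    · intro W Z' b hb c hc p h1 h2 h3 h4 h5
      have := h5 W b hb (cgen C X W c) (by rw [cpR_cgen, hc])
      rwa [cmul_cgen] at this
  · refine L.ind Y (fun Z' c => ∀ p : cobar C X Z' → Prop, (∀ x y, p x → p y → p (x + y)) →
      (∀ Y a, L.pA Y Z' a = a → ∀ w, p (ccons C X Y Z' a w)) →
      (∀ Y a, L.pA Y Z' a = a → ∀ w, p (L.cmul X Y Z' a w)) →
      (∀ Y b, L.pB Y Z' b = b → ∀ w, p (ccons C X Y Z' b w)) →
      (∀ Y b, L.pB Y Z' b = b → ∀ w, L.cpR X Y w = w → p (L.cmul X Y Z' b w)) →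
      p (ccons C X Y Z' c w)) ?_ ?_ ?_ ?_ ?_ Z c p add consA compA consB compB
    · intro Z' c c' hc hc' p h1 h2 h3 h4 h5
      rw [map_add, ladd_app]
      exact h1 _ _ (hc p h1 h2 h3 h4 h5) (hc' p h1 h2 h3 h4 h5)
    · intro Z' a ha p h1 h2 h3 h4 h5
      exact h2 Y a ha w
    · intro W Z' a ha c p h1 h2 h3 h4 h5
      have := h3 W a ha (ccons C X Y W c w)
      rwa [cmul_ccons] at this
    · intro Z' b hb p h1 h2 h3 h4 h5
      exact h4 Y b hb w
    · intro W Z' b hb c hc p h1 h2 h3 h4 h5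
      have := h5 W b hb (ccons C X Y W c w) (by rw [cpR_ccons, hc])
      rwa [cmul_ccons] at this

end FirstLetter

end Words

namespace FirstLetter

variable {O : Type u}

variable {C : GQuiver K O} {Δ : ∀ X Z, C X Z →ₗ[K] qtens C C X Z} (L : FirstLetter C Δ)

/-! ### The quadratic differential and the first letter -/

theorem cobarD_zero_cgen (X Z : O) (c : C X Z) :
    cobarD C 0 Δ X Z (cgen C X Z c) = -cquad C X Z (Δ X Z c) := by
  rw [cobarD_cgen]
  simp only [Pi.zero_apply, lzero_app, map_zero, neg_zero, zero_sub]

theorem cobarD_zero_ccons (X Y Z : O) (c : C Y Z) (w : cobar C X Y) :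
    cobarD C 0 Δ X Z (ccons C X Y Z c w) = -tmul (qshift (-1) C) X Y Z (cquad C Y Z (Δ Y Z c)) w -
        ccons C X Y Z ((C Y Z).sgn 1 c) (cobarD C 0 Δ X Y w) := by
  rw [cobarD_ccons]
  simp only [Pi.zero_apply, lzero_app, map_zero, neg_zero, zero_sub]

theorem tmul_cquad_qmk (X W Y Z : O) (x : C Y Z) (y : C W Y) (w : cobar C X W) :
    no_index (tmul (qshift (-1) C) X W Z (cquad C W Z (qmk C C W Y Z x y)) w) =
      ccons C X Y Z ((C Y Z).sgn 1 x) (ccons C X W Y y w) := by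
  rw [cquad_qmk]
  refine (tmul_tcons (qshift (-1) C) X W Y Z _ _ w).trans ?_
  exact congrArg (ccons C X Y Z ((C Y Z).sgn 1 x)) (tmul_tgen (qshift (-1) C) X W Y y w)

theorem cpN_cquad (X Z : O) (z : qtens C C X Z) : L.cpN X Z (cquad C X Z z) =
    cquad C X Z (qmap[C] (fun W => lid - L.pR W Z)
      (fun _ => lid) z) := by
  refine cfst_cquad X _ _ (fun Y c => ?_) z
  rw [lsub_app, lsub_app, map_sub, sgn_map_of_hasDegree_zero (L.pR_deg Y Z)]
  rfl

theorem cpR_cquad (X Z : O) (z : qtens C C X Z) : L.cpR X Z (cquad C X Z z) =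
    cquad C X Z (qmap[C] (fun W => L.pR W Z) (fun _ => lid) z) :=
  cfst_cquad X _ _ (fun Y c => by rw [sgn_map_of_hasDegree_zero (L.pR_deg Y Z)]) z

theorem cquad_qmap_m (X Y Z : O) (a : C Y Z) (z : qtens C C X Y) :
    cquad C X Z (qmap[C] (fun W => L.m W Y Z a)
      (fun _ => lid) z) = L.cmul X Y Z ((C Y Z).sgn 1 a) (cquad C X Y z) := by
  rw [cmul_eq]
  refine (cfst_cquad X _ _ (fun W c => ?_) z).symm
  rw [sgn_m]

theorem cmul_tmul (X W Y Z : O) (a : C Y Z) (u : cobar C W Y) (w : cobar C X W) :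
    L.cmul X Y Z a (tmul (qshift (-1) C) X W Y u w) =
      tmul (qshift (-1) C) X W Z (L.cmul W Y Z a u) w := by
  rw [cmul_eq, cmul_eq, cfst_tmul]

theorem tmul_cquad_qmap_m (X W Y Z : O) (a : C Y Z) (z : qtens C C W Y) (w : cobar C X W) :
    tmul (qshift (-1) C) X W Z (cquad C W Z (qmap[C] (fun V => L.m V Y Z a) (fun _ => lid) z)) w =
      L.cmul X Y Z ((C Y Z).sgn 1 a) (tmul (qshift (-1) C) X W Y (cquad C W Y z) w) := by
  refine Eq.trans ?_ (L.cmul_tmul X W Y Z _ _ w).symm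
  exact congrArg (fun u => tmul (qshift (-1) C) X W Z u w) (L.cquad_qmap_m W Y Z a z)

/-- The Leibniz rule for the product with a letter of the first kind. -/
theorem cpN_cobarD_cmul (X Y Z : O) {a : C Y Z} (ha : L.pA Y Z a = a) (w : cobar C X Y) :
    L.cpN X Z (cobarD C 0 Δ X Z (L.cmul X Y Z a w)) =
      L.cpN X Z (L.cmul X Y Z ((C Y Z).sgn 1 a) (cobarD C 0 Δ X Y w) -
        ccons C X Y Z ((C Y Z).sgn 1 a) w) := by
  refine cobar_induction (p := fun w => L.cpN X Z (cobarD C 0 Δ X Z (L.cmul X Y Z a w)) =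
      L.cpN X Z (L.cmul X Y Z ((C Y Z).sgn 1 a) (cobarD C 0 Δ X Y w) -
        ccons C X Y Z ((C Y Z).sgn 1 a) w)) ?_ ?_ ?_ ?_ w
  · simp only [map_zero, sub_zero]
  · intro x y hx hy
    simp only [map_add, map_sub] at hx hy ⊢
    rw [hx, hy]
    abel
  · intro c
    obtain ⟨θ, h1, h2⟩ := L.comul_compA X Y Z a ha c
    rw [cmul_cgen, cobarD_zero_cgen, h1, cobarD_zero_cgen]
    have h3 : L.cpN X Z (cquad C X Z θ) = 0 := by rw [cpN_cquad, h2, map_zero]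
    have h4 := L.cquad_qmap_m X Y Z a (Δ X Y c)
    simp only [map_add, map_neg, map_sub, h3, cquad_qmk]
    rw [h4]
    abel
  · intro W c w
    obtain ⟨θ, h1, h2⟩ := L.comul_compA W Y Z a ha c
    rw [cmul_ccons, cobarD_zero_ccons, h1, cobarD_zero_ccons]
    have h3 : L.cpN X Z (tmul (qshift (-1) C) X W Z (cquad C W Z θ) w) = 0 := by
      refine (cfst_tmul X W _ _ w).trans ?_
      refine (congrArg (fun u => tmul (qshift (-1) C) X W Z u w) (L.cpN_cquad W Z θ)).trans ?_
      simp only [h2, map_zero, lzero_app]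
    have h4 := L.tmul_cquad_qmap_m X W Y Z a (Δ W Y c) w
    simp only [map_add, map_neg, map_sub, h3, ladd_app, tmul_cquad_qmk, cmul_ccons, sgn_m]
    rw [h4]
    abel

/-- The Leibniz rule for the product with a letter of the second kind. -/
theorem cobarD_cmul (X Y Z : O) {b : C Y Z} (hb : L.pB Y Z b = b) (w : cobar C X Y) :
    cobarD C 0 Δ X Z (L.cmul X Y Z b (L.cpR X Y w)) =
      L.cmul X Y Z ((C Y Z).sgn 1 b) (cobarD C 0 Δ X Y (L.cpR X Y w)) -
        ccons C X Y Z ((C Y Z).sgn 1 b) (L.cpR X Y w) := by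
  refine cobar_induction (p := fun w => cobarD C 0 Δ X Z (L.cmul X Y Z b (L.cpR X Y w)) =
      L.cmul X Y Z ((C Y Z).sgn 1 b) (cobarD C 0 Δ X Y (L.cpR X Y w)) -
        ccons C X Y Z ((C Y Z).sgn 1 b) (L.cpR X Y w)) ?_ ?_ ?_ ?_ w
  · simp only [map_zero, sub_zero]
  · intro x y hx hy
    simp only [map_add] at hx hy ⊢
    rw [hx, hy]
    abel
  · intro c
    rw [cpR_cgen, cmul_cgen, cobarD_zero_cgen, L.comul_compB X Y Z b hb _ (L.pR_pR X Y c),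
      cobarD_zero_cgen]
    have h4 := L.cquad_qmap_m X Y Z b (Δ X Y (L.pR X Y c))
    simp only [map_add, map_neg, cquad_qmk]
    rw [h4]
    abel
  · intro W c w
    rw [cpR_ccons, cmul_ccons, cobarD_zero_ccons, L.comul_compB W Y Z b hb _ (L.pR_pR W Y c),
      cobarD_zero_ccons]
    have h4 := L.tmul_cquad_qmap_m X W Y Z b (Δ W Y (L.pR W Y c)) w
    simp only [map_add, map_neg, map_sub, ladd_app, tmul_cquad_qmk, cmul_ccons, sgn_m]
    rw [h4]
    abel

theorem cpR_cobarD_cpR (X Z : O) (w : cobar C X Z) :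
    L.cpR X Z (cobarD C 0 Δ X Z (L.cpR X Z w)) = cobarD C 0 Δ X Z (L.cpR X Z w) := by
  refine lapply_eq (L.cpR X Z ∘ₗ cobarD C 0 Δ X Z ∘ₗ L.cpR X Z)
    (cobarD C 0 Δ X Z ∘ₗ L.cpR X Z) (cobar_hom_ext (fun c => ?_) fun Y c w => ?_) w
  · rw [comp_app, comp_app, cpR_cgen, cobarD_zero_cgen, map_neg, cpR_cquad, L.comul_pR X Z _
      (L.pR_pR X Z c)]
  · rw [comp_app, comp_app, cpR_ccons, cobarD_zero_ccons, map_sub, map_neg, cpR_ccons,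
      sgn_map_of_hasDegree_zero (L.pR_deg Y Z), L.pR_pR]
    refine congrArg (fun u => -u - _) ?_
    refine (cfst_tmul X Y _ _ w).trans ?_
    refine congrArg (fun u => tmul (qshift (-1) C) X Y Z u w) ((L.cpR_cquad Y Z _).trans ?_)
    rw [L.comul_pR Y Z _ (L.pR_pR Y Z c)]

/-! ### The homotopy -/

/-- The part of the homotopy given by the letters of the first kind. -/
def hA (X Z : O) : cobar C X Z →ₗ[K] cobar C X Z :=
  chead 0 fun Y => -(L.cmul X Y Z ∘ₗ L.pA Y Z ∘ₗ (C Y Z).sgn 1)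

/-- The part of the homotopy given by the letters of the second kind. -/
def hB (X Z : O) : cobar C X Z →ₗ[K] cobar C X Z :=
  chead 0 fun Y => -((L.cmul X Y Z).compl₁₂ (L.pB Y Z ∘ₗ (C Y Z).sgn 1) (L.cpR X Y)) -
    (ccons C X Y Z).compl₁₂ (L.pB Y Z ∘ₗ (C Y Z).sgn 1) (L.hA X Y)

/-- The homotopy. -/
def h (X Z : O) : cobar C X Z →ₗ[K] cobar C X Z := L.hA X Z + L.hB X Z

/-- The projection onto the words with one letter, of the first kind. -/
def kA (X Z : O) : cobar C X Z →ₗ[K] cobar C X Z := chead (cgen C X Z ∘ₗ L.pA X Z) 0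

/-- The projection onto the words with one letter and onto the words consisting of a letter of the
second kind and one of the first kind. -/
def kap (X Z : O) : cobar C X Z →ₗ[K] cobar C X Z :=
  chead (cgen C X Z ∘ₗ (L.pA X Z + L.pB X Z)) fun Y =>
    (ccons C X Y Z).compl₁₂ (L.pB Y Z) (L.kA X Y)

theorem hA_cgen (X Z : O) (c : C X Z) : L.hA X Z (cgen C X Z c) = 0 := by
  rw [hA, chead_cgen, lzero_app]

theorem hA_ccons (X Y Z : O) (c : C Y Z) (w : cobar C X Y) :
    no_index (L.hA X Z (ccons C X Y Z c w)) =
      -L.cmul X Y Z (L.pA Y Z ((C Y Z).sgn 1 c)) w := by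
  rw [hA, chead_ccons]
  rfl

theorem hB_cgen (X Z : O) (c : C X Z) : L.hB X Z (cgen C X Z c) = 0 := by
  rw [hB, chead_cgen, lzero_app]

theorem hB_ccons (X Y Z : O) (c : C Y Z) (w : cobar C X Y) : L.hB X Z (ccons C X Y Z c w) =
      -L.cmul X Y Z (L.pB Y Z ((C Y Z).sgn 1 c)) (L.cpR X Y w) -
        ccons C X Y Z (L.pB Y Z ((C Y Z).sgn 1 c)) (L.hA X Y w) := by
  rw [hB, chead_ccons]
  rfl

theorem kA_cgen (X Z : O) (c : C X Z) :
    L.kA X Z (cgen C X Z c) = cgen C X Z (L.pA X Z c) := chead_cgen _ _ _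

theorem kA_ccons (X Y Z : O) (c : C Y Z) (w : cobar C X Y) :
    L.kA X Z (ccons C X Y Z c w) = 0 := chead_ccons _ _ _ _ _

theorem kap_cgen (X Z : O) (c : C X Z) :
    L.kap X Z (cgen C X Z c) = cgen C X Z (L.pA X Z c + L.pB X Z c) := chead_cgen _ _ _

theorem kap_ccons (X Y Z : O) (c : C Y Z) (w : cobar C X Y) :
    L.kap X Z (ccons C X Y Z c w) = ccons C X Y Z (L.pB Y Z c) (L.kA X Y w) :=
  chead_ccons _ _ _ _ _

theorem hA_cpR (X Z : O) (w : cobar C X Z) : L.hA X Z (L.cpR X Z w) = 0 := by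
  refine lapply_eq (L.hA X Z ∘ₗ L.cpR X Z) 0 (cobar_hom_ext (fun c => ?_) fun Y c w => ?_) w
  · rw [comp_app, cpR_cgen, hA_cgen, lzero_app]
  · rw [comp_app, cpR_ccons, hA_ccons, sgn_map_of_hasDegree_zero (L.pR_deg Y Z), L.pA_pR, map_zero,
      lzero_app, neg_zero, lzero_app]

theorem hA_cpN (X Z : O) (w : cobar C X Z) : L.hA X Z (L.cpN X Z w) = L.hA X Z w := by
  rw [cpN_eq, map_sub, hA_cpR, sub_zero]

theorem kA_cpR (X Z : O) (w : cobar C X Z) : L.kA X Z (L.cpR X Z w) = 0 := by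
  refine lapply_eq (L.kA X Z ∘ₗ L.cpR X Z) 0 (cobar_hom_ext (fun c => ?_) fun Y c w => ?_) w
  · rw [comp_app, cpR_cgen, kA_cgen, L.pA_pR, map_zero, lzero_app]
  · rw [comp_app, cpR_ccons, kA_ccons, lzero_app]

theorem hA_cmul (X Y Z : O) {a : C Y Z} (ha : L.pA Y Z a = a) (w : cobar C X Y) :
    L.hA X Z (L.cmul X Y Z a w) = 0 := by
  refine lapply_eq (L.hA X Z ∘ₗ L.cmul X Y Z a) 0 (cobar_hom_ext (fun c => ?_) fun W c w => ?_) w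
  · rw [comp_app, cmul_cgen, hA_cgen, lzero_app]
  · rw [comp_app, cmul_ccons, hA_ccons, sgn_m, L.pA_compA _ _ _ _ (L.sgn_letA Y Z ha), map_zero,
      lzero_app, neg_zero, lzero_app]

theorem kA_cmul (X Y Z : O) {a : C Y Z} (ha : L.pA Y Z a = a) (w : cobar C X Y) :
    L.kA X Z (L.cmul X Y Z a w) = 0 := by
  refine lapply_eq (L.kA X Z ∘ₗ L.cmul X Y Z a) 0 (cobar_hom_ext (fun c => ?_) fun W c w => ?_) w
  · rw [comp_app, cmul_cgen, kA_cgen, L.pA_compA _ _ _ _ ha, map_zero, lzero_app]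
  · rw [comp_app, cmul_ccons, kA_ccons, lzero_app]

theorem cpN_cmul (X Y Z : O) {a : C Y Z} (ha : L.pA Y Z a = a) (w : cobar C X Y) :
    L.cpN X Z (L.cmul X Y Z a w) = L.cmul X Y Z a w := by
  rw [cpN_eq, sub_eq_self]
  refine lapply_eq (L.cpR X Z ∘ₗ L.cmul X Y Z a) 0 (cobar_hom_ext (fun c => ?_) fun W c w => ?_) w
  · rw [comp_app, cmul_cgen, cpR_cgen, L.pR_compA _ _ _ _ ha, map_zero, lzero_app]
  · rw [comp_app, cmul_ccons, cpR_ccons, L.pR_compA _ _ _ _ ha, map_zero, lzero_app, lzero_app]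

theorem cpR_cmul (X Y Z : O) {b : C Y Z} (hb : L.pB Y Z b = b) (w : cobar C X Y) :
    L.cpR X Z (L.cmul X Y Z b (L.cpR X Y w)) = L.cmul X Y Z b (L.cpR X Y w) := by
  refine lapply_eq (L.cpR X Z ∘ₗ L.cmul X Y Z b ∘ₗ L.cpR X Y) (L.cmul X Y Z b ∘ₗ L.cpR X Y)
    (cobar_hom_ext (fun c => ?_) fun W c w => ?_) w
  · rw [comp_app, comp_app, cpR_cgen, cmul_cgen, cpR_cgen, L.pR_compB _ _ _ _ hb _ (L.pR_pR X Y c)]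
  · rw [comp_app, comp_app, cpR_ccons, cmul_ccons, cpR_ccons, L.pR_compB _ _ _ _ hb _ (L.pR_pR W Y
      c)]

theorem hB_cmul (X Y Z : O) {b : C Y Z} (hb : L.pB Y Z b = b) (w : cobar C X Y) :
    L.hB X Z (L.cmul X Y Z b (L.cpR X Y w)) = 0 := by
  refine lapply_eq (L.hB X Z ∘ₗ L.cmul X Y Z b ∘ₗ L.cpR X Y) 0
    (cobar_hom_ext (fun c => ?_) fun W c w => ?_) w
  · rw [comp_app, comp_app, cpR_cgen, cmul_cgen, hB_cgen, lzero_app]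
  · rw [comp_app, comp_app, cpR_ccons, cmul_ccons, hB_ccons, sgn_m, sgn_map_of_hasDegree_zero
      (L.pR_deg W Y), L.pB_compB _ _ _ _ (L.sgn_letB Y Z hb) _ (L.pR_pR W Y _)]
    simp only [map_zero, lzero_app, neg_zero, sub_zero]

theorem kap_cmul (X Y Z : O) {b : C Y Z} (hb : L.pB Y Z b = b) (w : cobar C X Y) :
    L.kap X Z (L.cmul X Y Z b (L.cpR X Y w)) = 0 := by
  refine lapply_eq (L.kap X Z ∘ₗ L.cmul X Y Z b ∘ₗ L.cpR X Y) 0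
    (cobar_hom_ext (fun c => ?_) fun W c w => ?_) w
  · rw [comp_app, comp_app, cpR_cgen, cmul_cgen, kap_cgen, L.pA_compB _ _ _ _ hb _ (L.pR_pR X Y _),
      L.pB_compB _ _ _ _ hb _ (L.pR_pR X Y _), add_zero, map_zero, lzero_app]
  · rw [comp_app, comp_app, cpR_ccons, cmul_ccons, kap_ccons, L.pB_compB _ _ _ _ hb _ (L.pR_pR W Y
      _), map_zero, lzero_app, lzero_app]

theorem cpR_hB (X Z : O) (w : cobar C X Z) : L.cpR X Z (L.hB X Z w) = L.hB X Z w := by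
  refine lapply_eq (L.cpR X Z ∘ₗ L.hB X Z) (L.hB X Z)
    (cobar_hom_ext (fun c => ?_) fun Y c w => ?_) w
  · rw [comp_app, hB_cgen, map_zero]
  · rw [comp_app, hB_ccons, map_sub, map_neg, cpR_ccons, L.pR_pB, cpR_cmul L X Y Z (L.pB_pB Y Z _)]

theorem cpN_kap (X Z : O) (w : cobar C X Z) : L.cpN X Z (L.kap X Z w) = L.kA X Z w := by
  refine lapply_eq (L.cpN X Z ∘ₗ L.kap X Z) (L.kA X Z)
    (cobar_hom_ext (fun c => ?_) fun Y c w => ?_) w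
  · rw [comp_app, cpN_eq, kap_cgen, cpR_cgen, kA_cgen, map_add (L.pR X Z), L.pR_letA _ _ _ (L.pA_pA
      X Z c), L.pR_pB, zero_add, map_add, add_sub_cancel_right]
  · rw [comp_app, cpN_eq, kap_ccons, cpR_ccons, kA_ccons, L.pR_pB, sub_self]

/-- The defect of the homotopy `hA`. -/
def rA (X Z : O) (w : cobar C X Z) : cobar C X Z :=
  L.cpN X Z w - L.kA X Z w - (cobarD C 0 Δ X Z (L.hA X Z w) + L.hA X Z (cobarD C 0 Δ X Z w))

theorem rA_cpR (X Z : O) (w : cobar C X Z) : L.rA X Z (L.cpR X Z w) = 0 := by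
  rw [rA, cpN_cpR, kA_cpR, hA_cpR, map_zero, ← cpR_cobarD_cpR, hA_cpR, sub_zero, add_zero, sub_zero]

theorem cpN_kA (X Z : O) (w : cobar C X Z) : L.cpN X Z (L.kA X Z w) = L.kA X Z w := by
  rw [← cpN_kap, cpN_eq, cpN_eq, map_sub, cpR_cpR, sub_self, sub_zero]

theorem cpN_cpN (X Z : O) (w : cobar C X Z) : L.cpN X Z (L.cpN X Z w) = L.cpN X Z w := by
  rw [cpN_eq _ _ _ (L.cpN X Z w), cpN_eq, map_sub, cpR_cpR, sub_self, sub_zero]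

theorem rA_add (X Z : O) (x y : cobar C X Z) : L.rA X Z (x + y) = L.rA X Z x + L.rA X Z y := by
  simp only [rA, map_add]
  abel

theorem cpN_rA (X Z : O) (w : cobar C X Z) : L.cpN X Z (L.rA X Z w) = 0 := by
  have hR : ∀ w, L.cpR X Z w = w → L.cpN X Z (L.rA X Z w) = 0 := by
    intro w hw
    rw [← hw, rA_cpR, map_zero]
  refine L.word_induction (p := fun w => L.cpN X Z (L.rA X Z w) = 0) ?_ ?_ ?_ ?_ ?_ ?_ ?_ w
  · intro x y hx hy
    rw [rA_add, map_add, hx, hy, add_zero]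
  · intro a ha
    have h1 : L.cpN X Z (cgen C X Z a) = cgen C X Z a := by
      rw [cpN_eq, cpR_cgen, L.pR_letA _ _ a ha, map_zero, sub_zero]
    rw [rA, hA_cgen, cobarD_zero_cgen, L.comul_letA _ _ a ha, kA_cgen, ha, h1]
    simp only [map_zero, neg_zero, sub_zero, sub_self, add_zero]
  · intro Y a ha w
    have ha' := L.sgn_letA Y Z ha
    have h1 := L.cpN_cobarD_cmul X Y Z ha' w
    rw [sgn_one_sgn_one, map_sub] at h1
    rw [rA, hA_ccons, ha', cobarD_zero_ccons, L.comul_letA _ _ a ha, kA_ccons]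
    simp only [map_zero, map_neg, map_sub, lzero_app, neg_zero, zero_sub, hA_ccons, sgn_one_sgn_one,
      ha, map_add, h1, neg_neg, sub_zero]
    rw [cpN_cpN]
    abel
  · intro Y a ha w
    have ha' := L.sgn_letA Y Z ha
    have h1 := L.cpN_cobarD_cmul X Y Z ha w
    have h2 : L.hA X Z (cobarD C 0 Δ X Z (L.cmul X Y Z a w)) = L.cmul X Y Z a w := by
      rw [← hA_cpN, h1, hA_cpN, map_sub, L.hA_cmul X Y Z ha', hA_ccons, sgn_one_sgn_one, ha,
        zero_sub, neg_neg]
    rw [rA, L.hA_cmul X Y Z ha, L.kA_cmul X Y Z ha, h2, L.cpN_cmul X Y Z ha, map_zero, sub_zero,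
      zero_add, sub_self, map_zero]
  · intro b hb
    exact hR _ (by rw [cpR_cgen, L.pR_letB _ _ b hb])
  · intro Y b hb w
    exact hR _ (by rw [cpR_ccons, L.pR_letB _ _ b hb])
  · intro Y b hb w hw
    refine hR _ ?_
    rw [← hw, L.cpR_cmul X Y Z hb]

theorem cpR_rA (X Z : O) (w : cobar C X Z) : L.cpR X Z (L.rA X Z w) = L.rA X Z w := by
  have h1 := L.cpN_rA X Z w
  rw [cpN_eq, sub_eq_zero] at h1
  exact h1.symm

/-- The defect of the homotopy for the quadratic part of the differential. -/
def r₀ (X Z : O) : cobar C X Z →ₗ[K] cobar C X Z :=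
  lid - L.kap X Z - (cobarD C 0 Δ X Z ∘ₗ L.h X Z + L.h X Z ∘ₗ cobarD C 0 Δ X Z)

theorem r₀_apply (X Z : O) (w : cobar C X Z) : L.r₀ X Z w = w - L.kap X Z w -
    (cobarD C 0 Δ X Z (L.hA X Z w) + cobarD C 0 Δ X Z (L.hB X Z w) +
      (L.hA X Z (cobarD C 0 Δ X Z w) + L.hB X Z (cobarD C 0 Δ X Z w))) := by
  rw [← map_add]
  rfl

theorem cpR_r₀ (X Z : O) (w : cobar C X Z) : L.cpR X Z (L.r₀ X Z w) = L.r₀ X Z w := by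
  have h1 := L.cpN_rA X Z w
  have h2 : ∀ w, L.cpN X Z (L.hB X Z w) = 0 := fun w => by rw [← cpR_hB, cpN_cpR]
  have h3 : L.cpN X Z (cobarD C 0 Δ X Z (L.hB X Z w)) = 0 := by
    rw [← cpR_hB, ← cpR_cobarD_cpR, cpN_cpR]
  have h4 : L.cpN X Z (L.r₀ X Z w) = 0 := by
    rw [← h1, r₀_apply, rA]
    simp only [map_sub, map_add, h2, h3, add_zero]
    rw [cpN_kap, cpN_kA, cpN_cpN]
  rw [cpN_eq, sub_eq_zero] at h4
  exact h4.symm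

theorem r₀_cmul (X Y Z : O) {b : C Y Z} (hb : L.pB Y Z b = b) (w : cobar C X Y) :
    L.r₀ X Z (L.cmul X Y Z b (L.cpR X Y w)) = 0 := by
  have hb' := L.sgn_letB Y Z hb
  have h1 : ∀ v, L.hA X Z (L.cmul X Y Z b (L.cpR X Y v)) = 0 := fun v => by
    rw [← L.cpR_cmul X Y Z hb, hA_cpR]
  have h2 : L.hA X Z (cobarD C 0 Δ X Z (L.cmul X Y Z b (L.cpR X Y w))) = 0 := by
    rw [← L.cpR_cmul X Y Z hb, ← cpR_cobarD_cpR, hA_cpR]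
  have h3 : L.hB X Z (cobarD C 0 Δ X Z (L.cmul X Y Z b (L.cpR X Y w))) =
      L.cmul X Y Z b (L.cpR X Y w) := by
    rw [L.cobarD_cmul X Y Z hb, map_sub, ← cpR_cobarD_cpR, L.hB_cmul X Y Z hb', hB_ccons,
      sgn_one_sgn_one, hb, cpR_cpR, hA_cpR, map_zero, sub_zero, zero_sub, neg_neg]
  rw [r₀_apply, h1, h2, h3, L.hB_cmul X Y Z hb, L.kap_cmul X Y Z hb]
  simp only [map_zero, sub_zero, zero_add, add_zero, sub_self]

theorem r₀_ccons (X Y Z : O) {b : C Y Z} (hb : L.pB Y Z b = b) (w : cobar C X Y) :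
    L.r₀ X Z (ccons C X Y Z b w) = ccons C X Y Z b (L.rA X Y w) +
      L.cmul X Y Z b (L.cpR X Y (cobarD C 0 Δ X Y (L.cpR X Y w) - cobarD C 0 Δ X Y w)) := by
  have hb' := L.sgn_letB Y Z hb
  have h1 : ∀ v, L.hA X Z (ccons C X Y Z b v) = 0 := fun v => by
    have : ccons C X Y Z b v = L.cpR X Z (ccons C X Y Z b v) := by
      rw [cpR_ccons, L.pR_letB _ _ b hb]
    rw [this, hA_cpR]
  have h2 : ∀ v, L.hA X Z (ccons C X Y Z ((C Y Z).sgn 1 b) v) = 0 := fun v => by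
    have : ccons C X Y Z ((C Y Z).sgn 1 b) v =
        L.cpR X Z (ccons C X Y Z ((C Y Z).sgn 1 b) v) := by
      rw [cpR_ccons, L.pR_letB _ _ _ hb']
    rw [this, hA_cpR]
  have h3 := L.cobarD_cmul X Y Z hb' w
  rw [sgn_one_sgn_one] at h3
  have h4 : cobarD C 0 Δ X Z (ccons C X Y Z b w) =
      -ccons C X Y Z ((C Y Z).sgn 1 b) (cobarD C 0 Δ X Y w) := by
    rw [cobarD_zero_ccons, L.comul_letB _ _ b hb]
    simp only [map_zero, lzero_app, neg_zero, zero_sub]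
  have h5 : ∀ v, cobarD C 0 Δ X Z (ccons C X Y Z ((C Y Z).sgn 1 b) v) =
      -ccons C X Y Z b (cobarD C 0 Δ X Y v) := fun v => by
    rw [cobarD_zero_ccons, L.comul_letB _ _ _ hb', sgn_one_sgn_one]
    simp only [map_zero, lzero_app, neg_zero, zero_sub]
  have h6 := L.cpR_cobarD_cpR X Y w
  rw [r₀_apply, h1, h4, hB_ccons, hb', map_neg, map_neg, h2, hB_ccons, sgn_one_sgn_one, hb,
    kap_ccons, hb, rA]
  have h7 := L.cpN_eq X Y w
  simp only [map_sub, map_add, map_neg, h3, h5, h6, h7, map_zero]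
  abel

theorem r₀_r₀_cpR (X Z : O) (w : cobar C X Z) :
    L.r₀ X Z (L.r₀ X Z (L.cpR X Z w)) = 0 := by
  refine L.word_induction (p := fun w => L.r₀ X Z (L.r₀ X Z (L.cpR X Z w)) = 0)
    ?_ ?_ ?_ ?_ ?_ ?_ ?_ w
  · intro x y hx hy
    rw [map_add, map_add, map_add, hx, hy, add_zero]
  · intro a ha
    rw [cpR_cgen, L.pR_letA _ _ a ha, map_zero, map_zero, map_zero]
  · intro Y a ha w
    rw [cpR_ccons, L.pR_letA _ _ a ha, map_zero, lzero_app, map_zero, map_zero]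
  · intro Y a ha w
    have h1 := L.cpN_cmul X Y Z ha w
    rw [cpN_eq, sub_eq_self] at h1
    rw [h1, map_zero, map_zero]
  · intro b hb
    have : L.r₀ X Z (cgen C X Z b) = 0 := by
      rw [r₀_apply, kap_cgen, L.pA_letB _ _ b hb, hb, zero_add, hA_cgen, hB_cgen, cobarD_zero_cgen,
        L.comul_letB _ _ b hb]
      simp only [map_zero, neg_zero, add_zero, sub_zero, sub_self]
    rw [cpR_cgen, L.pR_letB _ _ b hb, this, map_zero]
  · intro Y b hb w
    have h1 : L.rA X Y (L.rA X Y w) = 0 := by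
      have h2 := L.rA_cpR X Y (L.rA X Y w)
      rwa [cpR_rA] at h2
    rw [cpR_ccons, L.pR_letB _ _ b hb, L.r₀_ccons X Y Z hb, map_add, L.r₀_cmul X Y Z hb, L.r₀_ccons
      X Y Z hb, h1, cpR_rA, sub_self]
    simp only [map_zero, add_zero]
  · intro Y b hb w hw
    rw [← hw, L.cpR_cmul X Y Z hb, L.r₀_cmul X Y Z hb, map_zero]

theorem r₀_r₀_r₀ (X Z : O) (w : cobar C X Z) : L.r₀ X Z (L.r₀ X Z (L.r₀ X Z w)) = 0 := by
  rw [← cpR_r₀ L X Z w, r₀_r₀_cpR]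

end FirstLetter

section Length

variable {O : Type u}

/-- The words in a cobar construction with at most `l` letters. -/
def cfil (C : GQuiver K O) (X : O) : ∀ (_ : ℕ) (Z : O), Submodule K (cobar C X Z)
  | 0, _ => ⊥
  | l + 1, Z => Submodule.span K (Set.range (cgen C X Z) ∪
      {z | ∃ Y, ∃ c : C Y Z, ∃ w ∈ cfil C X l Y, z = ccons C X Y Z c w})

variable {C : GQuiver K O} {X : O}

theorem cgen_mem_cfil (l : ℕ) (Z : O) (c : C X Z) : cgen C X Z c ∈ cfil C X (l + 1) Z :=
  subset_span (Or.inl ⟨c, rfl⟩)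

theorem ccons_mem_cfil {l : ℕ} (Y Z : O) (c : C Y Z) {w : cobar C X Y} (hw : w ∈ cfil C X l Y) :
    ccons C X Y Z c w ∈ cfil C X (l + 1) Z :=
  subset_span (Or.inr ⟨Y, c, w, hw, rfl⟩)

theorem cfil_le {l : ℕ} {Z : O} {S : Submodule K (cobar C X Z)} (gen : ∀ c, cgen C X Z c ∈ S)
    (cons : ∀ Y c, ∀ w ∈ cfil C X l Y, ccons C X Y Z c w ∈ S) : cfil C X (l + 1) Z ≤ S := by
  refine span_le.2 ?_
  rintro _ (⟨c, rfl⟩ | ⟨Y, c, w, hw, rfl⟩)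
  · exact gen c
  · exact cons Y c w hw

theorem cfil_le_succ (l : ℕ) (Z : O) : cfil C X l Z ≤ cfil C X (l + 1) Z := by
  induction l generalizing Z with
  | zero => exact bot_le
  | succ l ih =>
    exact cfil_le (fun c => cgen_mem_cfil _ Z c) fun Y c w hw => ccons_mem_cfil Y Z c (ih Y hw)

theorem cfil_mono {l l' : ℕ} (h : l ≤ l') (Z : O) : cfil C X l Z ≤ cfil C X l' Z :=
  monotone_nat_of_le_succ (f := fun l => cfil C X l Z) (fun l => cfil_le_succ l Z) h

theorem exists_mem_cfil (Z : O) (w : cobar C X Z) : ∃ l, w ∈ cfil C X l Z := by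
  refine tbar_induction (qshift (-1) C) X (p := fun Z w => ∃ l, w ∈ cfil C X l Z) ?_ ?_ ?_ ?_ Z w
  · exact fun Z => ⟨0, zero_mem _⟩
  · rintro Z x y ⟨l, hx⟩ ⟨l', hy⟩
    exact ⟨max l l', add_mem (cfil_mono (le_max_left l l') Z hx)
      (cfil_mono (le_max_right l l') Z hy)⟩
  · exact fun Z i x hx => ⟨1, cgen_mem_cfil (C := C) 0 Z x⟩
  · rintro Y Z i x hx w ⟨l, hw⟩
    exact ⟨l + 1, ccons_mem_cfil (C := C) Y Z x hw⟩

theorem cfst_mem_cfil {Z Z' : O} (p : ∀ Y, C Y Z →ₗ[K] C Y Z') (l : ℕ) {w : cobar C X Z}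
    (hw : w ∈ cfil C X l Z) : cfst X p w ∈ cfil C X l Z' := by
  cases l with
  | zero => rw [(mem_bot K).1 hw, map_zero]; exact zero_mem _
  | succ l =>
    refine cfil_le (S := (cfil C X (l + 1) Z').comap (cfst X p)) (fun c => ?_)
      (fun Y c w hw => ?_) hw
    · rw [mem_comap, cfst_cgen]
      exact cgen_mem_cfil l Z' _
    · rw [mem_comap, cfst_ccons]
      exact ccons_mem_cfil Y Z' _ hw

theorem cobarD_mem_cfil (d : ∀ X Z, C X Z →ₗ[K] C X Z) (l : ℕ) {Z : O} {w : cobar C X Z}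
    (hw : w ∈ cfil C X l Z) : cobarD C d 0 X Z w ∈ cfil C X l Z := by
  induction l generalizing Z with
  | zero => rw [(mem_bot K).1 hw, map_zero]; exact zero_mem _
  | succ l ih =>
    refine cfil_le (S := (cfil C X (l + 1) Z).comap (cobarD C d 0 X Z)) (fun c => ?_)
      (fun Y c w hw => ?_) hw
    · rw [mem_comap, cobarD_cgen]
      simp only [Pi.zero_apply, lzero_app, map_zero, sub_zero]
      exact neg_mem (cgen_mem_cfil l Z _)
    · rw [mem_comap, cobarD_ccons]
      simp only [Pi.zero_apply, lzero_app, map_zero, sub_zero]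
      exact sub_mem (neg_mem (ccons_mem_cfil Y Z _ hw)) (ccons_mem_cfil Y Z _ (ih hw))

theorem cobarD_mem_cfil_succ (Δ : ∀ X Z, C X Z →ₗ[K] qtens C C X Z) (l : ℕ) {Z : O}
    {w : cobar C X Z} (hw : w ∈ cfil C X l Z) : cobarD C 0 Δ X Z w ∈ cfil C X (l + 1) Z := by
  induction l generalizing Z with
  | zero => rw [(mem_bot K).1 hw, map_zero]; exact zero_mem _
  | succ l ih =>
    refine cfil_le (S := (cfil C X (l + 1 + 1) Z).comap (cobarD C 0 Δ X Z)) (fun c => ?_)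
      (fun Y c w hw => ?_) hw
    · rw [mem_comap, FirstLetter.cobarD_zero_cgen]
      refine neg_mem ?_
      refine qtens_induction (p := fun z => cquad C X Z z ∈ cfil C X (l + 1 + 1) Z) ?_ ?_ ?_ _
      · rw [map_zero]; exact zero_mem _
      · intro x y hx hy; rw [map_add]; exact add_mem hx hy
      · intro Y x y
        rw [cquad_qmk]
        exact ccons_mem_cfil Y Z _ (cgen_mem_cfil l Y y)
    · rw [mem_comap, FirstLetter.cobarD_zero_ccons]
      refine sub_mem (neg_mem ?_) (ccons_mem_cfil Y Z _ (ih hw))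
      refine qtens_induction (p := fun z => tmul (qshift (-1) C) X Y Z (cquad C Y Z z) w ∈
        cfil C X (l + 1 + 1) Z) ?_ ?_ ?_ _
      · rw [map_zero, map_zero]; exact zero_mem _
      · intro x y hx hy; rw [map_add, map_add]; exact add_mem hx hy
      · intro V x y
        rw [FirstLetter.tmul_cquad_qmk]
        exact ccons_mem_cfil V Z _ (ccons_mem_cfil Y V _ hw)

end Length

namespace FirstLetter

section

variable {O : Type u} {C : GQuiver K O}
  {Δ : ∀ X Z, C X Z →ₗ[K] qtens C C X Z} (L : FirstLetter C Δ)

theorem cmul_mem_cfil {X Y Z : O} (c : C Y Z) {l : ℕ} {w : cobar C X Y} (hw : w ∈ cfil C X l Y) :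
    L.cmul X Y Z c w ∈ cfil C X l Z := by
  rw [cmul_eq]
  exact cfst_mem_cfil _ l hw

theorem hA_mem_cfil {X Z : O} {l : ℕ} {w : cobar C X Z} (hw : w ∈ cfil C X (l + 1) Z) :
    L.hA X Z w ∈ cfil C X l Z := by
  refine cfil_le (S := (cfil C X l Z).comap (L.hA X Z)) (fun c => ?_) (fun Y c w hw => ?_) hw
  · rw [mem_comap, hA_cgen]
    exact zero_mem _
  · rw [mem_comap, hA_ccons]
    exact neg_mem (L.cmul_mem_cfil _ hw)

theorem hB_mem_cfil {X Z : O} {l : ℕ} {w : cobar C X Z} (hw : w ∈ cfil C X (l + 1) Z) :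
    L.hB X Z w ∈ cfil C X l Z := by
  refine cfil_le (S := (cfil C X l Z).comap (L.hB X Z)) (fun c => ?_) (fun Y c w hw => ?_) hw
  · rw [mem_comap, hB_cgen]
    exact zero_mem _
  · rw [mem_comap, hB_ccons]
    refine sub_mem (neg_mem (L.cmul_mem_cfil _ (cfst_mem_cfil _ l hw))) ?_
    cases l with
    | zero =>
      rw [(mem_bot K).1 hw, map_zero, map_zero]
      exact zero_mem _
    | succ l => exact ccons_mem_cfil Y Z _ (L.hA_mem_cfil hw)

theorem h_mem_cfil {X Z : O} {l : ℕ} {w : cobar C X Z} (hw : w ∈ cfil C X (l + 1) Z) :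
    L.h X Z w ∈ cfil C X l Z :=
  add_mem (L.hA_mem_cfil hw) (L.hB_mem_cfil hw)

theorem kA_mem_cfil {X Z : O} {l : ℕ} {w : cobar C X Z} (hw : w ∈ cfil C X (l + 1) Z) :
    L.kA X Z w ∈ cfil C X (l + 1) Z := by
  refine cfil_le (S := (cfil C X (l + 1) Z).comap (L.kA X Z)) (fun c => ?_) (fun Y c w hw => ?_) hw
  · rw [mem_comap, kA_cgen]
    exact cgen_mem_cfil l Z _
  · rw [mem_comap, kA_ccons]
    exact zero_mem _

theorem kap_mem_cfil {X Z : O} {l : ℕ} {w : cobar C X Z} (hw : w ∈ cfil C X (l + 1) Z) :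
    L.kap X Z w ∈ cfil C X (l + 1) Z := by
  refine cfil_le (S := (cfil C X (l + 1) Z).comap (L.kap X Z)) (fun c => ?_) (fun Y c w hw => ?_) hw
  · rw [mem_comap, kap_cgen]
    exact cgen_mem_cfil l Z _
  · rw [mem_comap, kap_ccons]
    cases l with
    | zero =>
      rw [(mem_bot K).1 hw, map_zero, map_zero]
      exact zero_mem _
    | succ l => exact ccons_mem_cfil Y Z _ (L.kA_mem_cfil hw)

theorem r₀_mem_cfil {X Z : O} {l : ℕ} {w : cobar C X Z} (hw : w ∈ cfil C X l Z) :
    L.r₀ X Z w ∈ cfil C X l Z := by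
  cases l with
  | zero => rw [(mem_bot K).1 hw, map_zero]; exact zero_mem _
  | succ l =>
    refine sub_mem (sub_mem hw (L.kap_mem_cfil hw)) (add_mem ?_ ?_)
    · exact cobarD_mem_cfil_succ Δ l (L.h_mem_cfil hw)
    · exact L.h_mem_cfil (cobarD_mem_cfil_succ Δ (l + 1) hw)

theorem locally_nilpotent (d : ∀ X Z, C X Z →ₗ[K] C X Z) {X Z : O}
    (R : cobar C X Z →ₗ[K] cobar C X Z) (hR : ∀ w, R w = w - L.kap X Z w -
      (cobarD C d Δ X Z (L.h X Z w) + L.h X Z (cobarD C d Δ X Z w))) (w : cobar C X Z) :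
    ∃ n : ℕ, (R ^ n) w = 0 := by
  set S : cobar C X Z →ₗ[K] cobar C X Z :=
    cobarD C d 0 X Z ∘ₗ L.h X Z + L.h X Z ∘ₗ cobarD C d 0 X Z with hS
  have hS' : ∀ l, ∀ w ∈ cfil C X (l + 1) Z, S w ∈ cfil C X l Z := fun l w hw =>
    add_mem (cobarD_mem_cfil d l (L.h_mem_cfil hw)) (L.h_mem_cfil (cobarD_mem_cfil d (l + 1) hw))
  have hRS : ∀ w, R w = L.r₀ X Z w - S w := by
    intro w
    rw [hR, cobarD_add X Z w, cobarD_add X Z (L.h X Z w), map_add (L.h X Z)]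
    change _ = w - L.kap X Z w - (cobarD C 0 Δ X Z (L.h X Z w) + L.h X Z (cobarD C 0 Δ X Z w)) -
      (cobarD C d 0 X Z (L.h X Z w) + L.h X Z (cobarD C d 0 X Z w))
    abel
  have h1 : ∀ l, ∀ w ∈ cfil C X (l + 1) Z, R w - L.r₀ X Z w ∈ cfil C X l Z := by
    intro l w hw
    rw [hRS, sub_sub_cancel_left]
    exact neg_mem (hS' l w hw)
  have hRm : ∀ l, ∀ w ∈ cfil C X l Z, R w ∈ cfil C X l Z := by
    intro l w hw
    cases l with
    | zero => rw [(mem_bot K).1 hw, map_zero]; exact zero_mem _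
    | succ l =>
      have := add_mem (cfil_le_succ l Z (h1 l w hw)) (L.r₀_mem_cfil hw)
      rwa [sub_add_cancel] at this
  have h3 : ∀ l, ∀ w ∈ cfil C X (l + 1) Z, R (R (R w)) ∈ cfil C X l Z := by
    intro l w hw
    have e : R (R (R w)) = (R (R (R w)) - L.r₀ X Z (R (R w))) +
        L.r₀ X Z (R (R w) - L.r₀ X Z (R w)) + L.r₀ X Z (L.r₀ X Z (R w - L.r₀ X Z w)) := by
      simp only [map_sub, L.r₀_r₀_r₀ X Z w]
      abel
    rw [e]
    refine add_mem (add_mem ?_ ?_) ?_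
    · exact h1 l _ (hRm _ _ (hRm _ _ hw))
    · exact L.r₀_mem_cfil (h1 l _ (hRm _ _ hw))
    · exact L.r₀_mem_cfil (L.r₀_mem_cfil (h1 l _ hw))
  obtain ⟨l, hl⟩ := exists_mem_cfil Z w
  clear hR hS
  induction l generalizing w with
  | zero =>
    refine ⟨0, ?_⟩
    rw [(mem_bot K).1 hl, map_zero]
  | succ l ih =>
    obtain ⟨n, hn⟩ := ih _ (h3 l w hl)
    refine ⟨n + 3, ?_⟩
    rw [pow_add, Module.End.mul_apply]
    exact hn

/-! ### Degrees -/

theorem cmul_mem {X Y Z : O} {i j : ℤ} {c : C Y Z} (hc : c ∈ (C Y Z).gr i) {w : cobar C X Y}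
    (hw : w ∈ (cobar C X Y).gr j) : L.cmul X Y Z c w ∈ (cobar C X Z).gr (i + j) := by
  rw [cmul_eq, add_comm]
  refine cfst_mem X (k := i) (fun W n x hx => ?_) j w hw
  rw [add_comm]
  exact L.m_mem W Y Z i n c hc x hx

theorem hA_hasDegree (X Z : O) : HasDegree (cobar C X Z).gr (cobar C X Z).gr (L.hA X Z) (-1) := by
  intro n w hw
  refine cobar_gr_le X (S := ((cobar C X Z).gr (n + -1)).comap (L.hA X Z)) ?_ ?_ hw
  · rintro i hi c hc
    rw [mem_comap, hA_cgen]
    exact zero_mem _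
  · rintro Y i j hi c hc w hw
    rw [mem_comap, hA_ccons]
    have h1 := L.pA_deg Y Z i _ (sgn_mem _ 1 hc)
    rw [add_zero] at h1
    have h2 := L.cmul_mem h1 hw
    rw [show i + j = n + -1 by rw [← hi]; ring] at h2
    exact neg_mem h2

theorem hB_hasDegree (X Z : O) : HasDegree (cobar C X Z).gr (cobar C X Z).gr (L.hB X Z) (-1) := by
  intro n w hw
  refine cobar_gr_le X (S := ((cobar C X Z).gr (n + -1)).comap (L.hB X Z)) ?_ ?_ hw
  · rintro i hi c hc
    rw [mem_comap, hB_cgen]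
    exact zero_mem _
  · rintro Y i j hi c hc w hw
    rw [mem_comap, hB_ccons]
    have h1 := L.pB_deg Y Z i _ (sgn_mem _ 1 hc)
    rw [add_zero] at h1
    have h3 := cfst_mem X (fun W => L.pR_deg W Y) j w hw
    rw [add_zero] at h3
    have h2 := L.cmul_mem h1 h3
    rw [show i + j = n + -1 by rw [← hi]; ring] at h2
    exact sub_mem (neg_mem h2) (ccons_mem h1 (L.hA_hasDegree X Y j w hw) (by rw [← hi]; ring))

theorem h_hasDegree (X Z : O) : HasDegree (cobar C X Z).gr (cobar C X Z).gr (L.h X Z) (-1) :=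
  fun n w hw => add_mem (L.hA_hasDegree X Z n w hw) (L.hB_hasDegree X Z n w hw)

end

end FirstLetter

section TensorLetters

variable {O Ω : Type u}

/-- The projection from the reduced tensor quiver onto its generators. -/
def tproj (Q : GQuiver K O) (X Z : O) : tbar Q X Z →ₗ[K] Q X Z := desc fun n => match n with
    | 0 => lid
    | _ + 1 => 0

theorem tproj_tgen (Q : GQuiver K O) (X Z : O) (x : Q X Z) : tproj Q X Z (tgen Q X Z x) = x :=
  desc_tgen Q X Z _ _

theorem tproj_tcons (Q : GQuiver K O) (X Y Z : O) (x : Q Y Z) (w : tbar Q X Y) :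
    tproj Q X Z (tcons Q X Y Z x w) = 0 := by
  induction w using dsum_induction with
  | zero => simp only [map_zero]
  | add u v hu hv => rw [map_add, map_add, hu, hv, add_zero]
  | of n w =>
    change tproj Q X Z (tcons Q X Y Z x (tin Q n X Y w)) = _
    rw [tcons_tin]
    exact desc_tin Q (n + 1) X Z _ _

theorem tproj_hasDegree (Q : GQuiver K O) (X Z : O) :
    HasDegree (tbar Q X Z).gr (Q X Z).gr (tproj Q X Z) 0 := by
  intro k w hw
  rw [add_zero]
  refine tbar_gr_induction Q X (p := fun Z k w => tproj Q X Z w ∈ (Q X Z).gr k) ?_ ?_ ?_ ?_ ?_ Z k w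
    hw
  · intro Z k
    rw [map_zero]
    exact zero_mem _
  · intro Z k x y hx hy
    rw [map_add]
    exact add_mem hx hy
  · intro Z k a x hx
    rw [map_smul]
    exact Submodule.smul_mem _ _ hx
  · intro Z k x hx
    rwa [tproj_tgen]
  · intro Y Z i j x hx w hw _
    rw [tproj_tcons]
    exact zero_mem _

theorem tgen_tproj_hasDegree (Q : GQuiver K O) (X Z : O) :
    HasDegree (tbar Q X Z).gr (tbar Q X Z).gr (tgen Q X Z ∘ₗ tproj Q X Z) 0 := by
  intro k w hw
  have := tproj_hasDegree Q X Z k w hw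
  rw [add_zero] at this ⊢
  exact tgen_mem this

variable (E : GQuiver K O) (F : GQuiver K Ω)

/-- The projection onto the letters of the first kind. -/
def tredL (X Z : O × Ω) : tred E F X Z →ₗ[K] tred E F X Z :=
  rdiag 0 (tgen E X.1 Z.1 ∘ₗ tproj E X.1 Z.1) 0

/-- The projection onto the letters of the second kind. -/
def tredR (X Z : O × Ω) : tred E F X Z →ₗ[K] tred E F X Z :=
  rdiag 0 0 (tgen F X.2 Z.2 ∘ₗ tproj F X.2 Z.2)

/-- The projection onto the words in letters of the second kind. -/
def tredRR (X Z : O × Ω) : tred E F X Z →ₗ[K] tred E F X Z := rdiag 0 0 lid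

variable {E F}

theorem exists_redL {P P' : GQuiver K O} {Q Q' : GQuiver K Ω} {X Z : O × Ω}
    (l : P X.1 Z.1 →ₗ[K] P' X.1 Z.1) {p : red P' Q' X Z → Prop} (zero : p 0)
    (of : ∀ h x, p (redL P' Q' X Z h (l x))) (c : red P Q X Z) : p (rdiag 0 l 0 c) := by
  obtain ⟨t, x, y⟩ := c
  have h1 : rdiag (Q := Q) (Q' := Q') 0 l 0 (t, x, y) = (0, powMap id l x, 0) :=
    Prod.ext rfl (Prod.ext rfl (by
      refine pow_induction (P := fun y => powMap id (0 : Q X.2 Z.2 →ₗ[K] Q' X.2 Z.2) y = 0) ?_ ?_ y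
      · intro _
        exact map_zero _
      · intro h y
        rw [powMap_powIncl, lzero_app, map_zero]))
  rw [h1]
  refine pow_induction (P := fun x => p (0, powMap id l x, 0)) ?_ ?_ x
  · intro _
    rw [map_zero]
    exact zero
  · intro h x
    rw [powMap_powIncl]
    exact of h x

theorem exists_redR {P P' : GQuiver K O} {Q Q' : GQuiver K Ω} {X Z : O × Ω}
    (r : Q X.2 Z.2 →ₗ[K] Q' X.2 Z.2) {p : red P' Q' X Z → Prop} (zero : p 0)
    (of : ∀ h x, p (redR P' Q' X Z h (r x))) (c : red P Q X Z) : p (rdiag 0 0 r c) := by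
  obtain ⟨t, x, y⟩ := c
  have h1 : rdiag (P := P) (P' := P') 0 0 r (t, x, y) = (0, 0, powMap id r y) :=
    Prod.ext rfl (Prod.ext (by
      refine pow_induction (P := fun y => powMap id (0 : P X.1 Z.1 →ₗ[K] P' X.1 Z.1) y = 0) ?_ ?_ x
      · intro _
        exact map_zero _
      · intro h y
        rw [powMap_powIncl, lzero_app, map_zero]) rfl)
  rw [h1]
  refine pow_induction (P := fun y => p (0, 0, powMap id r y)) ?_ ?_ y
  · intro _
    rw [map_zero]
    exact zero
  · intro h x
    rw [powMap_powIncl]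
    exact of h x

theorem tredL_cases {p : ∀ X Z, tred E F X Z → Prop} (zero : ∀ X Z, p X Z 0)
    (of : ∀ y z b a, p (y, b) (z, b) (letL E F y z b a)) {X Z : O × Ω} {c : tred E F X Z}
    (hc : tredL E F X Z c = c) : p X Z c := by
  rw [← hc]
  refine exists_redL _ (zero X Z) ?_ c
  obtain ⟨y, b⟩ := X
  obtain ⟨z, b'⟩ := Z
  intro h x
  have : ∀ h : b = b', p (y, b) (z, b') (redL (tbar E) (tbar F) (y, b) (z, b') h
      (tgen E y z (tproj E y z x))) := by
    intro h
    subst h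
    exact of y z b _
  exact this h

theorem tredR_cases {p : ∀ X Z, tred E F X Z → Prop} (zero : ∀ X Z, p X Z 0)
    (of : ∀ x y z b, p (x, y) (x, z) (letR E F x y z b)) {X Z : O × Ω} {c : tred E F X Z}
    (hc : tredR E F X Z c = c) : p X Z c := by
  rw [← hc]
  refine exists_redR _ (zero X Z) ?_ c
  obtain ⟨x, y⟩ := X
  obtain ⟨x', z⟩ := Z
  intro h v
  have : ∀ h : x = x', p (x, y) (x', z) (redR (tbar E) (tbar F) (x, y) (x', z) h
      (tgen F y z (tproj F y z v))) := by
    intro h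
    subst h
    exact of x y z _
  exact this h

theorem tredRR_cases {X Z : O × Ω} {p : tred E F X Z → Prop} (zero : p 0)
    (of : ∀ h v, p (redR (tbar E) (tbar F) X Z h v)) {c : tred E F X Z}
    (hc : tredRR E F X Z c = c) : p c := by
  rw [← hc]
  exact exists_redR _ zero (fun h x => of h x) c

theorem map_tredComp_letL {X : O × Ω} {y z : O} {b : Ω}
    (f : tred E F X (z, b) →ₗ[K] N) (hT : ∀ w, f (redT (tbar E) (tbar F) X (z, b) w) = 0)
    (hL : ∀ h y a x, f (redL (tbar E) (tbar F) X (z, b) h (tcons E X.1 y z a x)) = 0) (a : E y z)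
    (c : tred E F X (y, b)) :
    f (tredComp E F X (y, b) (z, b) (letL E F y z b a) c) = 0 := by
  refine lapply_eq (f ∘ₗ tredComp E F X (y, b) (z, b) (letL E F y z b a)) 0 (red_ext ?_ ?_ ?_) c
  · intro i x _ j v _
    rw [comp_app, tredComp_letL_redT, hT, lzero_app]
  · intro h i x _
    rw [comp_app, tredComp_letL_redL, hL, lzero_app]
  · intro h j v _
    have : ∀ h : X.1 = y, f (tredComp E F X (y, b) (z, b) (letL E F y z b a)
        (redR (tbar E) (tbar F) X (y, b) h v)) = 0 := by
      intro h
      subst h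
      rw [tredComp_letL_redR, hT]
    exact this h

theorem tredL_redT (X Z : O × Ω) (w) : tredL E F X Z (redT (tbar E) (tbar F) X Z w) = 0 :=
  (rdiag_redT w).trans (map_zero _)

theorem tredL_redL (X Z : O × Ω) (h) (x) : tredL E F X Z (redL (tbar E) (tbar F) X Z h x) =
    redL (tbar E) (tbar F) X Z h (tgen E X.1 Z.1 (tproj E X.1 Z.1 x)) := rdiag_redL h x

theorem tredL_redR (X Z : O × Ω) (h) (x) : tredL E F X Z (redR (tbar E) (tbar F) X Z h x) = 0 :=
  (rdiag_redR h x).trans (map_zero _)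

theorem tredR_redT (X Z : O × Ω) (w) : tredR E F X Z (redT (tbar E) (tbar F) X Z w) = 0 :=
  (rdiag_redT w).trans (map_zero _)

theorem tredR_redL (X Z : O × Ω) (h) (x) : tredR E F X Z (redL (tbar E) (tbar F) X Z h x) = 0 :=
  (rdiag_redL h x).trans (map_zero _)

theorem tredR_redR (X Z : O × Ω) (h) (x) : tredR E F X Z (redR (tbar E) (tbar F) X Z h x) =
    redR (tbar E) (tbar F) X Z h (tgen F X.2 Z.2 (tproj F X.2 Z.2 x)) := rdiag_redR h x

theorem tredRR_redT (X Z : O × Ω) (w) : tredRR E F X Z (redT (tbar E) (tbar F) X Z w) = 0 :=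
  (rdiag_redT w).trans (map_zero _)

theorem tredRR_redL (X Z : O × Ω) (h) (x) : tredRR E F X Z (redL (tbar E) (tbar F) X Z h x) = 0 :=
  (rdiag_redL h x).trans (map_zero _)

theorem tredRR_redR (X Z : O × Ω) (h) (x) : tredRR E F X Z (redR (tbar E) (tbar F) X Z h x) =
    redR (tbar E) (tbar F) X Z h x := rdiag_redR h x

theorem zero_hasDegree {M N : GrMod.{u, u} K} (n : ℤ) : HasDegree M.gr N.gr (0 : M →ₗ[K] N) n :=
  fun _ _ _ => zero_mem _

theorem id_hasDegree {M : GrMod.{u, u} K} : HasDegree M.gr M.gr (lid : M →ₗ[K] M) 0 :=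
  fun i x hx => by rwa [add_zero]

variable (E F)

theorem tredL_letL (y z : O) (b : Ω) (a : E y z) :
    tredL E F (y, b) (z, b) (letL E F y z b a) = letL E F y z b a := by
  refine (tredL_redL _ _ _ _).trans ?_
  rw [tproj_tgen]
  rfl

theorem tredR_letR (x : O) (y z : Ω) (b : F y z) :
    tredR E F (x, y) (x, z) (letR E F x y z b) = letR E F x y z b := by
  refine (tredR_redR _ _ _ _).trans ?_
  rw [tproj_tgen]
  rfl

theorem qmap_tredComp_zero (X Y Z : O × Ω) (c) :
    qmap (P := tred E F) (Q := tred E F) (P' := tred E F) (Q' := tred E F) (X := X)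
      (Z := Y) (X' := X) (Z' := Z) (fun W => tredComp E F W Y Z 0) (fun _ => lid) c = 0 := by
  refine lcongr (g := 0) (qtens_ext fun V i x _ j y _ => ?_) c
  rw [qmap_qmk_id, map_zero, lzero_app, map_zero]
  rfl

/-- The formula for the comultiplication of the concatenation of `a` with a word, up to terms with
a first factor in letters of the second kind. -/
def HasComulComp (X Y Z : O × Ω) (a : tred E F Y Z) : Prop :=
  ∀ c : tred E F X Y, ∃ θ, tredComul E F X Z (tredComp E F X Y Z a c) =
    qmk (tred E F) (tred E F) X Y Z a c +
      qmap (P := tred E F) (Q := tred E F) (P' := tred E F) (Q' := tred E F) (X := X)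
        (Z := Y) (X' := X) (Z' := Z)
        (fun W => tredComp E F W Y Z a) (fun _ => lid) (tredComul E F X Y c) + θ ∧
      qmap (P := tred E F) (Q := tred E F) (P' := tred E F) (Q' := tred E F) (X := X)
        (Z := Z) (X' := X) (Z' := Z)
        (fun W => lid - tredRR E F W Z) (fun _ => lid) θ = 0

theorem hasComulComp_letL (X : O × Ω) (y z : O) (b : Ω) (a : E y z) :
    HasComulComp E F X (y, b) (z, b) (letL E F y z b a) := by
  intro c
  refine ⟨_, tredComul_letL_comp X y z b a c, ?_⟩
  refine qlift_tredTheta X y z b a _ (fun W h v => ?_) _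
  have h1 : (lid - tredRR E F W (z, b) : tred E F W (z, b) →ₗ[K] tred E F W (z, b)) (redR (tbar E) (tbar F) W (z, b) h v) = 0 :=
    sub_eq_zero.2 (tredRR_redR W (z, b) h v).symm
  refine lext fun y => ?_
  exact (congrArg (fun u => qmk (tred E F) (tred E F) X W (z, b) u y) h1).trans (by
    rw [map_zero])

theorem tredComul_redR_tredRR (X Z : O × Ω) (h) (v) :
    qmap (P := tred E F) (Q := tred E F) (P' := tred E F) (Q' := tred E F) (X := X)
        (Z := Z) (X' := X) (Z' := Z)
        (fun W => tredRR E F W Z) (fun _ => lid)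
        (tredComul E F X Z (redR (tbar E) (tbar F) X Z h v)) =
      tredComul E F X Z (redR (tbar E) (tbar F) X Z h v) := by
  have h1 := redComul_redR (P := tbar E) (Q := tbar F) (ΔP := tcomul E) (ΔQ := tcomul F) X Z h v
  rw [h1]
  generalize tcomul F X.2 Z.2 v = z
  refine lcongr (f := qmap (P := tred E F) (Q := tred E F) (P' := tred E F)
    (Q' := tred E F) (X := X) (Z := Z) (X' := X) (Z' := Z)
    (fun W => tredRR E F W Z) (fun _ => lid) ∘ₗ (qlift (P := tbar F) (Q := tbar F) fun y =>
      (qmk (red (tbar E) (tbar F)) (red (tbar E) (tbar F)) X (X.1, y) Z).compl₁₂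
        (redR (tbar E) (tbar F) (X.1, y) Z h) (redR (tbar E) (tbar F) X (X.1, y) rfl)))
    (qtens_ext fun Y i x _ j y _ => ?_) z
  rw [comp_app, qlift_qmk, compl₁₂_app, qmap_qmk_id, tredRR_redR]

theorem hasComulComp_zero (X Y Z : O × Ω) : HasComulComp E F X Y Z 0 := by
  intro c
  refine ⟨0, ?_, map_zero _⟩
  rw [qmap_tredComp_zero, map_zero, lzero_app, map_zero, map_zero, lzero_app, add_zero, add_zero]

/-- The formula for the comultiplication of the concatenation of `b` with a word in letters of the
second kind. -/
def HasComulCompR (X Y Z : O × Ω) (b : tred E F Y Z) : Prop :=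
  ∀ c : tred E F X Y, tredRR E F X Y c = c → tredComul E F X Z (tredComp E F X Y Z b c) =
    qmk (tred E F) (tred E F) X Y Z b c +
      qmap (P := tred E F) (Q := tred E F) (P' := tred E F) (Q' := tred E F) (X := X)
        (Z := Y) (X' := X) (Z' := Z)
        (fun W => tredComp E F W Y Z b) (fun _ => lid) (tredComul E F X Y c)

theorem hasComulCompR_zero (X Y Z : O × Ω) : HasComulCompR E F X Y Z 0 := by
  intro c _
  rw [qmap_tredComp_zero, map_zero, lzero_app, map_zero, map_zero, lzero_app, add_zero]

theorem hasComulCompR_letR (X : O × Ω) (x : O) (y z : Ω) (b : F y z) :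
    HasComulCompR E F X (x, y) (x, z) (letR E F x y z b) := by
  intro c hc
  refine tredRR_cases (p := fun c =>
    tredComul E F X (x, z) (tredComp E F X (x, y) (x, z) (letR E F x y z b) c) =
      qmk (tred E F) (tred E F) X (x, y) (x, z) (letR E F x y z b) c +
        qmap (P := tred E F) (Q := tred E F) (P' := tred E F) (Q' := tred E F) (X := X)
          (Z := (x, y)) (X' := X) (Z' := (x, z))
          (fun W => tredComp E F W (x, y) (x, z) (letR E F x y z b)) (fun _ => lid)
          (tredComul E F X (x, y) c)) ?_ (fun h v => ?_) hc
  · simp only [map_zero, add_zero]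
  · rw [tredComp_letR_redR]
    exact tredComul_redR_tcons X x y z b h v

theorem hasComulRR (X Z : O × Ω) (c : tred E F X Z) (hc : tredRR E F X Z c = c) :
    qmap (P := tred E F) (Q := tred E F) (P' := tred E F) (Q' := tred E F) (X := X)
      (Z := Z) (X' := X) (Z' := Z) (fun W => tredRR E F W Z) (fun _ => lid)
      (tredComul E F X Z c) = tredComul E F X Z c := by
  refine tredRR_cases (p := fun c => qmap (P := tred E F) (Q := tred E F) (P' := tred E F)
    (Q' := tred E F) (X := X) (Z := Z) (X' := X) (Z' := Z) (fun W => tredRR E F W Z)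
    (fun _ => lid) (tredComul E F X Z c) = tredComul E F X Z c) ?_ (fun h v => ?_) hc
  · simp only [map_zero]
  · exact tredComul_redR_tredRR E F X Z h v

/-- The first letters in the reduced tensor product of two tensor cocategories. -/
def tredFirstLetter : FirstLetter (tred E F) (tredComul E F) where
  m := tredComp E F
  pA := tredL E F
  pB := tredR E F
  pR := tredRR E F
  m_mem X Y Z i j f hf g hg := redComp_mem (P := tbar E) (Q := tbar F)
    (cP := tmul E) (cQ := tmul F) (fun X Y Z i j f hf g hg => tmul_mem (Q := E) X Y Z hf hg)
    (fun X Y Z i j f hf g hg => tmul_mem (Q := F) X Y Z hf hg) X Y Z hf hg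
  pA_deg X Z := rdiag_hasDegree (zero_hasDegree 0) (tgen_tproj_hasDegree E X.1 Z.1)
    (zero_hasDegree 0)
  pB_deg X Z := rdiag_hasDegree (zero_hasDegree 0) (zero_hasDegree 0)
    (tgen_tproj_hasDegree F X.2 Z.2)
  pR_deg X Z := rdiag_hasDegree (zero_hasDegree 0) (zero_hasDegree 0) id_hasDegree
  ind Y p add letA compA letB compB := by
    refine fun Z c => tred_induction (p := p) add ?_ ?_ ?_ ?_ Z c
    · exact fun z i a _ => letA (z, Y.2) _ (tredL_letL E F Y.1 z Y.2 a)
    · exact fun y z b i a _ c => compA (y, b) (z, b) _ (tredL_letL E F y z b a) c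
    · exact fun z i b _ => letB (Y.1, z) _ (tredR_letR E F Y.1 Y.2 z b)
    · intro y z i b _ v
      have := compB (Y.1, y) (Y.1, z) _ (tredR_letR E F Y.1 y z b)
        (redR (tbar E) (tbar F) Y (Y.1, y) rfl v) (tredRR_redR Y (Y.1, y) rfl v)
      rwa [tredComp_letR_redR] at this
  pB_letA X Z a ha := tredL_cases (p := fun X Z a => tredR E F X Z a = 0)
    (fun _ _ => map_zero _) (fun _ _ _ _ => tredR_redL _ _ _ _) ha
  pR_letA X Z a ha := tredL_cases (p := fun X Z a => tredRR E F X Z a = 0)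
    (fun _ _ => map_zero _) (fun _ _ _ _ => tredRR_redL _ _ _ _) ha
  comul_letA X Z a ha := tredL_cases (p := fun X Z a => tredComul E F X Z a = 0)
    (fun _ _ => map_zero _) (fun y z b a => tredComul_letL y z b a) ha
  pA_compA X Y Z a ha := tredL_cases
    (p := fun Y Z a => ∀ c, tredL E F X Z (tredComp E F X Y Z a c) = 0)
    (fun _ _ c => by rw [map_zero, lzero_app, map_zero])
    (fun _ _ _ a c => map_tredComp_letL _ (tredL_redT _ _) (fun h y a x => by
      rw [tredL_redL, tproj_tcons, map_zero, map_zero]) a c) ha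
  pB_compA X Y Z a ha := tredL_cases
    (p := fun Y Z a => ∀ c, tredR E F X Z (tredComp E F X Y Z a c) = 0)
    (fun _ _ c => by rw [map_zero, lzero_app, map_zero])
    (fun _ _ _ a c => map_tredComp_letL _ (tredR_redT _ _) (fun h y a x => tredR_redL _ _ _ _) a c)
    ha
  pR_compA X Y Z a ha := tredL_cases
    (p := fun Y Z a => ∀ c, tredRR E F X Z (tredComp E F X Y Z a c) = 0)
    (fun _ _ c => by rw [map_zero, lzero_app, map_zero])
    (fun _ _ _ a c => map_tredComp_letL _ (tredRR_redT _ _)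
      (fun h y a x => tredRR_redL _ _ _ _) a c) ha
  comul_compA X Y Z a ha := tredL_cases (p := HasComulComp E F X) (hasComulComp_zero E F X)
    (hasComulComp_letL E F X) ha
  pA_letB X Z a ha := tredR_cases (p := fun X Z a => tredL E F X Z a = 0)
    (fun _ _ => map_zero _) (fun _ _ _ _ => tredL_redR _ _ _ _) ha
  pR_letB X Z a ha := tredR_cases (p := fun X Z a => tredRR E F X Z a = a)
    (fun _ _ => map_zero _) (fun _ _ _ _ => tredRR_redR _ _ _ _) ha
  comul_letB X Z a ha := tredR_cases (p := fun X Z a => tredComul E F X Z a = 0)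
    (fun _ _ => map_zero _) (fun x y z b => tredComul_letR x y z b) ha
  pA_compB X Y Z b hb := tredR_cases
    (p := fun Y Z b => ∀ c, tredRR E F X Y c = c → tredL E F X Z (tredComp E F X Y Z b c) = 0)
    (fun _ _ c _ => by rw [map_zero, lzero_app, map_zero])
    (fun x y z b c hc => tredRR_cases
      (p := fun c => tredL E F X (x, z) (tredComp E F X (x, y) (x, z) (letR E F x y z b) c) = 0)
      (by rw [map_zero, map_zero]) (fun h v => by rw [tredComp_letR_redR, tredL_redR]) hc) hb
  pB_compB X Y Z b hb := tredR_cases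
    (p := fun Y Z b => ∀ c, tredRR E F X Y c = c → tredR E F X Z (tredComp E F X Y Z b c) = 0)
    (fun _ _ c _ => by rw [map_zero, lzero_app, map_zero])
    (fun x y z b c hc => tredRR_cases
      (p := fun c => tredR E F X (x, z) (tredComp E F X (x, y) (x, z) (letR E F x y z b) c) = 0)
      (by rw [map_zero, map_zero]) (fun h v => by
        rw [tredComp_letR_redR, tredR_redR, tproj_tcons, map_zero, map_zero]) hc) hb
  pR_compB X Y Z b hb := tredR_cases (p := fun Y Z b => ∀ c, tredRR E F X Y c = c →
      tredRR E F X Z (tredComp E F X Y Z b c) = tredComp E F X Y Z b c)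
    (fun _ _ c _ => by rw [map_zero, lzero_app, map_zero])
    (fun x y z b c hc => tredRR_cases
      (p := fun c => tredRR E F X (x, z) (tredComp E F X (x, y) (x, z) (letR E F x y z b) c) =
        tredComp E F X (x, y) (x, z) (letR E F x y z b) c)
      (by rw [map_zero, map_zero]) (fun h v => by rw [tredComp_letR_redR, tredRR_redR]) hc) hb
  comul_compB X Y Z b hb := tredR_cases (p := HasComulCompR E F X) (hasComulCompR_zero E F X)
    (hasComulCompR_letR E F X) hb
  comul_pR X Z c hc := hasComulRR E F X Z c hc

end TensorLetters

section Operations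

namespace AInfCat

variable (A : AInfCat K)

/-- The total operation of `A[1]`. -/
abbrev bop (X Z : A.Ob) : A.bar X Z →ₗ[K] A.sHom X Z := opTotal A.sHom A.b X Z

theorem bop_tgen (X Z : A.Ob) (x : A.sHom X Z) : A.bop X Z (tgen A.sHom X Z x) = -A.d X Z x :=
  desc_tgen ..

theorem bop_tcons_tgen (X Y Z : A.Ob) (x : A.sHom Y Z) (y : A.sHom X Y) :
    A.bop X Z (tcons A.sHom X Y Z x (tgen A.sHom X Y y)) =
      -A.comp X Y Z ((A.sHom Y Z).sgn 1 x) y := by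
  have h := tcons_tin A.sHom 0 X Y Z x y
  change A.bop X Z (tcons A.sHom X Y Z x (tin A.sHom 0 X Y y)) = _
  rw [h, bop, opTotal, desc_tin]
  have h' := A.unshiftPow_tmk 0 X Y Z x y
  change -(A.m 1 X Z (A.unshiftPow X 1 Z (tmk A.sHom 0 X Y Z x y))) = _
  rw [h']
  rfl

theorem bop_tcons_tcons (hA : A.IsDG) (X W Y Z : A.Ob) (x : A.sHom Y Z) (y : A.sHom W Y)
    (w : A.bar X W) :
    A.bop X Z (tcons A.sHom X Y Z x (tcons A.sHom X W Y y w)) = 0 := by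
  induction w using dsum_induction with
  | zero => rw [map_zero, map_zero, map_zero]
  | add u v hu hv => rw [map_add, map_add, map_add, hu, hv, add_zero]
  | of n w =>
    change A.bop X Z (tcons A.sHom X Y Z x (tcons A.sHom X W Y y (tin A.sHom n X W w))) = 0
    rw [tcons_tin, tcons_tin, bop, opTotal, desc_tin, b, hA (n + 1 + 1) (by omega) X Z]
    rw [LinearMap.zero_comp, LinearMap.comp_zero, neg_zero, lzero_app]

theorem barD_tgen (X Z : A.Ob) (x : A.sHom X Z) :
    A.barD X Z (tgen A.sHom X Z x) = -tgen A.sHom X Z (A.d X Z x) := by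
  have h := tins_tgen A.sHom A.bop (fun X Y => (A.sHom X Y).sgn 1) (fun _ _ => lid) X Z x
  refine h.trans ?_
  rw [tpre, ladd_app, comp_app _ (tcomul A.sHom X Z), tcomul_tgen, map_zero, add_zero, comp_app,
    bop_tgen, map_neg]

theorem barD_tcons (X Y Z : A.Ob) (x : A.sHom Y Z) (w : A.bar X Y) :
    A.barD X Z (tcons A.sHom X Y Z x w) =
      tgen A.sHom X Z (A.bop X Z (tcons A.sHom X Y Z x w)) - tcons A.sHom X Y Z (A.d Y Z x) w +
      (qlift fun W => (tcons A.sHom X W Z).compl₁₂ (A.bop W Z ∘ₗ tcons A.sHom W Y Z x)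
        lid) (tcomul A.sHom X Y w) +
      tcons A.sHom X Y Z ((A.sHom Y Z).sgn 1 x) (A.barD X Y w) := by
  have h := tins_tcons A.sHom A.bop (fun X Y => (A.sHom X Y).sgn 1) (fun _ _ => lid) X Y Z x w
  refine h.trans (congrArg (· + _) ?_)
  rw [tpre, ladd_app, comp_app _ (tcomul A.sHom X Z), tcomul_tcons, map_add, comp_app, qlift_qmk,
    compl₁₂_app, bop_tgen, map_neg, lneg_app, ← add_assoc, ← sub_eq_add_neg, qlift_qmap]
  rfl

theorem barD_tcons_tgen (X Y Z : A.Ob) (x : A.sHom Y Z) (y : A.sHom X Y) :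
    A.barD X Z (tcons A.sHom X Y Z x (tgen A.sHom X Y y)) =
      -tgen A.sHom X Z (A.comp X Y Z ((A.sHom Y Z).sgn 1 x) y) -
      tcons A.sHom X Y Z (A.d Y Z x) (tgen A.sHom X Y y) -
      tcons A.sHom X Y Z ((A.sHom Y Z).sgn 1 x) (tgen A.sHom X Y (A.d X Y y)) := by
  rw [barD_tcons, tcomul_tgen, map_zero, add_zero, barD_tgen, map_neg, bop_tcons_tgen, map_neg, ←
    sub_eq_add_neg]

theorem d_d (X Y : A.Ob) (f : A.Hom X Y) : A.d X Y (A.d X Y f) = 0 := by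
  have h := A.bar_isDGCocat.d_d X Y (tgen A.sHom X Y f)
  rw [barD_tgen, map_neg, barD_tgen, neg_neg] at h
  rw [← tproj_tgen A.sHom X Y (A.d X Y (A.d X Y f)), h, map_zero]

theorem d_isDifferential (X Y : A.Ob) : IsDifferential (A.Hom X Y).gr (A.d X Y) := by
  refine ⟨fun i x hx => ?_, A.d_d X Y⟩
  have := A.m_deg 0 X Y i x hx
  rwa [Nat.cast_zero, sub_zero] at this

theorem comp_mem (X Y Z : A.Ob) (i j : ℤ) (f : A.Hom Y Z) (hf : f ∈ (A.Hom Y Z).gr i)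
    (g : A.Hom X Y) (hg : g ∈ (A.Hom X Y).gr j) : A.comp X Y Z f g ∈ (A.Hom X Z).gr (i + j) := by
  have := A.m_deg 1 X Z (i + j) (qmk A.Hom (tpow A.Hom 0) X Y Z f g)
    (qmk_mem (P := A.Hom) (Q := tpow A.Hom 0) hf hg rfl)
  rwa [Nat.cast_one, sub_self, add_zero] at this

theorem sHom_mem {X Y : A.Ob} {i : ℤ} {f : A.Hom X Y} (hf : f ∈ (A.Hom X Y).gr i) :
    f ∈ (A.sHom X Y).gr (i - 1) := by
  change f ∈ (A.Hom X Y).gr (1 + (i - 1))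
  rwa [add_sub_cancel]

theorem sHom_sgn {X Y : A.Ob} {i : ℤ} {f : A.Hom X Y} (hf : f ∈ (A.Hom X Y).gr i) :
    (A.sHom X Y).sgn 1 f = -((i.negOnePow : ℤ) • f) := by
  rw [sgn_one_of_mem _ (A.sHom_mem hf), negOnePow_sub, negOnePow_one]
  simp

theorem d_comp (X Y Z : A.Ob) (i : ℤ) (f : A.Hom Y Z) (hf : f ∈ (A.Hom Y Z).gr i)
    (g : A.Hom X Y) : A.d X Z (A.comp X Y Z f g) =
      A.comp X Y Z (A.d Y Z f) g + (i.negOnePow : ℤ) • A.comp X Y Z f (A.d X Y g) := by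
  have h := A.opTotal_b_barD X Z (tcons A.sHom X Y Z f (tgen A.sHom X Y g))
  have h1 : (A.sHom Y Z).sgn 1 ((A.sHom Y Z).sgn 1 f) = f := sgn_one_sgn_one (A.sHom _ _) f
  rw [barD_tcons_tgen, map_sub, map_sub, map_neg, bop_tgen, bop_tcons_tgen, bop_tcons_tgen, h1,
    A.sHom_sgn hf, A.sHom_sgn ((A.d_isDifferential Y Z).1 i f hf), negOnePow_succ] at h
  rcases negOnePow_cases i with hi | hi <;> rw [hi] at h ⊢ <;>
    simp only [Units.val_neg, Units.val_one, neg_smul, one_smul, map_neg, neg_neg, lneg_app] at h ⊢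
  · rw [sub_neg_eq_add] at h
    rw [← sub_eq_zero, ← neg_eq_zero, ← h]
    abel
  · rw [sub_neg_eq_add] at h
    rw [← sub_eq_zero, ← h]
    abel

theorem comp_assoc (hA : A.IsDG) (X Y Z W : A.Ob) (f : A.Hom Z W) (g : A.Hom Y Z)
    (h : A.Hom X Y) : A.comp X Y W (A.comp Y Z W f g) h = A.comp X Z W f (A.comp X Y Z g h) := by
  refine gr_le_induction (A.Hom Z W) (p := fun f => A.comp X Y W (A.comp Y Z W f g) h =
    A.comp X Z W f (A.comp X Y Z g h)) (fun i f hf => ?_) ?_ ?_ f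
  · refine gr_le_induction (A.Hom Y Z) (p := fun g => A.comp X Y W (A.comp Y Z W f g) h =
      A.comp X Z W f (A.comp X Y Z g h)) (fun j g hg => ?_) ?_ ?_ g
    · have H := A.opTotal_b_barD X W (tcons A.sHom X Z W f (tcons A.sHom X Y Z g
        (tgen A.sHom X Y h)))
      have h1 : (A.sHom Z W).sgn 1 ((A.sHom Z W).sgn 1 f) = f := sgn_one_sgn_one (A.sHom _ _) f
      rw [barD_tcons, tcomul_tcons, tcomul_tgen, map_zero, add_zero, qlift_qmk, compl₁₂_app,
        comp_app, id_app, barD_tcons_tgen, bop_tcons_tcons _ hA, bop_tcons_tgen, map_zero] at H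
      simp only [map_add, map_sub, map_neg, lneg_app] at H
      rw [bop_tcons_tcons _ hA, bop_tcons_tcons _ hA, bop_tcons_tcons _ hA, bop_tcons_tgen,
        bop_tcons_tgen, h1, A.sHom_sgn hf, A.sHom_sgn hg] at H
      have h2 := A.sHom_sgn (A.comp_mem _ _ _ i j f hf g hg)
      rw [negOnePow_add] at h2
      rcases negOnePow_cases i with hi | hi <;> rcases negOnePow_cases j with hj | hj <;>
        rw [hi, hj] at h2 <;> rw [hi, hj] at H <;>
        simp only [Units.val_neg, Units.val_one, Units.val_mul, mul_neg, neg_mul, one_mul, mul_one,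
          neg_smul, one_smul, map_neg, neg_neg, lneg_app, map_zero, sub_zero, zero_add] at h2 H <;>
        rw [h2] at H <;>
        try simp only [map_neg, neg_neg, lneg_app] at H
      all_goals
        rw [← sub_eq_zero]
        first
        | rw [← H]; abel1
        | rw [← neg_eq_zero, ← H]; abel1
    · simp
    · intro x y hx hy
      simp only [map_add, ladd_app, hx, hy]
  · simp
  · intro x y hx hy
    simp only [map_add, ladd_app, hx, hy]

end AInfCat

end Operations

section Comparison

theorem redD_isDifferential {O Ω : Type u} {P : GQuiver K O} {Q : GQuiver K Ω}
    {dP : ∀ X Z, P X Z →ₗ[K] P X Z} {dQ : ∀ X Z, Q X Z →ₗ[K] Q X Z}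
    (hP : ∀ X Z, IsDifferential (P X Z).gr (dP X Z)) (hQ : ∀ X Z, IsDifferential (Q X Z).gr (dQ X Z))
    (X Z : O × Ω) : IsDifferential (red P Q X Z).gr (redD P Q dP dQ X Z) := by
  constructor
  · intro n x hx
    refine red_gr_le (S := ((red P Q X Z).gr (n + 1)).comap (redD P Q dP dQ X Z)) ?_ ?_ ?_ hx
    · intro i j hij x hx y hy
      rw [mem_comap, redD_redT]
      exact add_mem (redT_mem ((hP _ _).1 i x hx) hy (by rw [← hij]; ring))
        (redT_mem (sgn_mem _ 1 hx) ((hQ _ _).1 j y hy) (by rw [← hij]; ring))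
    · intro h x hx
      rw [mem_comap, redD_redL]
      exact redL_mem h ((hP _ _).1 n x hx)
    · intro h x hx
      rw [mem_comap, redD_redR]
      exact redR_mem h ((hQ _ _).1 n x hx)
  · intro x
    refine red_induction (p := fun x => redD P Q dP dQ X Z (redD P Q dP dQ X Z x) = 0) ?_ ?_ ?_ ?_ x
    · intro x y hx hy
      rw [map_add, map_add, hx, hy, add_zero]
    · intro i x hx j y hy
      rw [redD_redT, map_add, redD_redT, redD_redT, (hP _ _).2, (hQ _ _).2, sgn_one_of_mem _ ((hP _
        _).1 i x hx), sgn_one_of_mem _ hx, negOnePow_succ]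
      rcases negOnePow_cases i with hi | hi <;> rw [hi] <;>
      simp only [Units.val_neg, Units.val_one, neg_smul, one_smul, map_neg, neg_neg, zero_tmul,
        tmul_zero, TensorProduct.neg_tmul, map_zero, add_zero, zero_add] <;> abel
    · intro h i x hx
      rw [redD_redL, redD_redL, (hP _ _).2, map_zero]
    · intro h i x hx
      rw [redD_redR, redD_redR, (hQ _ _).2, map_zero]

variable (A B : AInfCat K)

theorem redABD_isDifferential (X Y : A.Ob × B.Ob) :
    IsDifferential (redAB A B X Y).gr (redABD A B X Y) :=
  redD_isDifferential A.d_isDifferential B.d_isDifferential X Y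

theorem barAB_isDGCocat : IsDGCocat (barAB A B) (barABD A B) (barABComul A B) :=
  A.bar_isDGCocat.red B.bar_isDGCocat

theorem cobarABD_isDifferential (X Y : A.Ob × B.Ob) :
    IsDifferential (cobarAB A B X Y).gr (cobarABD A B X Y) :=
  ⟨cobarD_hasDegree (barAB_isDGCocat A B).d_deg (barAB_isDGCocat A B).comul_deg X Y,
    cobarD_cobarD (barAB_isDGCocat A B) X Y⟩

/-- The morphisms of `A` as elements of `C`. -/
def ltrL (X Y : A.Ob × B.Ob) (h : X.2 = Y.2) : A.Hom X.1 Y.1 →ₗ[K] barAB A B X Y :=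
  redL A.bar B.bar X Y h ∘ₗ tgen A.sHom X.1 Y.1 ∘ₗ (A.Hom X.1 Y.1).toShift 1

/-- The morphisms of `B` as elements of `C`. -/
def ltrR (X Y : A.Ob × B.Ob) (h : X.1 = Y.1) : B.Hom X.2 Y.2 →ₗ[K] barAB A B X Y :=
  redR A.bar B.bar X Y h ∘ₗ tgen B.sHom X.2 Y.2 ∘ₗ (B.Hom X.2 Y.2).toShift 1

/-- The projections onto the letters of `C`. -/
def firstLetter : FirstLetter (barAB A B) (barABComul A B) := tredFirstLetter A.sHom B.sHom

section Letters

variable {A B} {X Y : A.Ob × B.Ob}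

theorem ltrL_mem (h : X.2 = Y.2) {i : ℤ} {f : A.Hom X.1 Y.1} (hf : f ∈ (A.Hom X.1 Y.1).gr i) :
    ltrL A B X Y h f ∈ (barAB A B X Y).gr (i - 1) :=
  redL_mem h (tgen_mem (Q := A.sHom) (A.sHom_mem hf))

theorem ltrR_mem (h : X.1 = Y.1) {i : ℤ} {f : B.Hom X.2 Y.2} (hf : f ∈ (B.Hom X.2 Y.2).gr i) :
    ltrR A B X Y h f ∈ (barAB A B X Y).gr (i - 1) :=
  redR_mem h (tgen_mem (Q := B.sHom) (B.sHom_mem hf))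

theorem barABD_ltrL (h : X.2 = Y.2) (f : A.Hom X.1 Y.1) :
    barABD A B X Y (ltrL A B X Y h f) = -ltrL A B X Y h (A.d X.1 Y.1 f) := by
  refine (redD_redL (P := A.bar) (Q := B.bar) (dP := A.barD) (dQ := B.barD) X Y h _).trans ?_
  exact (congrArg (redL A.bar B.bar X Y h) (A.barD_tgen X.1 Y.1 f)).trans (map_neg _ _)

theorem barABD_ltrR (h : X.1 = Y.1) (f : B.Hom X.2 Y.2) :
    barABD A B X Y (ltrR A B X Y h f) = -ltrR A B X Y h (B.d X.2 Y.2 f) := by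
  refine (redD_redR (P := A.bar) (Q := B.bar) (dP := A.barD) (dQ := B.barD) X Y h _).trans ?_
  exact (congrArg (redR A.bar B.bar X Y h) (B.barD_tgen X.2 Y.2 f)).trans (map_neg _ _)

theorem pA_ltrL (h : X.2 = Y.2) (f : A.Hom X.1 Y.1) :
    (firstLetter A B).pA X Y (ltrL A B X Y h f) = ltrL A B X Y h f :=
  (tredL_redL (E := A.sHom) (F := B.sHom) X Y h _).trans
    (congrArg (fun f => redL A.bar B.bar X Y h (tgen A.sHom X.1 Y.1 f)) (tproj_tgen A.sHom _ _ f))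

theorem pB_ltrR (h : X.1 = Y.1) (f : B.Hom X.2 Y.2) :
    (firstLetter A B).pB X Y (ltrR A B X Y h f) = ltrR A B X Y h f :=
  (tredR_redR (E := A.sHom) (F := B.sHom) X Y h _).trans
    (congrArg (fun f => redR A.bar B.bar X Y h (tgen B.sHom X.2 Y.2 f)) (tproj_tgen B.sHom _ _ f))

theorem barABComul_ltrL (h : X.2 = Y.2) (f : A.Hom X.1 Y.1) :
    barABComul A B X Y (ltrL A B X Y h f) = 0 :=
  (firstLetter A B).comul_letA X Y _ (pA_ltrL h f)

theorem barABComul_ltrR (h : X.1 = Y.1) (f : B.Hom X.2 Y.2) :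
    barABComul A B X Y (ltrR A B X Y h f) = 0 :=
  (firstLetter A B).comul_letB X Y _ (pB_ltrR h f)

theorem sgn_ltrL (h : X.2 = Y.2) {i : ℤ} {f : A.Hom X.1 Y.1} (hf : f ∈ (A.Hom X.1 Y.1).gr i) :
    (barAB A B X Y).sgn 1 (ltrL A B X Y h f) =
      -((i.negOnePow : ℤ) • ltrL A B X Y h f) := by
  rw [sgn_one_of_mem _ (ltrL_mem h hf), negOnePow_sub, negOnePow_one, mul_neg, mul_one,
    Units.val_neg, neg_smul]

theorem sgn_ltrR (h : X.1 = Y.1) {i : ℤ} {f : B.Hom X.2 Y.2} (hf : f ∈ (B.Hom X.2 Y.2).gr i) :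
    (barAB A B X Y).sgn 1 (ltrR A B X Y h f) =
      -((i.negOnePow : ℤ) • ltrR A B X Y h f) := by
  rw [sgn_one_of_mem _ (ltrR_mem h hf), negOnePow_sub, negOnePow_one, mul_neg, mul_one,
    Units.val_neg, neg_smul]

theorem pA_cases {p : barAB A B X Y → Prop} (zero : p 0) (of : ∀ h f, p (ltrL A B X Y h f))
    (c : barAB A B X Y) : p ((firstLetter A B).pA X Y c) :=
  exists_redL (P := A.bar) (P' := A.bar) (Q := B.bar) (Q' := B.bar)
    (tgen A.sHom X.1 Y.1 ∘ₗ tproj A.sHom X.1 Y.1) zero (fun h x => of h (tproj A.sHom _ _ x)) c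

theorem pB_cases {p : barAB A B X Y → Prop} (zero : p 0) (of : ∀ h f, p (ltrR A B X Y h f))
    (c : barAB A B X Y) : p ((firstLetter A B).pB X Y c) :=
  exists_redR (P := A.bar) (P' := A.bar) (Q := B.bar) (Q' := B.bar)
    (tgen B.sHom X.2 Y.2 ∘ₗ tproj B.sHom X.2 Y.2) zero (fun h x => of h (tproj B.sHom _ _ x)) c

theorem nGen_redT (z) : nGen A B X Y (redT A.bar B.bar X Y z) = 0 := by
  refine Prod.ext rfl (Prod.ext ?_ ?_)
  · exact map_zero (powMap id (A.barProj X.1 Y.1))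
  · exact map_zero (powMap id (B.barProj X.2 Y.2))

theorem barProj_tgen (A : AInfCat K) (X Y : A.Ob) (f : A.Hom X Y) :
    A.barProj X Y (tgen A.sHom X Y f) = f := desc_tgen ..

theorem barProj_tcons (A : AInfCat K) (X Y Z : A.Ob) (f : A.Hom Y Z) (w : A.bar X Y) :
    A.barProj X Z (tcons A.sHom X Y Z f w) = 0 :=
  tproj_tcons A.sHom X Y Z f w

theorem nGen_redL (h : X.2 = Y.2) (x : A.bar X.1 Y.1) : nGen A B X Y (redL A.bar B.bar X Y h x) =
      redL A.Hom B.Hom X Y h (A.barProj X.1 Y.1 x) := by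
  refine Prod.ext rfl (Prod.ext ?_ ?_)
  · exact powMap_powIncl id (A.barProj X.1 Y.1) h x
  · exact map_zero (powMap id (B.barProj X.2 Y.2))

theorem nGen_redR (h : X.1 = Y.1) (x : B.bar X.2 Y.2) : nGen A B X Y (redR A.bar B.bar X Y h x) =
      redR A.Hom B.Hom X Y h (B.barProj X.2 Y.2 x) := by
  refine Prod.ext rfl (Prod.ext ?_ ?_)
  · exact map_zero (powMap id (A.barProj X.1 Y.1))
  · exact powMap_powIncl id (B.barProj X.2 Y.2) h x

theorem nGen_ltrL (h : X.2 = Y.2) (f : A.Hom X.1 Y.1) :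
    nGen A B X Y (ltrL A B X Y h f) = redL A.Hom B.Hom X Y h f :=
  (nGen_redL h _).trans (congrArg (redL A.Hom B.Hom X Y h) (barProj_tgen A _ _ f))

theorem nGen_ltrR (h : X.1 = Y.1) (f : B.Hom X.2 Y.2) :
    nGen A B X Y (ltrR A B X Y h f) = redR A.Hom B.Hom X Y h f :=
  (nGen_redR h _).trans (congrArg (redR A.Hom B.Hom X Y h) (barProj_tgen B _ _ f))

theorem comparison_redL (h : X.2 = Y.2) (f : A.Hom X.1 Y.1) :
    comparison A B X Y (redL A.Hom B.Hom X Y h f) =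
      cgen (barAB A B) X Y (ltrL A B X Y h f) := by
  rw [comparison, coprod_app, coprod_app]
  refine (congrArg₂ (· + ·) (map_zero _) (congrArg₂ (· + ·) (desc_powIncl _ h f)
    (map_zero _))).trans ?_
  rw [zero_add, add_zero]
  rfl

theorem comparison_redR (h : X.1 = Y.1) (f : B.Hom X.2 Y.2) :
    comparison A B X Y (redR A.Hom B.Hom X Y h f) =
      cgen (barAB A B) X Y (ltrR A B X Y h f) := by
  rw [comparison, coprod_app, coprod_app]
  refine (congrArg₂ (· + ·) (map_zero _) (congrArg₂ (· + ·) (map_zero _)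
    (desc_powIncl _ h f))).trans ?_
  rw [zero_add, zero_add]
  rfl

theorem comparison_redT {i : ℤ} {f : A.Hom X.1 Y.1} (hf : f ∈ (A.Hom X.1 Y.1).gr i)
    (g : B.Hom X.2 Y.2) : comparison A B X Y (redT A.Hom B.Hom X Y (f ⊗ₜ g)) =
      ccons (barAB A B) X (Y.1, X.2) Y (ltrR A B (Y.1, X.2) Y rfl ((B.Hom X.2 Y.2).sgn i g))
        (cgen (barAB A B) X (Y.1, X.2) (ltrL A B X (Y.1, X.2) rfl f)) := by
  rw [comparison, coprod_app]
  refine (congrArg₂ (· + ·) rfl (map_zero _)).trans ?_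
  rw [add_zero, comp_app]
  refine (congrArg (TensorProduct.lift _) (kswap_tmul hf g)).trans ?_
  rfl

end Letters

end Comparison

section HomotopyEquivalence

variable (A B : AInfCat K)

theorem comparison_hasDegree (X Y : A.Ob × B.Ob) :
    HasDegree (redAB A B X Y).gr (cobarAB A B X Y).gr (comparison A B X Y) 0 := by
  intro n x hx
  rw [add_zero]
  refine red_gr_le (S := ((cobarAB A B X Y).gr n).comap (comparison A B X Y)) ?_ ?_ ?_ hx
  · intro i j hij x hx y hy
    rw [mem_comap, comparison_redT hx]
    have h1 := cgen_mem (ltrL_mem (X := X) (Y := (Y.1, X.2)) rfl hx) (sub_add_cancel i 1)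
    have h2 := ltrR_mem (X := (Y.1, X.2)) (Y := Y) rfl (sgn_mem _ i hy)
    exact ccons_mem h2 h1 (by rw [← hij]; ring)
  · intro h x hx
    rw [mem_comap, comparison_redL]
    exact cgen_mem (ltrL_mem _ hx) (sub_add_cancel n 1)
  · intro h x hx
    rw [mem_comap, comparison_redR]
    exact cgen_mem (ltrR_mem _ hx) (sub_add_cancel n 1)

variable {A B} in
theorem cobarABD_cgen_ltrL {X Y : A.Ob × B.Ob} (h : X.2 = Y.2) (f : A.Hom X.1 Y.1) :
    cobarABD A B X Y (cgen (barAB A B) X Y (ltrL A B X Y h f)) =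
      cgen (barAB A B) X Y (ltrL A B X Y h (A.d X.1 Y.1 f)) := by
  rw [cobarABD, cobarD_cgen, barABD_ltrL, barABComul_ltrL, map_neg, map_zero, neg_neg, sub_zero]

variable {A B} in
theorem cobarABD_cgen_ltrR {X Y : A.Ob × B.Ob} (h : X.1 = Y.1) (f : B.Hom X.2 Y.2) :
    cobarABD A B X Y (cgen (barAB A B) X Y (ltrR A B X Y h f)) =
      cgen (barAB A B) X Y (ltrR A B X Y h (B.d X.2 Y.2 f)) := by
  rw [cobarABD, cobarD_cgen, barABD_ltrR, barABComul_ltrR, map_neg, map_zero, neg_neg, sub_zero]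

variable {A B} in
theorem cobarABD_ccons_ltrR {X W Y : A.Ob × B.Ob} (h : W.1 = Y.1) {i : ℤ} {g : B.Hom W.2 Y.2}
    (hg : g ∈ (B.Hom W.2 Y.2).gr i) (w : cobarAB A B X W) :
    cobarABD A B X Y (ccons (barAB A B) X W Y (ltrR A B W Y h g) w) =
      ccons (barAB A B) X W Y (ltrR A B W Y h (B.d W.2 Y.2 g)) w +
      (i.negOnePow : ℤ) • ccons (barAB A B) X W Y (ltrR A B W Y h g) (cobarABD A B X W w) := by
  rw [cobarABD, cobarD_ccons, barABD_ltrR, barABComul_ltrR, sgn_ltrR h hg, map_neg, map_zero,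
    map_zero, map_neg, map_zsmul]
  rw [lneg_app, lneg_app, lzero_app, lsmul_app, neg_neg, sub_zero, sub_neg_eq_add]
  rfl

theorem comparison_isChainMap (X Y : A.Ob × B.Ob) :
    IsChainMap (redAB A B X Y).gr (redABD A B X Y) (cobarAB A B X Y).gr (cobarABD A B X Y)
      (comparison A B X Y) := by
  refine ⟨comparison_hasDegree A B X Y, fun x => ?_⟩
  refine lapply_eq (comparison A B X Y ∘ₗ redABD A B X Y)
    (cobarABD A B X Y ∘ₗ comparison A B X Y) (red_ext ?_ ?_ ?_) x
  · intro i f hf j g hg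
    have hdf := (A.d_isDifferential X.1 Y.1).1 i f hf
    have hD := cobarABD_ccons_ltrR (X := X) (W := (Y.1, X.2)) (Y := Y) rfl (sgn_mem _ i hg)
      (cgen (barAB A B) X (Y.1, X.2) (ltrL A B X (Y.1, X.2) rfl f))
    rw [comp_app, comp_app, redABD, redD_redT, map_add, comparison_redT hf, comparison_redT hdf,
      comparison_redT (sgn_mem _ 1 hf), hD, cobarABD_cgen_ltrL, sgn_of_mem _ _ hg, sgn_of_mem _ _
      hg, sgn_of_mem _ _ ((B.d_isDifferential X.2 Y.2).1 j g hg), sgn_one_of_mem _ hf]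
    have h1 : (i + 1) * j = i * j + j := by ring
    have h2 : i * (j + 1) = i * j + i := by ring
    rw [h1, h2, negOnePow_add, negOnePow_add]
    simp only [map_zsmul, lsmul_app]
    rw [add_comm, smul_smul, smul_smul]
    congr 2
    · rcases negOnePow_cases i with hi | hi <;> rw [hi] <;> simp
    · rw [Units.val_mul, mul_comm]
  · intro h i f hf
    rw [comp_app, comp_app, redABD, redD_redL, comparison_redL, comparison_redL, cobarABD_cgen_ltrL]
  · intro h i f hf
    rw [comp_app, comp_app, redABD, redD_redR, comparison_redR, comparison_redR, cobarABD_cgen_ltrR]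

/-- The product of two letters, if the first is one of `B` and the second is one of `A`. -/
abbrev pairComp (X Y Z : A.Ob × B.Ob) : redAB A B Y Z →ₗ[K] redAB A B X Y →ₗ[K] redAB A B X Z :=
  redComp A.Hom B.Hom (fun _ _ _ => 0) (fun _ _ _ => 0) X Y Z

/-- A left inverse of the comparison map. -/
def cretract (X Z : A.Ob × B.Ob) : cobarAB A B X Z →ₗ[K] redAB A B X Z :=
  chead (C := barAB A B) (nGen A B X Z) fun Y => (pairComp A B X Y Z).compl₁₂
    (nGen A B Y Z ∘ₗ (firstLetter A B).pB Y Z)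
    (chead (C := barAB A B) (nGen A B X Y ∘ₗ (firstLetter A B).pA X Y) 0)

theorem cretract_cgen (X Z : A.Ob × B.Ob) (c : barAB A B X Z) :
    cretract A B X Z (cgen (barAB A B) X Z c) = nGen A B X Z c :=
  chead_cgen _ _ _

theorem cretract_ccons_cgen (X Y Z : A.Ob × B.Ob) (c : barAB A B Y Z) (c' : barAB A B X Y) :
    cretract A B X Z (ccons (barAB A B) X Y Z c (cgen (barAB A B) X Y c')) =
      pairComp A B X Y Z (nGen A B Y Z ((firstLetter A B).pB Y Z c))
        (nGen A B X Y ((firstLetter A B).pA X Y c')) := by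
  rw [cretract, chead_ccons, compl₁₂_app, chead_cgen]
  rfl

theorem cretract_ccons_ccons (X W Y Z : A.Ob × B.Ob) (c : barAB A B Y Z) (c' : barAB A B W Y)
    (w : cobarAB A B X W) : cretract A B X Z (ccons (barAB A B) X Y Z c
      (ccons (barAB A B) X W Y c' w)) = 0 := by
  rw [cretract, chead_ccons, compl₁₂_app, chead_ccons]
  exact map_zero _

variable {A B} in
theorem leftInverse_comparison {X Y : A.Ob × B.Ob} {φ : cobarAB A B X Y →ₗ[K] redAB A B X Y}
    (cA : ∀ x y z, A.Hom y z →ₗ[K] A.Hom x y →ₗ[K] A.Hom x z)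
    (cB : ∀ x y z, B.Hom y z →ₗ[K] B.Hom x y →ₗ[K] B.Hom x z)
    (h1 : ∀ c, φ (cgen (barAB A B) X Y c) = nGen A B X Y c)
    (h2 : ∀ g f, φ (ccons (barAB A B) X (Y.1, X.2) Y (ltrR A B (Y.1, X.2) Y rfl g)
      (cgen (barAB A B) X (Y.1, X.2) (ltrL A B X (Y.1, X.2) rfl f))) =
      redComp A.Hom B.Hom cA cB X (Y.1, X.2) Y (redR A.Hom B.Hom (Y.1, X.2) Y rfl g)
        (redL A.Hom B.Hom X (Y.1, X.2) rfl f)) (x : redAB A B X Y) :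
    φ (comparison A B X Y x) = x := by
  refine lapply_eq (φ ∘ₗ comparison A B X Y) lid (red_ext ?_ ?_ ?_) x
  · intro i f hf j g hg
    have h := redComp_redR_redL A.Hom B.Hom cA cB X Y.1 Y.2 (sgn_mem _ i hg) f
    rw [comp_app, comparison_redT hf]
    refine ((h2 _ _).trans h).trans ?_
    rw [sgn_of_mem _ _ hg, sgn_of_mem _ _ hf, mul_comm j i, tmul_smul, ← smul_tmul', smul_smul]
    rcases negOnePow_cases (i * j) with hi | hi <;> rw [hi] <;> simp
  · intro h i f hf
    rw [comp_app, comparison_redL, h1, nGen_ltrL]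
    rfl
  · intro h i f hf
    rw [comp_app, comparison_redR, h1, nGen_ltrR]
    rfl

theorem cretract_comparison (X Y : A.Ob × B.Ob) :
    ∀ x, cretract A B X Y (comparison A B X Y x) = x :=
  leftInverse_comparison (fun _ _ _ => 0) (fun _ _ _ => 0) (cretract_cgen A B X Y) fun g f => by
    rw [cretract_ccons_cgen, pA_ltrL, pB_ltrR, nGen_ltrL, nGen_ltrR]

theorem nGen_mem (X Z : A.Ob × B.Ob) {i : ℤ} {c : barAB A B X Z} (hc : c ∈ (barAB A B X Z).gr i) :
    nGen A B X Z c ∈ (redAB A B X Z).gr (i + 1) := by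
  refine red_gr_le (S := ((redAB A B X Z).gr (i + 1)).comap (nGen A B X Z)) ?_ ?_ ?_ hc
  · intro i j hij x hx y hy
    rw [mem_comap, nGen_redT]
    exact zero_mem _
  · intro h x hx
    rw [mem_comap, nGen_redL]
    have := tproj_hasDegree A.sHom X.1 Z.1 i x hx
    rw [add_zero] at this
    refine redL_mem h ?_
    rw [add_comm]
    exact this
  · intro h x hx
    rw [mem_comap, nGen_redR]
    have := tproj_hasDegree B.sHom X.2 Z.2 i x hx
    rw [add_zero] at this
    refine redR_mem h ?_
    rw [add_comm]
    exact this

theorem cretract_hasDegree (X Z : A.Ob × B.Ob) :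
    HasDegree (cobarAB A B X Z).gr (redAB A B X Z).gr (cretract A B X Z) 0 := by
  intro n w hw
  rw [add_zero]
  refine cobar_gr_le X (S := ((redAB A B X Z).gr n).comap (cretract A B X Z)) ?_ ?_ hw
  · rintro i rfl c hc
    rw [mem_comap, cretract_cgen]
    exact nGen_mem A B X Z hc
  · intro Y i j hij c hc w hw
    rw [mem_comap]
    have h1 := nGen_mem A B Y Z ((firstLetter A B).pB_deg Y Z i c hc)
    refine cobar_gr_le X (S := ((redAB A B X Z).gr n).comap (cretract A B X Z ∘ₗ
      ccons (barAB A B) X Y Z c)) ?_ ?_ hw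
    · rintro k rfl c' hc'
      rw [mem_comap, comp_app, cretract_ccons_cgen]
      have h2 := nGen_mem A B X Y ((firstLetter A B).pA_deg X Y k c' hc')
      have h3 := redComp_mem (P := A.Hom) (Q := B.Hom) (cP := fun _ _ _ => 0)
        (cQ := fun _ _ _ => 0) (fun _ _ _ _ _ _ _ _ _ => zero_mem _)
        (fun _ _ _ _ _ _ _ _ _ => zero_mem _) X Y Z h1 h2
      rw [show n = i + 0 + 1 + (k + 0 + 1) by rw [← hij]; ring]
      exact h3
    · intro W k l _ c' _ w _
      rw [mem_comap, comp_app, cretract_ccons_ccons]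
      exact zero_mem _

theorem comparison_nGen (X Z : A.Ob × B.Ob) (c : barAB A B X Z) :
    comparison A B X Z (nGen A B X Z c) =
      cgen (barAB A B) X Z ((firstLetter A B).pA X Z c + (firstLetter A B).pB X Z c) := by
  refine lapply_eq (comparison A B X Z ∘ₗ nGen A B X Z)
    (cgen (barAB A B) X Z ∘ₗ ((firstLetter A B).pA X Z + (firstLetter A B).pB X Z))
    (red_ext (P := A.bar) (Q := B.bar) ?_ ?_ ?_) c
  · intro i f hf j g hg
    rw [comp_app, nGen_redT, map_zero, comp_app, ladd_app]
    rw [firstLetter]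
    have h1 := tredL_redT (E := A.sHom) (F := B.sHom) X Z (f ⊗ₜ g)
    have h2 := tredR_redT (E := A.sHom) (F := B.sHom) X Z (f ⊗ₜ g)
    refine Eq.trans ?_ (congrArg (cgen (barAB A B) X Z) (congrArg₂ (· + ·) h1 h2)).symm
    rw [add_zero, map_zero]
  · intro h i f hf
    rw [comp_app, nGen_redL, comparison_redL, comp_app, ladd_app]
    have h1 := tredL_redL (E := A.sHom) (F := B.sHom) X Z h f
    have h2 := tredR_redL (E := A.sHom) (F := B.sHom) X Z h f
    refine Eq.trans ?_ (congrArg (cgen (barAB A B) X Z) (congrArg₂ (· + ·) h1 h2)).symm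
    rw [add_zero]
    rfl
  · intro h i f hf
    rw [comp_app, nGen_redR, comparison_redR, comp_app, ladd_app]
    have h1 := tredL_redR (E := A.sHom) (F := B.sHom) X Z h f
    have h2 := tredR_redR (E := A.sHom) (F := B.sHom) X Z h f
    refine Eq.trans ?_ (congrArg (cgen (barAB A B) X Z) (congrArg₂ (· + ·) h1 h2)).symm
    rw [zero_add]
    rfl

theorem comparison_pairComp {X Y Z : A.Ob × B.Ob} (h : Y.1 = Z.1) (g : B.Hom Y.2 Z.2)
    (h' : X.2 = Y.2) (f : A.Hom X.1 Y.1) :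
    comparison A B X Z (pairComp A B X Y Z (redR A.Hom B.Hom Y Z h g) (redL A.Hom B.Hom X Y h' f)) =
      ccons (barAB A B) X Y Z (ltrR A B Y Z h g) (cgen (barAB A B) X Y (ltrL A B X Y h' f)) := by
  obtain ⟨x, b⟩ := X
  obtain ⟨y, b'⟩ := Y
  obtain ⟨y', z⟩ := Z
  obtain rfl : b = b' := h'
  obtain rfl : y = y' := h
  refine gr_le_induction (A.Hom x y) (p := fun f => comparison A B (x, b) (y, z)
    (pairComp A B (x, b) (y, b) (y, z) (redR A.Hom B.Hom (y, b) (y, z) rfl g)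
      (redL A.Hom B.Hom (x, b) (y, b) rfl f)) = ccons (barAB A B) (x, b) (y, b) (y, z)
        (ltrR A B (y, b) (y, z) rfl g)
        (cgen (barAB A B) (x, b) (y, b) (ltrL A B (x, b) (y, b) rfl f))) ?_ ?_ ?_ f
  · intro i f hf
    refine gr_le_induction (B.Hom b z) (p := fun g => comparison A B (x, b) (y, z)
      (pairComp A B (x, b) (y, b) (y, z) (redR A.Hom B.Hom (y, b) (y, z) rfl g)
        (redL A.Hom B.Hom (x, b) (y, b) rfl f)) = ccons (barAB A B) (x, b) (y, b) (y, z)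
          (ltrR A B (y, b) (y, z) rfl g)
          (cgen (barAB A B) (x, b) (y, b) (ltrL A B (x, b) (y, b) rfl f))) ?_ ?_ ?_ g
    · intro j g hg
      have h := redComp_redR_redL A.Hom B.Hom (fun _ _ _ => 0) (fun _ _ _ => 0) (x, b) y z hg f
      rw [h]
      rw [comparison_redT (sgn_mem _ j hf), sgn_of_mem _ _ hf, sgn_of_mem _ _ hg, mul_comm j i]
      rw [map_zsmul, map_zsmul, map_zsmul, map_zsmul, map_zsmul, lsmul_app, smul_smul]
      rcases negOnePow_cases (i * j) with hi | hi <;> rw [hi] <;> simp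
    · simp only [map_zero, lzero_app]
    · intro u v hu hv
      simp only [map_add, ladd_app, hu, hv]
  · simp only [map_zero]
  · intro u v hu hv
    simp only [map_add, hu, hv]

theorem comparison_cretract (X Z : A.Ob × B.Ob) (w : cobarAB A B X Z) :
    comparison A B X Z (cretract A B X Z w) = (firstLetter A B).kap X Z w := by
  refine cobar_induction (C := barAB A B)
    (p := fun w => comparison A B X Z (cretract A B X Z w) = (firstLetter A B).kap X Z w)
    ?_ ?_ ?_ ?_ w
  · rw [map_zero, map_zero, map_zero]
  · intro u v hu hv
    rw [map_add, map_add, map_add, hu, hv]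
  · intro c
    rw [cretract_cgen, comparison_nGen, FirstLetter.kap_cgen]
  · intro Y c w
    rw [FirstLetter.kap_ccons]
    refine cobar_induction (C := barAB A B)
      (p := fun w => comparison A B X Z (cretract A B X Z (ccons (barAB A B) X Y Z c w)) =
        ccons (barAB A B) X Y Z ((firstLetter A B).pB Y Z c) ((firstLetter A B).kA X Y w))
      ?_ ?_ ?_ ?_ w
    · simp only [map_zero]
    · intro u v hu hv
      simp only [map_add, hu, hv]
    · intro c'
      rw [cretract_ccons_cgen, FirstLetter.kA_cgen]
      refine pB_cases (p := fun b => comparison A B X Z (pairComp A B X Y Z (nGen A B Y Z b)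
        (nGen A B X Y ((firstLetter A B).pA X Y c'))) = ccons (barAB A B) X Y Z b
          (cgen (barAB A B) X Y ((firstLetter A B).pA X Y c'))) ?_ ?_ c
      · simp only [map_zero, lzero_app]
      · intro h g
        refine pA_cases (p := fun a => comparison A B X Z (pairComp A B X Y Z
          (nGen A B Y Z (ltrR A B Y Z h g)) (nGen A B X Y a)) =
            ccons (barAB A B) X Y Z (ltrR A B Y Z h g) (cgen (barAB A B) X Y a)) ?_ ?_ c'
        · simp only [map_zero]
        · intro h' f
          rw [nGen_ltrL, nGen_ltrR, comparison_pairComp]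
    · intro W c' w
      rw [cretract_ccons_ccons, FirstLetter.kA_ccons, map_zero, map_zero]

theorem h_ccons_ltrR {X Y Z : A.Ob × B.Ob} (h : Y.1 = Z.1) (g : B.Hom Y.2 Z.2)
    (h' : X.2 = Y.2) (f : A.Hom X.1 Y.1) :
    (firstLetter A B).h X Z (ccons (barAB A B) X Y Z (ltrR A B Y Z h g)
      (cgen (barAB A B) X Y (ltrL A B X Y h' f))) = 0 := by
  have h1 := (firstLetter A B).sgn_letB Y Z (pB_ltrR h g)
  have h2 := (firstLetter A B).pR_letA X Y _ (pA_ltrL h' f)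
  rw [FirstLetter.h, ladd_app, FirstLetter.hA_ccons, FirstLetter.hB_ccons, (firstLetter A B).pA_letB
    _ _ _ h1, FirstLetter.cpR_cgen, h2, FirstLetter.hA_cgen]
  simp only [map_zero, lzero_app, neg_zero, sub_zero, add_zero]

theorem h_comparison (X Y : A.Ob × B.Ob) (x : redAB A B X Y) :
    (firstLetter A B).h X Y (comparison A B X Y x) = 0 := by
  refine lapply_eq ((firstLetter A B).h X Y ∘ₗ comparison A B X Y) 0 (red_ext ?_ ?_ ?_) x
  · intro i f hf j g hg
    rw [comp_app, comparison_redT hf, h_ccons_ltrR]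
    rfl
  · intro h i f hf
    rw [comp_app, comparison_redL, FirstLetter.h, ladd_app, FirstLetter.hA_cgen,
      FirstLetter.hB_cgen, add_zero]
    rfl
  · intro h i f hf
    rw [comp_app, comparison_redR, FirstLetter.h, ladd_app, FirstLetter.hA_cgen,
      FirstLetter.hB_cgen, add_zero]
    rfl

/-- The remainder of the contraction of the cobar construction. -/
def remainder (X Y : A.Ob × B.Ob) : cobarAB A B X Y →ₗ[K] cobarAB A B X Y :=
  lid - comparison A B X Y ∘ₗ cretract A B X Y -
    (cobarABD A B X Y ∘ₗ (firstLetter A B).h X Y + (firstLetter A B).h X Y ∘ₗ cobarABD A B X Y)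

theorem remainder_nilpotent (X Y : A.Ob × B.Ob) (w : cobarAB A B X Y) :
    ∃ n : ℕ, ((remainder A B X Y) ^ n) w = 0 :=
  (firstLetter A B).locally_nilpotent (barABD A B) (remainder A B X Y)
    (fun w => by rw [← comparison_cretract]; rfl) w

theorem comparison_isHomotopyEquiv (X Y : A.Ob × B.Ob) :
    IsHomotopyEquiv (redAB A B X Y).gr (redABD A B X Y) (cobarAB A B X Y).gr (cobarABD A B X Y)
      (comparison A B X Y) :=
  isHomotopyEquiv_of_locally_nilpotent (comparison_isChainMap A B X Y) (cretract A B X Y)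
    (cretract_hasDegree A B X Y) (cretract_comparison A B X Y) ((firstLetter A B).h X Y)
    ((firstLetter A B).h_hasDegree X Y) (h_comparison A B X Y) (cobarABD_isDifferential A B X Y)
    (remainder A B X Y) (fun _ => rfl) (remainder_nilpotent A B X Y)

end HomotopyEquivalence

section LowPart

theorem eq_zero_of_mem_tlen_zero {O : Type u} {Q : GQuiver K O} {X Z : O} {u : tbar Q X Z}
    (hu : u ∈ tlen Q 0 X Z) : u = 0 := by
  have : tlen Q 0 X Z ≤ ⊥ := iSup_le fun n => absurd n.2 (Nat.succ_ne_zero _)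
  exact (mem_bot K).1 (this hu)

theorem exists_of_mem_tlen_one {O : Type u} {Q : GQuiver K O} {X Z : O} {u : tbar Q X Z}
    (hu : u ∈ tlen Q 1 X Z) : ∃ x, u = tgen Q X Z x := by
  have : tlen Q 1 X Z ≤ LinearMap.range (tgen Q X Z) := by
    refine iSup_le fun ⟨n, hn⟩ => ?_
    obtain rfl : n = 0 := by omega
    exact le_rfl
  obtain ⟨x, rfl⟩ := this hu
  exact ⟨x, rfl⟩

theorem tgen_mem_tlen {O : Type u} (Q : GQuiver K O) {X Z : O} (x : Q X Z) :
    tgen Q X Z x ∈ tlen Q 1 X Z :=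
  mem_iSup_of_mem (⟨0, rfl⟩ : {n : ℕ // n + 1 = 1}) ⟨x, rfl⟩

variable {A B : AInfCat K}

theorem genBideg_le {X Y : A.Ob × B.Ob} {i j : ℕ} {S : Submodule K (genAB A B X Y)}
    (hT : ∀ u ∈ tlen A.sHom i X.1 Y.1, ∀ v ∈ tlen B.sHom j X.2 Y.2,
      redT A.bar B.bar X Y (u ⊗ₜ v) ∈ S)
    (hL : j = 0 → ∀ h, ∀ u ∈ tlen A.sHom i X.1 Y.1, redL A.bar B.bar X Y h u ∈ S)
    (hR : i = 0 → ∀ h, ∀ v ∈ tlen B.sHom j X.2 Y.2, redR A.bar B.bar X Y h v ∈ S) :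
    genBideg A B i j X Y ≤ S := by
  refine span_le.2 ?_
  rintro _ ((⟨u, hu, v, hv, rfl⟩ | ⟨hj, h, u, hu, rfl⟩) | ⟨hi, h, v, hv, rfl⟩)
  · exact hT u hu v hv
  · exact hL hj h u hu
  · exact hR hi h v hv

theorem genBideg_zero_zero {X Y : A.Ob × B.Ob} : genBideg A B 0 0 X Y = ⊥ := by
  refine le_bot_iff.1 (genBideg_le ?_ ?_ ?_)
  · intro u hu v hv
    rw [eq_zero_of_mem_tlen_zero hu, zero_tmul, map_zero]
    exact zero_mem _
  · intro _ h u hu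
    rw [eq_zero_of_mem_tlen_zero hu, map_zero]
    exact zero_mem _
  · intro _ h u hu
    rw [eq_zero_of_mem_tlen_zero hu, map_zero]
    exact zero_mem _

theorem genBideg_one_zero_le {X Y : A.Ob × B.Ob} {S : Submodule K (genAB A B X Y)}
    (hL : ∀ h f, ltrL A B X Y h f ∈ S) : genBideg A B 1 0 X Y ≤ S := by
  refine genBideg_le ?_ ?_ ?_
  · intro u hu v hv
    rw [eq_zero_of_mem_tlen_zero hv, tmul_zero, map_zero]
    exact zero_mem _
  · intro _ h u hu
    obtain ⟨f, rfl⟩ := exists_of_mem_tlen_one hu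
    exact hL h f
  · intro h
    exact absurd h one_ne_zero

theorem genBideg_zero_one_le {X Y : A.Ob × B.Ob} {S : Submodule K (genAB A B X Y)}
    (hR : ∀ h f, ltrR A B X Y h f ∈ S) : genBideg A B 0 1 X Y ≤ S := by
  refine genBideg_le ?_ ?_ ?_
  · intro u hu v hv
    rw [eq_zero_of_mem_tlen_zero hu, zero_tmul, map_zero]
    exact zero_mem _
  · intro h
    exact absurd h one_ne_zero
  · intro _ h u hu
    obtain ⟨f, rfl⟩ := exists_of_mem_tlen_one hu
    exact hR h f

variable (A B) in
/-- The elements of `C` with one factor from `A` and one from `B`. -/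
def ltrT (X Y : A.Ob × B.Ob) (f : A.Hom X.1 Y.1) (g : B.Hom X.2 Y.2) : barAB A B X Y :=
  redT A.bar B.bar X Y (tgen A.sHom X.1 Y.1 f ⊗ₜ tgen B.sHom X.2 Y.2 g)

theorem genBideg_one_one_le {X Y : A.Ob × B.Ob} {S : Submodule K (genAB A B X Y)}
    (hT : ∀ f g, ltrT A B X Y f g ∈ S) : genBideg A B 1 1 X Y ≤ S := by
  refine genBideg_le ?_ (fun h => absurd h one_ne_zero) (fun h => absurd h one_ne_zero)
  intro u hu v hv
  obtain ⟨f, rfl⟩ := exists_of_mem_tlen_one hu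
  obtain ⟨g, rfl⟩ := exists_of_mem_tlen_one hv
  exact hT f g

theorem ltrL_mem_genBideg {X Y : A.Ob × B.Ob} (h : X.2 = Y.2) (f : A.Hom X.1 Y.1) :
    ltrL A B X Y h f ∈ genBideg A B 1 0 X Y :=
  subset_span (Or.inl (Or.inr ⟨rfl, h, _, tgen_mem_tlen A.sHom f, rfl⟩))

theorem ltrR_mem_genBideg {X Y : A.Ob × B.Ob} (h : X.1 = Y.1) (f : B.Hom X.2 Y.2) :
    ltrR A B X Y h f ∈ genBideg A B 0 1 X Y :=
  subset_span (Or.inr ⟨rfl, h, _, tgen_mem_tlen B.sHom f, rfl⟩)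

theorem ltrT_mem_genBideg {X Y : A.Ob × B.Ob} (f : A.Hom X.1 Y.1) (g : B.Hom X.2 Y.2) :
    ltrT A B X Y f g ∈ genBideg A B 1 1 X Y :=
  subset_span (Or.inl (Or.inl ⟨_, tgen_mem_tlen A.sHom f, _, tgen_mem_tlen B.sHom g, rfl⟩))

theorem eq_zero_of_mem_bidegPow {X : A.Ob × B.Ob} (l : ℕ) {m n : ℕ} (h : m + n ≤ l)
    {Z : A.Ob × B.Ob} {w : tpow (genAB A B) l X Z}
    (hw : w ∈ bidegPow (genAB A B) (genBideg A B) X l m n Z) : w = 0 := by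
  induction l generalizing m n Z with
  | zero =>
    obtain ⟨rfl, rfl⟩ : m = 0 ∧ n = 0 := by omega
    have hw' : w ∈ genBideg A B 0 0 X Z := hw
    rw [genBideg_zero_zero] at hw'
    exact (mem_bot K).1 hw'
  | succ l ih =>
    have : bidegPow (genAB A B) (genBideg A B) X (l + 1) m n Z ≤ ⊥ := by
      refine span_le.2 ?_
      rintro _ ⟨Y, i, j, m', n', x, w, hi, hj, hx, hw, rfl⟩
      refine (mem_bot K).2 ?_
      by_cases h0 : i + j = 0
      · obtain ⟨rfl, rfl⟩ : i = 0 ∧ j = 0 := by omega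
        rw [genBideg_zero_zero] at hx
        rw [(mem_bot K).1 hx, map_zero, lzero_app]
        rfl
      · rw [ih (by omega) hw, map_zero]
        rfl
    exact (mem_bot K).1 (this hw)

variable (A B) in
/-- The submodule spanned by the words with at most one letter from `A` and one from `B`. -/
def lowWords (X Z : A.Ob × B.Ob) : Submodule K (cobarAB A B X Z) := Submodule.span K {w |
    (∃ h f, w = cgen (barAB A B) X Z (ltrL A B X Z h f)) ∨
    (∃ h g, w = cgen (barAB A B) X Z (ltrR A B X Z h g)) ∨
    (∃ f g, w = cgen (barAB A B) X Z (ltrT A B X Z f g)) ∨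
    (∃ Y h g h' f, w = ccons (barAB A B) X Y Z (ltrR A B Y Z h g)
      (cgen (barAB A B) X Y (ltrL A B X Y h' f))) ∨
    ∃ Y h f h' g, w = ccons (barAB A B) X Y Z (ltrL A B Y Z h f)
      (cgen (barAB A B) X Y (ltrR A B X Y h' g))}

theorem lowPart_eq (X Z : A.Ob × B.Ob) : lowPart A B X Z = lowWords A B X Z := by
  refine le_antisymm ?_ ?_
  · refine iSup_le fun m => iSup_le fun n => iSup_le fun hmn => iSup_le fun l => ?_
    obtain ⟨hm, hn⟩ := hmn
    rw [Submodule.map_le_iff_le_comap]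
    match l with
    | 0 =>
      change genBideg A B m n X Z ≤ (lowWords A B X Z).comap (tin (genAB A B) 0 X Z)
      interval_cases m <;> interval_cases n
      · rw [genBideg_zero_zero]
        exact bot_le
      · exact genBideg_zero_one_le fun h f => subset_span (Or.inr (Or.inl ⟨h, f, rfl⟩))
      · exact genBideg_one_zero_le fun h f => subset_span (Or.inl ⟨h, f, rfl⟩)
      · exact genBideg_one_one_le fun f g =>
          subset_span (Or.inr (Or.inr (Or.inl ⟨f, g, rfl⟩)))
    | 1 =>
      refine span_le.2 ?_
      rintro _ ⟨Y, i, j, m', n', x, w, hi, hj, hx, hw, rfl⟩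
      have hw' : w ∈ genBideg A B m' n' X Y := hw
      have key : tin (genAB A B) 1 X Z (qmk (genAB A B) (tpow (genAB A B) 0) X Y Z x w) =
          ccons (barAB A B) X Y Z x (cgen (barAB A B) X Y w) :=
        (tcons_tin (genAB A B) 0 X Y Z x w).symm
      change tin (genAB A B) 1 X Z (qmk (genAB A B) (tpow (genAB A B) 0) X Y Z x w) ∈
        lowWords A B X Z
      rw [key]
      by_cases h0 : i + j = 0
      · obtain ⟨rfl, rfl⟩ : i = 0 ∧ j = 0 := by omega
        rw [genBideg_zero_zero] at hx
        rw [(mem_bot K).1 hx, map_zero, lzero_app]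
        exact zero_mem _
      by_cases h1 : m' + n' = 0
      · obtain ⟨rfl, rfl⟩ : m' = 0 ∧ n' = 0 := by omega
        rw [genBideg_zero_zero] at hw'
        obtain rfl : w = (0 : barAB A B X Y) := (mem_bot K).1 hw'
        have h0 := map_zero (cgen (barAB A B) X Y)
        rw [h0, map_zero]
        exact zero_mem _
      obtain ⟨rfl, rfl, rfl, rfl⟩ | ⟨rfl, rfl, rfl, rfl⟩ :
        (i = 1 ∧ j = 0 ∧ m' = 0 ∧ n' = 1) ∨ (i = 0 ∧ j = 1 ∧ m' = 1 ∧ n' = 0) := by omega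
      · refine genBideg_one_zero_le (S := (lowWords A B X Z).comap
          ((ccons (barAB A B) X Y Z).flip (cgen (barAB A B) X Y w))) (fun h f => ?_) hx
        refine genBideg_zero_one_le (S := (lowWords A B X Z).comap
          (ccons (barAB A B) X Y Z (ltrL A B Y Z h f) ∘ₗ cgen (barAB A B) X Y)) (fun h' g => ?_) hw'
        exact subset_span (Or.inr (Or.inr (Or.inr (Or.inr ⟨Y, h, f, h', g, rfl⟩))))
      · refine genBideg_zero_one_le (S := (lowWords A B X Z).comap
          ((ccons (barAB A B) X Y Z).flip (cgen (barAB A B) X Y w))) (fun h f => ?_) hx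
        refine genBideg_one_zero_le (S := (lowWords A B X Z).comap
          (ccons (barAB A B) X Y Z (ltrR A B Y Z h f) ∘ₗ cgen (barAB A B) X Y)) (fun h' g => ?_) hw'
        exact subset_span (Or.inr (Or.inr (Or.inr (Or.inl ⟨Y, h, f, h', g, rfl⟩))))
    | l + 2 =>
      intro w hw
      rw [eq_zero_of_mem_bidegPow (l + 2) (by omega) hw]
      exact zero_mem _
  · have hgen : ∀ m n, m ≤ 1 → n ≤ 1 → ∀ c ∈ genBideg A B m n X Z,
        cgen (barAB A B) X Z c ∈ lowPart A B X Z := fun m n hm hn c hc =>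
      mem_iSup_of_mem m (mem_iSup_of_mem n (mem_iSup_of_mem ⟨hm, hn⟩
        (mem_iSup_of_mem 0 ⟨c, hc, rfl⟩)))
    have hcons : ∀ Y i j m n, ∀ c ∈ genBideg A B i j Y Z, ∀ c' ∈ genBideg A B m n X Y,
        i + m ≤ 1 → j + n ≤ 1 → ccons (barAB A B) X Y Z c (cgen (barAB A B) X Y c') ∈
          lowPart A B X Z := fun Y i j m n c hc c' hc' hm hn =>
      mem_iSup_of_mem (i + m) (mem_iSup_of_mem (j + n) (mem_iSup_of_mem ⟨hm, hn⟩ (mem_iSup_of_mem 1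
          ⟨qmk (genAB A B) (tpow (genAB A B) 0) X Y Z c c', subset_span
            ⟨Y, i, j, m, n, c, c', rfl, rfl, hc, hc', rfl⟩,
            (tcons_tin (genAB A B) 0 X Y Z c c').symm⟩)))
    refine span_le.2 ?_
    rintro _ (⟨h, f, rfl⟩ | ⟨h, g, rfl⟩ | ⟨f, g, rfl⟩ | ⟨Y, h, g, h', f, rfl⟩ | ⟨Y, h, f, h', g, rfl⟩)
    · exact hgen 1 0 le_rfl zero_le_one _ (ltrL_mem_genBideg h f)
    · exact hgen 0 1 zero_le_one le_rfl _ (ltrR_mem_genBideg h g)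
    · exact hgen 1 1 le_rfl le_rfl _ (ltrT_mem_genBideg f g)
    · exact hcons Y 0 1 1 0 _ (ltrR_mem_genBideg h g) _ (ltrL_mem_genBideg h' f) le_rfl le_rfl
    · exact hcons Y 1 0 0 1 _ (ltrL_mem_genBideg h f) _ (ltrR_mem_genBideg h' g) le_rfl le_rfl

end LowPart

section

variable {O Ω : Type u} {P : GQuiver K O} {Q : GQuiver K Ω}
  {ΔP : ∀ X Z, P X Z →ₗ[K] qtens P P X Z} {ΔQ : ∀ X Z, Q X Z →ₗ[K] qtens Q Q X Z}

theorem qlift_redComul_redT {X Z : O × Ω}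
    (f : ∀ Y, red P Q Y Z →ₗ[K] red P Q X Y →ₗ[K] N) {i : ℤ} {u : P X.1 Z.1}
    (hi : u ∈ (P X.1 Z.1).gr i) (v : Q X.2 Z.2)
    (hu : qlift f (redShuf P Q X Z Z (fun Y => redProj P Q Y Z)
      (qmap[P, aug P] (fun Y => augIn P Y Z.1) (fun Y => augIn P X.1 Y) (ΔP X.1 Z.1 u))
      (augComul Q ΔQ X.2 Z.2 (augIn Q X.2 Z.2 v))) = 0)
    (hv : ∀ x ∈ [qmk (aug P) (aug P) X.1 X.1 Z.1 (augIn P X.1 Z.1 u) (augOne P X.1 X.1 rfl),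
      qmk (aug P) (aug P) X.1 Z.1 Z.1 (augOne P Z.1 Z.1 rfl) (augIn P X.1 Z.1 u)],
      qlift f (redShuf P Q X Z Z (fun Y => redProj P Q Y Z) x
        (qmap[Q, aug Q] (fun Y => augIn Q Y Z.2) (fun Y => augIn Q X.2 Y) (ΔQ X.2 Z.2 v))) = 0) :
    qlift f (redComul P Q ΔP ΔQ X Z (redT P Q X Z (u ⊗ₜ v))) =
      f (X.1, Z.2) (redL P Q (X.1, Z.2) Z rfl u) (redR P Q X (X.1, Z.2) rfl v) +
      f (Z.1, X.2) (redR P Q (Z.1, X.2) Z rfl ((Q X.2 Z.2).sgn i v))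
        (redL P Q X (Z.1, X.2) rfl u) := by
  have h1 := redComul_redProj_tmul (P := P) (Q := Q) (ΔP := ΔP) (ΔQ := ΔQ) X Z
    (augIn P X.1 Z.1 u) (augIn Q X.2 Z.2 v)
  rw [redProj_in_in] at h1
  rw [h1, augComul_augIn P, map_add, map_add, ladd_app, ladd_app, map_add, map_add, hu, zero_add,
    augComul_augIn, map_add, map_add, map_add, map_add, map_add, map_add, map_add, map_add, hv _ (by
    simp), hv _ (by simp), zero_add, zero_add, redShuf_qmk X Z Z _ X.1 X.2 _ (augOne_mem P X.1 X.1
    rfl), redShuf_qmk X Z Z _ X.1 Z.2 _ (augOne_mem P X.1 X.1 rfl), redShuf_qmk X Z Z _ Z.1 X.2 _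
    (augIn_mem P hi), redShuf_qmk X Z Z _ Z.1 Z.2 _ (augIn_mem P hi), redProj_one_one,
    aug_sgn_augOne, aug_sgn_augOne, redProj_one_one, map_zero, map_zero, map_zero, lzero_app,
    map_zero, zero_add, add_zero, aug_sgn_augIn, redProj_one_in, qlift_qmk, qlift_qmk]
  have h2 := redProj_in_one P Q (X.1, Z.2) Z rfl u
  have h3 := redProj_in_one P Q X (Z.1, X.2) rfl u
  have h4 := redProj_one_in P Q (Z.1, X.2) Z rfl ((Q X.2 Z.2).sgn i v)
  rw [h2]
  exact congrArg (_ + ·) (congrArg₂ (fun a b => f (Z.1, X.2) a b) h4 h3)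

end

section LowPartEquivalence

variable {A B : AInfCat K}

theorem comparison_mem_lowPart (X Z : A.Ob × B.Ob) (x : redAB A B X Z) :
    comparison A B X Z x ∈ lowPart A B X Z := by
  rw [lowPart_eq]
  refine red_induction (p := fun x => comparison A B X Z x ∈ lowWords A B X Z) ?_ ?_ ?_ ?_ x
  · intro x y hx hy
    rw [map_add]
    exact add_mem hx hy
  · intro i f hf j g hg
    rw [comparison_redT hf]
    exact subset_span (Or.inr (Or.inr (Or.inr (Or.inl ⟨_, _, _, _, _, rfl⟩))))
  · intro h i f hf
    rw [comparison_redL]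
    exact subset_span (Or.inl ⟨_, _, rfl⟩)
  · intro h i f hf
    rw [comparison_redR]
    exact subset_span (Or.inr (Or.inl ⟨_, _, rfl⟩))

theorem barABD_ltrT (X Z : A.Ob × B.Ob) (f : A.Hom X.1 Z.1) (g : B.Hom X.2 Z.2) :
    barABD A B X Z (ltrT A B X Z f g) = -ltrT A B X Z (A.d X.1 Z.1 f) g -
      ltrT A B X Z ((A.sHom X.1 Z.1).sgn 1 f) (B.d X.2 Z.2 g) := by
  have h := redD_redT (P := A.bar) (Q := B.bar) (dP := A.barD) (dQ := B.barD) X Z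
    (tgen A.sHom X.1 Z.1 f) (tgen B.sHom X.2 Z.2 g)
  refine h.trans ?_
  rw [A.barD_tgen, B.barD_tgen, tgen_sgn, TensorProduct.neg_tmul, TensorProduct.tmul_neg, map_neg,
    map_neg, ← sub_eq_add_neg]
  rfl

theorem qlift_barABComul_ltrT {X Z : A.Ob × B.Ob}
    (φ : ∀ Y, barAB A B Y Z →ₗ[K] barAB A B X Y →ₗ[K] N) {i : ℤ} {f : A.Hom X.1 Z.1}
    (hf : f ∈ (A.sHom X.1 Z.1).gr i) (g : B.Hom X.2 Z.2) :
    qlift φ (barABComul A B X Z (ltrT A B X Z f g)) =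
      φ (X.1, Z.2) (ltrL A B (X.1, Z.2) Z rfl f) (ltrR A B X (X.1, Z.2) rfl g) +
      φ (Z.1, X.2) (ltrR A B (Z.1, X.2) Z rfl ((B.sHom X.2 Z.2).sgn i g))
        (ltrL A B X (Z.1, X.2) rfl f) := by
  have h0 : A.barComul X.1 Z.1 (tgen A.sHom X.1 Z.1 f) = 0 := tcomul_tgen A.sHom X.1 Z.1 f
  have h1 : B.barComul X.2 Z.2 (tgen B.sHom X.2 Z.2 g) = 0 := tcomul_tgen B.sHom X.2 Z.2 g
  have h := qlift_redComul_redT (P := A.bar) (Q := B.bar) (ΔP := A.barComul) (ΔQ := B.barComul)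
    (X := X) (Z := Z) φ (u := tgen A.sHom X.1 Z.1 f) (tgen_mem (Q := A.sHom) hf)
    (tgen B.sHom X.2 Z.2 g) (by rw [h0]; simp only [map_zero, lzero_app])
    (fun w _ => by rw [h1]; simp only [map_zero])
  rw [tgen_sgn] at h
  exact h

theorem cgen_ltrT_mem (X Z : A.Ob × B.Ob) (f : A.Hom X.1 Z.1) (g : B.Hom X.2 Z.2) :
    cgen (barAB A B) X Z (ltrT A B X Z f g) ∈ lowWords A B X Z :=
  subset_span (Or.inr (Or.inr (Or.inl ⟨f, g, rfl⟩)))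

theorem ccons_ltrR_ltrL_mem (X Y Z : A.Ob × B.Ob) (h g h' f) :
    ccons (barAB A B) X Y Z (ltrR A B Y Z h g) (cgen (barAB A B) X Y (ltrL A B X Y h' f)) ∈
      lowWords A B X Z :=
  subset_span (Or.inr (Or.inr (Or.inr (Or.inl ⟨Y, h, g, h', f, rfl⟩))))

theorem ccons_ltrL_ltrR_mem (X Y Z : A.Ob × B.Ob) (h f h' g) :
    ccons (barAB A B) X Y Z (ltrL A B Y Z h f) (cgen (barAB A B) X Y (ltrR A B X Y h' g)) ∈
      lowWords A B X Z :=
  subset_span (Or.inr (Or.inr (Or.inr (Or.inr ⟨Y, h, f, h', g, rfl⟩))))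

theorem sgn_ltrL' {X Y : A.Ob × B.Ob} (h : X.2 = Y.2) (f : A.Hom X.1 Y.1) :
    (barAB A B X Y).sgn 1 (ltrL A B X Y h f) =
      ltrL A B X Y h ((A.sHom X.1 Y.1).sgn 1 f) := by
  refine lapply_eq ((barAB A B X Y).sgn 1 ∘ₗ ltrL A B X Y h)
    (ltrL A B X Y h ∘ₗ (A.sHom X.1 Y.1).sgn 1) (hom_ext_gr _ fun i f hf => ?_) f
  rw [comp_app, comp_app, sgn_ltrL h hf, A.sHom_sgn hf, map_neg, map_zsmul]

theorem sgn_ltrR' {X Y : A.Ob × B.Ob} (h : X.1 = Y.1) (g : B.Hom X.2 Y.2) :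
    (barAB A B X Y).sgn 1 (ltrR A B X Y h g) =
      ltrR A B X Y h ((B.sHom X.2 Y.2).sgn 1 g) := by
  refine lapply_eq ((barAB A B X Y).sgn 1 ∘ₗ ltrR A B X Y h)
    (ltrR A B X Y h ∘ₗ (B.sHom X.2 Y.2).sgn 1) (hom_ext_gr _ fun i f hf => ?_) g
  rw [comp_app, comp_app, sgn_ltrR h hf, B.sHom_sgn hf, map_neg, map_zsmul]

theorem cobarABD_cgen_ltrT_mem (X Z : A.Ob × B.Ob) (f : A.Hom X.1 Z.1) (g : B.Hom X.2 Z.2) :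
    cobarABD A B X Z (cgen (barAB A B) X Z (ltrT A B X Z f g)) ∈ lowWords A B X Z := by
  refine gr_le_induction (A.sHom X.1 Z.1) (p := fun f => cobarABD A B X Z
    (cgen (barAB A B) X Z (ltrT A B X Z f g)) ∈ lowWords A B X Z) (fun i f hf => ?_) ?_ ?_ f
  · rw [cobarABD, cobarD_cgen, barABD_ltrT, cquad, qlift_barABComul_ltrT _ hf, map_sub, map_neg]
    refine sub_mem (neg_mem (sub_mem (neg_mem (cgen_ltrT_mem X Z _ _)) (cgen_ltrT_mem X Z _ _)))
      (add_mem ?_ ?_)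
    · rw [compl₁₂_app, sgn_ltrL']
      exact ccons_ltrL_ltrR_mem X (X.1, Z.2) Z _ _ _ _
    · rw [compl₁₂_app, sgn_ltrR']
      exact ccons_ltrR_ltrL_mem X (Z.1, X.2) Z _ _ _ _
  · rw [ltrT, map_zero, zero_tmul, map_zero, map_zero, map_zero]
    exact zero_mem _
  · intro f f' hf hf'
    rw [ltrT, map_add, add_tmul, map_add, map_add, map_add]
    exact add_mem hf hf'

theorem cobarABD_mem_lowPart (X Z : A.Ob × B.Ob) (w : cobarAB A B X Z) (hw : w ∈ lowPart A B X Z) :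
    cobarABD A B X Z w ∈ lowPart A B X Z := by
  rw [lowPart_eq] at hw ⊢
  have : lowWords A B X Z ≤ (lowWords A B X Z).comap (cobarABD A B X Z) := by
    refine span_le.2 ?_
    rintro _ (⟨h, f, rfl⟩ | ⟨h, g, rfl⟩ | ⟨f, g, rfl⟩ | ⟨Y, h, g, h', f, rfl⟩ | ⟨Y, h, f, h', g, rfl⟩)
    · rw [SetLike.mem_coe, mem_comap, cobarABD_cgen_ltrL]
      exact subset_span (Or.inl ⟨_, _, rfl⟩)
    · rw [SetLike.mem_coe, mem_comap, cobarABD_cgen_ltrR]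
      exact subset_span (Or.inr (Or.inl ⟨_, _, rfl⟩))
    · exact cobarABD_cgen_ltrT_mem X Z f g
    · rw [SetLike.mem_coe, mem_comap, cobarABD, cobarD_ccons, barABD_ltrR, barABComul_ltrR,
        sgn_ltrR', ← cobarABD, cobarABD_cgen_ltrL]
      simp only [map_neg, lneg_app, neg_neg, map_zero, lzero_app, sub_zero]
      exact sub_mem (ccons_ltrR_ltrL_mem X Y Z _ _ _ _) (ccons_ltrR_ltrL_mem X Y Z _ _ _ _)
    · rw [SetLike.mem_coe, mem_comap, cobarABD, cobarD_ccons, barABD_ltrL, barABComul_ltrL,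
        sgn_ltrL', ← cobarABD, cobarABD_cgen_ltrR]
      simp only [map_neg, lneg_app, neg_neg, map_zero, lzero_app, sub_zero]
      exact sub_mem (ccons_ltrL_ltrR_mem X Y Z _ _ _ _) (ccons_ltrL_ltrR_mem X Y Z _ _ _ _)
  exact this hw

theorem m_ltrL_ltrR {X Y Z : A.Ob × B.Ob} (h : Y.2 = Z.2) (f : A.Hom Y.1 Z.1)
    (h' : X.1 = Y.1) (g : B.Hom X.2 Y.2) : ∃ f' g', (firstLetter A B).m X Y Z
      (ltrL A B Y Z h f) (ltrR A B X Y h' g) = ltrT A B X Z f' g' := by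
  obtain ⟨x, b⟩ := X
  obtain ⟨y, b'⟩ := Y
  obtain ⟨z, b''⟩ := Z
  obtain rfl : b' = b'' := h
  obtain rfl : x = y := h'
  exact ⟨f, g, tredComp_letL_redR (E := A.sHom) (F := B.sHom) (x, b) z b' f (tgen B.sHom b b' g)⟩

theorem h_mem_lowPart (X Z : A.Ob × B.Ob) (w : cobarAB A B X Z) (hw : w ∈ lowPart A B X Z) :
    (firstLetter A B).h X Z w ∈ lowPart A B X Z := by
  rw [lowPart_eq] at hw ⊢
  have : lowWords A B X Z ≤ (lowWords A B X Z).comap ((firstLetter A B).h X Z) := by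
    have hgen : ∀ c, (firstLetter A B).h X Z (cgen (barAB A B) X Z c) = 0 := fun c => by
      rw [FirstLetter.h, ladd_app, FirstLetter.hA_cgen, FirstLetter.hB_cgen, add_zero]
    refine span_le.2 ?_
    rintro _ (⟨h, f, rfl⟩ | ⟨h, g, rfl⟩ | ⟨f, g, rfl⟩ | ⟨Y, h, g, h', f, rfl⟩ | ⟨Y, h, f, h', g, rfl⟩)
    · rw [SetLike.mem_coe, mem_comap, hgen]
      exact zero_mem _
    · rw [SetLike.mem_coe, mem_comap, hgen]
      exact zero_mem _
    · rw [SetLike.mem_coe, mem_comap, hgen]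
      exact zero_mem _
    · rw [SetLike.mem_coe, mem_comap, h_ccons_ltrR]
      exact zero_mem _
    · have h1 := pA_ltrL h ((A.sHom Y.1 Z.1).sgn 1 f)
      obtain ⟨f', g', h2⟩ := m_ltrL_ltrR h ((A.sHom Y.1 Z.1).sgn 1 f) h' g
      rw [SetLike.mem_coe, mem_comap, FirstLetter.h, ladd_app, FirstLetter.hA_ccons,
        FirstLetter.hB_ccons, sgn_ltrL', h1, (firstLetter A B).pB_letA _ _ _ h1,
        FirstLetter.cmul_cgen, h2]
      simp only [map_zero, lzero_app, sub_zero, neg_zero, add_zero]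
      exact neg_mem (cgen_ltrT_mem X Z _ _)
  exact this hw

end LowPartEquivalence

section

variable (A B : AInfCat K)

/-- The comparison map with values in the words with at most one letter from each category. -/
def lowComparison (X Z : A.Ob × B.Ob) : redAB A B X Z →ₗ[K] lowPart A B X Z :=
  (comparison A B X Z).codRestrict _ (comparison_mem_lowPart X Z)

theorem remainder_mem_lowPart (X Z : A.Ob × B.Ob) (w : cobarAB A B X Z)
    (hw : w ∈ lowPart A B X Z) : remainder A B X Z w ∈ lowPart A B X Z :=
  sub_mem (sub_mem hw (comparison_mem_lowPart X Z _))
    (add_mem (cobarABD_mem_lowPart X Z _ (h_mem_lowPart X Z w hw))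
      (h_mem_lowPart X Z _ (cobarABD_mem_lowPart X Z w hw)))

theorem lowComparison_isHomotopyEquiv (X Z : A.Ob × B.Ob)
    (hL : ∀ x ∈ lowPart A B X Z, cobarABD A B X Z x ∈ lowPart A B X Z) :
    IsHomotopyEquiv (redAB A B X Z).gr (redABD A B X Z)
      (fun i => ((cobarAB A B X Z).gr i).comap (lowPart A B X Z).subtype)
      ((cobarABD A B X Z).restrict hL) (lowComparison A B X Z) := by
  have hc := comparison_isChainMap A B X Z
  have hd := cobarABD_isDifferential A B X Z
  refine isHomotopyEquiv_of_locally_nilpotent ⟨hc.1, fun x => Subtype.ext (hc.2 x)⟩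
    (cretract A B X Z ∘ₗ (lowPart A B X Z).subtype)
    (fun i x hx => cretract_hasDegree A B X Z i x.1 hx) (cretract_comparison A B X Z)
    (((firstLetter A B).h X Z).restrict (h_mem_lowPart X Z))
    (fun i x hx => (firstLetter A B).h_hasDegree X Z i x.1 hx)
    (fun x => Subtype.ext (h_comparison A B X Z x))
    ⟨fun i x hx => hd.1 i x.1 hx, fun x => Subtype.ext (hd.2 x.1)⟩
    ((remainder A B X Z).restrict (remainder_mem_lowPart A B X Z))
    (fun x => Subtype.ext rfl) (fun x => ?_)
  obtain ⟨n, hn⟩ := remainder_nilpotent A B X Z x.1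
  refine ⟨n, Subtype.ext ?_⟩
  rw [Module.End.pow_restrict]
  exact hn

theorem isHomotopyEquiv_iff_lowPart (X Z : A.Ob × B.Ob)
    (hL : ∀ x ∈ lowPart A B X Z, cobarABD A B X Z x ∈ lowPart A B X Z)
    (φ : cobarAB A B X Z →ₗ[K] redAB A B X Z)
    (hφ : IsChainMap (cobarAB A B X Z).gr (cobarABD A B X Z) (redAB A B X Z).gr (redABD A B X Z) φ) :
    IsHomotopyEquiv (cobarAB A B X Z).gr (cobarABD A B X Z) (redAB A B X Z).gr (redABD A B X Z) φ ↔
      IsHomotopyEquiv (fun i => ((cobarAB A B X Z).gr i).comap (lowPart A B X Z).subtype)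
        ((cobarABD A B X Z).restrict hL) (redAB A B X Z).gr (redABD A B X Z)
        (φ ∘ₗ (lowPart A B X Z).subtype) := by
  have h1 := comparison_isHomotopyEquiv A B X Z
  have h2 := lowComparison_isHomotopyEquiv A B X Z hL
  constructor
  · intro h
    refine IsHomotopyEquiv.of_comp ⟨fun i x hx => hφ.1 i x.1 hx, fun x => hφ.2 x.1⟩ h2 ?_
    have h3 := IsHomotopyEquiv.comp h h1
    exact h3
  · intro h
    refine IsHomotopyEquiv.of_comp hφ h1 ?_
    have h3 := IsHomotopyEquiv.comp h h2
    exact h3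

end

section Laws

variable {O Ω : Type u}

/-- The laws of a non-unital dg category, except for the square of the differential. -/
structure IsDGComp (P : GQuiver K O) (d : ∀ X Y, P X Y →ₗ[K] P X Y)
    (c : ∀ X Y Z, P Y Z →ₗ[K] P X Y →ₗ[K] P X Z) : Prop where
  d_deg : ∀ X Y, HasDegree (P X Y).gr (P X Y).gr (d X Y) 1
  mem : ∀ X Y Z i j, ∀ f ∈ (P Y Z).gr i, ∀ g ∈ (P X Y).gr j, c X Y Z f g ∈ (P X Z).gr (i + j)
  leibniz : ∀ X Y Z f g, d X Z (c X Y Z f g) =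
    c X Y Z (d Y Z f) g + c X Y Z ((P Y Z).sgn 1 f) (d X Y g)
  assoc : ∀ X Y Z W (f : P Z W) (g : P Y Z) (h : P X Y),
    c X Y W (c Y Z W f g) h = c X Z W f (c X Y Z g h)

variable {P : GQuiver K O} {Q : GQuiver K Ω} {dP : ∀ X Y, P X Y →ₗ[K] P X Y}
  {dQ : ∀ X Y, Q X Y →ₗ[K] Q X Y} {cP : ∀ X Y Z, P Y Z →ₗ[K] P X Y →ₗ[K] P X Z}
  {cQ : ∀ X Y Z, Q Y Z →ₗ[K] Q X Y →ₗ[K] Q X Z}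

theorem IsDGComp.sgn (hP : IsDGComp P dP cP) (X Y Z : O) (p : ℤ) (f : P Y Z) (g : P X Y) :
    (P X Z).sgn p (cP X Y Z f g) = cP X Y Z ((P Y Z).sgn p f) ((P X Y).sgn p g) := by
  refine lapply_eq ((P X Z).sgn p ∘ₗ (cP X Y Z).flip g)
    ((cP X Y Z).flip ((P X Y).sgn p g) ∘ₗ (P Y Z).sgn p) (hom_ext_gr _ fun i a ha => ?_) f
  refine lapply_eq ((P X Z).sgn p ∘ₗ cP X Y Z a)
    (cP X Y Z ((P Y Z).sgn p a) ∘ₗ (P X Y).sgn p) (hom_ext_gr _ fun j c hc => ?_) g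
  rw [comp_app, comp_app, sgn_of_mem _ _ (hP.mem X Y Z i j a ha c hc), sgn_of_mem _ _ ha, sgn_of_mem
    _ _ hc, map_zsmul, map_zsmul, lsmul_app, smul_smul, mul_add, negOnePow_add, Units.val_mul,
    mul_comm]

theorem IsDGComp.aug (hP : IsDGComp P dP cP) : IsDGComp (aug P) (augD P dP) (augComp P cP) where
  d_deg X Y i x hx := by
    refine aug_gr_induction (S := ((AInf.aug P X Y).gr (i + 1)).comap (augD P dP X Y)) ?_ ?_ hx
    · intro x hx
      rw [mem_comap, augD_augIn]
      exact augIn_mem P (hP.d_deg X Y i x hx)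
    · intro h _
      rw [mem_comap, augD_augOne]
      exact zero_mem _
  mem X Y Z i j f hf g hg := augComp_mem hP.mem X Y Z hf hg
  leibniz X Y Z f g := by
    refine lapply_eq (augD P dP X Z ∘ₗ (augComp P cP X Y Z).flip g)
      ((augComp P cP X Y Z).flip g ∘ₗ augD P dP Y Z +
        (augComp P cP X Y Z).flip (augD P dP X Y g) ∘ₗ (AInf.aug P Y Z).sgn 1)
      (aug_ext (fun f => ?_) ?_) f
    · refine lapply_eq (augD P dP X Z ∘ₗ augComp P cP X Y Z (augIn P Y Z f))
        (augComp P cP X Y Z (augD P dP Y Z (augIn P Y Z f)) +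
          augComp P cP X Y Z ((AInf.aug P Y Z).sgn 1 (augIn P Y Z f)) ∘ₗ augD P dP X Y)
        (aug_ext (fun g => ?_) ?_) g
      · rw [comp_app, augComp_in_in, augD_augIn, hP.leibniz, ladd_app, augD_augIn, aug_sgn_augIn,
          augComp_in_in, comp_app, augD_augIn, augComp_in_in, map_add]
      · have : ∀ h : X = Y, augD P dP X Z
            (augComp P cP X Y Z (augIn P Y Z f) (augOne P X Y h)) =
            augComp P cP X Y Z (augD P dP Y Z (augIn P Y Z f)) (augOne P X Y h) +
            augComp P cP X Y Z ((AInf.aug P Y Z).sgn 1 (augIn P Y Z f))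
              (augD P dP X Y (augOne P X Y h)) := by
          intro h
          subst h
          rw [augComp_in_one, augD_augIn, augComp_in_one, augD_augOne, map_zero, add_zero]
        exact this
    · have : ∀ h : Y = Z, augD P dP X Z (augComp P cP X Y Z (augOne P Y Z h) g) =
          augComp P cP X Y Z (augD P dP Y Z (augOne P Y Z h)) g +
          augComp P cP X Y Z ((AInf.aug P Y Z).sgn 1 (augOne P Y Z h)) (augD P dP X Y g) := by
        intro h
        subst h
        rw [augComp_one_left, augD_augOne, map_zero, lzero_app, zero_add, aug_sgn_augOne,
          augComp_one_left]
      exact this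
  assoc X Y Z W f g h := by
    refine aug_induction (p := fun f => augComp P cP X Y W (augComp P cP Y Z W f g) h =
      augComp P cP X Z W f (augComp P cP X Y Z g h)) ?_ ?_ ?_ (fun f => ?_) ?_ f
    · intro x y hx hy
      simp only [map_add, ladd_app, hx, hy]
    · intro a x hx
      simp only [map_smul, lsmul_app, hx]
    · simp only [map_zero, lzero_app]
    · refine aug_induction (p := fun g => augComp P cP X Y W (augComp P cP Y Z W (augIn P Z W f) g)
        h = augComp P cP X Z W (augIn P Z W f) (augComp P cP X Y Z g h)) ?_ ?_ ?_ (fun g => ?_) ?_ g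
      · intro x y hx hy
        simp only [map_add, ladd_app, hx, hy]
      · intro a x hx
        simp only [map_smul, lsmul_app, hx]
      · simp only [map_zero, lzero_app]
      · refine lapply_eq (augComp P cP X Y W (augComp P cP Y Z W (augIn P Z W f) (augIn P Y Z g)))
          (augComp P cP X Z W (augIn P Z W f) ∘ₗ augComp P cP X Y Z (augIn P Y Z g))
          (aug_ext (fun h => ?_) ?_) h
        · rw [augComp_in_in, augComp_in_in, hP.assoc, comp_app, augComp_in_in, augComp_in_in]
        · have : ∀ h : X = Y, augComp P cP X Y W (augComp P cP Y Z W (augIn P Z W f)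
              (augIn P Y Z g)) (augOne P X Y h) = augComp P cP X Z W (augIn P Z W f)
                (augComp P cP X Y Z (augIn P Y Z g) (augOne P X Y h)) := by
            intro h
            subst h
            rw [augComp_one_right, augComp_one_right]
          exact this
      · intro h
        subst h
        rw [augComp_one_right, augComp_one_left]
    · intro h
      subst h
      rw [augComp_one_left, augComp_one_left]

theorem IsDGComp.ptens_leibniz (hP : IsDGComp P dP cP) (hQ : IsDGComp Q dQ cQ) (X Y Z : O × Ω)
    (x : ptens P Q Y Z) (y : ptens P Q X Y) :
    tensD (P X.1 Z.1) (Q X.2 Z.2) (dP X.1 Z.1) (dQ X.2 Z.2) (ptensComp P Q cP cQ X Y Z x y) =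
      ptensComp P Q cP cQ X Y Z (tensD (P Y.1 Z.1) (Q Y.2 Z.2) (dP Y.1 Z.1) (dQ Y.2 Z.2) x) y +
      ptensComp P Q cP cQ X Y Z ((ptens P Q Y Z).sgn 1 x)
        (tensD (P X.1 Y.1) (Q X.2 Y.2) (dP X.1 Y.1) (dQ X.2 Y.2) y) := by
  refine lapply_eq (tensD (P X.1 Z.1) (Q X.2 Z.2) (dP X.1 Z.1) (dQ X.2 Z.2) ∘ₗ
      (ptensComp P Q cP cQ X Y Z).flip y)
    ((ptensComp P Q cP cQ X Y Z).flip y ∘ₗ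
      tensD (P Y.1 Z.1) (Q Y.2 Z.2) (dP Y.1 Z.1) (dQ Y.2 Z.2) +
      (ptensComp P Q cP cQ X Y Z).flip (tensD (P X.1 Y.1) (Q X.2 Y.2) (dP X.1 Y.1) (dQ X.2 Y.2) y)
        ∘ₗ (ptens P Q Y Z).sgn 1) (tens_ext fun i f hf j g hg => ?_) x
  refine lapply_eq (tensD (P X.1 Z.1) (Q X.2 Z.2) (dP X.1 Z.1) (dQ X.2 Z.2) ∘ₗ
      ptensComp P Q cP cQ X Y Z (f ⊗ₜ g))
    (ptensComp P Q cP cQ X Y Z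
      (tensD (P Y.1 Z.1) (Q Y.2 Z.2) (dP Y.1 Z.1) (dQ Y.2 Z.2) (f ⊗ₜ g)) +
      ptensComp P Q cP cQ X Y Z ((ptens P Q Y Z).sgn 1 (f ⊗ₜ g)) ∘ₗ
        tensD (P X.1 Y.1) (Q X.2 Y.2) (dP X.1 Y.1) (dQ X.2 Y.2))
    (tens_ext fun i' f' hf' j' g' hg' => ?_) y
  have h1 := sgn_map_of_hasDegree (hP.d_deg X.1 Y.1) j f'
  rw [mul_one] at h1
  rw [comp_app, ptensComp_tmul P Q cP cQ X Y Z f hg, tensD_tmul, hP.leibniz, hQ.leibniz, hP.sgn,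
    sgn_sgn, ladd_app, tensD_tmul, map_add, ladd_app, ptensComp_tmul P Q cP cQ X Y Z _ hg,
    ptensComp_tmul P Q cP cQ X Y Z _ (hQ.d_deg _ _ _ _ hg), comp_app, tens_sgn, tensD_tmul, map_add,
    ptensComp_tmul P Q cP cQ X Y Z _ (sgn_mem _ 1 hg), ptensComp_tmul P Q cP cQ X Y Z _ (sgn_mem _ 1
    hg), sgn_sgn, h1, sgn_one_of_mem _ hg]
  rw [add_comm j 1, map_zsmul, map_zsmul, lsmul_app, add_tmul, tmul_add, ← smul_tmul', tmul_smul]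
  have h2 : (j.negOnePow : ℤ) * (j.negOnePow : ℤ) = 1 := by
    rcases negOnePow_cases j with hj | hj <;> rw [hj] <;> rfl
  rw [lsmul_app, tmul_smul, smul_smul, h2, one_smul]
  abel

theorem IsDGComp.ptens_assoc (hP : IsDGComp P dP cP) (hQ : IsDGComp Q dQ cQ) (X Y Z W : O × Ω)
    (x : ptens P Q Z W) (y : ptens P Q Y Z) (z : ptens P Q X Y) :
    ptensComp P Q cP cQ X Y W (ptensComp P Q cP cQ Y Z W x y) z =
      ptensComp P Q cP cQ X Z W x (ptensComp P Q cP cQ X Y Z y z) := by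
  refine lapply_eq ((ptensComp P Q cP cQ X Y W).flip z ∘ₗ (ptensComp P Q cP cQ Y Z W).flip y)
    ((ptensComp P Q cP cQ X Z W).flip (ptensComp P Q cP cQ X Y Z y z))
    (tens_ext fun i f hf j g hg => ?_) x
  refine lapply_eq ((ptensComp P Q cP cQ X Y W).flip z ∘ₗ ptensComp P Q cP cQ Y Z W (f ⊗ₜ g))
    (ptensComp P Q cP cQ X Z W (f ⊗ₜ g) ∘ₗ (ptensComp P Q cP cQ X Y Z).flip z)
    (tens_ext fun i' f' hf' j' g' hg' => ?_) y
  refine lapply_eq (ptensComp P Q cP cQ X Y W (ptensComp P Q cP cQ Y Z W (f ⊗ₜ g) (f' ⊗ₜ g')))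
    (ptensComp P Q cP cQ X Z W (f ⊗ₜ g) ∘ₗ ptensComp P Q cP cQ X Y Z (f' ⊗ₜ g'))
    (tens_ext fun i'' f'' hf'' j'' g'' hg'' => ?_) z
  rw [ptensComp_tmul P Q cP cQ Y Z W f hg, ptensComp_tmul P Q cP cQ X Y W _ (hQ.mem _ _ _ _ _ _ hg _
    hg'), hP.assoc, hQ.assoc, comp_app, ptensComp_tmul P Q cP cQ X Y Z f' hg', ptensComp_tmul P Q cP
    cQ X Z W f hg, hP.sgn, sgn_sgn]

theorem exists_augComp_augIn (X Y Z : O) (f : P Y Z) (g : aug P X Y) :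
    ∃ f', augComp P cP X Y Z (augIn P Y Z f) g = augIn P X Z f' := by
  refine aug_induction (p := fun g => ∃ f', augComp P cP X Y Z (augIn P Y Z f) g = augIn P X Z f')
    ?_ ?_ ?_ ?_ ?_ g
  · rintro x y ⟨x', hx⟩ ⟨y', hy⟩
    exact ⟨x' + y', by rw [map_add, hx, hy, map_add]⟩
  · rintro a x ⟨x', hx⟩
    exact ⟨a • x', by rw [map_smul, hx, map_smul]⟩
  · exact ⟨0, by rw [map_zero, map_zero]⟩
  · exact fun x => ⟨_, augComp_in_in P cP X Y Z f x⟩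
  · have : ∀ h : X = Y, ∃ f', augComp P cP X Y Z (augIn P Y Z f) (augOne P X Y h) =
        augIn P X Z f' := by
      intro h
      subst h
      exact ⟨f, augComp_in_one P cP X Z f⟩
    exact this

theorem augIn_tmul_mem (X Y : O × Ω) (x : P X.1 Y.1) (y : aug Q X.2 Y.2) :
    augIn P X.1 Y.1 x ⊗ₜ y ∈ LinearMap.range (redIncl P Q X Y) := by
  refine aug_induction (p := fun y => augIn P X.1 Y.1 x ⊗ₜ y ∈ LinearMap.range (redIncl P Q X Y))
    ?_ ?_ ?_ ?_ ?_ y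
  · intro y y' hy hy'
    rw [tmul_add]
    exact add_mem hy hy'
  · intro a y hy
    rw [tmul_smul]
    exact Submodule.smul_mem _ _ hy
  · rw [tmul_zero]
    exact zero_mem _
  · exact fun y => ⟨_, redIncl_redT P Q X Y x y⟩
  · exact fun h => ⟨_, redIncl_redL P Q X Y h x⟩

theorem tmul_augIn_mem (X Y : O × Ω) (x : aug P X.1 Y.1) (y : Q X.2 Y.2) :
    x ⊗ₜ augIn Q X.2 Y.2 y ∈ LinearMap.range (redIncl P Q X Y) := by
  refine aug_induction (p := fun x => x ⊗ₜ augIn Q X.2 Y.2 y ∈ LinearMap.range (redIncl P Q X Y))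
    ?_ ?_ ?_ ?_ ?_ x
  · intro y y' hy hy'
    rw [add_tmul]
    exact add_mem hy hy'
  · intro a y hy
    rw [← smul_tmul']
    exact Submodule.smul_mem _ _ hy
  · rw [zero_tmul]
    exact zero_mem _
  · exact fun x => ⟨_, redIncl_redT P Q X Y x y⟩
  · exact fun h => ⟨_, redIncl_redR P Q X Y h y⟩

theorem redIncl_redComp (X Y Z : O × Ω) (f : red P Q Y Z) (g : red P Q X Y) :
    redIncl P Q X Z (redComp P Q cP cQ X Y Z f g) =
      ptensComp (aug P) (aug Q) (augComp P cP) (augComp Q cQ) X Y Z (redIncl P Q Y Z f)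
        (redIncl P Q X Y g) := by
  have : ptensComp (aug P) (aug Q) (augComp P cP) (augComp Q cQ) X Y Z (redIncl P Q Y Z f)
      (redIncl P Q X Y g) ∈ LinearMap.range (redIncl P Q X Z) := by
    generalize redIncl P Q X Y g = z
    induction z using TensorProduct.induction_on with
    | zero => rw [map_zero]; exact zero_mem _
    | add u v hu hv => rw [map_add]; exact add_mem hu hv
    | tmul x y =>
      refine red_induction (p := fun f => ptensComp (aug P) (aug Q) (augComp P cP) (augComp Q cQ)
        X Y Z (redIncl P Q Y Z f) (x ⊗ₜ y) ∈ LinearMap.range (redIncl P Q X Z)) ?_ ?_ ?_ ?_ f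
      · intro u v hu hv
        rw [map_add, map_add, ladd_app]
        exact add_mem hu hv
      · intro i f hf j g hg
        rw [redIncl_redT, ptensComp_tmul _ _ _ _ X Y Z _ (augIn_mem Q hg)]
        obtain ⟨f', h⟩ := exists_augComp_augIn (cP := cP) X.1 Y.1 Z.1 f ((aug P X.1 Y.1).sgn j x)
        rw [h]
        exact augIn_tmul_mem X Z f' _
      · intro h i f hf
        rw [redIncl_redL, ptensComp_tmul _ _ _ _ X Y Z _ (augOne_mem Q _ _ h)]
        obtain ⟨f', h⟩ := exists_augComp_augIn (cP := cP) X.1 Y.1 Z.1 f ((aug P X.1 Y.1).sgn 0 x)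
        rw [h]
        exact augIn_tmul_mem X Z f' _
      · intro h i g hg
        rw [redIncl_redR, ptensComp_tmul _ _ _ _ X Y Z _ (augIn_mem Q hg)]
        obtain ⟨g', h⟩ := exists_augComp_augIn (cP := cQ) X.2 Y.2 Z.2 g y
        rw [h]
        exact tmul_augIn_mem X Z _ g'
  obtain ⟨w, hw⟩ := this
  rw [redComp_apply, ← hw, redProj_redIncl]

theorem IsDGComp.red (hP : IsDGComp P dP cP) (hQ : IsDGComp Q dQ cQ)
    (hd : ∀ X Z, HasDegree (red P Q X Z).gr (red P Q X Z).gr (redD P Q dP dQ X Z) 1) :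
    IsDGComp (red P Q) (redD P Q dP dQ) (redComp P Q cP cQ) where
  d_deg := hd
  mem X Y Z i j f hf g hg := redComp_mem hP.mem hQ.mem X Y Z hf hg
  leibniz X Y Z f g := by
    have h := IsDGComp.ptens_leibniz hP.aug hQ.aug X Y Z (redIncl P Q Y Z f) (redIncl P Q X Y g)
    rw [← redIncl_redD, ← redIncl_redD, sgn_map_of_hasDegree_zero (redIncl_hasDegree P Q Y Z)] at h
    rw [redComp_apply, ← redProj_tensD, h, map_add]
    rfl
  assoc X Y Z W f g h := by
    rw [redComp_apply, redIncl_redComp, IsDGComp.ptens_assoc hP.aug hQ.aug, ← redIncl_redComp]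
    rfl

end Laws

section

variable {O Ω : Type u} {P : GQuiver K O} {Q : GQuiver K Ω}
  {ΔP : ∀ X Z, P X Z →ₗ[K] qtens P P X Z} {ΔQ : ∀ X Z, Q X Z →ₗ[K] qtens Q Q X Z}

theorem qlift_redComul_redT_of_redT_eq_zero {X Z : O × Ω} (f : ∀ Y, red P Q Y Z →ₗ[K] red P Q X Y →ₗ[K] N)
    (hl : ∀ Y z w, f Y (redT P Q Y Z z) w = 0) (hr : ∀ Y w z, f Y w (redT P Q X Y z) = 0) {i : ℤ}
    {u : P X.1 Z.1} (hi : u ∈ (P X.1 Z.1).gr i) (v : Q X.2 Z.2) :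
    qlift f (redComul P Q ΔP ΔQ X Z (redT P Q X Z (u ⊗ₜ v))) =
      f (X.1, Z.2) (redL P Q (X.1, Z.2) Z rfl u) (redR P Q X (X.1, Z.2) rfl v) +
      f (Z.1, X.2) (redR P Q (Z.1, X.2) Z rfl ((Q X.2 Z.2).sgn i v))
        (redL P Q X (Z.1, X.2) rfl u) := by
  have h1 : ∀ y y' p q j, ∀ x' ∈ (aug P X.1 y).gr j, ∀ v', qlift f (redShuf P Q X Z Z
      (fun Y => redProj P Q Y Z) (qmk (aug P) (aug P) X.1 y Z.1 (augIn P y Z.1 p) x')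
        (qmk (aug Q) (aug Q) X.2 y' Z.2 (augIn Q y' Z.2 q) v')) = 0 := by
    intro y y' p q j x' hx' v'
    rw [redShuf_qmk X Z Z _ y y' _ hx', aug_sgn_augIn, qlift_qmk]
    have := redProj_in_in P Q (y, y') Z p ((Q y' Z.2).sgn j q)
    rw [this, hl]
  have h2 : ∀ y y' x j, ∀ p ∈ (P X.1 y).gr j, ∀ v q, qlift f (redShuf P Q X Z Z
      (fun Y => redProj P Q Y Z) (qmk (aug P) (aug P) X.1 y Z.1 x (augIn P X.1 y p))
        (qmk (aug Q) (aug Q) X.2 y' Z.2 v (augIn Q X.2 y' q))) = 0 := by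
    intro y y' x j p hp v q
    rw [redShuf_qmk X Z Z _ y y' _ (augIn_mem P hp), qlift_qmk]
    have := redProj_in_in P Q X (y, y') p q
    rw [this, hr]
  refine qlift_redComul_redT f hi v ?_ ?_
  · refine lapply_eq (qlift f ∘ₗ (redShuf P Q X Z Z (fun Y => redProj P Q Y Z)).flip
      (augComul Q ΔQ X.2 Z.2 (augIn Q X.2 Z.2 v)) ∘ₗ qmap[P, aug P] (fun Y => augIn P Y Z.1) (fun Y => augIn P X.1 Y)) 0
      (qtens_ext fun Y i x hx j x' hx' => ?_) (ΔP X.1 Z.1 u)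
    rw [comp_app, comp_app, qmap_qmk, flip_app, augComul_augIn, map_add, map_add, map_add, map_add,
      h1 _ _ _ _ _ _ (augIn_mem P hx'), h2 _ _ _ _ _ hx', add_zero, add_zero]
    exact lapply_eq (qlift f ∘ₗ redShuf P Q X Z Z (fun Y => redProj P Q Y Z)
      (qmk (aug P) (aug P) X.1 Y Z.1 (augIn P Y Z.1 x) (augIn P X.1 Y x')) ∘ₗ
      qmap[Q, aug Q] (fun Y => augIn Q Y Z.2)
        (fun Y => augIn Q X.2 Y)) 0 (qtens_ext fun Y k y hy l y' hy' => by
          rw [comp_app, comp_app, qmap_qmk, h1 _ _ _ _ _ _ (augIn_mem P hx')]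
          rfl) (ΔQ X.2 Z.2 v)
  · intro x hx
    refine lapply_eq (qlift f ∘ₗ redShuf P Q X Z Z (fun Y => redProj P Q Y Z) x ∘ₗ
      qmap[Q, aug Q] (fun Y => augIn Q Y Z.2)
        (fun Y => augIn Q X.2 Y)) 0 (qtens_ext fun Y k y hy l y' hy' => ?_) (ΔQ X.2 Z.2 v)
    rw [comp_app, comp_app, qmap_qmk]
    rcases List.mem_pair.mp hx with rfl | rfl
    · rw [h1 _ _ _ _ _ _ (augOne_mem P _ _ rfl)]
      rfl
    · rw [h2 _ _ _ _ _ hi]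
      rfl

end

section DGLaws

theorem AInfCat.isDGComp {A : AInfCat K} (hA : A.IsDG) : IsDGComp A.Hom A.d A.comp where
  d_deg X Y := (A.d_isDifferential X Y).1
  mem := A.comp_mem
  leibniz X Y Z f g := by
    refine lapply_eq (A.d X Z ∘ₗ (A.comp X Y Z).flip g) ((A.comp X Y Z).flip g ∘ₗ A.d Y Z +
        (A.comp X Y Z).flip (A.d X Y g) ∘ₗ (A.Hom Y Z).sgn 1) (hom_ext_gr _ fun i x hx => ?_) f
    rw [ladd_app, comp_app, comp_app, comp_app, flip_app, flip_app, flip_app, A.d_comp X Y Z i x hx,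
      sgn_one_of_mem _ hx, map_zsmul]
    rfl
  assoc := A.comp_assoc hA

variable {A B : AInfCat K}

theorem redAB_isDGComp (hA : A.IsDG) (hB : B.IsDG) :
    IsDGComp (redAB A B) (redABD A B) (redComp A.Hom B.Hom A.comp B.comp) :=
  IsDGComp.red (AInfCat.isDGComp hA) (AInfCat.isDGComp hB)
    fun X Z => (redABD_isDifferential A B X Z).1

variable (A B) in
theorem cobarAB_isDGComp : IsDGComp (cobarAB A B) (cobarABD A B) (tmul (genAB A B)) where
  d_deg X Y := (cobarABD_isDifferential A B X Y).1
  mem X Y Z _ _ _ hf _ hg := tmul_mem (Q := genAB A B) X Y Z hf hg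
  leibniz := cobarD_tmul
  assoc := tmul_assoc (Q := genAB A B)

theorem IsDGComp.isDGCat {O : Type u} {P : GQuiver K O} {d : ∀ X Y, P X Y →ₗ[K] P X Y}
    {c : ∀ X Y Z, P Y Z →ₗ[K] P X Y →ₗ[K] P X Z} (h : IsDGComp P d c)
    (hd : ∀ X Y, IsDifferential (P X Y).gr (d X Y)) : DGData.IsDGCat ⟨O, P, d, c⟩ where
  isDifferential := hd
  comp_deg := h.mem
  leibniz X Y Z i f hf g := by
    refine (h.leibniz X Y Z f g).trans (congrArg (_ + ·) ?_)
    rw [sgn_one_of_mem _ hf, map_zsmul]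
    rfl
  assoc := h.assoc

end DGLaws

section FunctorN

theorem AInfCat.barProj_barD {A : AInfCat K} (hA : A.IsDG) (X Z : A.Ob) (w : A.bar X Z) :
    -A.barProj X Z (A.barD X Z w) - (qlift fun Y => (A.comp X Y Z).compl₁₂
      (A.barProj Y Z ∘ₗ (A.bar Y Z).sgn 1) (A.barProj X Y)) (A.barComul X Z w) =
        A.d X Z (A.barProj X Z w) := by
  refine tbar_induction A.sHom X (p := fun Z w => -A.barProj X Z (A.barD X Z w) -
    (qlift fun Y => (A.comp X Y Z).compl₁₂ (A.barProj Y Z ∘ₗ (A.bar Y Z).sgn 1) (A.barProj X Y))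
      (A.barComul X Z w) = A.d X Z (A.barProj X Z w)) ?_ ?_ ?_ ?_ Z w
  · intro Z
    simp only [map_zero, neg_zero, sub_zero]
  · intro Z u v hu hv
    simp only [map_add, ← hu, ← hv]
    abel
  · intro Z i x hx
    have h : A.barComul X Z (tgen A.sHom X Z x) = 0 := tcomul_tgen ..
    rw [h, A.barD_tgen, map_neg, barProj_tgen, barProj_tgen, map_zero, sub_zero, neg_neg]
  · intro Y Z i x hx w _
    have h1 : A.barComul X Z (tcons A.sHom X Y Z x w) = _ := tcomul_tcons A.sHom X Y Z x w
    have h2 : ∀ z, A.barProj X Z ((qlift fun W => (tcons A.sHom X W Z).compl₁₂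
        (A.bop W Z ∘ₗ tcons A.sHom W Y Z x) lid) z) = 0 := fun z =>
      lapply_eq (A.barProj X Z ∘ₗ (qlift fun W => (tcons A.sHom X W Z).compl₁₂
        (A.bop W Z ∘ₗ tcons A.sHom W Y Z x) lid)) 0 (qtens_ext
          fun W i y hy j v hv => by
            rw [comp_app, qlift_qmk, compl₁₂_app, barProj_tcons]; rfl) z
    have h3 : ∀ z, (qlift fun Y => (A.comp X Y Z).compl₁₂ (A.barProj Y Z ∘ₗ (A.bar Y Z).sgn 1)
        (A.barProj X Y)) (qmap[tbar A.sHom] (fun W => tcons A.sHom W Y Z x) (fun _ => lid) z) = 0 :=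
      fun z => by
        rw [qlift_qmap]
        refine qlift_eq_zero (fun W i y hy j v hv => ?_) z
        rw [compl₁₂_app, compl₁₂_app, comp_app]
        have := tcons_sgn A.sHom W Y Z 1 x y
        rw [this, barProj_tcons, map_zero, lzero_app]
    rw [A.barD_tcons, h1, map_add, map_add, map_add, map_sub, h2, h3, barProj_tcons, barProj_tcons,
      barProj_tcons, barProj_tgen, qlift_qmk, compl₁₂_app, comp_app, map_zero]
    have h4 := tgen_sgn A.sHom Y Z 1 x
    rw [h4, barProj_tgen, sub_zero, add_zero, add_zero, add_zero]
    refine tbar_induction A.sHom X (p := fun Y w => ∀ x : A.sHom Y Z,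
      -A.bop X Z (tcons A.sHom X Y Z x w) -
        A.comp X Y Z ((A.sHom Y Z).sgn 1 x) (A.barProj X Y w) = 0) ?_ ?_ ?_ ?_ Y w x
    · intro Y x
      simp only [map_zero, neg_zero, sub_zero]
    · intro Y u v hu hv x
      refine Eq.trans ?_ ((congrArg₂ (· + ·) (hu x) (hv x)).trans (add_zero 0))
      simp only [map_add]
      abel
    · intro Y i y _ x
      rw [A.bop_tcons_tgen, barProj_tgen, neg_neg, sub_self]
    · intro W Y i y _ w _ x
      rw [A.bop_tcons_tcons hA, barProj_tcons, map_zero, neg_zero, sub_zero]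

variable (A B : AInfCat K)

/-- The maps between morphisms of the functor `N`. -/
abbrev nMap (X Z : A.Ob × B.Ob) : cobarAB A B X Z →ₗ[K] redAB A B X Z := (functorN A B).map X Z

/-- The composition of the reduction of the tensor product of the augmentations. -/
abbrev redABComp (X Y Z : A.Ob × B.Ob) : redAB A B Y Z →ₗ[K] redAB A B X Y →ₗ[K] redAB A B X Z :=
  redComp A.Hom B.Hom A.comp B.comp X Y Z

theorem nMap_cgen (X Z : A.Ob × B.Ob) (c : barAB A B X Z) :
    nMap A B X Z (cgen (barAB A B) X Z c) = nGen A B X Z c := desc_tgen ..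

theorem nMap_ccons (X Y Z : A.Ob × B.Ob) (c : barAB A B Y Z) (w : cobarAB A B X Y) :
    nMap A B X Z (ccons (barAB A B) X Y Z c w) =
      redABComp A B X Y Z (nGen A B Y Z c) (nMap A B X Y w) := by
  induction w using dsum_induction with
  | zero => simp only [map_zero]
  | add u v hu hv => rw [map_add, map_add, hu, hv, map_add, map_add]
  | of n w =>
    change desc _ (tcons (genAB A B) X Y Z c (tin (genAB A B) n X Y w)) =
      redABComp A B X Y Z _ (desc _ (tin (genAB A B) n X Y w))
    have h1 := tcons_tin (genAB A B) n X Y Z c w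
    have h2 := desc_tin (genAB A B) n X Y (fun n => nPow A B X n Y) w
    have h3 := desc_tin (genAB A B) (n + 1) X Z (fun n => nPow A B X n Z)
      (tmk (genAB A B) n X Y Z c w)
    rw [h1]
    refine h3.trans ((tlift_tmk _ _ _ _).trans ?_)
    exact congrArg (redABComp A B X Y Z (nGen A B Y Z c)) h2.symm

variable {A B}

theorem nMap_hasDegree (X Z : A.Ob × B.Ob) :
    HasDegree (cobarAB A B X Z).gr (redAB A B X Z).gr (nMap A B X Z) 0 := by
  intro n w hw
  rw [add_zero]
  refine tbar_gr_induction (genAB A B) X (p := fun Z n w => nMap A B X Z w ∈ (redAB A B X Z).gr n)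
    ?_ ?_ ?_ ?_ ?_ Z n w hw
  · intro Z k
    rw [map_zero]
    exact zero_mem _
  · intro Z k x y hx hy
    rw [map_add]
    exact add_mem hx hy
  · intro Z k a x hx
    rw [map_smul]
    exact Submodule.smul_mem _ a hx
  · intro Z k x hx
    have h := nGen_mem A B X Z (i := -1 + k) hx
    rw [← nMap_cgen, neg_add_cancel_comm] at h
    exact h
  · intro Y Z i j x hx w hw h
    have h1 := nGen_mem A B Y Z (i := -1 + i) hx
    rw [neg_add_cancel_comm] at h1
    have h2 := redComp_mem A.comp_mem B.comp_mem X Y Z h1 h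
    have h3 := nMap_ccons A B X Y Z x w
    exact h3 ▸ h2

theorem nMap_tmul (hA : A.IsDG) (hB : B.IsDG) (X Y Z : A.Ob × B.Ob) (u : cobarAB A B Y Z)
    (w : cobarAB A B X Y) : nMap A B X Z (tmul (genAB A B) X Y Z u w) =
      redABComp A B X Y Z (nMap A B Y Z u) (nMap A B X Y w) := by
  refine cobar_ext (C := barAB A B) (X := Y) (N := fun Z => redAB A B X Z)
    (f := fun Z => nMap A B X Z ∘ₗ (tmul (genAB A B) X Y Z).flip w)
    (g := fun Z => (redABComp A B X Y Z).flip (nMap A B X Y w) ∘ₗ nMap A B Y Z) ?_ ?_ Z u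
  · intro Z i c hc
    have h := tmul_tgen (genAB A B) X Y Z c w
    refine (congrArg (nMap A B X Z) h).trans ((nMap_ccons A B X Y Z c w).trans ?_)
    rw [← nMap_cgen]
    rfl
  · intro W Z i c hc u h
    have h1 := tmul_tcons (genAB A B) X Y W Z c u w
    refine (congrArg (nMap A B X Z) h1).trans ((nMap_ccons A B X W Z c _).trans ?_)
    refine (congrArg (redABComp A B X W Z (nGen A B W Z c)) h).trans ?_
    refine ((redAB_isDGComp hA hB).assoc X Y W Z _ _ _).symm.trans ?_
    rw [comp_app, flip_app, nMap_ccons]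

end FunctorN

section FunctorN

variable {A B : AInfCat K}

variable (A B) in
/-- The product of the values of `N` on two generators, up to sign. -/
abbrev nQuad (X Z : A.Ob × B.Ob) : qtens (barAB A B) (barAB A B) X Z →ₗ[K] redAB A B X Z :=
  qlift fun Y => (redABComp A B X Y Z).compl₁₂ (nGen A B Y Z ∘ₗ (barAB A B Y Z).sgn 1)
    (nGen A B X Y)

theorem nMap_cquad (X Z : A.Ob × B.Ob) (z : qtens (barAB A B) (barAB A B) X Z) :
    nMap A B X Z (cquad (barAB A B) X Z z) = nQuad A B X Z z := by
  refine lcongr (f := nMap A B X Z ∘ₗ cquad (barAB A B) X Z) (qtens_ext fun Y i x hx j y hy => ?_) z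
  rw [comp_app, cquad, qlift_qmk, qlift_qmk, compl₁₂_app, nMap_ccons, nMap_cgen, compl₁₂_app,
    comp_app]

theorem barProj_mem {X Y : A.Ob} {i : ℤ} {x : A.bar X Y} (hx : x ∈ (A.bar X Y).gr i) :
    A.barProj X Y x ∈ (A.Hom X Y).gr (1 + i) := by
  have := tproj_hasDegree A.sHom X Y i x hx
  rw [add_zero] at this
  exact this

theorem nGen_sgn_redL (X Y : A.Ob × B.Ob) (h) (x : A.bar X.1 Y.1) :
    nGen A B X Y ((barAB A B X Y).sgn 1 (redL A.bar B.bar X Y h x)) =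
      redL A.Hom B.Hom X Y h (A.barProj X.1 Y.1 ((A.bar X.1 Y.1).sgn 1 x)) := by
  have h1 := sgn_map_of_hasDegree_zero (f := redL A.bar B.bar X Y h)
    (fun i x hx => (add_zero i).symm ▸ redL_mem h hx) 1 x
  exact (congrArg (nGen A B X Y) h1).trans (nGen_redL h _)

theorem nGen_sgn_redR (X Y : A.Ob × B.Ob) (h) (x : B.bar X.2 Y.2) :
    nGen A B X Y ((barAB A B X Y).sgn 1 (redR A.bar B.bar X Y h x)) =
      redR A.Hom B.Hom X Y h (B.barProj X.2 Y.2 ((B.bar X.2 Y.2).sgn 1 x)) := by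
  have h1 := sgn_map_of_hasDegree_zero (f := redR A.bar B.bar X Y h)
    (fun i x hx => (add_zero i).symm ▸ redR_mem h hx) 1 x
  exact (congrArg (nGen A B X Y) h1).trans (nGen_redR h _)

theorem nGen_sgn_redT (X Y : A.Ob × B.Ob) (z) :
    nGen A B X Y ((barAB A B X Y).sgn 1 (redT A.bar B.bar X Y z)) = 0 := by
  have h1 := sgn_map_of_hasDegree_zero (M := ptens A.bar B.bar X Y) (f := redT A.bar B.bar X Y)
    (fun i x hx => ⟨(add_zero i).symm ▸ hx, zero_mem _, zero_mem _⟩) 1 z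
  exact (congrArg (nGen A B X Y) h1).trans (nGen_redT _)

theorem redABComp_nGen_redL_redR (x₁ z₁ : A.Ob) (x₂ z₂ : B.Ob) (x : A.bar x₁ z₁) (y : B.bar x₂ z₂) :
    redABComp A B (x₁, x₂) (x₁, z₂) (z₁, z₂) (nGen A B (x₁, z₂) (z₁, z₂)
      ((barAB A B (x₁, z₂) (z₁, z₂)).sgn 1 (redL A.bar B.bar (x₁, z₂) (z₁, z₂) rfl x)))
      (nGen A B (x₁, x₂) (x₁, z₂) (redR A.bar B.bar (x₁, x₂) (x₁, z₂) rfl y)) =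
    redT A.Hom B.Hom (x₁, x₂) (z₁, z₂)
      (A.barProj x₁ z₁ ((A.bar x₁ z₁).sgn 1 x) ⊗ₜ B.barProj x₂ z₂ y) := by
  have e1 := nGen_sgn_redL (x₁, z₂) (z₁, z₂) rfl x
  have e2 := nGen_redR (X := (x₁, x₂)) (Y := (x₁, z₂)) rfl y
  rw [e1, e2]
  exact redComp_redL_redR A.Hom B.Hom A.comp B.comp (x₁, x₂) z₁ z₂ _ _

theorem redABComp_nGen_redR_redL (x₁ z₁ : A.Ob) (x₂ z₂ : B.Ob) (x : A.bar x₁ z₁)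
    {j : ℤ} {y : B.bar x₂ z₂} (hy : y ∈ (B.bar x₂ z₂).gr j) :
    redABComp A B (x₁, x₂) (z₁, x₂) (z₁, z₂) (nGen A B (z₁, x₂) (z₁, z₂)
      ((barAB A B (z₁, x₂) (z₁, z₂)).sgn 1 (redR A.bar B.bar (z₁, x₂) (z₁, z₂) rfl y)))
      (nGen A B (x₁, x₂) (z₁, x₂) (redL A.bar B.bar (x₁, x₂) (z₁, x₂) rfl x)) =
    redT A.Hom B.Hom (x₁, x₂) (z₁, z₂) ((A.Hom x₁ z₁).sgn (1 + j) (A.barProj x₁ z₁ x) ⊗ₜ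
        B.barProj x₂ z₂ ((B.bar x₂ z₂).sgn 1 y)) := by
  have e1 := nGen_sgn_redR (z₁, x₂) (z₁, z₂) rfl y
  have e2 := nGen_redL (X := (x₁, x₂)) (Y := (z₁, x₂)) rfl x
  rw [e1, e2]
  exact redComp_redR_redL A.Hom B.Hom A.comp B.comp (x₁, x₂) z₁ z₂ (barProj_mem (sgn_mem _ 1 hy)) _

theorem nQuad_barABComul_redT {X Z : A.Ob × B.Ob} {i j : ℤ} {x : A.bar X.1 Z.1}
    (hx : x ∈ (A.bar X.1 Z.1).gr i) {y : B.bar X.2 Z.2} (hy : y ∈ (B.bar X.2 Z.2).gr j) :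
    nQuad A B X Z (barABComul A B X Z (redT A.bar B.bar X Z (x ⊗ₜ y))) = 0 := by
  obtain ⟨x₁, x₂⟩ := X
  obtain ⟨z₁, z₂⟩ := Z
  have h := qlift_redComul_redT_of_redT_eq_zero (P := A.bar) (Q := B.bar) (ΔP := A.barComul)
    (ΔQ := B.barComul) (X := (x₁, x₂)) (Z := (z₁, z₂))
    (fun Y => (redABComp A B (x₁, x₂) Y (z₁, z₂)).compl₁₂
      (nGen A B Y (z₁, z₂) ∘ₗ (barAB A B Y (z₁, z₂)).sgn 1) (nGen A B (x₁, x₂) Y))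
    (fun Y z w => by
      have := nGen_sgn_redT Y (z₁, z₂) z
      rw [compl₁₂_app, comp_app, this, map_zero, lzero_app])
    (fun Y w z => by
      have := nGen_redT (X := (x₁, x₂)) (Y := Y) z
      rw [compl₁₂_app, this, map_zero]) hx y
  refine h.trans ?_
  rw [compl₁₂_app, compl₁₂_app, comp_app, comp_app]
  have e1 := redABComp_nGen_redL_redR x₁ z₁ x₂ z₂ x y
  have e2 := redABComp_nGen_redR_redL x₁ z₁ x₂ z₂ x (sgn_mem _ i hy)
  rw [e1, e2]
  rw [sgn_sgn, sgn_of_mem (B.bar x₂ z₂) _ hy, sgn_of_mem (A.bar x₁ z₁) _ hx,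
    sgn_of_mem (A.Hom x₁ z₁) _ (barProj_mem hx), map_zsmul, map_zsmul, ← smul_tmul', ← smul_tmul', tmul_smul,
    smul_smul, map_zsmul, map_zsmul, ← add_smul, ← Units.val_mul, ← negOnePow_add,
    show (1 + j) * (1 + i) + (1 + i) * j = 1 * i + 1 + 2 * (j + i * j) by ring,
    negOnePow_add, Int.negOnePow_two_mul, negOnePow_succ]
  simp

theorem nGen_barABD (hA : A.IsDG) (hB : B.IsDG) (X Z : A.Ob × B.Ob) (c : barAB A B X Z) :
    -nGen A B X Z (barABD A B X Z c) - nQuad A B X Z (barABComul A B X Z c) =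
      redABD A B X Z (nGen A B X Z c) := by
  refine lapply_eq (-(nGen A B X Z ∘ₗ barABD A B X Z) -
    nQuad A B X Z ∘ₗ barABComul A B X Z) (redABD A B X Z ∘ₗ nGen A B X Z)
    (red_ext ?_ ?_ ?_) c
  · intro i x hx j y hy
    have h := redD_redT (P := A.bar) (Q := B.bar) (dP := A.barD) (dQ := B.barD) X Z x y
    rw [comp_app, nGen_redT, map_zero, lsub_app, lneg_app, comp_app, comp_app, nQuad_barABComul_redT
      hx hy, sub_zero, neg_eq_zero]
    refine (congrArg (nGen A B X Z) h).trans ?_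
    rw [map_add, nGen_redT, nGen_redT, add_zero]
  · obtain ⟨x₁, x₂⟩ := X
    obtain ⟨z₁, z₂⟩ := Z
    intro h i x hx
    obtain rfl : x₂ = z₂ := h
    have h1 := redD_redL (P := A.bar) (Q := B.bar) (dP := A.barD) (dQ := B.barD) (x₁, x₂) (z₁, x₂)
      rfl x
    have h2 := redComul_redL (P := A.bar) (Q := B.bar) (ΔP := A.barComul) (ΔQ := B.barComul)
      (x₁, x₂) (z₁, x₂) rfl x
    have h3 := redD_redL (P := A.Hom) (Q := B.Hom) (dP := A.d) (dQ := B.d) (x₁, x₂) (z₁, x₂)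
      rfl (A.barProj x₁ z₁ x)
    have h4 := nGen_redL (X := (x₁, x₂)) (Y := (z₁, x₂)) rfl x
    have h5 := nGen_redL (X := (x₁, x₂)) (Y := (z₁, x₂)) rfl (A.barD x₁ z₁ x)
    refine (congrArg₂ (fun a b => -nGen A B (x₁, x₂) (z₁, x₂) a - nQuad A B _ _ b) h1 h2).trans ?_
    refine Eq.trans ?_ (congrArg (redABD A B (x₁, x₂) (z₁, x₂)) h4).symm
    refine Eq.trans ?_ h3.symm
    rw [h5, ← AInfCat.barProj_barD hA, map_sub, map_neg]
    refine sub_right_inj.mpr ?_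
    refine lapply_eq (nQuad A B (x₁, x₂) (z₁, x₂) ∘ₗ qlift fun y =>
        (qmk (barAB A B) (barAB A B) (x₁, x₂) (y, x₂) (z₁, x₂)).compl₁₂
        (redL A.bar B.bar (y, x₂) (z₁, x₂) rfl) (redL A.bar B.bar (x₁, x₂) (y, x₂) rfl))
      (redL A.Hom B.Hom (x₁, x₂) (z₁, x₂) rfl ∘ₗ qlift fun Y => (A.comp x₁ Y z₁).compl₁₂
        (A.barProj Y z₁ ∘ₗ (A.bar Y z₁).sgn 1) (A.barProj x₁ Y))
      (qtens_ext fun y i a ha j b hb => ?_) (A.barComul x₁ z₁ x)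
    rw [comp_app, comp_app, qlift_qmk, qlift_qmk, compl₁₂_app, compl₁₂_app, comp_app, qlift_qmk,
      compl₁₂_app, comp_app]
    have e1 := nGen_sgn_redL (y, x₂) (z₁, x₂) rfl a
    have e2 := nGen_redL (X := (x₁, x₂)) (Y := (y, x₂)) rfl b
    rw [e1, e2]
    exact redComp_redL_redL A.Hom B.Hom A.comp B.comp (x₁, x₂) y z₁ x₂ rfl _ _
  · obtain ⟨x₁, x₂⟩ := X
    obtain ⟨z₁, z₂⟩ := Z
    intro h i x hx
    obtain rfl : x₁ = z₁ := h
    have h1 := redD_redR (P := A.bar) (Q := B.bar) (dP := A.barD) (dQ := B.barD) (x₁, x₂) (x₁, z₂)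
      rfl x
    have h2 := redComul_redR (P := A.bar) (Q := B.bar) (ΔP := A.barComul) (ΔQ := B.barComul)
      (x₁, x₂) (x₁, z₂) rfl x
    have h3 := redD_redR (P := A.Hom) (Q := B.Hom) (dP := A.d) (dQ := B.d) (x₁, x₂) (x₁, z₂)
      rfl (B.barProj x₂ z₂ x)
    have h4 := nGen_redR (X := (x₁, x₂)) (Y := (x₁, z₂)) rfl x
    have h5 := nGen_redR (X := (x₁, x₂)) (Y := (x₁, z₂)) rfl (B.barD x₂ z₂ x)
    refine (congrArg₂ (fun a b => -nGen A B (x₁, x₂) (x₁, z₂) a - nQuad A B _ _ b) h1 h2).trans ?_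
    refine Eq.trans ?_ (congrArg (redABD A B (x₁, x₂) (x₁, z₂)) h4).symm
    refine Eq.trans ?_ h3.symm
    rw [h5, ← AInfCat.barProj_barD hB, map_sub, map_neg]
    refine sub_right_inj.mpr ?_
    refine lapply_eq (nQuad A B (x₁, x₂) (x₁, z₂) ∘ₗ qlift fun y =>
        (qmk (barAB A B) (barAB A B) (x₁, x₂) (x₁, y) (x₁, z₂)).compl₁₂
        (redR A.bar B.bar (x₁, y) (x₁, z₂) rfl) (redR A.bar B.bar (x₁, x₂) (x₁, y) rfl))
      (redR A.Hom B.Hom (x₁, x₂) (x₁, z₂) rfl ∘ₗ qlift fun Y => (B.comp x₂ Y z₂).compl₁₂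
        (B.barProj Y z₂ ∘ₗ (B.bar Y z₂).sgn 1) (B.barProj x₂ Y))
      (qtens_ext fun y i a ha j b hb => ?_) (B.barComul x₂ z₂ x)
    rw [comp_app, comp_app, qlift_qmk, qlift_qmk, compl₁₂_app, compl₁₂_app, comp_app, qlift_qmk,
      compl₁₂_app, comp_app]
    have e1 := nGen_sgn_redR (x₁, y) (x₁, z₂) rfl a
    have e2 := nGen_redR (X := (x₁, x₂)) (Y := (x₁, y)) rfl b
    rw [e1, e2]
    exact redComp_redR_redR A.Hom
      B.Hom A.comp B.comp (x₁, x₂) x₁ y z₂ rfl (barProj_mem (sgn_mem _ 1 ha)) _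

end FunctorN

section FunctorN

variable {A B : AInfCat K}

theorem nMap_cobarABD_cgen (hA : A.IsDG) (hB : B.IsDG) (X Z : A.Ob × B.Ob) (c : barAB A B X Z) :
    nMap A B X Z (cobarABD A B X Z (cgen (barAB A B) X Z c)) =
      redABD A B X Z (nMap A B X Z (cgen (barAB A B) X Z c)) := by
  rw [cobarABD, cobarD_cgen, map_sub, map_neg, nMap_cgen, nMap_cgen, nMap_cquad, nGen_barABD hA hB]

theorem nMap_isChainMap (hA : A.IsDG) (hB : B.IsDG) (X Z : A.Ob × B.Ob) :
    IsChainMap (cobarAB A B X Z).gr (cobarABD A B X Z) (redAB A B X Z).gr (redABD A B X Z)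
      (nMap A B X Z) := by
  refine ⟨nMap_hasDegree X Z, fun w => ?_⟩
  refine cobar_ext (C := barAB A B) (X := X) (N := fun Z => redAB A B X Z)
    (f := fun Z => nMap A B X Z ∘ₗ cobarABD A B X Z)
    (g := fun Z => redABD A B X Z ∘ₗ nMap A B X Z) ?_ ?_ Z w
  · intro Z i c hc
    exact nMap_cobarABD_cgen hA hB X Z c
  · intro Y Z i c hc w h
    have h1 := (cobarAB_isDGComp A B).leibniz X Y Z (cgen (barAB A B) Y Z c) w
    have h2 := (redAB_isDGComp hA hB).leibniz X Y Z (nMap A B Y Z (cgen (barAB A B) Y Z c))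
      (nMap A B X Y w)
    have h3 := tmul_tgen (genAB A B) X Y Z c w
    rw [comp_app, comp_app] at h ⊢
    refine (congrArg (fun w => nMap A B X Z (cobarABD A B X Z w)) h3.symm).trans ?_
    refine (congrArg (nMap A B X Z) h1).trans ?_
    rw [map_add, nMap_tmul hA hB, nMap_tmul hA hB, nMap_cobarABD_cgen hA hB, h, ←
      sgn_map_of_hasDegree_zero (nMap_hasDegree Y Z)]
    refine h2.symm.trans (congrArg (redABD A B X Z) ?_)
    exact (nMap_tmul hA hB X Y Z _ w).symm.trans (congrArg (nMap A B X Z) h3)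

theorem nMap_comparison (X Y : A.Ob × B.Ob) : ∀ x, nMap A B X Y (comparison A B X Y x) = x :=
  leftInverse_comparison A.comp B.comp (nMap_cgen A B X Y) fun g f => by
    rw [nMap_ccons, nMap_cgen, nGen_ltrL, nGen_ltrR]

theorem functorN_isDGFunctor (hA : A.IsDG) (hB : B.IsDG) : (functorN A B).IsDGFunctor :=
  ⟨nMap_isChainMap hA hB, nMap_tmul hA hB⟩

theorem functorN_isHomotopyIso (hA : A.IsDG) (hB : B.IsDG) : (functorN A B).IsHomotopyIso := by
  refine ⟨Function.bijective_id, fun X Y => IsHomotopyEquiv.of_comp (nMap_isChainMap hA hB X Y)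
    (comparison_isHomotopyEquiv A B X Y) ?_⟩
  have h : nMap A B X Y ∘ₗ comparison A B X Y = lid := lext (nMap_comparison X Y)
  exact h ▸ IsHomotopyEquiv.id

end FunctorN

section Maps

theorem tbarMap_tgen {O Ω : Type u} (φ : O → Ω) {Q : GQuiver K O} {Q' : GQuiver K Ω}
    (F : ∀ X Y, Q X Y →ₗ[K] Q' (φ X) (φ Y)) (X Z : O) (x : Q X Z) :
    tbarMap φ F X Z (tgen Q X Z x) = tgen Q' (φ X) (φ Z) (F X Z x) := desc_tgen ..

theorem tbarMap_tcons {O Ω : Type u} (φ : O → Ω) {Q : GQuiver K O} {Q' : GQuiver K Ω}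
    (F : ∀ X Y, Q X Y →ₗ[K] Q' (φ X) (φ Y)) (X Y Z : O) (x : Q Y Z) (w : tbar Q X Y) :
    tbarMap φ F X Z (tcons Q X Y Z x w) =
      tcons Q' (φ X) (φ Y) (φ Z) (F Y Z x) (tbarMap φ F X Y w) := by
  induction w using dsum_induction with
  | zero => simp only [map_zero]
  | add u v hu hv => rw [map_add, map_add, hu, hv, map_add, map_add]
  | of n w =>
    change desc _ (tcons Q X Y Z x (tin Q n X Y w)) =
      tcons Q' (φ X) (φ Y) (φ Z) (F Y Z x) (desc _ (tin Q n X Y w))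
    rw [tcons_tin, desc_tin, desc_tin, comp_app, comp_app, tcons_tin]
    exact congrArg (tin Q' (n + 1) (φ X) (φ Z)) (tlift_tmk _ _ _ _)

variable {O Ω O₁ O₁' : Type u} {P : GQuiver K O} {Q : GQuiver K Ω} {P₁ : GQuiver K O₁}
  {Q₁ : GQuiver K O₁'} (φ : O → O₁) (ψ : Ω → O₁') (F : ∀ X Y, P X Y →ₗ[K] P₁ (φ X) (φ Y))
  (G : ∀ X Y, Q X Y →ₗ[K] Q₁ (ψ X) (ψ Y))

theorem redMap_redT (X Y : O × Ω) (f : P X.1 Y.1) (g : Q X.2 Y.2) :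
    redMap φ ψ F G X Y (redT P Q X Y (f ⊗ₜ g)) =
      redT P₁ Q₁ (Prod.map φ ψ X) (Prod.map φ ψ Y) (F X.1 Y.1 f ⊗ₜ G X.2 Y.2 g) :=
  Prod.ext rfl (map_zero (LinearMap.prodMap (powMap (congrArg ψ) (F X.1 Y.1))
    (powMap (congrArg φ) (G X.2 Y.2))))

theorem redMap_redL (X Y : O × Ω) (h : X.2 = Y.2) (f : P X.1 Y.1) :
    redMap φ ψ F G X Y (redL P Q X Y h f) =
      redL P₁ Q₁ (Prod.map φ ψ X) (Prod.map φ ψ Y) (congrArg ψ h) (F X.1 Y.1 f) :=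
  Prod.ext (map_zero (TensorProduct.map (F X.1 Y.1) (G X.2 Y.2)))
    (Prod.ext (powMap_powIncl (congrArg ψ) (F X.1 Y.1) h f)
      (map_zero (powMap (congrArg φ) (G X.2 Y.2))))

theorem redMap_redR (X Y : O × Ω) (h : X.1 = Y.1) (g : Q X.2 Y.2) :
    redMap φ ψ F G X Y (redR P Q X Y h g) =
      redR P₁ Q₁ (Prod.map φ ψ X) (Prod.map φ ψ Y) (congrArg φ h) (G X.2 Y.2 g) :=
  Prod.ext (map_zero (TensorProduct.map (F X.1 Y.1) (G X.2 Y.2)))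
    (Prod.ext (map_zero (powMap (congrArg ψ) (F X.1 Y.1)))
      (powMap_powIncl (congrArg φ) (G X.2 Y.2) h g))

variable {φ ψ F G} {cP : ∀ X Y Z, P Y Z →ₗ[K] P X Y →ₗ[K] P X Z}
  {cQ : ∀ X Y Z, Q Y Z →ₗ[K] Q X Y →ₗ[K] Q X Z}
  {cP₁ : ∀ X Y Z, P₁ Y Z →ₗ[K] P₁ X Y →ₗ[K] P₁ X Z}
  {cQ₁ : ∀ X Y Z, Q₁ Y Z →ₗ[K] Q₁ X Y →ₗ[K] Q₁ X Z}

theorem redMap_redComp_redL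
    (hF : ∀ X Y Z f g, F X Z (cP X Y Z f g) = cP₁ (φ X) (φ Y) (φ Z) (F Y Z f) (F X Y g))
    (X Y Z : O × Ω) (h : Y.2 = Z.2) (f : P Y.1 Z.1) (y : red P Q X Y) :
    redMap φ ψ F G X Z (redComp P Q cP cQ X Y Z (redL P Q Y Z h f) y) =
      redComp P₁ Q₁ cP₁ cQ₁ (Prod.map φ ψ X) (Prod.map φ ψ Y) (Prod.map φ ψ Z)
        (redMap φ ψ F G Y Z (redL P Q Y Z h f)) (redMap φ ψ F G X Y y) := by
  obtain ⟨x₁, x₂⟩ := X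
  obtain ⟨y₁, y₂⟩ := Y
  obtain ⟨z₁, z₂⟩ := Z
  obtain rfl : y₂ = z₂ := h
  rw [redMap_redL]
  refine lapply_eq (redMap φ ψ F G (x₁, x₂) (z₁, y₂) ∘ₗ
    redComp P Q cP cQ (x₁, x₂) (y₁, y₂) (z₁, y₂) (redL P Q (y₁, y₂) (z₁, y₂) rfl f))
    (redComp P₁ Q₁ cP₁ cQ₁ (φ x₁, ψ x₂) (φ y₁, ψ y₂) (φ z₁, ψ y₂)
      (redL P₁ Q₁ (φ y₁, ψ y₂) (φ z₁, ψ y₂) rfl (F y₁ z₁ f)) ∘ₗ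
      redMap φ ψ F G (x₁, x₂) (y₁, y₂)) (red_ext ?_ ?_ ?_) y
  · intro i f' _ j g' _
    rw [comp_app, redComp_redL_redT, redMap_redT, comp_app, redMap_redT, hF]
    exact (redComp_redL_redT ..).symm
  · intro h i f' _
    rw [comp_app, redComp_redL_redL, redMap_redL, comp_app, redMap_redL, hF]
    exact (redComp_redL_redL P₁ Q₁ cP₁ cQ₁ (φ x₁, ψ x₂) (φ y₁) (φ z₁) (ψ y₂) _ _ _).symm
  · intro h j g' _
    obtain rfl : x₁ = y₁ := h
    have e := redComp_redL_redR P Q cP cQ (x₁, x₂) z₁ y₂ f g'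
    refine (congrArg (redMap φ ψ F G (x₁, x₂) (z₁, y₂)) e).trans ?_
    rw [redMap_redT, comp_app, redMap_redR]
    exact (redComp_redL_redR P₁ Q₁ cP₁ cQ₁ (φ x₁, ψ x₂) (φ z₁) (ψ y₂) _ _).symm

theorem redMap_redComp_redR
    (hG : ∀ X Y Z f g, G X Z (cQ X Y Z f g) = cQ₁ (ψ X) (ψ Y) (ψ Z) (G Y Z f) (G X Y g))
    (hF : ∀ X Y, HasDegree (P X Y).gr (P₁ (φ X) (φ Y)).gr (F X Y) 0)
    (X Y Z : O × Ω) (h : Y.1 = Z.1) {j : ℤ} {g : Q Y.2 Z.2} (hg : g ∈ (Q Y.2 Z.2).gr j)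
    (hg' : G Y.2 Z.2 g ∈ (Q₁ (ψ Y.2) (ψ Z.2)).gr j) (y : red P Q X Y) :
    redMap φ ψ F G X Z (redComp P Q cP cQ X Y Z (redR P Q Y Z h g) y) =
      redComp P₁ Q₁ cP₁ cQ₁ (Prod.map φ ψ X) (Prod.map φ ψ Y) (Prod.map φ ψ Z)
        (redMap φ ψ F G Y Z (redR P Q Y Z h g)) (redMap φ ψ F G X Y y) := by
  obtain ⟨x₁, x₂⟩ := X
  obtain ⟨y₁, y₂⟩ := Y
  obtain ⟨z₁, z₂⟩ := Z
  obtain rfl : y₁ = z₁ := h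
  rw [redMap_redR]
  refine lapply_eq (redMap φ ψ F G (x₁, x₂) (y₁, z₂) ∘ₗ
    redComp P Q cP cQ (x₁, x₂) (y₁, y₂) (y₁, z₂) (redR P Q (y₁, y₂) (y₁, z₂) rfl g))
    (redComp P₁ Q₁ cP₁ cQ₁ (φ x₁, ψ x₂) (φ y₁, ψ y₂) (φ y₁, ψ z₂)
      (redR P₁ Q₁ (φ y₁, ψ y₂) (φ y₁, ψ z₂) rfl (G y₂ z₂ g)) ∘ₗ
      redMap φ ψ F G (x₁, x₂) (y₁, y₂)) (red_ext ?_ ?_ ?_) y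
  · intro i f' _ k g' _
    have e := redComp_redR_redT P₁ Q₁ cP₁ cQ₁ (φ x₁, ψ x₂) (φ y₁) (ψ y₂) (ψ z₂) hg'
      (F x₁ y₁ f') (G x₂ y₂ g')
    rw [comp_app, redComp_redR_redT P Q cP cQ (x₁, x₂) y₁ y₂ z₂ hg, redMap_redT, comp_app,
      redMap_redT, hG, ← sgn_map_of_hasDegree_zero (hF x₁ y₁)]
    exact e.symm
  · intro h i f' _
    obtain rfl : x₂ = y₂ := h
    have e := redComp_redR_redL P Q cP cQ (x₁, x₂) y₁ z₂ hg f'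
    have e' := redComp_redR_redL P₁ Q₁ cP₁ cQ₁ (φ x₁, ψ x₂) (φ y₁) (ψ z₂) hg' (F x₁ y₁ f')
    refine (congrArg (redMap φ ψ F G (x₁, x₂) (y₁, z₂)) e).trans ?_
    rw [redMap_redT, comp_app, redMap_redL, ← sgn_map_of_hasDegree_zero (hF x₁ y₁)]
    exact e'.symm
  · intro h k g' _
    have e := redComp_redR_redR P₁ Q₁ cP₁ cQ₁ (φ x₁, ψ x₂) (φ y₁) (ψ y₂) (ψ z₂) (congrArg φ h) hg'
      (G x₂ y₂ g')
    rw [comp_app, redComp_redR_redR P Q cP cQ (x₁, x₂) y₁ y₂ z₂ h hg, redMap_redR, comp_app,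
      redMap_redR, hG]
    exact e.symm

end Maps

section Naturality

variable {A B A' B' : AInfCat K}

theorem barProj_barFun (F : DGFunData A.toDG A'.toDG) (X Z : A.Ob) (w : A.bar X Z) :
    A'.barProj (F.obj X) (F.obj Z) (barFun F X Z w) = F.map X Z (A.barProj X Z w) := by
  refine tbar_ext A.sHom X (N := fun Z => A'.Hom (F.obj X) (F.obj Z))
    (f := fun Z => A'.barProj (F.obj X) (F.obj Z) ∘ₗ barFun F X Z)
    (g := fun Z => F.map X Z ∘ₗ A.barProj X Z) ?_ ?_ Z w
  · intro Z i x hx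
    have h := tbarMap_tgen (Q := A.sHom) (Q' := A'.sHom) F.obj F.map X Z x
    refine (congrArg (A'.barProj (F.obj X) (F.obj Z)) h).trans ((barProj_tgen A' _ _ _).trans ?_)
    exact congrArg (F.map X Z) (barProj_tgen A X Z x).symm
  · intro Y Z i x hx w _
    have h := tbarMap_tcons (Q := A.sHom) (Q' := A'.sHom) F.obj F.map X Y Z x w
    refine (congrArg (A'.barProj (F.obj X) (F.obj Z)) h).trans
      ((barProj_tcons A' _ _ _ _ _).trans ?_)
    exact ((congrArg (F.map X Z) (barProj_tcons A X Y Z x w)).trans (map_zero _)).symm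

variable (F : DGFunData A.toDG A'.toDG) (G : DGFunData B.toDG B'.toDG)

/-- The map between the cocategories `C` induced by functors `F` and `G`. -/
abbrev barABFun (X Y : A.Ob × B.Ob) :
    barAB A B X Y →ₗ[K] barAB A' B' (F.obj X.1, G.obj X.2) (F.obj Y.1, G.obj Y.2) :=
  redMap F.obj G.obj (barFun F) (barFun G) X Y

/-- The map between reductions induced by functors `F` and `G`. -/
abbrev redABFun (X Y : A.Ob × B.Ob) :
    redAB A B X Y →ₗ[K] redAB A' B' (F.obj X.1, G.obj X.2) (F.obj Y.1, G.obj Y.2) :=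
  redMap (P := A.Hom) (Q := B.Hom) (P₁ := A'.Hom) (Q₁ := B'.Hom) F.obj G.obj F.map G.map X Y

theorem nGen_barABFun (X Y : A.Ob × B.Ob) (c : barAB A B X Y) :
    nGen A' B' (F.obj X.1, G.obj X.2) (F.obj Y.1, G.obj Y.2) (barABFun F G X Y c) =
      redABFun F G X Y (nGen A B X Y c) := by
  refine lapply_eq (nGen A' B' (F.obj X.1, G.obj X.2) (F.obj Y.1, G.obj Y.2) ∘ₗ barABFun F G X Y)
    (redABFun F G X Y ∘ₗ nGen A B X Y) (red_ext ?_ ?_ ?_) c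
  · intro i x _ j y _
    have h := redMap_redT F.obj G.obj (barFun F) (barFun G) X Y x y
    refine (congrArg (nGen A' B' _ _) h).trans ((nGen_redT _).trans ?_)
    rw [comp_app, nGen_redT, map_zero]
  · intro h i x _
    have h1 := redMap_redL F.obj G.obj (barFun F) (barFun G) X Y h x
    refine (congrArg (nGen A' B' _ _) h1).trans ((nGen_redL (congrArg G.obj h) _).trans ?_)
    rw [comp_app, nGen_redL]
    refine (congrArg _ (barProj_barFun F X.1 Y.1 x)).trans ?_
    exact (redMap_redL (P := A.Hom) (Q := B.Hom) (P₁ := A'.Hom) (Q₁ := B'.Hom) F.obj G.obj F.map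
      G.map X Y h _).symm
  · intro h i x _
    have h1 := redMap_redR F.obj G.obj (barFun F) (barFun G) X Y h x
    refine (congrArg (nGen A' B' _ _) h1).trans ((nGen_redR (congrArg F.obj h) _).trans ?_)
    rw [comp_app, nGen_redR]
    refine (congrArg _ (barProj_barFun G X.2 Y.2 x)).trans ?_
    exact (redMap_redR (P := A.Hom) (Q := B.Hom) (P₁ := A'.Hom) (Q₁ := B'.Hom) F.obj G.obj F.map
      G.map X Y h _).symm

variable {F G}

theorem redABFun_redABComp_nGen (hF : F.IsDGFunctor) (hG : G.IsDGFunctor) (X Y Z : A.Ob × B.Ob)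
    (c : barAB A B Y Z) (y : redAB A B X Y) :
    redABFun F G X Z (redABComp A B X Y Z (nGen A B Y Z c) y) =
      redABComp A' B' (F.obj X.1, G.obj X.2) (F.obj Y.1, G.obj Y.2) (F.obj Z.1, G.obj Z.2)
        (redABFun F G Y Z (nGen A B Y Z c)) (redABFun F G X Y y) := by
  refine lapply_eq (redABFun F G X Z ∘ₗ (redABComp A B X Y Z).flip y ∘ₗ nGen A B Y Z)
    ((redABComp A' B' (F.obj X.1, G.obj X.2) (F.obj Y.1, G.obj Y.2)
      (F.obj Z.1, G.obj Z.2)).flip (redABFun F G X Y y) ∘ₗ redABFun F G Y Z ∘ₗ nGen A B Y Z)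
    (red_ext ?_ ?_ ?_) c
  · intro i f hf j g hg
    rw [comp_app, comp_app, comp_app, comp_app, nGen_redT, map_zero, map_zero, map_zero, map_zero]
  · intro h i f hf
    rw [comp_app, comp_app, comp_app, comp_app, nGen_redL, flip_app, flip_app]
    exact redMap_redComp_redL (P := A.Hom) (Q := B.Hom) (P₁ := A'.Hom) (Q₁ := B'.Hom)
      (cP₁ := A'.comp) (cQ₁ := B'.comp) hF.map_comp X Y Z h _ y
  · intro h i g hg
    rw [comp_app, comp_app, comp_app, comp_app, nGen_redR, flip_app, flip_app]
    exact redMap_redComp_redR (P := A.Hom) (Q := B.Hom) (P₁ := A'.Hom) (Q₁ := B'.Hom)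
      (cP₁ := A'.comp) (cQ₁ := B'.comp) hG.map_comp
      (fun X Y => (hF.isChainMap X Y).1) X Y Z h (barProj_mem hg)
      (add_zero (1 + i) ▸ (hG.isChainMap _ _).1 _ _ (barProj_mem hg)) y

theorem nMap_cobarFun (hF : F.IsDGFunctor) (hG : G.IsDGFunctor) (X Z : A.Ob × B.Ob)
    (w : cobarAB A B X Z) :
    nMap A' B' (F.obj X.1, G.obj X.2) (F.obj Z.1, G.obj Z.2) ((cobarFun F G).map X Z w) =
      redABFun F G X Z (nMap A B X Z w) := by
  refine cobar_ext (C := barAB A B) (X := X)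
    (N := fun Z => redAB A' B' (F.obj X.1, G.obj X.2) (F.obj Z.1, G.obj Z.2))
    (f := fun Z => nMap A' B' (F.obj X.1, G.obj X.2) (F.obj Z.1, G.obj Z.2) ∘ₗ
      (cobarFun F G).map X Z)
    (g := fun Z => redABFun F G X Z ∘ₗ nMap A B X Z) ?_ ?_ Z w
  · intro Z i c _
    have h := tbarMap_tgen (Q := genAB A B) (Q' := genAB A' B') (Prod.map F.obj G.obj)
      (barABFun F G) X Z c
    refine (congrArg (nMap A' B' _ _) h).trans ((nMap_cgen A' B' _ _ _).trans ?_)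
    rw [comp_app, nMap_cgen]
    exact nGen_barABFun F G X Z c
  · intro Y Z i c _ w hw
    have h := tbarMap_tcons (Q := genAB A B) (Q' := genAB A' B') (Prod.map F.obj G.obj)
      (barABFun F G) X Y Z c w
    refine (congrArg (nMap A' B' _ _) h).trans ((nMap_ccons A' B' _ _ _ _ _).trans ?_)
    rw [comp_app, nMap_ccons, redABFun_redABComp_nGen hF hG]
    exact congrArg₂ (fun a b => redABComp A' B' _ _ _ a b) (nGen_barABFun F G Y Z c) hw

theorem functorN_natural (hF : F.IsDGFunctor) (hG : G.IsDGFunctor) :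
    (functorN A' B').comp (cobarFun F G) = (redFun F G).comp (functorN A B) :=
  congrArg (DGFunData.mk (D := cobarDG A B) (E := redDG A' B') (Prod.map F.obj G.obj))
    (funext fun X => funext fun Z => lext (nMap_cobarFun hF hG X Z))

end Naturality

end AInf

end

theorem mainTheorem8 (K : Type u) [CommRing K] :
    (∀ (A B : AInf.AInfCat.{u} K) (X Y : A.Ob × B.Ob),
      AInf.IsDifferential (AInf.redAB A B X Y).gr (AInf.redABD A B X Y) ∧
      AInf.IsDifferential (AInf.cobarAB A B X Y).gr (AInf.cobarABD A B X Y) ∧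
      AInf.IsHomotopyEquiv (AInf.redAB A B X Y).gr (AInf.redABD A B X Y)
        (AInf.cobarAB A B X Y).gr (AInf.cobarABD A B X Y) (AInf.comparison A B X Y) ∧
      ∃ hL : ∀ x ∈ AInf.lowPart A B X Y, AInf.cobarABD A B X Y x ∈ AInf.lowPart A B X Y,
        ∀ φ : AInf.cobarAB A B X Y →ₗ[K] AInf.redAB A B X Y,
          AInf.IsChainMap (AInf.cobarAB A B X Y).gr (AInf.cobarABD A B X Y)
            (AInf.redAB A B X Y).gr (AInf.redABD A B X Y) φ →
          (AInf.IsHomotopyEquiv (AInf.cobarAB A B X Y).gr (AInf.cobarABD A B X Y)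
              (AInf.redAB A B X Y).gr (AInf.redABD A B X Y) φ ↔
            AInf.IsHomotopyEquiv
              (fun i => ((AInf.cobarAB A B X Y).gr i).comap (AInf.lowPart A B X Y).subtype)
              ((AInf.cobarABD A B X Y).restrict hL)
              (AInf.redAB A B X Y).gr (AInf.redABD A B X Y)
              (φ ∘ₗ (AInf.lowPart A B X Y).subtype))) ∧
    (∀ A B : AInf.AInfCat.{u} K, A.IsDG → B.IsDG →
      (AInf.cobarDG A B).IsDGCat ∧ (AInf.redDG A B).IsDGCat ∧
      (AInf.functorN A B).IsDGFunctor ∧ (AInf.functorN A B).IsHomotopyIso) ∧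
    (∀ A B A' B' : AInf.AInfCat.{u} K, A.IsDG → B.IsDG → A'.IsDG → B'.IsDG →
      ∀ (F : AInf.DGFunData A.toDG A'.toDG) (G : AInf.DGFunData B.toDG B'.toDG),
        F.IsDGFunctor → G.IsDGFunctor →
        (AInf.functorN A' B').comp (AInf.cobarFun F G) =
          (AInf.redFun F G).comp (AInf.functorN A B)) := by
  refine ⟨fun A B X Y => ⟨AInf.redABD_isDifferential A B X Y, AInf.cobarABD_isDifferential A B X Y,
    AInf.comparison_isHomotopyEquiv A B X Y, AInf.cobarABD_mem_lowPart X Y, fun φ hφ =>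
      AInf.isHomotopyEquiv_iff_lowPart A B X Y _ φ hφ⟩,
    fun A B hA hB => ⟨(AInf.cobarAB_isDGComp A B).isDGCat
        (AInf.cobarABD_isDifferential A B),
      (AInf.redAB_isDGComp hA hB).isDGCat (AInf.redABD_isDifferential A B),
      AInf.functorN_isDGFunctor hA hB, AInf.functorN_isHomotopyIso hA hB⟩,
    fun A B A' B' _ _ _ _ F G hF hG => AInf.functorN_natural hF hG⟩
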